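/- Let $M$ be a smooth (Hausdorff, second countable) manifold-with-boundary of dimension $2k+1$, $k\ge 0$, with interior $\mathring M$, and let the circle $S^1$ act smoothly and freely on an open neighbourhood $U$ of $\partial M$. Let $M_{\mathrm{cut}}=M/{\sim}$, where distinct points are equivalent iff they both lie in $\partial M$ and in the same $S^1$-orbit; give it the quotient topology, let $c\colon M\to M_{\mathrm{cut}}$ be the quotient map, and let $M_{\mathrm{red}}=c(\partial M)=(\partial M)/S^1\subset M_{\mathrm{cut}}$. An invariant boundary defining function is a smooth $f\colon M\to\mathbb R_{\ge 0}$ with $f^{-1}(0)=\partial M$, with $df\neq 0$ at every point of $\partial M$, and $S^1$-invariant on some $S^1$-invariant open neighbourhood of $\partial M$ in $U$. Given such an $f$, let $\mathcal F_M$ be the set of functions $h\colon M_{\mathrm{cut}}\to\mathbb R$ such that $h\circ c$ is smooth on $\mathring M$ and such that there are an $S^1$-invariant open neighbourhood $V$ of $\partial M$ in $U$ and a smooth $H\colon V\times\mathbb C\to\mathbb R$ with $H(a\cdot x,z)=H(x,az)$ for all $a\in S^1$, $(x,z)\in V\times\mathbb C$, and $h(c(x))=H(x,\sqrt{f(x)})$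 for all $x\in V$. A contact one-form on a manifold of dimension $2m+1$ is a smooth one-form $\alpha$ such that $\alpha\wedge(d\alpha)^m$ vanishes nowhere. Let $\beta$ be a contact one-form on $M$ whose pullback to $\partial M$ is $S^1$-basic (that is, horizontal and invariant), and which is $S^1$-invariant on some $S^1$-invariant open neighbourhood of $\partial M$ in $U$. Then the following holds. 1. The spaces $M_{\mathrm{cut}}$ and $M_{\mathrm{red}}$ are Hausdorff and second countable. $M_{\mathrm{red}}$ carries a smooth manifold structure (of dimension $2k-1$ if $k\ge1$; if $k=0$ then $M_{\mathrm{red}}$ is empty) for which the quotient map $\partial M\to M_{\mathrm{red}}$ is a submersion; there is a unique smooth one-form $\beta_{\mathrm{red}}$ on $M_{\mathrm{red}}$ whose pullback to $\partial M$ equals the pullback of $\beta$ to $\partial M$; and $\beta_{\mathrm{red}}$ is a contact one-form on $M_{\mathrm{red}}$. 2. $M_{\mathrm{red}}$, with this structure, is a contact submanifold of $M_{\mathrm{cut}}$: for every invariant boundary defining function $f$, $M_{\mathrm{cut}}$ carries a smooth structure of dimension $2k+1$ whose smooth real-valued functions are exactly the elements of $\mathcal F_M$; there is a unique smooth one-form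 $\beta_{\mathrm{cut}}$ on $M_{\mathrm{cut}}$ whose pullback under $c|_{\mathring M}$ is $\beta|_{\mathring M}$; $\beta_{\mathrm{cut}}$ is a contact one-form; and the inclusion $M_{\mathrm{red}}\hookrightarrow M_{\mathrm{cut}}$ is a smooth embedding which pulls $\beta_{\mathrm{cut}}$ back to the contact form $\beta_{\mathrm{red}}$. -/

import Mathlib

open Set Function Topology Manifold ContDiff

noncomputable section
namespace CircleCut

/-- The inclusion `ℝᵈ → ℝᵈ⁺¹`, `y ↦ (0, y)`. -/
def euclCons (d : ℕ) (y : EuclideanSpace ℝ (Fin d)) : EuclideanSpace ℝ (Fin (d + 1)) :=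
  WithLp.toLp 2 (Fin.cons 0 y)

/-- The projection `ℝᵈ⁺¹ → ℝᵈ`, `(y₀, y) ↦ y`. -/
def euclTail (d : ℕ) (y : EuclideanSpace ℝ (Fin (d + 1))) : EuclideanSpace ℝ (Fin d) :=
  WithLp.toLp 2 (fun i => y i.succ)

@[simp] lemma euclCons_zero (d : ℕ) (y : EuclideanSpace ℝ (Fin d)) : euclCons d y 0 = 0 := rfl

@[simp] lemma euclTail_euclCons (d : ℕ) (y : EuclideanSpace ℝ (Fin d)) :
    euclTail d (euclCons d y) = y := by
  ext i; simp [euclTail, euclCons]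

lemma euclCons_euclTail (d : ℕ) {y : EuclideanSpace ℝ (Fin (d + 1))} (hy : y 0 = 0) :
    euclCons d (euclTail d y) = y := by
  ext i
  refine Fin.cases ?_ (fun j => ?_) i
  · simp [hy]
  · simp [euclTail, euclCons]

lemma contDiff_euclCons (d : ℕ) : ContDiff ℝ ∞ (euclCons d) := by
  rw [contDiff_euclidean]
  intro i
  refine Fin.cases ?_ (fun j => ?_) i
  · simpa using contDiff_const
  · simp only [euclCons, Fin.cons_succ]
    fun_prop

lemma contDiff_euclTail (d : ℕ) : ContDiff ℝ ∞ (euclTail d) := by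
  rw [contDiff_euclidean]
  intro i
  simp only [euclTail]
  fun_prop

/-- The inclusion of `ℝᵈ` into the half space of dimension `d + 1` as its boundary hyperplane. -/
def halfCons (d : ℕ) (y : EuclideanSpace ℝ (Fin d)) : EuclideanHalfSpace (d + 1) :=
  ⟨euclCons d y, by simp⟩

lemma halfCons_euclTail (d : ℕ) {y : EuclideanHalfSpace (d + 1)} (hy : y.1 0 = 0) :
    halfCons d (euclTail d y.1) = y :=
  Subtype.ext (euclCons_euclTail d hy)

lemma continuous_halfCons (d : ℕ) : Continuous (halfCons d) :=
  (contDiff_euclCons d).continuous.subtype_mk _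

section Boundary

variable {d : ℕ} {M : Type*} [TopologicalSpace M] [ChartedSpace (EuclideanHalfSpace (d + 1)) M]
  [IsManifold (𝓡∂ (d + 1)) ∞ M]

lemma mem_boundary_iff_of_mem_atlas {e : OpenPartialHomeomorph M (EuclideanHalfSpace (d + 1))}
    (he : e ∈ atlas (EuclideanHalfSpace (d + 1)) M) {x : M} (hx : x ∈ e.source) :
    x ∈ (𝓡∂ (d + 1)).boundary M ↔ (e x).1 0 = 0 := by
  have h1 := ModelWithCorners.isInteriorPoint_iff_of_mem_atlas (I := 𝓡∂ (d + 1)) (M := M)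
    (n := ∞) (by simp) he hx
  have h2 : e.extend (𝓡∂ (d + 1)) x ∈ interior (e.extend (𝓡∂ (d + 1))).target ↔
      0 < (e x).1 0 := by
    have h4 : e.extend (𝓡∂ (d + 1)) x ∈ interior (range (𝓡∂ (d + 1))) ↔ 0 < (e x).1 0 := by
      rw [interior_range_modelWithCornersEuclideanHalfSpace]
      rfl
    rw [← h4]
    exact ⟨fun h => interior_mono (e.extend_target_subset_range) h,
      fun h => e.mem_interior_extend_target (e.map_source hx) h⟩
  rw [← ModelWithCorners.compl_interior, mem_compl_iff]
  have h3 : x ∈ (𝓡∂ (d + 1)).interior M ↔ 0 < (e x).1 0 := h1.trans h2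
  rw [h3, not_lt]
  exact ⟨fun h => le_antisymm h (e x).2, fun h => h.le⟩


lemma symm_halfCons_mem_boundary {e : OpenPartialHomeomorph M (EuclideanHalfSpace (d + 1))}
    (he : e ∈ atlas (EuclideanHalfSpace (d + 1)) M) {y : EuclideanSpace ℝ (Fin d)}
    (hy : halfCons d y ∈ e.target) : e.symm (halfCons d y) ∈ (𝓡∂ (d + 1)).boundary M := by
  rw [mem_boundary_iff_of_mem_atlas he (e.map_target hy), e.right_inv hy]
  exact euclCons_zero d y

/-- The restriction to the boundary of a chart `e` of a manifold with boundary, followed by the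
identification of the boundary hyperplane of the half space with `ℝᵈ`. The point `x₀` only serves
as a value of the inverse map outside the target of the chart. -/
def boundaryChart (e : OpenPartialHomeomorph M (EuclideanHalfSpace (d + 1)))
    (he : e ∈ atlas (EuclideanHalfSpace (d + 1)) M) (x₀ : (𝓡∂ (d + 1)).boundary M) :
    OpenPartialHomeomorph ((𝓡∂ (d + 1)).boundary M) (EuclideanSpace ℝ (Fin d)) where
  toFun x := euclTail d (e x).1
  invFun y :=
    open Classical in
    if h : halfCons d y ∈ e.target then
      ⟨e.symm (halfCons d y), symm_halfCons_mem_boundary he h⟩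
    else x₀
  source := Subtype.val ⁻¹' e.source
  target := halfCons d ⁻¹' e.target
  map_source' x hx := by
    simp only [mem_preimage] at hx ⊢
    rw [halfCons_euclTail d ((mem_boundary_iff_of_mem_atlas he hx).1 x.2)]
    exact e.map_source hx
  map_target' y hy := by
    simp only [mem_preimage] at hy ⊢
    rw [dif_pos hy]
    exact e.map_target hy
  left_inv' x hx := by
    have h := halfCons_euclTail d ((mem_boundary_iff_of_mem_atlas he hx).1 x.2)
    have h' : halfCons d (euclTail d (e x).1) ∈ e.target := by rw [h]; exact e.map_source hx
    rw [dif_pos h']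
    ext
    simp only [h]
    exact e.left_inv hx
  right_inv' y hy := by
    simp only [mem_preimage] at hy
    rw [dif_pos hy]
    have h : e (e.symm (halfCons d y)) = halfCons d y := e.right_inv hy
    rw [h]
    exact euclTail_euclCons d y
  open_source := e.open_source.preimage continuous_subtype_val
  open_target := e.open_target.preimage (continuous_halfCons d)
  continuousOn_toFun := by
    refine (contDiff_euclTail d).continuous.comp_continuousOn
      (continuous_subtype_val.comp_continuousOn ?_)
    exact e.continuousOn.comp continuous_subtype_val.continuousOn (fun x hx => hx)
  continuousOn_invFun := by
    rw [Topology.IsInducing.subtypeVal.continuousOn_iff]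
    refine (e.continuousOn_symm.comp (continuous_halfCons d).continuousOn
      (fun x hx => hx)).congr ?_
    intro y hy
    have hy' : halfCons d y ∈ e.target := hy
    simp only [Function.comp_apply, dif_pos hy']

/-- The boundary of a smooth `(d + 1)`-dimensional manifold with boundary, with the smooth atlas
obtained by restricting the charts of the manifold. -/
instance boundaryChartedSpace :
    ChartedSpace (EuclideanSpace ℝ (Fin d)) ((𝓡∂ (d + 1)).boundary M) where
  atlas := {φ | ∃ (e : OpenPartialHomeomorph M (EuclideanHalfSpace (d + 1)))
    (he : e ∈ atlas (EuclideanHalfSpace (d + 1)) M) (x₀ : (𝓡∂ (d + 1)).boundary M),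
    φ = boundaryChart e he x₀}
  chartAt x := boundaryChart (chartAt _ (x : M)) (chart_mem_atlas _ _) x
  mem_chart_source x := mem_chart_source (EuclideanHalfSpace (d + 1)) (x : M)
  chart_mem_atlas x := ⟨_, chart_mem_atlas _ _, x, rfl⟩

instance boundaryIsManifold : IsManifold (𝓡 d) ∞ ((𝓡∂ (d + 1)).boundary M) := by
  refine isManifold_of_contDiffOn _ _ _ ?_
  rintro _ _ ⟨e, he, x₀, rfl⟩ ⟨e', he', x₁, rfl⟩
  have h : e.symm.trans e' ∈ contDiffGroupoid ∞ (𝓡∂ (d + 1)) :=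
    HasGroupoid.compatible he he'
  have h1 := (mem_groupoid_of_pregroupoid.1 h).1
  have h2 : ContDiffOn ℝ ∞ ((𝓡∂ (d + 1)) ∘ (e.symm.trans e') ∘ (𝓡∂ (d + 1)).symm)
      ((𝓡∂ (d + 1)).symm ⁻¹' (e.symm.trans e').source ∩ range (𝓡∂ (d + 1))) := h1
  have hI (y : EuclideanSpace ℝ (Fin d)) :
      (𝓡∂ (d + 1)).symm (euclCons d y) = halfCons d y :=
    (𝓡∂ (d + 1)).left_inv (halfCons d y)
  have hval {y : EuclideanSpace ℝ (Fin d)} (hy : y ∈ (boundaryChart e he x₀).target) :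
      (((boundaryChart e he x₀).symm y : (𝓡∂ (d + 1)).boundary M) : M)
        = e.symm (halfCons d y) := by
    have hy' : halfCons d y ∈ e.target := hy
    simp only [boundaryChart, OpenPartialHomeomorph.coe_mk_symm, PartialEquiv.coe_symm_mk,
      dif_pos hy']
  simp only [modelWithCornersSelf_coe, modelWithCornersSelf_coe_symm, range_id, inter_univ,
    preimage_id_eq, id_eq, Function.comp_id, Function.id_comp]
  refine ((contDiff_euclTail d).comp_contDiffOn (h2.comp (contDiff_euclCons d).contDiffOn
    ?_)).congr ?_
  · intro y hy
    rw [OpenPartialHomeomorph.trans_source, OpenPartialHomeomorph.symm_source] at hy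
    obtain ⟨hy1, hy2⟩ := hy
    refine ⟨?_, halfCons d y, rfl⟩
    rw [mem_preimage, hI, OpenPartialHomeomorph.trans_source]
    refine ⟨hy1, ?_⟩
    have hy3 : (((boundaryChart e he x₀).symm y : (𝓡∂ (d + 1)).boundary M) : M) ∈ e'.source := hy2
    rwa [hval hy1] at hy3
  · intro y hy
    rw [OpenPartialHomeomorph.trans_source, OpenPartialHomeomorph.symm_source] at hy
    have h3 : ((boundaryChart e he x₀).symm.trans (boundaryChart e' he' x₁)) y
        = euclTail d (e' (((boundaryChart e he x₀).symm y : (𝓡∂ (d + 1)).boundary M) : M)).1 := rfl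
    rw [h3, hval hy.1]
    simp only [Function.comp_apply, hI]
    rfl

end Boundary
section Forms

variable {E : Type*} [NormedAddCommGroup E] [NormedSpace ℝ E]
  {H : Type*} [TopologicalSpace H] (I : ModelWithCorners ℝ E H)
  {E' : Type*} [NormedAddCommGroup E'] [NormedSpace ℝ E']
  {H' : Type*} [TopologicalSpace H'] (I' : ModelWithCorners ℝ E' H')
  (M : Type*) [TopologicalSpace M] [ChartedSpace H M]
  {M' : Type*} [TopologicalSpace M'] [ChartedSpace H' M']

/-- A (not necessarily smooth) differential `p`-form on a manifold. -/
abbrev DiffForm (p : ℕ) : Type _ := ∀ x : M, TangentSpace I x [⋀^Fin p]→L[ℝ] ℝ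

variable {M} {p q : ℕ}

/-- The pullback `f^* β` of a differential form. -/
def DiffForm.pullback (f : M → M') (β : DiffForm I' M' p) : DiffForm I M p :=
  fun x => (β (f x)).compContinuousLinearMap (mfderiv I I' f x)

variable {I}

/-- The expression of a differential form in the preferred chart at `x₀`, that is, its pullback
under the inverse of that chart. -/
def DiffForm.inChart (β : DiffForm I M p) (x₀ : M) : E → E [⋀^Fin p]→L[ℝ] ℝ :=
  fun y => (β ((extChartAt I x₀).symm y)).compContinuousLinearMap
    (mfderivWithin 𝓘(ℝ, E) I (extChartAt I x₀).symm (range I) y)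

/-- Smoothness of a differential form: its expressions in charts are smooth. -/
def DiffForm.IsSmooth (β : DiffForm I M p) : Prop :=
  ∀ x₀ : M, ContDiffOn ℝ ∞ (β.inChart x₀) (extChartAt I x₀).target

/-- The exterior derivative of a differential form. At `x` it is computed in the preferred chart
at `x`, which is the chart that identifies `TangentSpace I x` with the model space `E`. -/
def DiffForm.d (β : DiffForm I M p) : DiffForm I M (p + 1) :=
  fun x => (extDerivWithin (β.inChart x) (range I) (extChartAt I x x) : E [⋀^Fin (p + 1)]→L[ℝ] ℝ)

end Forms

section Wedge

variable {V : Type*} [AddCommGroup V] [Module ℝ V] {p q : ℕ}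

/-- The wedge product of alternating forms. -/
def wedge (a : V [⋀^Fin p]→ₗ[ℝ] ℝ) (b : V [⋀^Fin q]→ₗ[ℝ] ℝ) : V [⋀^Fin (p + q)]→ₗ[ℝ] ℝ :=
  ((LinearMap.mul' ℝ ℝ).compAlternatingMap (a.domCoprod b)).domDomCongr finSumFinEquiv

/-- The `m`-th wedge power `σ ∧ ... ∧ σ` of an alternating two-form. -/
def wedgePow (σ : V [⋀^Fin 2]→ₗ[ℝ] ℝ) : (m : ℕ) → V [⋀^Fin (2 * m)]→ₗ[ℝ] ℝ
  | 0 => AlternatingMap.constOfIsEmpty ℝ V (Fin 0) 1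
  | m + 1 => wedge (wedgePow σ m) σ

end Wedge

section Contact

variable {E : Type*} [NormedAddCommGroup E] [NormedSpace ℝ E]
  {H : Type*} [TopologicalSpace H] {I : ModelWithCorners ℝ E H}
  {M : Type*} [TopologicalSpace M] [ChartedSpace H M]

/-- A contact one-form on a manifold (possibly with boundary) of dimension `2 * m + 1`: a smooth
one-form `β` such that `β ∧ (dβ)^m` vanishes nowhere. -/
structure IsContactForm (m : ℕ) (β : DiffForm I M 1) : Prop where
  finrank_eq : Module.finrank ℝ E = 2 * m + 1
  isSmooth : β.IsSmooth
  wedge_ne_zero : ∀ x : M,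
    wedge (β x).toAlternatingMap (wedgePow (β.d x).toAlternatingMap m) ≠ 0

end Contact

section Cut

variable (d : ℕ) {M : Type*} [TopologicalSpace M] [ChartedSpace (EuclideanHalfSpace (d + 1)) M]
  (U : TopologicalSpace.Opens M) [MulAction Circle U]

/-- The relation that collapses the boundary along the circle orbits: distinct points are
equivalent iff they both lie in the boundary and in the same orbit. -/
def cutSetoid : Setoid M where
  r x y := x = y ∨ (x ∈ (𝓡∂ (d + 1)).boundary M ∧ y ∈ (𝓡∂ (d + 1)).boundary M ∧
    ∃ x' y' : U, (x' : M) = x ∧ (y' : M) = y ∧ ∃ a : Circle, a • x' = y')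
  iseqv := by
    refine ⟨fun x => Or.inl rfl, ?_, ?_⟩
    · rintro x y (rfl | ⟨hx, hy, x', y', hx', hy', a, h⟩)
      · exact Or.inl rfl
      · exact Or.inr ⟨hy, hx, y', x', hy', hx', a⁻¹, by rw [← h, inv_smul_smul]⟩
    · rintro x y z (rfl | ⟨hx, hy, x', y', hx', hy', a, h⟩) h2
      · exact h2
      · obtain (rfl | ⟨hy2, hz, y'', z', hy'', hz', b, h'⟩) := h2
        · exact Or.inr ⟨hx, hy, x', y', hx', hy', a, h⟩
        · obtain rfl : y' = y'' := Subtype.ext (hy'.trans hy''.symm)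
          exact Or.inr ⟨hx, hz, x', z', hx', hz', b * a, by rw [mul_smul, h, h']⟩

/-- The cut space `M_cut = M / ∼`, with the quotient topology. -/
abbrev CutSpace : Type _ := Quotient (cutSetoid d U)

/-- The quotient map `c : M → M_cut`. -/
def cutMap (x : M) : CutSpace d U := Quotient.mk (cutSetoid d U) x

/-- The subset `M_red = c(∂M)` of `M_cut`, which as a set is `∂M / S¹`. -/
def redSet : Set (CutSpace d U) := cutMap d U '' (𝓡∂ (d + 1)).boundary M

/-- The quotient map `∂M → M_red`. -/
def redMap (x : (𝓡∂ (d + 1)).boundary M) : redSet d U := ⟨cutMap d U x, x, x.2, rfl⟩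

/-- `V` is a circle-invariant open neighbourhood of the boundary of `M` in `U`. -/
structure IsInvariantNhd (V : Set U) : Prop where
  isOpen : IsOpen V
  boundary_subset : ∀ x : U, (x : M) ∈ (𝓡∂ (d + 1)).boundary M → x ∈ V
  smul_mem : ∀ (a : Circle) (x : U), x ∈ V → a • x ∈ V

/-- An invariant boundary defining function: a smooth function `f ≥ 0` on `M` with
`f⁻¹(0) = ∂M`, whose differential vanishes nowhere on `∂M`, and which is invariant near `∂M`. -/
structure IsInvariantBoundaryDefining (f : M → ℝ) : Prop where
  contMDiff : ContMDiff (𝓡∂ (d + 1)) 𝓘(ℝ, ℝ) ∞ f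
  nonneg : ∀ x, 0 ≤ f x
  eq_zero_iff : ∀ x, f x = 0 ↔ x ∈ (𝓡∂ (d + 1)).boundary M
  mfderiv_ne_zero : ∀ x ∈ (𝓡∂ (d + 1)).boundary M, mfderiv (𝓡∂ (d + 1)) 𝓘(ℝ, ℝ) f x ≠ 0
  invariant : ∃ V : Set U, IsInvariantNhd d U V ∧ ∀ (a : Circle), ∀ x ∈ V, f (a • x : U) = f x

/-- The functions `h : M_cut → ℝ` whose lift `h ∘ c` to `M` is smooth on the interior of `M` and,
on an invariant neighbourhood `V` of the boundary, has the form `x ↦ H (x, √(f x))` for a smooth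
function `H : V × ℂ → ℝ` with `H (a • x, z) = H (x, a z)`. -/
def cutSmoothFunctions (f : M → ℝ) : Set (CutSpace d U → ℝ) :=
  {h | ContMDiffOn (𝓡∂ (d + 1)) 𝓘(ℝ, ℝ) ∞ (h ∘ cutMap d U) ((𝓡∂ (d + 1)).interior M) ∧
    ∃ (V : Set U) (H : U × ℂ → ℝ), IsInvariantNhd d U V ∧
      ContMDiffOn ((𝓡∂ (d + 1)).prod 𝓘(ℝ, ℂ)) 𝓘(ℝ, ℝ) ∞ H (V ×ˢ univ) ∧
      (∀ (a : Circle), ∀ x ∈ V, ∀ z : ℂ, H (a • x, z) = H (x, a * z)) ∧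
      ∀ x ∈ V, h (cutMap d U x) = H (x, (√(f x) : ℝ))}

/-- A differential form on `M` is invariant near `∂M` if its restriction to some invariant
neighbourhood of the boundary is preserved by the circle action. -/
def IsInvariantNearBoundary {p : ℕ} (β : DiffForm (𝓡∂ (d + 1)) M p) : Prop :=
  ∃ V : Set U, IsInvariantNhd d U V ∧ ∀ a : Circle, ∀ x ∈ V,
    DiffForm.pullback (𝓡∂ (d + 1)) (𝓡∂ (d + 1)) (fun y : U => ((a • y : U) : M)) β x =
      DiffForm.pullback (𝓡∂ (d + 1)) (𝓡∂ (d + 1)) (fun y : U => (y : M)) β x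

variable {d} [IsManifold (𝓡∂ (d + 1)) ∞ M]

/-- The pullback of a differential form on `M` to the boundary `∂M`. -/
def boundaryPullback {p : ℕ} (β : DiffForm (𝓡∂ (d + 1)) M p) :
    DiffForm (𝓡 d) ((𝓡∂ (d + 1)).boundary M) p :=
  DiffForm.pullback (𝓡 d) (𝓡∂ (d + 1)) Subtype.val β

/-- A one-form `β` on `M` is basic on `∂M` if its pullback to `∂M` is horizontal, i.e. vanishes on
the velocity vectors of the curves `t ↦ exp(it) • x` with `x ∈ ∂M`, and is invariant under the
circle action. -/
structure IsBasicOnBoundary (hU : (𝓡∂ (d + 1)).boundary M ⊆ U)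
    (β : DiffForm (𝓡∂ (d + 1)) M 1) : Prop where
  horizontal : ∀ x : (𝓡∂ (d + 1)).boundary M,
    DiffForm.pullback 𝓘(ℝ, ℝ) (𝓡∂ (d + 1))
      (fun t : ℝ => ((Circle.exp t • (⟨x, hU x.2⟩ : U) : U) : M)) β 0 (fun _ => (1 : ℝ)) = 0
  invariant : ∀ a : Circle,
    DiffForm.pullback (𝓡 d) (𝓡∂ (d + 1))
      (fun x : (𝓡∂ (d + 1)).boundary M => ((a • (⟨x, hU x.2⟩ : U) : U) : M)) β =
        boundaryPullback β

variable {U} {m n p : ℕ}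

/-- `β_red` is the differential form on `M_red` induced by the form `β` on `M`: it is smooth and
its pullback to `∂M` under the quotient map is the pullback of `β` to `∂M`. -/
structure IsReducedForm [ChartedSpace (EuclideanSpace ℝ (Fin m)) (redSet d U)]
    (β : DiffForm (𝓡∂ (d + 1)) M p) (βred : DiffForm (𝓡 m) (redSet d U) p) : Prop where
  isSmooth : βred.IsSmooth
  pullback_eq : DiffForm.pullback (𝓡 d) (𝓡 m) (redMap d U) βred = boundaryPullback β

/-- `β_cut` is the differential form on `M_cut` induced by the form `β` on `M`: it is smooth and
its pullback to the interior of `M` under the quotient map is `β`. -/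
structure IsCutForm [ChartedSpace (EuclideanSpace ℝ (Fin n)) (CutSpace d U)]
    (β : DiffForm (𝓡∂ (d + 1)) M p) (βcut : DiffForm (𝓡 n) (CutSpace d U) p) : Prop where
  isSmooth : βcut.IsSmooth
  pullback_eq : ∀ x ∈ (𝓡∂ (d + 1)).interior M,
    DiffForm.pullback (𝓡∂ (d + 1)) (𝓡 n) (cutMap d U) βcut x = β x

end Cut

end CircleCut
end

/-! Near a boundary point, freeness of the action gives coordinates (θ, y, t) in which the circle
translates θ, while t ≥ 0 vanishes exactly on the boundary (`AdaptedChart`,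
`nonempty_adaptedChart`). Collapsing the circles at t = 0 means reading θ and √t as polar
coordinates: with w = √t e^{iθ} the cut space is locally an open subset of Y × ℂ, and the reduced
space is the locus w = 0. Passing to another adapted chart multiplies t by a positive smooth
function ρ of (y, t), by Hadamard's lemma, and shifts θ by a function of (y, t). So w is multiplied
by a smooth function of (y, |w|²), and the charts are compatible (`cutCoord_polar_trans`,
`contDiffAt_cutCoord_polar`). Over the interior the charts of M are kept. No boundary defining
function enters, so a single smooth structure serves every f.

An invariant β has the form α + g dθ, where α involves only dy and dt and all coefficients depend on
(y, t) only. Horizontality on the boundary says g = 0 at t = 0, so g = tG with G smooth. Since t dθ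
= Im(w̄ dw) for t = |w|², the form β becomes the smooth form α + G Im(w̄ dw) on Y × ℂ (`cutForm`,
`exists_hasMFDerivAt_polar`), and its restriction to w = 0 is the reduced form (`redForm`). The cut
form is unique because the complement of the reduced space is dense. The reduced form is unique
because the projection of the boundary has surjective derivatives.

For contactness, the condition β ∧ (dβ)^m ≠ 0 is replaced by the equivalent one that dβ is
nondegenerate on ker β (`isContactPair_of_wedge_ne_zero`, `wedge_ne_zero_of_isContactPair`). Along
the boundary, contactness of β forces G ≠ 0. A correction in the orbit direction then gives
nondegeneracy of the reduced form (`ContactAt.horizontal`). At w = 0 the differential of the cut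
form is that of the reduced form plus 2G times the area form of ℂ, so it is nondegenerate as well
(`contactAt_cutForm`).

For the smooth functions, write f = t · slope with slope positive at the boundary
(`slope_zero_pos`). An equivariant H yields h as H evaluated at (slice (y, |w|²), √slope · w), which
is smooth in (y, w). Conversely, a smooth h is extended locally to functions on U × ℂ with
prescribed values where |z|² = f(x). These are glued by a partition of unity and averaged over the
circle (`mem_cutSmoothFunctions_of_contMDiff`). The topological claims hold because the quotient map
is closed with compact fibres. -/

noncomputable section
namespace CircleCut

set_option linter.unusedSectionVars false

/-! ### Exterior algebra: wedge powers expanded into determinants of covectors. -/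

section ContactAlgebra

variable {V : Type*} [AddCommGroup V] [Module ℝ V]

/-- The product multilinear map `v ↦ ∏ i, ℓ i (v i)` of a family of covectors. -/
def covectorProd {ι : Type*} [Fintype ι] (ℓ : ι → V →ₗ[ℝ] ℝ) :
    MultilinearMap ℝ (fun _ : ι => V) ℝ :=
  (MultilinearMap.mkPiAlgebra ℝ ι ℝ).compLinearMap ℓ

/-- The wedge product of a family of covectors. -/
def covectorWedge {ι : Type*} [Fintype ι] [DecidableEq ι] (ℓ : ι → V →ₗ[ℝ] ℝ) :
    V [⋀^ι]→ₗ[ℝ] ℝ :=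
  MultilinearMap.alternatization (covectorProd ℓ)

lemma covectorWedge_apply {ι : Type*} [Fintype ι] [DecidableEq ι] (ℓ : ι → V →ₗ[ℝ] ℝ)
    (u : ι → V) : covectorWedge ℓ u = (Matrix.of fun k i => ℓ i (u k)).det := by
  rw [covectorWedge, MultilinearMap.alternatization_apply, Matrix.det_apply]
  refine Finset.sum_congr rfl fun π _ => ?_
  simp [covectorProd]

lemma covectorWedge_comp_equiv {ι κ : Type*} [Fintype ι] [DecidableEq ι] [Fintype κ]
    [DecidableEq κ] (e : κ ≃ ι) (ℓ : ι → V →ₗ[ℝ] ℝ) (u : κ → V) :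
    covectorWedge (ℓ ∘ e) u = covectorWedge ℓ (u ∘ e.symm) := by
  rw [covectorWedge_apply, covectorWedge_apply, ← Matrix.det_submatrix_equiv_self e]
  congr 1
  ext i j
  simp

lemma covectorWedge_comp_perm {ι : Type*} [Fintype ι] [DecidableEq ι] (e : Equiv.Perm ι)
    (ℓ : ι → V →ₗ[ℝ] ℝ) : covectorWedge (ℓ ∘ e) = Equiv.Perm.sign e • covectorWedge ℓ := by
  ext u
  rw [AlternatingMap.smul_apply, covectorWedge_apply, covectorWedge_apply, Units.smul_def,
    zsmul_eq_mul, ← Matrix.det_permute']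
  rfl

lemma covectorWedge_eq_zero_of_eq {ι : Type*} [Fintype ι] [DecidableEq ι] {ℓ : ι → V →ₗ[ℝ] ℝ}
    {i j : ι} (hij : i ≠ j) (h : ℓ i = ℓ j) : covectorWedge ℓ = 0 := by
  ext u
  rw [covectorWedge_apply]
  exact Matrix.det_zero_of_column_eq hij (fun k => by simp [h])

/-- Alternatization carries the product of multilinear maps to `domCoprod`, which sums over shuffles
only, so no factorials appear. -/
lemma wedge_covectorWedge {p q : ℕ} (ℓ : Fin p → V →ₗ[ℝ] ℝ) (ℓ' : Fin q → V →ₗ[ℝ] ℝ) :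
    wedge (covectorWedge ℓ) (covectorWedge ℓ') = covectorWedge (Fin.append ℓ ℓ') := by
  have h : (LinearMap.mul' ℝ ℝ).compAlternatingMap
      ((covectorWedge ℓ).domCoprod (covectorWedge ℓ')) = covectorWedge (Sum.elim ℓ ℓ') := by
    ext u
    rw [covectorWedge, covectorWedge, ← MultilinearMap.domCoprod_alternization,
      LinearMap.compAlternatingMap_apply, covectorWedge, MultilinearMap.alternatization_apply,
      MultilinearMap.alternatization_apply, map_sum]
    refine Finset.sum_congr rfl fun π _ => ?_
    rw [Units.smul_def, Units.smul_def, map_zsmul]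
    simp [covectorProd]
  have h2 : Fin.append ℓ ℓ' = Sum.elim ℓ ℓ' ∘ finSumFinEquiv.symm := by
    ext i v
    refine Fin.addCases (fun i => ?_) (fun i => ?_) i <;> simp
  ext u
  rw [wedge, h, h2, covectorWedge_comp_equiv]
  rfl

lemma wedge_add_left {p q : ℕ} (a a' : V [⋀^Fin p]→ₗ[ℝ] ℝ) (b : V [⋀^Fin q]→ₗ[ℝ] ℝ) :
    wedge (a + a') b = wedge a b + wedge a' b := by
  simp only [wedge, ← AlternatingMap.domCoprod'_apply, TensorProduct.add_tmul, map_add]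
  ext; simp

/-- The wedge product as a bilinear map. -/
def wedgeBilin (p q : ℕ) :
    (V [⋀^Fin p]→ₗ[ℝ] ℝ) →ₗ[ℝ] (V [⋀^Fin q]→ₗ[ℝ] ℝ) →ₗ[ℝ] (V [⋀^Fin (p + q)]→ₗ[ℝ] ℝ) :=
  LinearMap.mk₂ ℝ wedge wedge_add_left
    (fun c a b => by
      simp only [wedge, ← AlternatingMap.domCoprod'_apply, ← TensorProduct.smul_tmul', map_smul]
      ext; simp)
    (fun a b b' => by
      simp only [wedge, ← AlternatingMap.domCoprod'_apply, TensorProduct.tmul_add, map_add]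
      ext; simp)
    (fun c a b => by
      simp only [wedge, ← AlternatingMap.domCoprod'_apply, TensorProduct.tmul_smul, map_smul]
      ext; simp)

lemma wedge_eq_wedgeBilin {p q : ℕ} (a : V [⋀^Fin p]→ₗ[ℝ] ℝ) (b : V [⋀^Fin q]→ₗ[ℝ] ℝ) :
    wedge a b = wedgeBilin p q a b := rfl

/-- The list of covectors `ξ (j 0), η (j 0), ξ (j 1), η (j 1), ...`. -/
def interleave {J : Type*} (ξ η : J → V →ₗ[ℝ] ℝ) :
    (m : ℕ) → (Fin m → J) → Fin (2 * m) → V →ₗ[ℝ] ℝ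
  | 0, _ => fun i => i.elim0
  | m + 1, j => Fin.append (interleave ξ η m (Fin.init j)) ![ξ (j (Fin.last m)), η (j (Fin.last m))]

lemma covectorWedge_pair_apply (ξ η : V →ₗ[ℝ] ℝ) (v w : V) :
    covectorWedge ![ξ, η] ![v, w] = ξ v * η w - η v * ξ w := by
  rw [covectorWedge_apply, Matrix.det_fin_two]
  simp

/-- Bilinearity expands the power of a sum of decomposable two-forms into a sum over words in J; the
inductive step splits off the last letter of the word. -/
lemma wedgePow_eq_sum {J : Type*} [Fintype J] {ξ η : J → V →ₗ[ℝ] ℝ} {σ : V [⋀^Fin 2]→ₗ[ℝ] ℝ}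
    (h : σ = ∑ j, covectorWedge ![ξ j, η j]) (m : ℕ) :
    wedgePow σ m = ∑ j : Fin m → J, covectorWedge (interleave ξ η m j) := by
  induction m with
  | zero =>
    ext u
    simp [wedgePow, covectorWedge_apply]
  | succ m ih =>
    have h3 : ∑ j : Fin (m + 1) → J, covectorWedge (interleave ξ η (m + 1) j) =
        ∑ x : J × (Fin m → J), wedge (covectorWedge (interleave ξ η m x.2))
          (covectorWedge ![ξ x.1, η x.1]) := by
      refine Fintype.sum_equiv (Fin.snocEquiv (fun _ : Fin (m + 1) => J)).symm _ _ fun j => ?_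
      rw [wedge_covectorWedge]
      rfl
    rw [h3, Fintype.sum_prod_type]
    rw [wedgePow, ih, wedge_eq_wedgeBilin]
    conv_lhs => rw [h]
    simp only [map_sum, LinearMap.sum_apply]
    rfl

/-- The index `2 i + k` as a pair `(i, k)`. -/
def pairIndex : (m : ℕ) → Fin (2 * m) ≃ Fin m × Fin 2 := fun m =>
  (finCongr (Nat.mul_comm 2 m)).trans finProdFinEquiv.symm

lemma interleave_apply {J : Type*} (ξ η : J → V →ₗ[ℝ] ℝ) (m : ℕ) (j : Fin m → J)
    (i : Fin (2 * m)) : interleave ξ η m j i =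
      ![ξ, η] (pairIndex m i).2 (j (pairIndex m i).1) := by
  induction m with
  | zero => exact i.elim0
  | succ m ih =>
    refine Fin.addCases (m := 2 * m) (n := 2) (fun i => ?_) (fun i => ?_) i
    · rw [interleave]
      -- `2 * (m + 1)` agrees with `2 * m + 2` only after unfolding, which `rw` does not see.
      erw [Fin.append_left]
      rw [ih]
      have h1 : (pairIndex (m + 1) (Fin.castAdd 2 i)).2 = (pairIndex m i).2 := by
        ext
        simp [pairIndex, finProdFinEquiv, Fin.modNat]
      have h2 : (pairIndex (m + 1) (Fin.castAdd 2 i)).1 = (pairIndex m i).1.castSucc := by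
        ext
        simp [pairIndex, finProdFinEquiv, Fin.divNat]
      erw [h1, h2]
      rfl
    · rw [interleave]
      erw [Fin.append_right]
      have h1 : (pairIndex (m + 1) (Fin.natAdd (2 * m) i)).2 = i := by
        ext
        simp [pairIndex, finProdFinEquiv, Fin.modNat]
        omega
      have h2 : (pairIndex (m + 1) (Fin.natAdd (2 * m) i)).1 = Fin.last m := by
        ext
        simp [pairIndex, finProdFinEquiv, Fin.divNat]
        omega
      erw [h1, h2]
      fin_cases i <;> rfl

/-- Permuting the pairs acts by the same permutation on their first and on their second entries, so
the sign is a square. -/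
lemma interleave_comp_perm {J : Type*} (ξ η : J → V →ₗ[ℝ] ℝ) (m : ℕ) (j : Fin m → J)
    (π : Equiv.Perm (Fin m)) : ∃ e : Equiv.Perm (Fin (2 * m)), Equiv.Perm.sign e = 1 ∧
      interleave ξ η m (j ∘ π) = interleave ξ η m j ∘ e := by
  refine ⟨(pairIndex m).trans ((Equiv.prodCongrLeft (fun _ : Fin 2 => π)).trans
    (pairIndex m).symm), ?_, ?_⟩
  · rw [← Equiv.trans_assoc, Equiv.Perm.sign_trans_trans_symm, Equiv.Perm.sign_prodCongrLeft]
    simp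
  · ext i v
    simp [interleave_apply]

end ContactAlgebra

/-! ### The contact condition as nondegeneracy on the kernel. -/

section ContactAlgebra

variable {V : Type*} [AddCommGroup V] [Module ℝ V]

/-- The covector underlying an alternating one-form. -/
def toCovector (a : V [⋀^Fin 1]→ₗ[ℝ] ℝ) : V →ₗ[ℝ] ℝ :=
  (AlternatingMap.ofSubsingleton ℝ V ℝ (0 : Fin 1)).symm a

lemma toCovector_apply (a : V [⋀^Fin 1]→ₗ[ℝ] ℝ) (v : V) : toCovector a v = a (fun _ => v) := rfl

lemma eq_covectorWedge_toCovector (a : V [⋀^Fin 1]→ₗ[ℝ] ℝ) :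
    a = covectorWedge ![toCovector a] := by
  ext u
  rw [covectorWedge_apply, Matrix.det_fin_one]
  simp only [Matrix.of_apply, Matrix.cons_val_zero, toCovector_apply]
  congr 1
  ext i
  rw [Subsingleton.elim i 0]

/-- The bilinear form underlying an alternating two-form. -/
def toBilin (σ : V [⋀^Fin 2]→ₗ[ℝ] ℝ) : V →ₗ[ℝ] V →ₗ[ℝ] ℝ where
  toFun x := toCovector (σ.curryLeft x)
  map_add' x y := by ext; simp [toCovector_apply]
  map_smul' c x := by ext; simp [toCovector_apply]

lemma toBilin_apply (σ : V [⋀^Fin 2]→ₗ[ℝ] ℝ) (x y : V) : toBilin σ x y = σ ![x, y] := by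
  change σ (Matrix.vecCons x fun _ => y) = _
  congr 1
  ext i
  fin_cases i <;> rfl

lemma toBilin_self (σ : V [⋀^Fin 2]→ₗ[ℝ] ℝ) (x : V) : toBilin σ x x = 0 := by
  rw [toBilin_apply]
  exact σ.map_eq_zero_of_eq _ (i := 0) (j := 1) rfl (by decide)

lemma alternating_sum_apply {ι J : Type*} (s : Finset J) (f : J → V [⋀^ι]→ₗ[ℝ] ℝ) (u : ι → V) :
    (∑ j ∈ s, f j) u = ∑ j ∈ s, f j u := by
  classical
  induction s using Finset.induction_on with
  | empty => simp
  | insert a s ha ih => rw [Finset.sum_insert ha, Finset.sum_insert ha, AlternatingMap.add_apply, ih]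

lemma alternating_two_ext {σ σ' : V [⋀^Fin 2]→ₗ[ℝ] ℝ} (h : ∀ x y, σ ![x, y] = σ' ![x, y]) :
    σ = σ' := by
  ext u
  have : u = ![u 0, u 1] := by ext i; fin_cases i <;> rfl
  rw [this, h]

/-- A pair of a one-form and a two-form such that the two-form is nondegenerate on the kernel of
the one-form. -/
def IsContactPair (b : V →ₗ[ℝ] ℝ) (B : V →ₗ[ℝ] V →ₗ[ℝ] ℝ) : Prop :=
  ∀ v, b v = 0 → (∀ w, b w = 0 → B v w = 0) → v = 0

/-- In top degree it suffices to evaluate on a basis u: the coefficients of v in that basis form a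
left null vector of the matrix of values ℓ i (u k). A dependent family is killed by alternation. -/
lemma covectorWedge_eq_zero_of_common_kernel [FiniteDimensional ℝ V] {n : ℕ}
    (hn : Module.finrank ℝ V = n) (ℓ : Fin n → V →ₗ[ℝ] ℝ) {v : V} (hv : v ≠ 0)
    (h : ∀ i, ℓ i v = 0) : covectorWedge ℓ = 0 := by
  ext u
  by_cases hu : LinearIndependent ℝ u
  · have hspan := hu.span_eq_top_of_card_eq_finrank' (by simp [hn])
    have hmem : v ∈ Submodule.span ℝ (range u) := hspan ▸ Submodule.mem_top
    obtain ⟨c, hc⟩ := (Submodule.mem_span_range_iff_exists_fun ℝ).1 hmem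
    rw [covectorWedge_apply, AlternatingMap.zero_apply, ← Matrix.exists_vecMul_eq_zero_iff]
    refine ⟨c, ?_, ?_⟩
    · rintro rfl
      exact hv (by simp [← hc])
    · ext i
      have := h i
      rw [← hc, map_sum] at this
      simpa [Matrix.vecMul, dotProduct] using this
  · exact AlternatingMap.map_linearDependent _ _ hu

/-- Independent covectors are jointly surjective, so there are vectors dual to them, and on these
the determinant is that of the identity matrix. -/
lemma covectorWedge_ne_zero_of_linearIndependent {ι : Type*} [Fintype ι] [DecidableEq ι]
    {ℓ : ι → V →ₗ[ℝ] ℝ} (hℓ : LinearIndependent ℝ ℓ) : covectorWedge ℓ ≠ 0 := by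
  have hsurj : Surjective (LinearMap.pi ℓ) := by
    rw [← LinearMap.range_eq_top]
    by_contra hne
    obtain ⟨f, hf0, hf⟩ := Submodule.exists_le_ker_of_lt_top _ (lt_top_iff_ne_top.2 hne)
    apply hf0
    have hc : ∑ i, f (Pi.single i 1) • ℓ i = 0 := by
      ext v
      have h1 : f (LinearMap.pi ℓ v) = 0 := hf ⟨v, rfl⟩
      have h2 : LinearMap.pi ℓ v = ∑ i, ℓ i v • (Pi.single i (1 : ℝ) : ι → ℝ) := by
        ext j
        simp [Pi.single_apply]
      rw [h2, map_sum] at h1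
      simpa [mul_comm] using h1
    have h3 := Fintype.linearIndependent_iff.1 hℓ _ hc
    refine LinearMap.pi_ext' fun i => ?_
    ext
    simpa using h3 i
  intro h0
  choose u hu using fun k : ι => hsurj (Pi.single k 1)
  have h1 : covectorWedge ℓ u = 1 := by
    rw [covectorWedge_apply, ← Matrix.det_one (n := ι) (R := ℝ)]
    congr 1
    ext k i
    have := congrFun (hu k) i
    simp only [LinearMap.pi_apply] at this
    simp [this, Matrix.one_apply, Pi.single_apply, eq_comm]
  rw [h0] at h1
  simp at h1

/-- Darboux bases: an alternating bilinear form is a sum of wedges of pairs of covectors which have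
a dual family of vectors. -/
lemma exists_darboux [FiniteDimensional ℝ V] (B : V →ₗ[ℝ] V →ₗ[ℝ] ℝ) (hB : ∀ x, B x x = 0) :
    ∃ (r : ℕ) (ξ η : Fin r → V →ₗ[ℝ] ℝ) (e f : Fin r → V),
      (∀ x y, B x y = ∑ i, (ξ i x * η i y - η i x * ξ i y)) ∧
      (∀ i j, ξ i (e j) = if i = j then 1 else 0) ∧ (∀ i j, η i (e j) = 0) ∧
      (∀ i j, ξ i (f j) = 0) ∧ (∀ i j, η i (f j) = if i = j then 1 else 0) := by
  -- Induction on the rank of B, expressed as dim V − dim ker B.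
  induction hn : Module.finrank ℝ V - Module.finrank ℝ (LinearMap.ker B) using Nat.strong_induction_on
    generalizing B with
  | _ n ih =>
  have hskew : ∀ x y, B x y = - B y x := fun x y => by
    have := hB (x + y)
    simp only [map_add, LinearMap.add_apply, hB] at this
    linarith
  by_cases h0 : B = 0
  · exact ⟨0, fun i => i.elim0, fun i => i.elim0, fun i => i.elim0, fun i => i.elim0,
      by simp [h0], fun i => i.elim0, fun i => i.elim0, fun i => i.elim0, fun i => i.elim0⟩
  obtain ⟨e₀, f₀, h1⟩ : ∃ x y, B x y = 1 := by
    by_contra! hcon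
    apply h0
    ext x y
    by_contra hxy
    apply hcon ((B x y)⁻¹ • x) y
    simp only [map_smul, LinearMap.smul_apply, smul_eq_mul]
    exact inv_mul_cancel₀ hxy
  set ξ₀ : V →ₗ[ℝ] ℝ := B.flip f₀ with hξ₀
  set η₀ : V →ₗ[ℝ] ℝ := B e₀ with hη₀
  have hξe : ξ₀ e₀ = 1 := h1
  have hξf : ξ₀ f₀ = 0 := hB f₀
  have hηe : η₀ e₀ = 0 := hB e₀
  have hηf : η₀ f₀ = 1 := h1
  -- Removing the hyperbolic plane of `e₀` and `f₀` leaves a form that has both vectors in its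
  -- kernel, hence of smaller rank.
  set B' : V →ₗ[ℝ] V →ₗ[ℝ] ℝ := B - ξ₀.smulRight η₀ + η₀.smulRight ξ₀ with hB'
  have hB'a : ∀ x y, B' x y = B x y - ξ₀ x * η₀ y + η₀ x * ξ₀ y := fun x y => by simp [hB']
  have hB'e : ∀ y, B' e₀ y = 0 := fun y => by rw [hB'a, hξe, hηe, hη₀]; ring
  have hB'f : ∀ y, B' f₀ y = 0 := fun y => by
    rw [hB'a, hξf, hηf, hξ₀, hskew f₀ y, LinearMap.flip_apply]; ring
  have hlt : LinearMap.ker B < LinearMap.ker B' := by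
    refine lt_of_le_of_ne (fun z hz => ?_) ?_
    · rw [LinearMap.mem_ker] at hz ⊢
      ext y
      rw [hB'a, hξ₀, hη₀, LinearMap.flip_apply, hskew e₀ z, hz]
      simp
    · intro heq
      have : e₀ ∈ LinearMap.ker B := by
        rw [heq, LinearMap.mem_ker]
        ext y
        simp [hB'e]
      rw [LinearMap.mem_ker] at this
      rw [hη₀, this] at h1
      simp at h1
  have hfr := Submodule.finrank_lt_finrank_of_lt hlt
  have hle := Submodule.finrank_le (LinearMap.ker B')
  obtain ⟨r, ξ, η, e, f, hs, hξe', hηe', hξf', hηf'⟩ := ih _ (by omega) B'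
    (fun x => by rw [hB'a, hB]; ring) rfl
  -- Pairing z with `f i` and `e i` reads off ξ i z and, up to sign, η i z. So the covectors found
  -- by induction vanish on the kernel of B', in particular on `e₀` and `f₀`.
  have kill : ∀ z, (∀ y, B' z y = 0) → ∀ i, ξ i z = 0 ∧ η i z = 0 := by
    intro z hz i
    have a1 := hz (f i)
    have a2 := hz (e i)
    rw [hs] at a1 a2
    simp only [hξe', hηe', hξf', hηf'] at a1 a2
    simp at a1 a2
    exact ⟨a1, a2⟩
  have ke := kill e₀ hB'e
  have kf := kill f₀ hB'f
  -- The old dual vectors are projected off the plane of `e₀` and `f₀`, so that `ξ₀` and `η₀` vanish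
  -- on them.
  refine ⟨r + 1, Fin.cons ξ₀ ξ, Fin.cons η₀ η,
    Fin.cons e₀ (fun i => e i - ξ₀ (e i) • e₀ - η₀ (e i) • f₀),
    Fin.cons f₀ (fun i => f i - ξ₀ (f i) • e₀ - η₀ (f i) • f₀), ?_, ?_, ?_, ?_, ?_⟩
  · intro x y
    rw [Fin.sum_univ_succ]
    simp only [Fin.cons_zero, Fin.cons_succ]
    rw [← hs, hB'a]
    ring
  all_goals
    intro i j
    refine Fin.cases ?_ (fun i => ?_) i <;> refine Fin.cases ?_ (fun j => ?_) j
    all_goals simp [hξe, hξf, hηe, hηf, ke, kf, hξe', hηe', hξf', hηf', Fin.succ_inj,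
      (Fin.succ_ne_zero _).symm]

lemma wedge_wedgePow_eq_sum {J : Type*} [Fintype J] {ξ η : J → V →ₗ[ℝ] ℝ}
    {σ : V [⋀^Fin 2]→ₗ[ℝ] ℝ} (h : σ = ∑ j, covectorWedge ![ξ j, η j])
    (a : V [⋀^Fin 1]→ₗ[ℝ] ℝ) (m : ℕ) :
    wedge a (wedgePow σ m) = ∑ j : Fin m → J,
      covectorWedge (Fin.append ![toCovector a] (interleave ξ η m j)) := by
  rw [wedgePow_eq_sum h, wedge_eq_wedgeBilin, map_sum]
  refine Finset.sum_congr rfl fun j _ => ?_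
  conv_lhs => rw [eq_covectorWedge_toCovector a]
  exact wedge_covectorWedge _ _

/-- Used to discard every word containing a pair whose first factor is b: that covector already
stands in front. -/
lemma covectorWedge_append_eq_zero {J : Type*} (ξ η : J → V →ₗ[ℝ] ℝ) (b : V →ₗ[ℝ] ℝ) {m : ℕ}
    {j : Fin m → J} {i : Fin m} (h : ξ (j i) = b) :
    covectorWedge (Fin.append ![b] (interleave ξ η m j)) = 0 := by
  refine covectorWedge_eq_zero_of_eq (i := Fin.castAdd (2 * m) 0)
    (j := Fin.natAdd 1 ((pairIndex m).symm (i, 0))) ?_ ?_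
  · simp only [ne_eq, Fin.ext_iff, Fin.val_castAdd, Fin.val_natAdd, Fin.val_zero]
    omega
  · rw [Fin.append_left, Fin.append_right, interleave_apply]
    simp [h]

/-- Suppose v violates the conclusion. Then B v vanishes on ker b, so B v = c b. Changing B by a
multiple of b ∧ φ, where φ v = 1, which the product with b does not see, moves v into the kernel of
B. What remains is a sum of top-degree products of covectors that all kill v. -/
lemma isContactPair_of_wedge_ne_zero [FiniteDimensional ℝ V] {m : ℕ}
    (hV : Module.finrank ℝ V = 2 * m + 1) {a : V [⋀^Fin 1]→ₗ[ℝ] ℝ} {σ : V [⋀^Fin 2]→ₗ[ℝ] ℝ}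
    (h : wedge a (wedgePow σ m) ≠ 0) : IsContactPair (toCovector a) (toBilin σ) := by
  intro v hbv hv
  by_contra hv0
  apply h
  set b := toCovector a with hb
  set B := toBilin σ with hBdef
  obtain ⟨c, hc⟩ : ∃ c : ℝ, c • b = B v := by
    have := mem_span_of_iInf_ker_le_ker (L := fun _ : Unit => b) (K := B v)
      (fun w hw => hv w (by simpa using hw))
    rw [range_const] at this
    exact Submodule.mem_span_singleton.1 this
  obtain ⟨φ, hφ⟩ : ∃ φ : V →ₗ[ℝ] ℝ, φ v = 1 := by
    obtain ⟨φ, hφ⟩ := not_forall.1 (mt (Module.forall_dual_apply_eq_zero_iff ℝ v).1 hv0)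
    exact ⟨(φ v)⁻¹ • φ, inv_mul_cancel₀ hφ⟩
  -- T projects along v. Since B' is unchanged by T in both arguments, it can be expanded in
  -- covectors composed with T, all of which kill v.
  set T : V →ₗ[ℝ] V := LinearMap.id - φ.smulRight v with hT
  have hTv : T v = 0 := by simp [hT, hφ]
  set B' : V →ₗ[ℝ] V →ₗ[ℝ] ℝ := B + b.smulRight (c • φ) - (c • φ).smulRight b with hB'
  have hB'a : ∀ x y, B' x y = B x y + b x * (c * φ y) - c * φ x * b y := fun x y => by simp [hB']
  have hskew : ∀ x y, B x y = - B y x := fun x y => by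
    have := toBilin_self σ (x + y)
    simp only [map_add, LinearMap.add_apply, toBilin_self] at this
    linarith
  have hB'v : ∀ y, B' v y = 0 := fun y => by
    rw [hB'a, ← hc, hbv, hφ]
    simp
  have hB'skew : ∀ x y, B' x y = - B' y x := fun x y => by
    rw [hB'a, hB'a, hskew x y]
    ring
  have hB'T : ∀ x y, B' (T x) (T y) = B' x y := fun x y => by
    simp [hT, hB'v, hB'skew _ v]
  set bas := Module.finBasis ℝ V
  have hexp : ∀ x y, B' x y = ∑ i, ∑ k, bas.repr x i * bas.repr y k * B' (bas i) (bas k) := by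
    intro x y
    conv_lhs => rw [← bas.sum_repr x, ← bas.sum_repr y]
    simp only [map_sum, map_smul, LinearMap.sum_apply, LinearMap.smul_apply, smul_eq_mul,
      Finset.mul_sum, mul_assoc]
    rw [Finset.sum_comm]
    refine Finset.sum_congr rfl fun i _ => Finset.sum_congr rfl fun k _ => by ring
  let n := Module.finrank ℝ V
  -- The index `none` carries the correction term with factor b. The double sum over basis indices
  -- counts each pair in both orders, hence the factor `2⁻¹`.
  let ξ : Option (Fin n × Fin n) → V →ₗ[ℝ] ℝ := fun o => o.elim b
    (fun p => (2⁻¹ * B' (bas p.1) (bas p.2)) • (bas.coord p.1 ∘ₗ T))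
  let η : Option (Fin n × Fin n) → V →ₗ[ℝ] ℝ := fun o => o.elim (-(c • φ))
    (fun p => bas.coord p.2 ∘ₗ T)
  have hσ : σ = ∑ j, covectorWedge ![ξ j, η j] := by
    refine alternating_two_ext fun x y => ?_
    rw [← toBilin_apply, ← hBdef]
    simp only [alternating_sum_apply, AlternatingMap.add_apply, covectorWedge_pair_apply, Fintype.sum_option,
      Fintype.sum_prod_type]
    have e1 := hexp (T x) (T y)
    have e2 := hexp (T y) (T x)
    have e3 := hB'skew (T x) (T y)
    have e4 := hB'T x y
    have e5 := hB'a x y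
    have e6 : ∑ i, ∑ k, (ξ (some (i, k)) x * η (some (i, k)) y - η (some (i, k)) x *
        ξ (some (i, k)) y) = 2⁻¹ * (B' (T x) (T y) - B' (T y) (T x)) := by
      rw [e1, e2, mul_sub, Finset.mul_sum, Finset.mul_sum, ← Finset.sum_sub_distrib]
      refine Finset.sum_congr rfl fun i _ => ?_
      rw [Finset.mul_sum, Finset.mul_sum, ← Finset.sum_sub_distrib]
      refine Finset.sum_congr rfl fun k _ => ?_
      simp only [ξ, η, Option.elim_some, LinearMap.smul_apply, LinearMap.comp_apply,
        Module.Basis.coord_apply, smul_eq_mul]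
      ring
    rw [e6]
    simp only [ξ, η, Option.elim_none, LinearMap.neg_apply, LinearMap.smul_apply, smul_eq_mul]
    linarith
  rw [wedge_wedgePow_eq_sum hσ]
  refine Finset.sum_eq_zero fun j _ => ?_
  by_cases hj : ∃ i, j i = none
  · obtain ⟨i, hi⟩ := hj
    exact covectorWedge_append_eq_zero ξ η b (i := i) (by rw [hi]; rfl)
  · push Not at hj
    refine covectorWedge_eq_zero_of_common_kernel (by omega) _ hv0 fun i => ?_
    refine Fin.addCases (fun i => ?_) (fun i => ?_) i
    · rw [Fin.append_left]
      simpa using hbv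
    · rw [Fin.append_right, interleave_apply]
      obtain ⟨p, hp⟩ := Option.ne_none_iff_exists'.1 (hj (pairIndex m i).1)
      rw [hp]
      rcases (pairIndex m i).2 with ⟨_ | _ | k, hk⟩
      · simp [ξ, hTv]
      · simp [η, hTv]
      · omega

/-- After subtracting b ∧ B(R, ·) with b R = 1, a Darboux family of r pairs together with b
separates points, which forces r = m. In the expansion only the r! bijective words survive and they
all contribute the same nonzero determinant. -/
lemma wedge_ne_zero_of_isContactPair [FiniteDimensional ℝ V] {m : ℕ}
    (hV : Module.finrank ℝ V = 2 * m + 1) {a : V [⋀^Fin 1]→ₗ[ℝ] ℝ} {σ : V [⋀^Fin 2]→ₗ[ℝ] ℝ}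
    (h : IsContactPair (toCovector a) (toBilin σ)) : wedge a (wedgePow σ m) ≠ 0 := by
  set b := toCovector a with hb
  set B := toBilin σ with hBdef
  -- For b = 0 the form B would be nondegenerate on all of V, so the Darboux covectors would give V
  -- the even dimension 2r.
  by_cases hb0 : b = 0
  · exfalso
    obtain ⟨r, ξ, η, e, f, hs, h1, h2, h3, h4⟩ := exists_darboux B (toBilin_self σ)
    let Φ : V →ₗ[ℝ] (Fin r → ℝ) × (Fin r → ℝ) := (LinearMap.pi ξ).prod (LinearMap.pi η)
    have hinj : Injective Φ := by
      rw [injective_iff_map_eq_zero]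
      intro v hv
      refine h v (by simp [hb0]) fun w _ => ?_
      rw [hs]
      refine Finset.sum_eq_zero fun i _ => ?_
      have e1 : ξ i v = 0 := congrFun (congrArg Prod.fst hv) i
      have e2 : η i v = 0 := congrFun (congrArg Prod.snd hv) i
      rw [e1, e2]
      ring
    have hsurj : Surjective Φ := fun p => by
      refine ⟨∑ j, p.1 j • e j + ∑ j, p.2 j • f j, ?_⟩
      refine Prod.ext (funext fun i => ?_) (funext fun i => ?_) <;> simp [Φ, h1, h2, h3, h4]
    have := (LinearEquiv.ofBijective Φ ⟨hinj, hsurj⟩).finrank_eq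
    simp only [hV, Module.finrank_prod, Module.finrank_fintype_fun_eq_card, Fintype.card_fin] at this
    omega
  obtain ⟨R, hR⟩ : ∃ R, b R = 1 := by
    obtain ⟨x, hx⟩ := not_forall.1 (mt LinearMap.ext_iff.2 hb0)
    exact ⟨(b x)⁻¹ • x, by rw [map_smul]; exact inv_mul_cancel₀ hx⟩
  have hskew : ∀ x y, B x y = - B y x := fun x y => by
    have := toBilin_self σ (x + y)
    simp only [map_add, LinearMap.add_apply, toBilin_self] at this
    linarith
  set ζ : V →ₗ[ℝ] ℝ := B R with hζ
  -- This correction puts R into the kernel of B', so the Darboux covectors vanish on R and are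
  -- complementary to b.
  set B' : V →ₗ[ℝ] V →ₗ[ℝ] ℝ := B - b.smulRight ζ + ζ.smulRight b with hB'
  have hB'a : ∀ x y, B' x y = B x y - b x * ζ y + ζ x * b y := fun x y => by simp [hB']
  have hζR : ζ R = 0 := toBilin_self σ R
  have hB'R : ∀ y, B' R y = 0 := fun y => by
    rw [hB'a, hR, hζR, hζ]
    ring
  obtain ⟨r, ξ, η, e, f, hs, h1, h2, h3, h4⟩ := exists_darboux B'
    (fun x => by rw [hB'a, toBilin_self]; ring)
  have kR : ∀ i, ξ i R = 0 ∧ η i R = 0 := by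
    intro i
    have a1 := hB'R (f i)
    have a2 := hB'R (e i)
    rw [hs] at a1 a2
    simp only [h1, h2, h3, h4] at a1 a2
    simp at a1 a2
    exact ⟨a1, a2⟩
  have hr : r = m := by
    let Φ : V →ₗ[ℝ] ℝ × ((Fin r → ℝ) × (Fin r → ℝ)) :=
      b.prod ((LinearMap.pi ξ).prod (LinearMap.pi η))
    have hinj : Injective Φ := by
      rw [injective_iff_map_eq_zero]
      intro v hv
      have e0 : b v = 0 := congrArg Prod.fst hv
      refine h v e0 fun w hw => ?_
      have := hB'a v w
      rw [e0, hw, hs, Finset.sum_eq_zero] at this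
      · linarith
      · intro i _
        have e1 : ξ i v = 0 := congrFun (congrArg Prod.fst (congrArg Prod.snd hv)) i
        have e2 : η i v = 0 := congrFun (congrArg Prod.snd (congrArg Prod.snd hv)) i
        rw [e1, e2]
        ring
    have hsurj : Surjective Φ := fun p => by
      let z := ∑ j, p.2.1 j • e j + ∑ j, p.2.2 j • f j
      refine ⟨z + (p.1 - b z) • R, ?_⟩
      refine Prod.ext (by simp [Φ, hR]) (Prod.ext (funext fun i => ?_) (funext fun i => ?_)) <;>
        simp [Φ, z, h1, h2, h3, h4, kR]
    have := (LinearEquiv.ofBijective Φ ⟨hinj, hsurj⟩).finrank_eq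
    simp only [hV, Module.finrank_prod, Module.finrank_fintype_fun_eq_card, Fintype.card_fin,
      Module.finrank_self] at this
    omega
  subst hr
  let ξ' : Option (Fin r) → V →ₗ[ℝ] ℝ := fun o => o.elim b ξ
  let η' : Option (Fin r) → V →ₗ[ℝ] ℝ := fun o => o.elim ζ η
  have hσ : σ = ∑ j, covectorWedge ![ξ' j, η' j] := by
    refine alternating_two_ext fun x y => ?_
    rw [← toBilin_apply, ← hBdef]
    simp only [alternating_sum_apply, AlternatingMap.add_apply, covectorWedge_pair_apply, Fintype.sum_option]
    have e1 := hs x y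
    have e2 := hB'a x y
    simp only [ξ', η', Option.elim_none, Option.elim_some]
    rw [← e1, e2]
    ring
  let D := covectorWedge (Fin.append ![b] (interleave ξ η r id))
  have hinter : ∀ j : Fin r → Fin r,
      interleave ξ' η' r (fun i => some (j i)) = interleave ξ η r j := by
    intro j
    ext i v
    rw [interleave_apply, interleave_apply]
    rcases (pairIndex r i).2 with ⟨_ | _ | k, hk⟩
    · rfl
    · rfl
    · omega
  have hperm : ∀ π : Equiv.Perm (Fin r),
      covectorWedge (Fin.append ![b] (interleave ξ η r π)) = D := by
    intro π
    obtain ⟨E, hE, hE2⟩ := interleave_comp_perm ξ η r id π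
    rw [id_comp] at hE2
    let E' : Equiv.Perm (Fin (1 + 2 * r)) := (finSumFinEquiv.symm.trans
      (Equiv.sumCongr (Equiv.refl _) E)).trans finSumFinEquiv
    have hE' : Equiv.Perm.sign E' = 1 := by
      refine (Equiv.Perm.sign_symm_trans_trans _ finSumFinEquiv).trans ?_
      exact (Equiv.Perm.sign_sumCongr 1 E).trans (by rw [hE]; simp)
    have : Fin.append ![b] (interleave ξ η r π) = Fin.append ![b] (interleave ξ η r id) ∘ E' := by
      ext i v
      refine Fin.addCases (fun i => ?_) (fun i => ?_) i
      · simp [E']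
      · simp [E', hE2]
    rw [this, covectorWedge_comp_perm, hE', one_smul]
  -- A word with the letter `none` repeats b, and a non-injective word repeats a covector; the
  -- remaining words are the permutations.
  have hsum : wedge a (wedgePow σ r) = (r.factorial : ℝ) • D := by
    rw [wedge_wedgePow_eq_sum hσ]
    have hsub : ∀ j : Fin r → Option (Fin r), (¬ ∃ π : Equiv.Perm (Fin r), j = fun i => some (π i)) →
        covectorWedge (Fin.append ![toCovector a] (interleave ξ' η' r j)) = 0 := by
      intro j hj
      by_cases hn : ∃ i, j i = none
      · obtain ⟨i, hi⟩ := hn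
        exact covectorWedge_append_eq_zero ξ' η' b (i := i) (by rw [hi]; rfl)
      · push Not at hn
        choose k hk using fun i => Option.ne_none_iff_exists'.1 (hn i)
        have hk' : j = fun i => some (k i) := funext hk
        have hkinj : ¬ Injective k := fun hki => hj ⟨Equiv.ofBijective k
          (Finite.injective_iff_bijective.1 hki), hk'⟩
        obtain ⟨i₁, i₂, hi, hne⟩ : ∃ i₁ i₂, k i₁ = k i₂ ∧ i₁ ≠ i₂ := by
          simpa [Injective] using hkinj
        refine covectorWedge_eq_zero_of_eq (i := Fin.natAdd 1 ((pairIndex r).symm (i₁, 0)))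
          (j := Fin.natAdd 1 ((pairIndex r).symm (i₂, 0))) ?_ ?_
        · intro he
          have := (pairIndex r).symm.injective (Fin.natAdd_injective _ _ he)
          exact hne (Prod.ext_iff.1 this).1
        · rw [Fin.append_right, Fin.append_right, interleave_apply, interleave_apply]
          simp [hk', hi]
    let ι : Equiv.Perm (Fin r) ↪ (Fin r → Option (Fin r)) :=
      ⟨fun π i => some (π i), fun π π' hπ => Equiv.ext fun i => Option.some.inj (congrFun hπ i)⟩
    rw [← Finset.sum_subset (Finset.subset_univ (Finset.univ.map ι))]
    · rw [Finset.sum_map]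
      have : ∀ π : Equiv.Perm (Fin r), covectorWedge (Fin.append ![toCovector a]
          (interleave ξ' η' r (ι π))) = D := fun π => by
        rw [← hperm π, ← hinter]
        rfl
      rw [Finset.sum_congr rfl fun π _ => this π, Finset.sum_const, Finset.card_univ,
        Fintype.card_perm, Fintype.card_fin, Nat.cast_smul_eq_nsmul]
    · intro j _ hj
      refine hsub j ?_
      rintro ⟨π, rfl⟩
      exact hj (Finset.mem_map.2 ⟨π, Finset.mem_univ _, rfl⟩)
  rw [hsum]
  refine smul_ne_zero (by positivity) (covectorWedge_ne_zero_of_linearIndependent ?_)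
  rw [Fintype.linearIndependent_iff]
  intro g hg
  let g0 := g (Fin.castAdd (2 * r) 0)
  let gp : Fin r × Fin 2 → ℝ := fun p => g (Fin.natAdd 1 ((pairIndex r).symm p))
  -- A linear relation is tested on R, on the vectors `e i` and on the vectors `f i`, each of which
  -- isolates one coefficient.
  have hg' : ∀ v, g0 * b v + ∑ i, (gp (i, 0) * ξ i v + gp (i, 1) * η i v) = 0 := by
    intro v
    have h5 := congrArg (fun L : V →ₗ[ℝ] ℝ => L v) hg
    simp only [LinearMap.sum_apply, LinearMap.add_apply, LinearMap.smul_apply, smul_eq_mul,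
      LinearMap.zero_apply,      Fin.sum_univ_add, Fin.append_left, Fin.append_right] at h5
    rw [← h5]
    congr 1
    · simp [g0]
    · rw [← (pairIndex r).symm.sum_comp, Fintype.sum_prod_type]
      refine Finset.sum_congr rfl fun i _ => ?_
      rw [Fin.sum_univ_two, interleave_apply, interleave_apply]
      simp [gp]
  have hg0 : g0 = 0 := by
    have := hg' R
    simpa [kR, hR] using this
  have hξ0 : ∀ i, gp (i, 0) = 0 := fun i => by
    have := hg' (e i)
    simpa [hg0, h1, h2] using this
  have hη0 : ∀ i, gp (i, 1) = 0 := fun i => by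
    have := hg' (f i)
    simpa [hg0, h3, h4] using this
  intro i
  refine Fin.addCases (fun i => ?_) (fun i => ?_) i
  · rw [Subsingleton.elim i 0]
    exact hg0
  · have : g (Fin.natAdd 1 i) = gp (pairIndex r i) := by simp [gp]
    rw [this]
    rcases hp : pairIndex r i with ⟨k, ⟨_ | _ | l, hl⟩⟩
    · exact hξ0 k
    · exact hη0 k
    · omega

end ContactAlgebra

/-! ### Calculus up to the boundary: integrals with parameters and Hadamard's lemma. -/

section Calculus

open MeasureTheory

/-- Compactness of the interval makes D(x', t) uniformly close to D(x, t) for x' near x. Convexity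
of A then allows the mean value inequality, with a bound uniform in t that can be integrated. -/
lemma hasFDerivWithinAt_intervalIntegral {E F : Type*} [NormedAddCommGroup E] [NormedSpace ℝ E]
    [NormedAddCommGroup F] [NormedSpace ℝ F] [CompleteSpace F] {A : Set E} (hA : Convex ℝ A)
    {a b : ℝ} (hab : a < b) {G : E → ℝ → F} {D : E → ℝ → E →L[ℝ] F}
    (hG : ∀ x ∈ A, ∀ t ∈ Icc a b, HasFDerivWithinAt (fun x => G x t) (D x t) A x)
    (hGc : ∀ x ∈ A, ContinuousOn (G x) (Icc a b))
    (hD : ContinuousOn (fun p : E × ℝ => D p.1 p.2) (A ×ˢ Icc a b)) {x : E} (hx : x ∈ A) :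
    HasFDerivWithinAt (fun x => ∫ t in a..b, G x t) (∫ t in a..b, D x t) A x := by
  have hDx : ContinuousOn (D x) (Icc a b) :=
    hD.comp (by fun_prop : ContinuousOn (fun t : ℝ => (x, t)) (Icc a b)) (fun t ht => ⟨hx, ht⟩)
  rw [hasFDerivWithinAt_iff_isLittleO, Asymptotics.isLittleO_iff]
  intro c hc
  have hba : 0 < b - a := sub_pos.2 hab
  have hunif : ∀ᶠ x' in 𝓝 x, ∀ t ∈ Icc a b, t ∈ Icc a b → x' ∈ A → ‖D x' t - D x t‖ ≤ c / (b - a) := by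
    refine isCompact_Icc.eventually_forall_of_forall_eventually fun t ht => ?_
    have h1 : ContinuousWithinAt (fun p : E × ℝ => D p.1 p.2 - D x p.2) (A ×ˢ Icc a b) (x, t) := by
      refine (hD (x, t) ⟨hx, ht⟩).sub ?_
      exact (hDx t ht).comp continuous_snd.continuousWithinAt (fun p hp => hp.2)
    have h2 := h1.norm.tendsto
    have h3 : ∀ᶠ p in 𝓝[A ×ˢ Icc a b] (x, t), ‖D p.1 p.2 - D x p.2‖ < c / (b - a) :=
      h2.eventually_lt_const (by simp only [sub_self, norm_zero]; positivity)
    rw [eventually_nhdsWithin_iff] at h3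
    filter_upwards [h3] with p hp ht' hpA
    exact (hp ⟨hpA, ht'⟩).le
  obtain ⟨ε, hε, hball⟩ := Metric.eventually_nhds_iff_ball.1 hunif
  filter_upwards [inter_mem_nhdsWithin A (Metric.ball_mem_nhds x hε)] with x' hx'
  have hint : ∀ z ∈ A, IntervalIntegrable (G z) volume a b := fun z hz =>
    (hGc z hz).intervalIntegrable_of_Icc hab.le
  have hDint : IntervalIntegrable (D x) volume a b := hDx.intervalIntegrable_of_Icc hab.le
  rw [ContinuousLinearMap.intervalIntegral_apply hDint,
    ← intervalIntegral.integral_sub (hint _ hx'.1) (hint _ hx),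
    ← intervalIntegral.integral_sub ((hint _ hx'.1).sub (hint _ hx)) ?_]
  · have hb : ∀ t ∈ uIoc a b, ‖G x' t - G x t - D x t (x' - x)‖ ≤ c / (b - a) * ‖x' - x‖ := by
      intro t ht
      rw [uIoc_of_le hab.le] at ht
      have ht' := Ioc_subset_Icc_self ht
      refine Convex.norm_image_sub_le_of_norm_hasFDerivWithin_le' (f := fun z => G z t)
        (f' := fun z => D z t) (s := A ∩ Metric.ball x ε)
        (fun z hz => (hG z hz.1 t ht').mono inter_subset_left)
        (fun z hz => hball z hz.2 t ht' ht' hz.1) (hA.inter (convex_ball x ε))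
        ⟨hx, Metric.mem_ball_self hε⟩ hx'
    refine (intervalIntegral.norm_integral_le_of_norm_le_const hb).trans (le_of_eq ?_)
    rw [abs_of_pos hba]
    field_simp
  · exact ContinuousOn.intervalIntegrable_of_Icc hab.le (hDx.clm_apply continuousOn_const)

theorem contDiffOn_intervalIntegral {E F : Type} [NormedAddCommGroup E] [NormedSpace ℝ E]
    [NormedAddCommGroup F] [NormedSpace ℝ F] [CompleteSpace F] {A : Set E} (hA : Convex ℝ A)
    (hA' : UniqueDiffOn ℝ A) {a b : ℝ} (hab : a < b) {G : E × ℝ → F}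
    (hG : ContDiffOn ℝ ∞ G (A ×ˢ Icc a b)) :
    ContDiffOn ℝ ∞ (fun x => ∫ t in a..b, G (x, t)) A := by
  have hU : UniqueDiffOn ℝ (A ×ˢ Icc a b) := hA'.prod (uniqueDiffOn_Icc hab)
  have key : ∀ (F : Type) [NormedAddCommGroup F] [NormedSpace ℝ F] [CompleteSpace F]
      (G : E × ℝ → F), ContDiffOn ℝ ∞ G (A ×ˢ Icc a b) → ∀ x ∈ A,
      HasFDerivWithinAt (fun x => ∫ t in a..b, G (x, t)) (∫ t in a..b,
        (fderivWithin ℝ G (A ×ˢ Icc a b) (x, t)).comp (ContinuousLinearMap.inl ℝ E ℝ)) A x := by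
    intro F _ _ _ G hG x hx
    refine hasFDerivWithinAt_intervalIntegral hA hab (G := fun x t => G (x, t))
      (D := fun x t => (fderivWithin ℝ G (A ×ˢ Icc a b) (x, t)).comp
        (ContinuousLinearMap.inl ℝ E ℝ)) ?_ ?_ ?_ hx
    · intro z hz t ht
      have h1 := (hG.differentiableOn (by simp) (z, t) ⟨hz, ht⟩).hasFDerivWithinAt
      exact h1.comp z ((hasFDerivAt_prodMk_left z t).hasFDerivWithinAt) (fun w hw => mk_mem_prod hw ht)
    · intro z hz
      exact hG.continuousOn.comp (by fun_prop : ContinuousOn (fun t : ℝ => (z, t)) (Icc a b))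
        (fun t ht => ⟨hz, ht⟩)
    · exact (hG.continuousOn_fderivWithin hU (by simp)).clm_comp continuousOn_const
  rw [contDiffOn_infty]
  intro n
  -- The target is generalised because the derivative is again a parameter integral, with values in
  -- E →L[ℝ] F.
  induction n generalizing F with
  | zero =>
    rw [Nat.cast_zero, contDiffOn_zero]
    exact fun x hx => (key F G hG x hx).continuousWithinAt
  | succ n ih =>
    rw [Nat.cast_succ, contDiffOn_succ_iff_hasFDerivWithinAt_of_uniqueDiffOn hA']
    refine ⟨by simp, _, ?_, key F G hG⟩
    refine ih (G := fun p => (fderivWithin ℝ G (A ×ˢ Icc a b) p).comp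
        (ContinuousLinearMap.inl ℝ E ℝ)) ?_
    exact (hG.fderivWithin hU (m := ∞) (by simp)).clm_comp contDiffOn_const

section Hadamard

variable {Y : Type} [NormedAddCommGroup Y] [NormedSpace ℝ Y] 

/-- The closed half space `t ≥ 0` of `Y × ℝ`. -/
def upperHalf (Y : Type) : Set (Y × ℝ) := {q | 0 ≤ q.2}

lemma convex_upperHalf : Convex ℝ (upperHalf Y) := by
  have : upperHalf Y = (LinearMap.snd ℝ Y ℝ) ⁻¹' Ici 0 := rfl
  rw [this]
  exact (convex_Ici 0).linear_preimage _

lemma uniqueDiffOn_upperHalf : UniqueDiffOn ℝ (upperHalf Y) := by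
  have : upperHalf Y = univ ×ˢ Ici 0 := by ext; simp [upperHalf]
  rw [this]
  exact uniqueDiffOn_univ.prod (uniqueDiffOn_Ici 0)

lemma upperHalf_mem_nhds {q : Y × ℝ} (hq : 0 < q.2) : upperHalf Y ∈ 𝓝 q := by
  filter_upwards [continuous_snd.continuousAt.eventually (lt_mem_nhds hq)] with x hx
  exact le_of_lt hx

/-- The quotient of `T` by the last coordinate, extended to `t = 0` by the normal derivative. -/
def normalQuot (T : Y × ℝ → ℝ) (q : Y × ℝ) : ℝ :=
  if q.2 = 0 then fderivWithin ℝ T (upperHalf Y) q (0, 1) else T q / q.2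

lemma mul_normalQuot {T : Y × ℝ → ℝ} {q : Y × ℝ} (h : q.2 = 0 → T q = 0) :
    q.2 * normalQuot T q = T q := by
  unfold normalQuot
  split_ifs with h0
  · rw [h0, h h0, zero_mul]
  · field_simp

/-- Hadamard's lemma up to the boundary: where T vanishes at t = 0, the quotient T / t equals ∫₀¹
∂ₜT(y, st) ds, which also gives the right value at t = 0. Away from t = 0 it is an ordinary
quotient. -/
lemma contDiffOn_normalQuot {O : Set (Y × ℝ)} (hO : IsOpen O) {T : Y × ℝ → ℝ}
    (hT : ContDiffOn ℝ ∞ T (O ∩ upperHalf Y)) (h0 : ∀ q ∈ O, q.2 = 0 → T q = 0) :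
    ContDiffOn ℝ ∞ (normalQuot T) (O ∩ upperHalf Y) := by
  intro q₀ hq₀
  rcases eq_or_lt_of_le (show (0 : ℝ) ≤ q₀.2 from hq₀.2) with hz | hz
  · obtain ⟨ρ, hρ, hball⟩ := Metric.isOpen_iff.1 hO q₀ hq₀.1
    set A := Metric.ball q₀ ρ ∩ upperHalf Y with hA
    have hAconv : Convex ℝ A := (convex_ball q₀ ρ).inter convex_upperHalf
    have hAU : UniqueDiffOn ℝ A := by
      rw [hA, inter_comm]
      exact uniqueDiffOn_upperHalf.inter Metric.isOpen_ball
    have hTA : ContDiffOn ℝ ∞ T A := hT.mono (inter_subset_inter_left _ hball)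
    have hfd : ∀ q ∈ A, fderivWithin ℝ T A q = fderivWithin ℝ T (upperHalf Y) q := fun q hq => by
      rw [hA, inter_comm]
      exact fderivWithin_inter (Metric.isOpen_ball.mem_nhds hq.1)
    set G : (Y × ℝ) × ℝ → ℝ := fun p => fderivWithin ℝ T A (p.1.1, p.2 * p.1.2) (0, 1) with hG
    -- The centre has last coordinate 0 and the norm is a maximum, so shrinking t does not leave the
    -- half ball.
    have hmaps : ∀ q ∈ A, ∀ s ∈ Icc (0 : ℝ) 1, (q.1, s * q.2) ∈ A := by
      intro q hq s hs
      have hq2 : 0 ≤ q.2 := hq.2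
      refine ⟨?_, mul_nonneg hs.1 hq2⟩
      have := hq.1
      rw [Metric.mem_ball, Prod.dist_eq, max_lt_iff, ← hz, Real.dist_eq, sub_zero,
        abs_of_nonneg hq2] at this
      rw [Metric.mem_ball, Prod.dist_eq, max_lt_iff, ← hz, Real.dist_eq, sub_zero,
        abs_of_nonneg (mul_nonneg hs.1 hq2)]
      exact ⟨this.1, (mul_le_of_le_one_left hq2 hs.2).trans_lt this.2⟩
    have hGs : ContDiffOn ℝ ∞ G (A ×ˢ Icc 0 1) := by
      refine ContDiffOn.clm_apply ?_ contDiffOn_const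
      exact (hTA.fderivWithin hAU (m := ∞) (by simp)).comp (by fun_prop)
        (fun p hp => hmaps p.1 hp.1 p.2 hp.2)
    have hI := contDiffOn_intervalIntegral hAconv hAU zero_lt_one hGs
    have heq : ∀ q ∈ A, normalQuot T q = ∫ s in (0 : ℝ)..1, G (q, s) := by
      intro q hq
      rcases eq_or_lt_of_le (show (0 : ℝ) ≤ q.2 from hq.2) with hq2 | hq2
      · have : ∀ s : ℝ, G (q, s) = fderivWithin ℝ T (upperHalf Y) q (0, 1) := fun s => by
          rw [hG]
          simp only [← hq2, mul_zero]
          rw [hq2, hfd q hq]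
        simp [normalQuot, ← hq2, this]
      · have hcont : ContinuousOn (fun s : ℝ => G (q, s)) (Icc 0 1) :=
          hGs.continuousOn.comp (by fun_prop) (fun s hs => ⟨hq, hs⟩)
        have hint := intervalIntegral.integral_eq_sub_of_hasDerivAt_of_le zero_le_one
          (f := fun s : ℝ => T (q.1, s * q.2)) (f' := fun s => q.2 * G (q, s))
          (hTA.continuousOn.comp (by fun_prop) (fun s hs => hmaps q hq s hs)) ?_
          ((continuousOn_const.mul hcont).intervalIntegrable_of_Icc zero_le_one)
        · have h1 : T (q.1, (0 : ℝ) * q.2) = 0 :=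
            h0 _ (hball (hmaps q hq 0 ⟨le_rfl, zero_le_one⟩).1) (by simp)
          rw [intervalIntegral.integral_const_mul, h1, sub_zero, one_mul] at hint
          rw [normalQuot, if_neg hq2.ne', ← Prod.mk.eta (p := q), ← hint]
          field_simp
        · intro s hs
          have hm := hmaps q hq s (Ioo_subset_Icc_self hs)
          have hnhds : A ∈ 𝓝 (q.1, s * q.2) := Filter.inter_mem
            (Metric.isOpen_ball.mem_nhds hm.1) (upperHalf_mem_nhds (mul_pos hs.1 hq2))
          have h1 := ((hTA.differentiableOn (by simp) _ hm).hasFDerivWithinAt).hasFDerivAt hnhds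
          have h2 : HasDerivAt (fun s : ℝ => (q.1, s * q.2)) ((0 : Y), q.2) s :=
            (hasDerivAt_const s q.1).prodMk (by simpa using (hasDerivAt_id s).mul_const q.2)
          have h3 := h1.comp_hasDerivAt s h2
          refine h3.congr_deriv ?_
          simp only [hG]
          have : ((0 : Y), q.2) = q.2 • ((0 : Y), (1 : ℝ)) := by simp
          rw [this, map_smul, smul_eq_mul]
    have hfin : ContDiffWithinAt ℝ ∞ (normalQuot T) A q₀ :=
      (hI.congr heq) q₀ ⟨Metric.mem_ball_self hρ, hq₀.2⟩
    refine hfin.mono_of_mem_nhdsWithin ?_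
    rw [hA]
    exact Filter.inter_mem (mem_nhdsWithin_of_mem_nhds (Metric.ball_mem_nhds _ hρ))
      (Filter.mem_of_superset self_mem_nhdsWithin inter_subset_right)
  · refine ContDiffWithinAt.congr_of_eventuallyEq
      (f := fun q => T q / q.2) ((hT q₀ hq₀).div contDiffWithinAt_snd hz.ne') ?_ ?_
    · filter_upwards [mem_nhdsWithin_of_mem_nhds
        (continuous_snd.continuousAt.eventually (lt_mem_nhds hz))] with q hq
      simp [normalQuot, (show 0 < q.2 from hq).ne']
    · simp [normalQuot, hz.ne']

end Hadamard

end Calculus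

/-! ### An implicit function theorem with parameters in a half space. -/

section ImplicitFunction

/-- The shear `(v, s) ↦ (v, D (v, s))` as a continuous linear equivalence. -/
def shearEquiv {E : Type*} [NormedAddCommGroup E] [NormedSpace ℝ E] (D : E × ℝ →L[ℝ] ℝ)
    (h : D (0, 1) ≠ 0) : (E × ℝ) ≃L[ℝ] (E × ℝ) :=
  ContinuousLinearEquiv.equivOfInverse ((ContinuousLinearMap.fst ℝ E ℝ).prod D)
    ((ContinuousLinearMap.fst ℝ E ℝ).prod ((D (0, 1))⁻¹ • (ContinuousLinearMap.snd ℝ E ℝ -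
      (D.comp (ContinuousLinearMap.inl ℝ E ℝ)).comp (ContinuousLinearMap.fst ℝ E ℝ))))
    (by
      rintro ⟨v, s⟩
      have h1 : D (v, s) = D (v, 0) + s * D (0, 1) := by
        rw [← smul_eq_mul, ← map_smul, ← map_add]
        simp
      simp only [h1, ContinuousLinearMap.prod_apply, ContinuousLinearMap.coe_fst',
        smul_apply, sub_apply, ContinuousLinearMap.coe_snd', ContinuousLinearMap.comp_apply,
        ContinuousLinearMap.inl_apply, smul_eq_mul, add_sub_cancel_left]
      field_simp)
    (by
      rintro ⟨v, s⟩
      have h1 : ∀ t, D (v, t) = D (v, 0) + t * D (0, 1) := fun t => by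
        rw [← smul_eq_mul, ← map_smul, ← map_add]
        simp
      simp only [ContinuousLinearMap.prod_apply, ContinuousLinearMap.coe_fst',
        smul_apply, sub_apply, ContinuousLinearMap.coe_snd', ContinuousLinearMap.comp_apply,
        ContinuousLinearMap.inl_apply, smul_eq_mul, Prod.mk.injEq, true_and]
      rw [h1]
      field_simp
      ring)

/-- Implicit function theorem for one scalar unknown, with parameters in a set with unique
differentials, such as a half space. -/
theorem exists_implicit_scalar {E : Type*} [NormedAddCommGroup E] [NormedSpace ℝ E] {C : Set E}
    (hC : UniqueDiffOn ℝ C) {x₀ : E} (hx₀ : x₀ ∈ C) {O : Set (E × ℝ)} (hO : IsOpen O)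
    (hxO : (x₀, (0 : ℝ)) ∈ O) {g : E × ℝ → ℝ} (hg : ContDiffOn ℝ ∞ g (O ∩ C ×ˢ univ))
    (h0 : g (x₀, 0) = 0) {c : ℝ} (hd : HasDerivAt (fun τ => g (x₀, τ)) c 0) (hc : c ≠ 0) :
    ∃ δ > 0, ∃ N : Set E, IsOpen N ∧ x₀ ∈ N ∧ N ×ˢ Ioo (-δ) δ ⊆ O ∧ ∃ T : E → ℝ,
      ContDiffOn ℝ ∞ T (N ∩ C) ∧ ∀ x ∈ N ∩ C, T x ∈ Ioo (-δ) δ ∧ g (x, T x) = 0 ∧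
        ∀ τ ∈ Ioo (-δ) δ, g (x, τ) = 0 → τ = T x := by
  -- With a positive τ-derivative, g(x, ·) is strictly increasing near 0 for x near `x₀`. Thus T x
  -- is the point where the sign changes, and no extension of g beyond C is needed.
  wlog hcpos : 0 < c generalizing g c
  · obtain ⟨δ, hδ, N, hN, hxN, hNO, T, hT, hT'⟩ := this (g := fun p => - g p) hg.neg (by simp [h0])
      hd.neg (neg_ne_zero.2 hc) (neg_pos.2 (lt_of_le_of_ne (not_lt.1 hcpos) hc))
    exact ⟨δ, hδ, N, hN, hxN, hNO, T, hT, fun x hx => ⟨(hT' x hx).1,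
      neg_eq_zero.1 (hT' x hx).2.1, fun τ hτ h => (hT' x hx).2.2 τ hτ (by simp [h])⟩⟩
  set S : Set (E × ℝ) := O ∩ C ×ˢ univ with hS
  have hCU : UniqueDiffOn ℝ (C ×ˢ (univ : Set ℝ)) := hC.prod uniqueDiffOn_univ
  have hSU : UniqueDiffOn ℝ S := by
    rw [hS, inter_comm]
    exact hCU.inter hO
  set D : E × ℝ → (E × ℝ →L[ℝ] ℝ) := fderivWithin ℝ g S with hD
  have hDs : ContDiffOn ℝ ∞ D S := hg.fderivWithin hSU (by simp)
  have hgD : ∀ p ∈ S, HasFDerivWithinAt g (D p) (C ×ˢ univ) p := fun p hp =>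
    ((hg.differentiableOn (by simp) p hp).hasFDerivWithinAt).mono_of_mem_nhdsWithin
      (Filter.inter_mem (mem_nhdsWithin_of_mem_nhds (hO.mem_nhds hp.1)) self_mem_nhdsWithin)
  have hderiv : ∀ x τ, (x, τ) ∈ S → HasDerivAt (fun τ => g (x, τ)) (D (x, τ) (0, 1)) τ := by
    intro x τ hp
    have h1 : HasDerivWithinAt (fun τ : ℝ => (x, τ)) ((0 : E), (1 : ℝ)) univ τ :=
      ((hasDerivAt_const τ x).prodMk (hasDerivAt_id τ)).hasDerivWithinAt
    have h2 := (hgD _ hp).comp_hasDerivWithinAt τ h1 (fun s _ => mk_mem_prod hp.2.1 (mem_univ s))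
    exact hasDerivWithinAt_univ.1 h2
  have hS0 : (x₀, (0 : ℝ)) ∈ S := ⟨hxO, hx₀, mem_univ _⟩
  have hD0 : D (x₀, 0) (0, 1) = c := (hderiv x₀ 0 hS0).unique hd
  have hpc : ContinuousOn (fun p => D p (0, 1)) S := hDs.continuousOn.clm_apply continuousOn_const
  obtain ⟨u, hu, hupos⟩ : ∃ u ∈ 𝓝 (x₀, (0 : ℝ)), ∀ p ∈ u ∩ S, 0 < D p (0, 1) := by
    have := (hpc _ hS0).tendsto.eventually_const_lt (u := 0) (by simpa [hD0] using hcpos)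
    obtain ⟨u, hu, h⟩ := mem_nhdsWithin_iff_exists_mem_nhds_inter.1 this
    exact ⟨u, hu, fun p hp => h hp⟩
  obtain ⟨ε, hε, hεO⟩ := Metric.mem_nhds_iff.1 (Filter.inter_mem hu (hO.mem_nhds hxO))
  set δ := ε / 2 with hδ
  have hδpos : 0 < δ := by positivity
  have hbox : ∀ x ∈ Metric.ball x₀ ε, ∀ τ ∈ Icc (-δ) δ, (x, τ) ∈ u ∩ O := by
    intro x hx τ hτ
    apply hεO
    rw [← ball_prod_same]
    refine ⟨hx, ?_⟩
    rw [Metric.mem_ball, Real.dist_eq, sub_zero]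
    have := abs_le.2 ⟨hτ.1, hτ.2⟩
    dsimp only
    linarith
  have hboxS : ∀ x ∈ Metric.ball x₀ ε ∩ C, ∀ τ ∈ Icc (-δ) δ, (x, τ) ∈ S := fun x hx τ hτ =>
    ⟨(hbox x hx.1 τ hτ).2, hx.2, mem_univ _⟩
  have hmono : ∀ x ∈ Metric.ball x₀ ε ∩ C, StrictMonoOn (fun τ => g (x, τ)) (Icc (-δ) δ) := by
    intro x hx
    refine strictMonoOn_of_deriv_pos (convex_Icc _ _)
      (fun τ hτ => (hderiv x τ (hboxS x hx τ hτ)).continuousAt.continuousWithinAt) fun τ hτ => ?_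
    have hτ' := interior_subset hτ
    rw [(hderiv x τ (hboxS x hx τ hτ')).deriv]
    exact hupos _ ⟨(hbox x hx.1 τ hτ').1, hboxS x hx τ hτ'⟩
  have hcontx : ∀ x ∈ Metric.ball x₀ ε ∩ C, ∀ τ ∈ Icc (-δ) δ,
      ContinuousWithinAt (fun x => g (x, τ)) C x := by
    intro x hx τ hτ
    have h1 := (hgD _ (hboxS x hx τ hτ)).continuousWithinAt
    exact h1.comp (f := fun x : E => (x, τ)) (by fun_prop) (fun z hz => mk_mem_prod hz (mem_univ _))
  have hx₀b : x₀ ∈ Metric.ball x₀ ε ∩ C := ⟨Metric.mem_ball_self hε, hx₀⟩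
  have hδm : δ ∈ Icc (-δ) δ := ⟨by linarith, le_rfl⟩
  have hδm' : -δ ∈ Icc (-δ) δ := ⟨le_rfl, by linarith⟩
  have h0m : (0 : ℝ) ∈ Icc (-δ) δ := ⟨by linarith, by linarith⟩
  obtain ⟨v, hv, hvpos⟩ : ∃ v ∈ 𝓝 x₀, ∀ x ∈ v ∩ C, g (x, -δ) < 0 ∧ 0 < g (x, δ) := by
    have h1 : g (x₀, -δ) < 0 := by
      rw [← h0]
      exact hmono x₀ hx₀b hδm' h0m (by linarith)
    have h2 : 0 < g (x₀, δ) := by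
      rw [← h0]
      exact hmono x₀ hx₀b h0m hδm hδpos
    have := ((hcontx x₀ hx₀b _ hδm').tendsto.eventually_lt_const h1).and
      ((hcontx x₀ hx₀b _ hδm).tendsto.eventually_const_lt h2)
    obtain ⟨v, hv, h⟩ := mem_nhdsWithin_iff_exists_mem_nhds_inter.1 this
    exact ⟨v, hv, fun x hx => h hx⟩
  set N : Set E := interior v ∩ Metric.ball x₀ ε with hN
  have hNopen : IsOpen N := isOpen_interior.inter Metric.isOpen_ball
  have hxN : x₀ ∈ N := ⟨mem_interior_iff_mem_nhds.2 hv, Metric.mem_ball_self hε⟩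
  have hNb : ∀ x ∈ N ∩ C, x ∈ Metric.ball x₀ ε ∩ C := fun x hx => ⟨hx.1.2, hx.2⟩
  have hex : ∀ x, ∃ τ, x ∈ N ∩ C → τ ∈ Ioo (-δ) δ ∧ g (x, τ) = 0 := by
    intro x
    by_cases hx : x ∈ N ∩ C
    · have hsign := hvpos x ⟨interior_subset hx.1.1, hx.2⟩
      have hcont : ContinuousOn (fun τ => g (x, τ)) (Icc (-δ) δ) := fun τ hτ =>
        (hderiv x τ (hboxS x (hNb x hx) τ hτ)).continuousAt.continuousWithinAt
      obtain ⟨τ, hτ, hτ0⟩ := intermediate_value_Ioo (by linarith) hcont hsign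
      exact ⟨τ, fun _ => ⟨hτ, hτ0⟩⟩
    · exact ⟨0, fun h => absurd h hx⟩
  choose T hT using hex
  have hTS : ∀ x ∈ N ∩ C, (x, T x) ∈ S := fun x hx =>
    hboxS x (hNb x hx) _ (Ioo_subset_Icc_self (hT x hx).1)
  have hTpos : ∀ x ∈ N ∩ C, 0 < D (x, T x) (0, 1) := fun x hx =>
    hupos _ ⟨(hbox x (hNb x hx).1 _ (Ioo_subset_Icc_self (hT x hx).1)).1, hTS x hx⟩
  have hTcont : ContinuousOn T (N ∩ C) := by
    intro x hx
    have hTx := hT x hx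
    refine tendsto_order.2 ⟨fun a ha => ?_, fun a ha => ?_⟩
    · rcases le_or_gt a (-δ) with h | h
      · filter_upwards [self_mem_nhdsWithin] with x' hx'
        exact h.trans_lt (hT x' hx').1.1
      · have ham : a ∈ Icc (-δ) δ := ⟨h.le, (ha.trans hTx.1.2).le⟩
        have h1 : g (x, a) < 0 := by
          rw [← hTx.2]
          exact hmono x (hNb x hx) ham (Ioo_subset_Icc_self hTx.1) ha
        have h2 := ((hcontx x (hNb x hx) a ham).mono
          (inter_subset_right (s := N))).tendsto.eventually_lt_const h1
        filter_upwards [h2, self_mem_nhdsWithin] with x' h3 hx'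
        refine ((hmono x' (hNb x' hx')).lt_iff_lt ham (Ioo_subset_Icc_self (hT x' hx').1)).1 ?_
        simpa only [(hT x' hx').2] using h3
    · rcases le_or_gt δ a with h | h
      · filter_upwards [self_mem_nhdsWithin] with x' hx'
        exact (hT x' hx').1.2.trans_le h
      · have ham : a ∈ Icc (-δ) δ := ⟨(hTx.1.1.trans ha).le, h.le⟩
        have h1 : 0 < g (x, a) := by
          rw [← hTx.2]
          exact hmono x (hNb x hx) (Ioo_subset_Icc_self hTx.1) ham ha
        have h2 := ((hcontx x (hNb x hx) a ham).mono
          (inter_subset_right (s := N))).tendsto.eventually_const_lt h1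
        filter_upwards [h2, self_mem_nhdsWithin] with x' h3 hx'
        refine ((hmono x' (hNb x' hx')).lt_iff_lt (Ioo_subset_Icc_self (hT x' hx').1) ham).1 ?_
        simpa only [(hT x' hx').2] using h3
  -- The map (x, 0) ↦ (x, T x) is inverse to (x, τ) ↦ (x, g(x, τ)), whose derivative is an
  -- invertible shear; continuity of T then yields its derivative.
  have hTderiv : ∀ x ∈ N ∩ C, HasFDerivWithinAt T
      (-((D (x, T x) (0, 1))⁻¹ • (D (x, T x)).comp (ContinuousLinearMap.inl ℝ E ℝ)))
      (N ∩ C) x := by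
    intro x hx
    have hf : HasFDerivWithinAt (fun p : E × ℝ => (p.1, g p))
        (shearEquiv (D (x, T x)) (hTpos x hx).ne' : E × ℝ →L[ℝ] E × ℝ) (C ×ˢ univ) (x, T x) :=
      hasFDerivAt_fst.hasFDerivWithinAt.prodMk (hgD _ (hTS x hx))
    have hG := HasFDerivWithinAt.of_local_left_inverse (g := fun p : E × ℝ => (p.1, T p.1))
      (a := (x, (0 : ℝ))) (s := (N ∩ C) ×ˢ {0}) ?_ hf ⟨hx, rfl⟩ ?_
    · have h1 := (hG.comp x (f := fun z : E => (z, (0 : ℝ))) (s := N ∩ C)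
        ((hasFDerivAt_prodMk_left x (0 : ℝ)).hasFDerivWithinAt)
        (fun z hz => mk_mem_prod hz rfl)).snd
      refine h1.congr_fderiv ?_
      ext v
      simp [shearEquiv]
    · refine tendsto_nhdsWithin_of_tendsto_nhds_of_eventually_within _ ?_ ?_
      · have h1 : ContinuousOn (fun p : E × ℝ => (p.1, T p.1)) ((N ∩ C) ×ˢ {0}) :=
          continuousOn_fst.prodMk (hTcont.comp continuousOn_fst (fun p hp => hp.1))
        exact h1 _ ⟨hx, rfl⟩
      · filter_upwards [self_mem_nhdsWithin] with p hp
        exact ⟨hp.1.2, mem_univ _⟩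
    · filter_upwards [self_mem_nhdsWithin] with p hp
      have h2 : p.2 = 0 := hp.2
      exact Prod.ext rfl (by simp only [(hT p.1 hp.1).2, h2])
  refine ⟨δ, hδpos, N, hNopen, hxN, fun p hp =>
    (hbox p.1 hp.1.2 p.2 (Ioo_subset_Icc_self hp.2)).2, T, ?_, fun x hx => ⟨(hT x hx).1,
    (hT x hx).2, fun τ hτ h => ?_⟩⟩
  · have hNU : UniqueDiffOn ℝ (N ∩ C) := by
      rw [inter_comm]
      exact hC.inter hNopen
    -- Bootstrapping: the formula for the derivative involves T only through smooth functions of (x,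
    -- T x), so each order of smoothness yields the next.
    rw [contDiffOn_infty]
    intro n
    induction n with
    | zero => rwa [Nat.cast_zero, contDiffOn_zero]
    | succ n ih =>
      rw [Nat.cast_succ, contDiffOn_succ_iff_hasFDerivWithinAt_of_uniqueDiffOn hNU]
      refine ⟨by simp, _, ?_, hTderiv⟩
      have h1 : ContDiffOn ℝ n (fun x => D (x, T x)) (N ∩ C) :=
        (hDs.of_le (by exact_mod_cast le_top)).comp (contDiffOn_id.prodMk ih) hTS
      exact (((h1.clm_apply contDiffOn_const).inv (fun x hx => (hTpos x hx).ne')).smul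
        (h1.clm_comp contDiffOn_const)).neg
  · refine (hmono x (hNb x hx)).injOn (Ioo_subset_Icc_self hτ) (Ioo_subset_Icc_self (hT x hx).1) ?_
    simp only [h, (hT x hx).2]

end ImplicitFunction

/-! ### Closed surjections with compact fibres. -/

section PerfectMaps

variable {X Z : Type*} [TopologicalSpace X] [TopologicalSpace Z] {f : X → Z}

/-- The set in question consists of the points whose whole fibre lies in O. It is the basic tool for
pushing open sets forward along a closed map. -/
lemma IsClosedMap.isOpen_fibreInterior (hf : IsClosedMap f) {O : Set X} (hO : IsOpen O) :
    IsOpen (f '' Oᶜ)ᶜ :=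
  (hf _ hO.isClosed_compl).isOpen_compl

/-- Disjoint compact fibres have disjoint open neighbourhoods, and the points whose fibres lie
inside these are separated downstairs. -/
lemma t2Space_of_perfect [T2Space X] (hf : IsClosedMap f) (hs : Surjective f)
    (hk : ∀ z, IsCompact (f ⁻¹' {z})) : T2Space Z := by
  refine ⟨fun z z' hzz' => ?_⟩
  obtain ⟨u, v, hu, hv, hzu, hzv, huv⟩ := SeparatedNhds.of_isCompact_isCompact (hk z) (hk z')
    (disjoint_left.2 fun x hx hx' => hzz' (hx.symm.trans hx'))
  refine ⟨_, _, IsClosedMap.isOpen_fibreInterior hf hu, IsClosedMap.isOpen_fibreInterior hf hv,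
    ?_, ?_, ?_⟩
  · rintro ⟨x, hx, rfl⟩
    exact hx (hzu rfl)
  · rintro ⟨x, hx, rfl⟩
    exact hx (hzv rfl)
  · refine disjoint_left.2 fun w hw hw' => ?_
    obtain ⟨x, rfl⟩ := hs w
    have hxu : x ∈ u := by_contra fun h => hw ⟨x, h, rfl⟩
    have hxv : x ∈ v := by_contra fun h => hw' ⟨x, h, rfl⟩
    exact disjoint_left.1 huv hxu hxv

/-- A compact fibre inside an open set is covered by finitely many basic sets. So the fibre
interiors of finite unions of basic sets form a countable basis. -/
lemma secondCountableTopology_of_perfect [SecondCountableTopology X] (hc : Continuous f)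
    (hf : IsClosedMap f) (hs : Surjective f) (hk : ∀ z, IsCompact (f ⁻¹' {z})) :
    SecondCountableTopology Z := by
  set b := TopologicalSpace.countableBasis X
  have hb := TopologicalSpace.isBasis_countableBasis X
  set B : Set (Set Z) := (fun s : Set (Set X) => (f '' (⋃₀ s)ᶜ)ᶜ) '' {s | s.Finite ∧ s ⊆ b}
  have hB : TopologicalSpace.IsTopologicalBasis B := by
    refine TopologicalSpace.isTopologicalBasis_of_isOpen_of_nhds ?_ ?_
    · rintro _ ⟨s, ⟨-, hs⟩, rfl⟩
      exact IsClosedMap.isOpen_fibreInterior hf (isOpen_sUnion fun t ht => hb.isOpen (hs ht))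
    · intro z O hz hO
      have hO' : IsOpen (f ⁻¹' O) := hO.preimage hc
      have h1 : ∀ x ∈ f ⁻¹' {z}, ∃ t ∈ b, x ∈ t ∧ t ⊆ f ⁻¹' O := fun x hx =>
        hb.exists_subset_of_mem_open (show f x ∈ O by rw [show f x = z from hx]; exact hz) hO'
      choose! t htb hxt htO using h1
      obtain ⟨F, hF, hcov⟩ := (hk z).elim_nhds_subcover t
        (fun x hx => (hb.isOpen (htb x hx)).mem_nhds (hxt x hx))
      refine ⟨_, ⟨t '' (F : Set X), ⟨F.finite_toSet.image t, ?_⟩, rfl⟩, ?_, ?_⟩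
      · rintro _ ⟨x, hx, rfl⟩
        exact htb x (hF x hx)
      · rintro ⟨x, hx, hxz⟩
        obtain ⟨y, hy, hxy⟩ := mem_iUnion₂.1 (hcov (show x ∈ f ⁻¹' {z} from hxz))
        exact hx ⟨t y, ⟨y, hy, rfl⟩, hxy⟩
      · intro w hw
        obtain ⟨x, rfl⟩ := hs w
        have hx : x ∈ ⋃₀ (t '' (F : Set X)) := by_contra fun h => hw ⟨x, h, rfl⟩
        obtain ⟨_, ⟨y, hy, rfl⟩, hxy⟩ := hx
        exact htO y (hF y hy) hxy
  exact hB.secondCountableTopology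
    ((countable_ofPred_finite_subset (TopologicalSpace.countable_countableBasis X)).image _)

end PerfectMaps

lemma continuousSMul_circle (d : ℕ) {M : Type*} [TopologicalSpace M]
    [ChartedSpace (EuclideanHalfSpace (d + 1)) M] (U : TopologicalSpace.Opens M)
    [MulAction Circle U] [ContMDiffSMul (𝓡 1) (𝓡∂ (d + 1)) ∞ Circle U] :
    ContinuousSMul Circle U :=
  ⟨(ContMDiffSMul.contMDiff_smul (I := 𝓡 1) (I' := 𝓡∂ (d + 1)) (n := ∞)).continuous⟩


/-! ### The topology of the cut space. -/

section CutTopology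

variable {d : ℕ} {M : Type*} [TopologicalSpace M] [ChartedSpace (EuclideanHalfSpace (d + 1)) M]
  {U : TopologicalSpace.Opens M} [MulAction Circle U]

lemma cutMap_eq_iff {x y : M} : cutMap d U x = cutMap d U y ↔ x = y ∨
    (x ∈ (𝓡∂ (d + 1)).boundary M ∧ y ∈ (𝓡∂ (d + 1)).boundary M ∧
    ∃ x' y' : U, (x' : M) = x ∧ (y' : M) = y ∧ ∃ a : Circle, a • x' = y') :=
  Quotient.eq (r := cutSetoid d U)

lemma continuous_cutMap : Continuous (cutMap d U) := continuous_quotient_mk'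

lemma surjective_cutMap : Surjective (cutMap d U) := Quotient.mk_surjective

lemma isQuotientMap_cutMap : IsQuotientMap (cutMap d U) := isQuotientMap_quotient_mk'

lemma cutMap_smul {a : Circle} {x : U} (hx : (x : M) ∈ (𝓡∂ (d + 1)).boundary M)
    (hax : ((a • x : U) : M) ∈ (𝓡∂ (d + 1)).boundary M) :
    cutMap d U (a • x : U) = cutMap d U x :=
  (cutMap_eq_iff.2 (Or.inr ⟨hx, hax, x, a • x, rfl, rfl, a, rfl⟩)).symm

lemma cutMap_mem_redSet_iff {x : M} :
    cutMap d U x ∈ redSet d U ↔ x ∈ (𝓡∂ (d + 1)).boundary M := by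
  refine ⟨?_, fun h => ⟨x, h, rfl⟩⟩
  rintro ⟨y, hy, hxy⟩
  rcases cutMap_eq_iff.1 hxy with rfl | ⟨-, h, -⟩
  exacts [hy, h]

lemma cutMap_injective_of_not_mem {x y : M} (hx : x ∉ (𝓡∂ (d + 1)).boundary M)
    (h : cutMap d U x = cutMap d U y) : x = y := by
  rcases cutMap_eq_iff.1 h with h | ⟨h, -⟩
  exacts [h, absurd h hx]

variable [IsManifold (𝓡∂ (d + 1)) ∞ M]

lemma isClosed_boundary' : IsClosed ((𝓡∂ (d + 1)).boundary M) :=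
  ModelWithCorners.isClosed_boundary (n := ∞) (by simp)

lemma isOpen_interior' : IsOpen ((𝓡∂ (d + 1)).interior M) :=
  ModelWithCorners.isOpen_interior (n := ∞) (by simp)

lemma mem_interior_iff_not_mem_boundary {x : M} :
    x ∈ (𝓡∂ (d + 1)).interior M ↔ x ∉ (𝓡∂ (d + 1)).boundary M := by
  rw [← ModelWithCorners.compl_boundary, mem_compl_iff]

variable [ContMDiffSMul (𝓡 1) (𝓡∂ (d + 1)) ∞ Circle U]

lemma contMDiff_smul_left (a : Circle) :
    ContMDiff (𝓡∂ (d + 1)) (𝓡∂ (d + 1)) ∞ (fun x : U => a • x) :=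
  (ContMDiffSMul.contMDiff_smul (I := 𝓡 1) (I' := 𝓡∂ (d + 1)) (n := ∞) (G := Circle)
    (M := U)).comp (contMDiff_const.prodMk contMDiff_id)

/-- Each group element acts by a diffeomorphism of U, and diffeomorphisms preserve the boundary. -/
lemma smul_mem_boundary_iff (a : Circle) (x : U) :
    ((a • x : U) : M) ∈ (𝓡∂ (d + 1)).boundary M ↔ (x : M) ∈ (𝓡∂ (d + 1)).boundary M := by
  let Φ : U ≃ₘ^∞⟮𝓡∂ (d + 1), 𝓡∂ (d + 1)⟯ U :=
    { toFun := fun x => a • x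
      invFun := fun x => a⁻¹ • x
      left_inv := fun x => inv_smul_smul a x
      right_inv := fun x => smul_inv_smul a x
      contMDiff_toFun := contMDiff_smul_left a
      contMDiff_invFun := contMDiff_smul_left a⁻¹ }
  have h := Φ.preimage_boundary (by simp)
  rw [ModelWithCorners.boundary_open] at h
  exact Set.ext_iff.1 h x

lemma cutMap_smul_of_mem {a : Circle} {x : U} (hx : (x : M) ∈ (𝓡∂ (d + 1)).boundary M) :
    cutMap d U (a • x : U) = cutMap d U x :=
  cutMap_smul hx ((smul_mem_boundary_iff a x).2 hx)

-- The saturation of a closed set C is C ∪ S¹·(C ∩ ∂M). The orbit of a closed set under a compact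
-- group is closed in U, and intersecting with the closed set ∂M ⊆ U makes it closed in M.
open scoped Pointwise in
lemma isClosedMap_cutMap (hU : (𝓡∂ (d + 1)).boundary M ⊆ U) : IsClosedMap (cutMap d U) := by
  have := continuousSMul_circle d U
  intro C hC
  rw [← isQuotientMap_cutMap.isClosed_preimage]
  set B : Set U := Subtype.val ⁻¹' (C ∩ (𝓡∂ (d + 1)).boundary M)
  have hB : IsClosed B := (hC.inter isClosed_boundary').preimage continuous_subtype_val
  have hZ : IsClosed ((univ : Set Circle) • B) := hB.smul_left_of_isCompact isCompact_univ
  obtain ⟨F, hF, hFZ⟩ := isClosed_induced_iff.1 hZ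
  have heq : cutMap d U ⁻¹' (cutMap d U '' C) = C ∪ F ∩ (𝓡∂ (d + 1)).boundary M := by
    ext x
    constructor
    · rintro ⟨y, hy, hxy⟩
      rcases cutMap_eq_iff.1 hxy with rfl | ⟨hyb, hxb, y', x', rfl, rfl, a, hax⟩
      · exact Or.inl hy
      · refine Or.inr ⟨?_, hxb⟩
        have : x' ∈ (univ : Set Circle) • B := ⟨a, mem_univ _, y', ⟨hy, hyb⟩, hax⟩
        rwa [← hFZ] at this
    · rintro (hx | ⟨hxF, hxb⟩)
      · exact ⟨x, hx, rfl⟩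
      · have : (⟨x, hU hxb⟩ : U) ∈ (univ : Set Circle) • B := by rw [← hFZ]; exact hxF
        obtain ⟨a, -, y, hy, hay⟩ := this
        refine ⟨y, hy.1, ?_⟩
        exact cutMap_eq_iff.2 (Or.inr ⟨hy.2, hxb, y, _, rfl, rfl, a, hay⟩)
  rw [heq]
  exact hC.union (hF.inter isClosed_boundary')

/-- A fibre is a single interior point or one circle orbit in the boundary. -/
lemma isCompact_cutMap_fibre (hU : (𝓡∂ (d + 1)).boundary M ⊆ U) (z : CutSpace d U) :
    IsCompact (cutMap d U ⁻¹' {z}) := by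
  have := continuousSMul_circle d U
  obtain ⟨x, rfl⟩ := surjective_cutMap z
  by_cases hx : x ∈ (𝓡∂ (d + 1)).boundary M
  · have : cutMap d U ⁻¹' {cutMap d U x} =
        range (fun a : Circle => ((a • (⟨x, hU hx⟩ : U) : U) : M)) := by
      ext y
      constructor
      · intro hy
        rcases cutMap_eq_iff.1 hy with rfl | ⟨hyb, hxb, y', x', rfl, rfl, a, hax⟩
        · exact ⟨1, by simp⟩
        · exact ⟨a⁻¹, by
            change ((a⁻¹ • x' : U) : M) = y'
            rw [← hax, inv_smul_smul]⟩
      · rintro ⟨a, rfl⟩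
        exact cutMap_smul_of_mem (x := ⟨x, hU hx⟩) hx
    rw [this]
    exact isCompact_range (by fun_prop)
  · have : cutMap d U ⁻¹' {cutMap d U x} = {x} := by
      ext y
      exact ⟨fun hy => (cutMap_injective_of_not_mem hx (Eq.symm hy)).symm, fun hy => by
        rw [show y = x from hy]; rfl⟩
    rw [this]
    exact isCompact_singleton

theorem t2Space_cutSpace [T2Space M] (hU : (𝓡∂ (d + 1)).boundary M ⊆ U) :
    T2Space (CutSpace d U) :=
  t2Space_of_perfect (isClosedMap_cutMap hU) surjective_cutMap (isCompact_cutMap_fibre hU)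

theorem secondCountableTopology_cutSpace [SecondCountableTopology M]
    (hU : (𝓡∂ (d + 1)).boundary M ⊆ U) : SecondCountableTopology (CutSpace d U) :=
  secondCountableTopology_of_perfect continuous_cutMap (isClosedMap_cutMap hU) surjective_cutMap
    (isCompact_cutMap_fibre hU)

end CutTopology

/-! ### Coordinates adapted to a free circle action. -/

section Adapted

variable {d : ℕ} {M : Type*} [TopologicalSpace M] [ChartedSpace (EuclideanHalfSpace (d + 1)) M]
  {U : TopologicalSpace.Opens M} [MulAction Circle U]

/-- The half ball of radius `r` about the origin of `Y × ℝ`. -/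
def halfBall (Y : Type) [NormedAddCommGroup Y] (r : ℝ) : Set (Y × ℝ) :=
  Metric.ball 0 r ∩ upperHalf Y

variable (d U) in
/-- Coordinates near the orbit of a boundary point `p` that are adapted to the circle action: an
invariant open set `dom`, an equivariant map `ang` to the circle, and an invariant map `pr` to a
half space, such that `(ang, pr)` is a diffeomorphism whose inverse is `(a, q) ↦ a • slice q`. -/
structure AdaptedChart (Y : Type) [NormedAddCommGroup Y] [NormedSpace ℝ Y] (V : Set U)
    (p : U) where
  r : ℝ
  r_pos : 0 < r
  dom : Set U
  ang : U → Circle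
  pr : U → Y × ℝ
  slice : Y × ℝ → U
  dom_subset : dom ⊆ V
  isOpen_dom : IsOpen dom
  smul_mem : ∀ a : Circle, ∀ x ∈ dom, a • x ∈ dom
  slice_zero : slice 0 = p
  slice_mem : ∀ q ∈ halfBall Y r, slice q ∈ dom
  pr_mem : ∀ x ∈ dom, pr x ∈ halfBall Y r
  ang_smul : ∀ a : Circle, ∀ x ∈ dom, ang (a • x) = a * ang x
  pr_smul : ∀ a : Circle, ∀ x ∈ dom, pr (a • x) = pr x
  ang_slice : ∀ q ∈ halfBall Y r, ang (slice q) = 1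
  pr_slice : ∀ q ∈ halfBall Y r, pr (slice q) = q
  ang_smul_slice : ∀ x ∈ dom, ang x • slice (pr x) = x
  mem_boundary_iff : ∀ x ∈ dom, (x : M) ∈ (𝓡∂ (d + 1)).boundary M ↔ (pr x).2 = 0
  contMDiffOn_slice : ContMDiffOn 𝓘(ℝ, Y × ℝ) (𝓡∂ (d + 1)) ∞ slice (halfBall Y r)
  contMDiffOn_ang : ContMDiffOn (𝓡∂ (d + 1)) (𝓡 1) ∞ ang dom
  contMDiffOn_pr : ContMDiffOn (𝓡∂ (d + 1)) 𝓘(ℝ, Y × ℝ) ∞ pr dom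
  slice_mem_source : ∀ q ∈ halfBall Y r,
    (slice q : M) ∈ (chartAt (EuclideanHalfSpace (d + 1)) (p : M)).source
  cutModel : EuclideanSpace ℝ (Fin (d + 1)) ≃L[ℝ] Y × ℂ
  bdryModel : EuclideanSpace ℝ (Fin d) ≃L[ℝ] ℝ × Y

/-- Here ξ is the velocity of the orbit, tangent to the boundary. The functional ℓ is normalised by
ℓ ξ = 1 and kills the normal direction `e₀`, so the slice ker ℓ splits into Y and the normal line. P
projects onto it along ξ without changing the normal coordinate. -/
lemma exists_slice_splitting {Y : Type} [NormedAddCommGroup Y] [NormedSpace ℝ Y]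
    [FiniteDimensional ℝ Y] (hY : Module.finrank ℝ Y + 1 = d)
    {ξ : EuclideanSpace ℝ (Fin (d + 1))} (hξ : ξ ≠ 0) (hξ0 : ξ 0 = 0) :
    ∃ (Λ : Y × ℝ →L[ℝ] EuclideanSpace ℝ (Fin (d + 1)))
      (P : EuclideanSpace ℝ (Fin (d + 1)) →L[ℝ] Y × ℝ)
      (ℓ : EuclideanSpace ℝ (Fin (d + 1)) →L[ℝ] ℝ),
      (∀ q, P (Λ q) = q) ∧ (∀ q, ℓ (Λ q) = 0) ∧ (∀ v, ℓ v = 0 → Λ (P v) = v) ∧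
      (∀ q, (Λ q) 0 = q.2) ∧ (∀ v, (P v).2 = v 0) ∧ ℓ ξ ≠ 0 := by
  set e₀ : EuclideanSpace ℝ (Fin (d + 1)) := EuclideanSpace.single 0 1 with he₀
  set x₀ : EuclideanSpace ℝ (Fin (d + 1)) →L[ℝ] ℝ := EuclideanSpace.proj 0 with hx₀
  set c : ℝ := inner ℝ ξ ξ with hc
  have hc0 : c ≠ 0 := inner_self_ne_zero.2 hξ
  set ℓ : EuclideanSpace ℝ (Fin (d + 1)) →L[ℝ] ℝ := c⁻¹ • innerSL ℝ ξ with hℓ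
  have hℓξ : ℓ ξ = 1 := by
    change c⁻¹ * inner ℝ ξ ξ = 1
    exact inv_mul_cancel₀ hc0
  have hℓe : ℓ e₀ = 0 := by
    change c⁻¹ * inner ℝ ξ (EuclideanSpace.single 0 1) = 0
    rw [EuclideanSpace.inner_single_right]
    simp [hξ0]
  have hxe : x₀ e₀ = 1 := by
    change (EuclideanSpace.single (0 : Fin (d + 1)) (1 : ℝ)) 0 = 1
    simp
  have hxξ : x₀ ξ = 0 := hξ0
  set F : EuclideanSpace ℝ (Fin (d + 1)) →ₗ[ℝ] ℝ × ℝ := (x₀ : EuclideanSpace ℝ (Fin (d + 1)) →ₗ[ℝ] ℝ).prod (ℓ : EuclideanSpace ℝ (Fin (d + 1)) →ₗ[ℝ] ℝ) with hF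
  have hFs : Surjective F := fun p => ⟨p.1 • e₀ + p.2 • ξ, by
    refine Prod.ext ?_ ?_ <;> simp [hF, hxe, hxξ, hℓe, hℓξ]⟩
  set K := LinearMap.ker F with hK
  have hKm : ∀ v, v ∈ K ↔ x₀ v = 0 ∧ ℓ v = 0 := fun v => by
    simp [hK, hF]
  have hKdim : Module.finrank ℝ Y = Module.finrank ℝ K := by
    have h1 := LinearMap.finrank_range_add_finrank_ker F
    rw [LinearMap.range_eq_top.2 hFs, finrank_top] at h1
    simp only [Module.finrank_prod, Module.finrank_self, finrank_euclideanSpace,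
      Fintype.card_fin] at h1
    change _ = Module.finrank ℝ (LinearMap.ker F)
    omega
  set κ : Y ≃L[ℝ] K := ContinuousLinearEquiv.ofFinrankEq hKdim
  set proj : EuclideanSpace ℝ (Fin (d + 1)) →L[ℝ] K := (ContinuousLinearMap.id ℝ (EuclideanSpace ℝ (Fin (d + 1))) - x₀.smulRight e₀ - ℓ.smulRight ξ).codRestrict
    K (fun v => by
      rw [hKm]
      simp [hxe, hxξ, hℓe, hℓξ]) with hproj
  have hproj' : ∀ v, (proj v : EuclideanSpace ℝ (Fin (d + 1))) = v - x₀ v • e₀ - ℓ v • ξ := fun v => rfl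
  refine ⟨(K.subtypeL ∘L (κ : Y →L[ℝ] K)).coprod ((ContinuousLinearMap.id ℝ ℝ).smulRight e₀),
    ((κ.symm : K →L[ℝ] Y) ∘L proj).prod x₀, ℓ, ?_, ?_, ?_, ?_, fun v => rfl, by simp [hℓξ]⟩
  · rintro ⟨y, t⟩
    have h1 := (hKm (κ y)).1 (κ y).2
    have h2 : proj ((κ y : EuclideanSpace ℝ (Fin (d + 1))) + t • e₀) = κ y := by
      apply Subtype.ext
      rw [hproj']
      simp [h1.1, h1.2, hxe, hℓe]
    refine Prod.ext ?_ ?_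
    · simp [h2]
    · simp [h1.1, hxe]
  · rintro ⟨y, t⟩
    have h1 := (hKm (κ y)).1 (κ y).2
    simp [h1.2, hℓe]
  · intro v hv
    simp [hproj', hv]
  · rintro ⟨y, t⟩
    have h1 := (hKm (κ y)).1 (κ y).2
    have h2 : (κ y : EuclideanSpace ℝ (Fin (d + 1))) 0 = 0 := h1.1
    simp [h2, he₀]

variable [IsManifold (𝓡∂ (d + 1)) ∞ M]

lemma mem_boundary_iff_extChartAt (p : U) {x : U} (hx : x ∈ (extChartAt (𝓡∂ (d + 1)) p).source) :
    (x : M) ∈ (𝓡∂ (d + 1)).boundary M ↔ (extChartAt (𝓡∂ (d + 1)) p x) 0 = 0 := by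
  rw [extChartAt_source] at hx
  have h := mem_boundary_iff_of_mem_atlas (d := d) (M := U) (chart_mem_atlas _ p) hx
  rw [ModelWithCorners.boundary_open] at h
  exact h

lemma extChartAt_zero_nonneg (p x : U) : 0 ≤ (extChartAt (𝓡∂ (d + 1)) p x) 0 :=
  (chartAt (EuclideanHalfSpace (d + 1)) p x).2

variable [ContMDiffSMul (𝓡 1) (𝓡∂ (d + 1)) ∞ Circle U]

variable (d) in
lemma contMDiff_orbit (p : U) :
    ContMDiff 𝓘(ℝ, ℝ) (𝓡∂ (d + 1)) ∞ (fun τ : ℝ => Circle.exp τ • p) :=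
  (ContMDiffSMul.contMDiff_smul (I := 𝓡 1) (I' := 𝓡∂ (d + 1)) (n := ∞) (G := Circle)
    (M := U)).comp (contMDiff_circleExp.prodMk contMDiff_const)

lemma circle_exp_arg_ne {δ : ℝ} (hδ : 0 < δ) : ∃ τ : ℝ, |τ| < δ ∧ Circle.exp τ ≠ 1 := by
  refine ⟨min (δ / 2) 1, ?_, ?_⟩
  · rw [abs_of_pos (by positivity)]
    exact (min_le_left _ _).trans_lt (by linarith)
  · intro h
    obtain ⟨m, hm⟩ := Circle.exp_eq_one.1 h
    have h1 : 0 < min (δ / 2) 1 := by positivity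
    have h2 : min (δ / 2) 1 ≤ 1 := min_le_right _ _
    have hπ := Real.pi_gt_three
    rw [hm] at h1 h2
    have h3 : (0 : ℝ) < m := by
      by_contra hcon
      nlinarith
    have h4 : (1 : ℝ) ≤ m := by
      have : (0 : ℤ) < m := by exact_mod_cast h3
      exact_mod_cast this
    nlinarith

/-- The generator of a free circle action does not vanish. -/
lemma orbit_deriv_ne_zero (hfree : ∀ (a : Circle) (x : U), a • x = x → a = 1) (p : U) :
    deriv (fun τ : ℝ => extChartAt (𝓡∂ (d + 1)) p (Circle.exp τ • p)) 0 ≠ 0 := by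
  intro h0
  set I := 𝓡∂ (d + 1)
  set γ : ℝ → U := fun τ => Circle.exp τ • p with hγ
  have hγs : ContMDiff 𝓘(ℝ, ℝ) I ∞ γ := contMDiff_orbit d p
  have hγd : MDifferentiable 𝓘(ℝ, ℝ) I γ := hγs.mdifferentiable (by simp)
  have hγ0 : γ 0 = p := by simp [hγ]
  have hκ : ∀ τ, γ τ ∈ (extChartAt I p).source → HasDerivAt (fun τ => extChartAt I p (γ τ))
      ((mfderiv I 𝓘(ℝ, EuclideanSpace ℝ (Fin (d + 1))) (extChartAt I p) (γ τ) :
        EuclideanSpace ℝ (Fin (d + 1)) →L[ℝ] EuclideanSpace ℝ (Fin (d + 1)))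
        ((mfderiv 𝓘(ℝ, ℝ) I γ τ : ℝ →L[ℝ] EuclideanSpace ℝ (Fin (d + 1))) 1)) τ := by
    intro τ hτ
    rw [extChartAt_source] at hτ
    have h1 := (mdifferentiableAt_extChartAt (I := I) hτ).hasMFDerivAt
    have h2 := (h1.comp τ (hγd τ).hasMFDerivAt).hasFDerivAt
    obtain ⟨L, hL, hL1⟩ : ∃ L : ℝ →L[ℝ] EuclideanSpace ℝ (Fin (d + 1)),
        HasFDerivAt (fun τ => extChartAt I p (γ τ)) L τ ∧ L 1 =
        (mfderiv I 𝓘(ℝ, EuclideanSpace ℝ (Fin (d + 1))) (extChartAt I p) (γ τ) :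
        EuclideanSpace ℝ (Fin (d + 1)) →L[ℝ] EuclideanSpace ℝ (Fin (d + 1)))
        ((mfderiv 𝓘(ℝ, ℝ) I γ τ : ℝ →L[ℝ] EuclideanSpace ℝ (Fin (d + 1))) 1) := ⟨_, h2, rfl⟩
    rw [← hL1]
    exact hL.hasDerivAt
  have hp : p ∈ (extChartAt I p).source := mem_extChartAt_source p
  have hzero : mfderiv 𝓘(ℝ, ℝ) I γ 0 = 0 := by
    have h1 := hκ 0 (by rw [hγ0]; exact hp)
    have h2 := h1.deriv
    have h3 : deriv (fun τ => extChartAt I p (γ τ)) 0 = 0 := h0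
    rw [h3] at h2
    have hinv := isInvertible_mfderiv_extChartAt (I := I) (x := p) (y := γ 0) (by rw [hγ0]; exact hp)
    have h4 : mfderiv 𝓘(ℝ, ℝ) I γ 0 1 = 0 := by
      apply hinv.injective
      rw [map_zero]
      exact h2.symm
    ext1
    exact h4
  -- The group law transports the derivative at time 0 to every time. A zero velocity at one moment
  -- therefore makes the orbit constant for a short time, against freeness.
  have hall : ∀ τ, mfderiv 𝓘(ℝ, ℝ) I γ τ = 0 := by
    intro τ
    have hcomp : γ = (fun x : U => Circle.exp τ • x) ∘ γ ∘ (fun s => s - τ) := by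
      ext s
      simp only [hγ, comp_apply, ← mul_smul, ← Circle.exp_add]
      congr 3
      ring
    have hsub : HasMFDerivAt 𝓘(ℝ, ℝ) 𝓘(ℝ, ℝ) (fun s : ℝ => s - τ) τ (ContinuousLinearMap.id ℝ ℝ) :=
      ((hasFDerivAt_id τ).sub_const τ).hasMFDerivAt
    have hg : HasMFDerivAt 𝓘(ℝ, ℝ) I γ ((fun s : ℝ => s - τ) τ)
        (0 : ℝ →L[ℝ] EuclideanSpace ℝ (Fin (d + 1))) := by
      have h5 : (fun s : ℝ => s - τ) τ = 0 := sub_self τ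
      rw [h5]
      have := (hγd 0).hasMFDerivAt
      rw [hzero] at this
      exact this
    have h5 := ((contMDiff_smul_left (d := d) (U := U) (Circle.exp τ)).mdifferentiable (by simp)
      (γ (τ - τ))).hasMFDerivAt
    have h6 := HasMFDerivAt.comp τ h5 (HasMFDerivAt.comp (f := fun s : ℝ => s - τ) τ hg hsub)
    rw [← hcomp] at h6
    rw [h6.mfderiv]
    ext1
    exact map_zero (mfderiv I I (fun x : U => Circle.exp τ • x) (γ (τ - τ)) :
      EuclideanSpace ℝ (Fin (d + 1)) →L[ℝ] EuclideanSpace ℝ (Fin (d + 1)))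
  obtain ⟨δ, hδ, hball⟩ := Metric.isOpen_iff.1
    ((isOpen_extChartAt_source (I := I) p).preimage hγs.continuous) 0
      (show γ 0 ∈ (extChartAt I p).source from hγ0.symm ▸ hp)
  obtain ⟨τ, hτ, hτ1⟩ := circle_exp_arg_ne hδ
  have hτb : τ ∈ Metric.ball (0 : ℝ) δ := by simpa using hτ
  have hconst := (convex_ball (0 : ℝ) δ).is_const_of_fderivWithin_eq_zero (𝕜 := ℝ)
    (f := fun τ => extChartAt I p (γ τ))
    (fun s hs => (hκ s (hball hs)).differentiableAt.differentiableWithinAt) (fun s hs => by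
      rw [fderivWithin_of_isOpen Metric.isOpen_ball hs, (hκ s (hball hs)).hasFDerivAt.fderiv, hall]
      ext1
      change (1 : ℝ) • (mfderiv I 𝓘(ℝ, EuclideanSpace ℝ (Fin (d + 1))) (extChartAt I p) (γ s) :
        EuclideanSpace ℝ (Fin (d + 1)) →L[ℝ] EuclideanSpace ℝ (Fin (d + 1))) 0 = 0
      rw [map_zero, smul_zero]) hτb (Metric.mem_ball_self hδ)
  have h7 := (extChartAt I p).injOn (hball hτb) (by rw [hγ0]; exact hp) hconst
  rw [hγ0] at h7
  exact hτ1 (hfree _ _ h7)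

/-- For a free action of the circle, a group element that moves a point near `p` to a point near
`p` is close to `1`. -/
lemma exists_nhds_abs_arg_lt [T2Space M] [ContinuousSMul Circle U] (hfree : ∀ (a : Circle) (x : U), a • x = x → a = 1)
    (p : U) {δ : ℝ} (hδ : 0 < δ) :
    ∃ N ∈ 𝓝 p, ∀ x ∈ N, ∀ a : Circle, a • x ∈ N → |Complex.arg a| < δ := by
  set O : Set Circle := {a | |Complex.arg a| < δ} with hO
  have hO1 : O ∈ 𝓝 (1 : Circle) := by
    have h1 : ContinuousAt (fun a : Circle => |Complex.arg a|) 1 := by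
      exact ContinuousAt.abs (ContinuousAt.comp (f := fun a : Circle => (a : ℂ)) (g := Complex.arg)
        (Complex.continuousAt_arg (by simp [Complex.slitPlane]))
        continuous_subtype_val.continuousAt)
    exact h1.eventually_lt_const (by simpa using hδ)
  have hK : IsCompact (interior O)ᶜ := isOpen_interior.isClosed_compl.isCompact
  -- Outside a neighbourhood of 1 the group elements form a compact set, and each of them moves p;
  -- so they move all points near p out of a common neighbourhood.
  have h2 : ∀ᶠ z in 𝓝 (p, p), ∀ a ∈ (interior O)ᶜ, a • z.1 ≠ z.2 := by
    refine hK.eventually_forall_of_forall_eventually fun a ha => ?_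
    have hne : a • p ≠ p := fun h => by
      rw [hfree a p h] at ha
      exact ha (mem_interior_iff_mem_nhds.2 hO1)
    have hc : Continuous (fun z : (U × U) × Circle => (z.2 • z.1.1, z.1.2)) := by fun_prop
    exact hc.continuousAt.eventually (isClosed_diagonal.isOpen_compl.mem_nhds
      (show (a • p, p) ∈ (diagonal U)ᶜ from hne))
  rw [nhds_prod_eq, Filter.eventually_iff, Filter.mem_prod_same_iff] at h2
  obtain ⟨N, hN, h⟩ := h2
  refine ⟨N, hN, fun x hx a hax => ?_⟩
  by_contra hcon
  exact h (mk_mem_prod hx hax) a (fun hi => hcon (show a ∈ O from interior_subset hi)) rfl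

end Adapted

/-! ### Existence of adapted coordinates. -/

section AdaptedExistence

variable {d : ℕ} {M : Type*} [TopologicalSpace M] [ChartedSpace (EuclideanHalfSpace (d + 1)) M]
  [IsManifold (𝓡∂ (d + 1)) ∞ M]
  {U : TopologicalSpace.Opens M} [MulAction Circle U]
  [ContMDiffSMul (𝓡 1) (𝓡∂ (d + 1)) ∞ Circle U]

lemma mem_range_halfSpace_iff {v : EuclideanSpace ℝ (Fin (d + 1))} :
    v ∈ range (𝓡∂ (d + 1)) ↔ 0 ≤ v 0 := by
  rw [range_modelWithCornersEuclideanHalfSpace]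
  rfl

/-- Local data near a boundary point `p` that split a neighbourhood of `p` into a slice and an
orbit direction. -/
structure LocalSlice (p : U) (Y : Type) [NormedAddCommGroup Y] [NormedSpace ℝ Y] where
  D : Set U
  isOpen_D : IsOpen D
  mem_D : p ∈ D
  δ : ℝ
  δ_pos : 0 < δ
  τ : U → ℝ
  π : U → Y × ℝ
  O : Set (Y × ℝ)
  isOpen_O : IsOpen O
  zero_mem_O : 0 ∈ O
  sl : Y × ℝ → U
  sl_zero : sl 0 = p
  continuousOn_sl : ContinuousOn sl O
  contMDiffOn_sl : ContMDiffOn 𝓘(ℝ, Y × ℝ) (𝓡∂ (d + 1)) ∞ sl (O ∩ upperHalf Y)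
  contMDiffOn_τ : ContMDiffOn (𝓡∂ (d + 1)) 𝓘(ℝ, ℝ) ∞ τ D
  contMDiffOn_π : ContMDiffOn (𝓡∂ (d + 1)) 𝓘(ℝ, Y × ℝ) ∞ π D
  π_nonneg : ∀ x ∈ D, 0 ≤ (π x).2
  sl_π : ∀ x ∈ D, sl (π x) = (Circle.exp (τ x))⁻¹ • x
  τ_sl : ∀ q ∈ O ∩ upperHalf Y, sl q ∈ D → τ (sl q) = 0
  π_sl : ∀ q ∈ O ∩ upperHalf Y, sl q ∈ D → π (sl q) = q
  sl_injOn : InjOn sl (O ∩ upperHalf Y)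
  τ_unique : ∀ x ∈ D, ∀ q ∈ O ∩ upperHalf Y, ∀ s : ℝ, |s| < δ →
    (Circle.exp s)⁻¹ • x = sl q → s = τ x
  mem_boundary_iff : ∀ q ∈ O ∩ upperHalf Y,
    (sl q : M) ∈ (𝓡∂ (d + 1)).boundary M ↔ q.2 = 0
  sl_mem_source : ∀ q ∈ O ∩ upperHalf Y,
    (sl q : M) ∈ (chartAt (EuclideanHalfSpace (d + 1)) (p : M)).source

/-- In the chart at p the slice is the affine subspace ℓ = ℓ(φ p). The time τ(x) that moves a nearby
point x back to it solves ℓ(φ(exp(−iτ)·x) − φ p) = 0. The implicit function theorem over the half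
space applies since the τ-derivative at p is −ℓ ξ ≠ 0. -/
lemma nonempty_localSlice (hfree : ∀ (a : Circle) (x : U), a • x = x → a = 1)
    {Y : Type} [NormedAddCommGroup Y] [NormedSpace ℝ Y]
    [FiniteDimensional ℝ Y] (hY : Module.finrank ℝ Y + 1 = d) {p : U}
    (hp : (p : M) ∈ (𝓡∂ (d + 1)).boundary M) : Nonempty (LocalSlice (d := d) p Y) := by
  set I := 𝓡∂ (d + 1)
  set φ := extChartAt I p with hφ
  set C : Set (EuclideanSpace ℝ (Fin (d + 1))) := range I with hC
  set OE : Set (EuclideanSpace ℝ (Fin (d + 1))) :=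
    I.symm ⁻¹' (chartAt (EuclideanHalfSpace (d + 1)) p).target with hOE
  have hOEo : IsOpen OE := (chartAt _ p).open_target.preimage I.continuous_symm
  have htgt : φ.target = OE ∩ C := extChartAt_target I p
  have hφs : ContinuousOn φ.symm OE := by
    have : ContinuousOn ((chartAt (EuclideanHalfSpace (d + 1)) p).symm ∘ I.symm) OE :=
      (chartAt _ p).continuousOn_symm.comp I.continuous_symm.continuousOn (fun x hx => hx)
    exact this
  have hS : IsOpen φ.source := isOpen_extChartAt_source (I := I) p
  have hpS : p ∈ φ.source := mem_extChartAt_source p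
  have hps : φ.symm (φ p) = p := φ.left_inv hpS
  have hφC : ∀ x, φ x ∈ C := fun x => ⟨_, rfl⟩
  have hx0 : (φ p) 0 = 0 := (mem_boundary_iff_extChartAt p hpS).1 hp
  have hφpO : φ p ∈ OE := by
    have := φ.map_source hpS
    rw [htgt] at this
    exact this.1
  have hφd : ContMDiffOn I 𝓘(ℝ, EuclideanSpace ℝ (Fin (d + 1))) ∞ φ φ.source := by
    rw [hφ, extChartAt_source]
    exact contMDiffOn_extChartAt
  have hφsd : ContMDiffOn 𝓘(ℝ, EuclideanSpace ℝ (Fin (d + 1))) I ∞ φ.symm (OE ∩ C) := by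
    rw [← htgt]
    exact contMDiffOn_extChartAt_symm p
  have hsm : ContMDiff ((𝓡 1).prod I) I ∞ (fun z : Circle × U => z.1 • z.2) :=
    ContMDiffSMul.contMDiff_smul
  -- the generator of the action in the chart
  set κ : ℝ → EuclideanSpace ℝ (Fin (d + 1)) := fun τ => φ (Circle.exp τ • p) with hκ
  have hκ0 : κ 0 = φ p := by simp [hκ]
  have hγ0 : Circle.exp 0 • p ∈ φ.source := by simpa using hpS
  have hκd : HasDerivAt κ (deriv κ 0) 0 := by
    apply DifferentiableAt.hasDerivAt
    have h1 : ContMDiffAt 𝓘(ℝ, ℝ) 𝓘(ℝ, EuclideanSpace ℝ (Fin (d + 1))) ∞ κ 0 :=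
      ContMDiffAt.comp (g := φ) (0 : ℝ) (hφd.contMDiffAt (hS.mem_nhds hγ0)) (contMDiff_orbit d p 0)
    exact (contMDiffAt_iff_contDiffAt.1 h1).differentiableAt (by simp)
  have hξ : deriv κ 0 ≠ 0 := orbit_deriv_ne_zero hfree p
  -- The orbit of a boundary point stays in the boundary, so its velocity has no normal component.
  have hξ0 : (deriv κ 0) 0 = 0 := by
    have h1 : HasDerivAt (fun τ => κ τ 0) ((deriv κ 0) 0) 0 :=
      (EuclideanSpace.proj (𝕜 := ℝ) (0 : Fin (d + 1))).hasFDerivAt.comp_hasDerivAt 0 hκd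
    have h2 : ∀ᶠ τ in 𝓝 (0 : ℝ), κ τ 0 = 0 := by
      filter_upwards [(contMDiff_orbit d p).continuous.continuousAt.eventually
        (hS.mem_nhds hγ0)] with τ hτ
      exact (mem_boundary_iff_extChartAt p hτ).1 ((smul_mem_boundary_iff _ _).2 hp)
    exact h1.unique ((hasDerivAt_const (0 : ℝ) (0 : ℝ)).congr_of_eventuallyEq h2)
  obtain ⟨Λ, P, ℓ, hPΛ, hℓΛ, hΛP, hΛ0, hP2, hℓξ⟩ := exists_slice_splitting hY hξ hξ0
  -- the implicit function
  set G : EuclideanSpace ℝ (Fin (d + 1)) × ℝ → U := fun z => (Circle.exp z.2)⁻¹ • φ.symm z.1 with hG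
  have hexp : ContMDiff 𝓘(ℝ, ℝ) (𝓡 1) ∞ (fun s : ℝ => (Circle.exp s)⁻¹) :=
    contMDiff_circleExp.inv
  have hcs := continuousSMul_circle d U
  have hGc : ContinuousOn G (OE ×ˢ univ) := by
    have h1 : ContinuousOn (fun z : EuclideanSpace ℝ (Fin (d + 1)) × ℝ => φ.symm z.1)
      (OE ×ˢ univ) := hφs.comp continuous_fst.continuousOn (fun z hz => hz.1)
    exact ((Circle.exp.continuous.comp continuous_snd).inv.continuousOn).smul h1
  set O := (OE ×ˢ (univ : Set ℝ)) ∩ G ⁻¹' φ.source with hO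
  have hOo : IsOpen O := hGc.isOpen_inter_preimage (hOEo.prod isOpen_univ) hS
  set g : EuclideanSpace ℝ (Fin (d + 1)) × ℝ → ℝ := fun z => ℓ (φ (G z) - φ p) with hg
  have hpO : (φ p, (0 : ℝ)) ∈ O := ⟨⟨hφpO, mem_univ _⟩, by
    simpa [hG, hps] using hpS⟩
  have hgd : ContDiffOn ℝ ∞ g (O ∩ C ×ˢ univ) := by
    have h1 : ContMDiffOn 𝓘(ℝ, EuclideanSpace ℝ (Fin (d + 1)) × ℝ) I ∞ G
        (O ∩ C ×ˢ univ) := by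
      have h2 : ContMDiffOn 𝓘(ℝ, EuclideanSpace ℝ (Fin (d + 1)) × ℝ) I ∞
          (fun z : EuclideanSpace ℝ (Fin (d + 1)) × ℝ => φ.symm z.1) (O ∩ C ×ˢ univ) :=
        hφsd.comp contDiff_fst.contMDiff.contMDiffOn (fun z hz => ⟨hz.1.1.1, hz.2.1⟩)
      exact hsm.comp_contMDiffOn ((hexp.comp contDiff_snd.contMDiff).contMDiffOn.prodMk h2)
    have h2 := hφd.comp h1 (fun z hz => hz.1.2)
    have h3 := contMDiffOn_iff_contDiffOn.1 h2
    exact ℓ.contDiff.comp_contDiffOn (h3.sub contDiffOn_const)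
  have hg0 : g (φ p, 0) = 0 := by simp [hg, hG, hps]
  have hgτ : HasDerivAt (fun τ => g (φ p, τ)) (-ℓ (deriv κ 0)) 0 := by
    have h1 : HasDerivAt (fun τ : ℝ => κ (-τ)) (-deriv κ 0) 0 := by
      have h2 : HasDerivAt κ (deriv κ 0) (-0) := by simpa using hκd
      have h3 := h2.scomp 0 (hasDerivAt_neg (0 : ℝ))
      rw [neg_smul, one_smul] at h3
      exact h3
    have h3 := ℓ.hasFDerivAt.comp_hasDerivAt 0 (h1.sub_const (φ p))
    rw [map_neg] at h3
    refine h3.congr_of_eventuallyEq (Filter.Eventually.of_forall fun τ => ?_)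
    simp [hg, hG, hps, hκ, Circle.exp_neg]
  obtain ⟨δ, hδ, N, hN, hpN, hNO, T, hT, hTs⟩ := exists_implicit_scalar
    (C := C) I.uniqueDiffOn (hφC p) hOo hpO hgd hg0 hgτ (neg_ne_zero.2 hℓξ)
  set D := φ.source ∩ φ ⁻¹' N with hD
  have hφc : ContinuousOn φ φ.source := continuousOn_extChartAt p
  have hDo : IsOpen D := hφc.isOpen_inter_preimage hS hN
  set τ : U → ℝ := fun x => T (φ x) with hτ
  set π : U → Y × ℝ := fun x => P (φ ((Circle.exp (τ x))⁻¹ • x) - φ p) with hπ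
  set sl : Y × ℝ → U := fun q => φ.symm (φ p + Λ q) with hsl
  have hGφ : ∀ x ∈ φ.source, ∀ s, G (φ x, s) = (Circle.exp s)⁻¹ • x := fun x hx s => by
    simp [hG, φ.left_inv hx]
  have hDS : ∀ x ∈ D, (Circle.exp (τ x))⁻¹ • x ∈ φ.source := fun x hx => by
    have := (hNO (mk_mem_prod hx.2 (hTs (φ x) ⟨hx.2, hφC x⟩).1)).2
    rwa [mem_preimage, hGφ x hx.1] at this
  have hΛπ : ∀ x ∈ D, Λ (π x) = φ ((Circle.exp (τ x))⁻¹ • x) - φ p := fun x hx => by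
    apply hΛP
    have := (hTs (φ x) ⟨hx.2, hφC x⟩).2.1
    change ℓ (φ (G (φ x, τ x)) - φ p) = 0 at this
    rwa [hGφ x hx.1] at this
  have hτd : ContMDiffOn I 𝓘(ℝ, ℝ) ∞ τ D :=
    (contMDiffOn_iff_contDiffOn.2 hT).comp (hφd.mono inter_subset_left)
      (fun x hx => ⟨hx.2, hφC x⟩)
  have hsub : ∀ q ∈ ((fun q => φ p + Λ q) ⁻¹' OE) ∩ upperHalf Y, φ p + Λ q ∈ φ.target := by
    rintro q ⟨hq, hq2⟩
    rw [htgt]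
    refine ⟨hq, mem_range_halfSpace_iff.2 ?_⟩
    rw [PiLp.add_apply, hx0, zero_add, hΛ0]
    exact hq2
  have hΛc : Continuous (fun q => φ p + Λ q) := by fun_prop
  have hτsl : ∀ q ∈ ((fun q => φ p + Λ q) ⁻¹' OE) ∩ upperHalf Y, sl q ∈ D → τ (sl q) = 0 := by
    intro q hq hqD
    have h1 : φ (sl q) = φ p + Λ q := φ.right_inv (hsub q hq)
    refine ((hTs (φ (sl q)) ⟨hqD.2, hφC _⟩).2.2 0 ⟨by linarith, hδ⟩ ?_).symm
    change ℓ (φ (G (φ (sl q), 0)) - φ p) = 0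
    rw [hGφ _ hqD.1]
    simp [h1, hℓΛ]
  refine ⟨⟨D, hDo, ⟨hpS, hpN⟩, δ, hδ, τ, π, (fun q => φ p + Λ q) ⁻¹' OE, hOEo.preimage hΛc,
    by simpa using hφpO, sl, by simpa [hsl] using hps, hφs.comp hΛc.continuousOn (fun q hq => hq),
    ?_, hτd, ?_, ?_, ?_, ?_, ?_, ?_, ?_, ?_, ?_⟩⟩
  · refine hφsd.comp (ContDiff.contMDiff ?_).contMDiffOn (fun q hq => htgt ▸ hsub q hq)
    exact contDiff_const.add Λ.contDiff
  · have h1 : ContMDiffOn I I ∞ (fun x => (Circle.exp (τ x))⁻¹ • x) D :=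
      hsm.comp_contMDiffOn ((hexp.comp_contMDiffOn hτd).prodMk contMDiffOn_id)
    have h2 := hφd.comp h1 hDS
    have h3 : ContDiff ℝ ∞ (fun v => P (v - φ p)) := P.contDiff.comp (contDiff_id.sub contDiff_const)
    exact h3.contMDiff.comp_contMDiffOn h2
  · intro x hx
    change 0 ≤ (P _).2
    rw [hP2, PiLp.sub_apply, hx0, sub_zero]
    exact extChartAt_zero_nonneg p _
  · intro x hx
    change φ.symm (φ p + Λ (π x)) = _
    rw [hΛπ x hx, add_sub_cancel]
    exact φ.left_inv (hDS x hx)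
  · exact hτsl
  · intro q hq hqD
    have h1 : φ (sl q) = φ p + Λ q := φ.right_inv (hsub q hq)
    change P (φ ((Circle.exp (τ (sl q)))⁻¹ • sl q) - φ p) = q
    rw [hτsl q hq hqD, Circle.exp_zero, inv_one, one_smul, h1, add_sub_cancel_left, hPΛ]
  · intro q hq q' hq' h
    have h1 := φ.symm.injOn (hsub q hq) (hsub q' hq') h
    rw [← hPΛ q, ← hPΛ q', add_left_cancel h1]
  · intro x hx q hq s hs h
    refine (hTs (φ x) ⟨hx.2, hφC x⟩).2.2 s (abs_lt.1 hs) ?_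
    change ℓ (φ (G (φ x, s)) - φ p) = 0
    rw [hGφ _ hx.1, h]
    have h1 : φ (sl q) = φ p + Λ q := φ.right_inv (hsub q hq)
    simp [h1, hℓΛ]
  · intro q hq
    have h1 : φ (sl q) = φ p + Λ q := φ.right_inv (hsub q hq)
    rw [mem_boundary_iff_extChartAt p (φ.map_target (hsub q hq)), h1, PiLp.add_apply, hx0,
      zero_add, hΛ0]
  · intro q hq
    have h1 : sl q ∈ φ.source := φ.map_target (hsub q hq)
    rw [hφ, extChartAt_source, TopologicalSpace.Opens.chartAt_eq,
      OpenPartialHomeomorph.subtypeRestr_source] at h1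
    exact h1

lemma circle_exp_arg (a : Circle) : Circle.exp (Complex.arg a) = a := by
  ext
  rw [Circle.coe_exp]
  have := Complex.norm_mul_exp_arg_mul_I (a : ℂ)
  rwa [Circle.norm_coe, Complex.ofReal_one, one_mul] at this

/-- Adapted coordinates exist near every boundary point. -/
theorem nonempty_adaptedChart [T2Space M] (hfree : ∀ (a : Circle) (x : U), a • x = x → a = 1)
    {Y : Type} [NormedAddCommGroup Y] [NormedSpace ℝ Y]
    [FiniteDimensional ℝ Y] (hY : Module.finrank ℝ Y + 1 = d) {p : U}
    (hp : (p : M) ∈ (𝓡∂ (d + 1)).boundary M) {V : Set U} (hV : IsOpen V)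
    (hVi : ∀ a : Circle, ∀ x ∈ V, a • x ∈ V) (hpV : p ∈ V) :
    Nonempty (AdaptedChart d U Y V p) := by
  obtain ⟨L⟩ := nonempty_localSlice hfree hY hp
  have hcs := continuousSMul_circle d U
  obtain ⟨N, hN, hNδ⟩ := exists_nhds_abs_arg_lt hfree p L.δ_pos
  obtain ⟨r, hr, hball⟩ : ∃ r > 0, ∀ q ∈ Metric.ball (0 : Y × ℝ) r,
      q ∈ L.O ∧ L.sl q ∈ N ∩ L.D ∩ V := by
    have h1 : ∀ᶠ q in 𝓝 (0 : Y × ℝ), L.sl q ∈ N ∩ L.D ∩ V := by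
      refine (L.continuousOn_sl.continuousAt (L.isOpen_O.mem_nhds L.zero_mem_O)).eventually ?_
      rw [L.sl_zero]
      exact Filter.inter_mem (Filter.inter_mem hN (L.isOpen_D.mem_nhds L.mem_D)) (hV.mem_nhds hpV)
    obtain ⟨r, hr, h⟩ := Metric.eventually_nhds_iff_ball.1
      ((L.isOpen_O.eventually_mem L.zero_mem_O).and h1)
    exact ⟨r, hr, h⟩
  have hbO : ∀ q ∈ halfBall Y r, q ∈ L.O ∩ upperHalf Y := fun q hq => ⟨(hball q hq.1).1, hq.2⟩
  have hbD : ∀ q ∈ halfBall Y r, L.sl q ∈ L.D := fun q hq => (hball q hq.1).2.1.2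
  -- uniqueness of the decomposition
  have hinj : ∀ a : Circle, ∀ q ∈ halfBall Y r, ∀ q' ∈ halfBall Y r, a • L.sl q = L.sl q' →
      a = 1 ∧ q = q' := by
    intro a q hq q' hq' h
    have h1 : |Complex.arg a| < L.δ := hNδ _ (hball q hq.1).2.1.1 a (h ▸ (hball q' hq'.1).2.1.1)
    have h2 := L.τ_unique _ (hbD q' hq') q (hbO q hq) _ h1 (by
      rw [circle_exp_arg, ← h, inv_smul_smul])
    rw [L.τ_sl q' (hbO q' hq') (hbD q' hq')] at h2
    have h3 : a = 1 := by rw [← circle_exp_arg a, h2, Circle.exp_zero]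
    refine ⟨h3, L.sl_injOn (hbO q hq) (hbO q' hq') ?_⟩
    rw [← h, h3, one_smul]
  set W : Set U := {x | ∃ z : Circle × (Y × ℝ), z.2 ∈ halfBall Y r ∧ z.1 • L.sl z.2 = x} with hW
  have hex : ∀ x : U, ∃ z : Circle × (Y × ℝ), x ∈ W → z.2 ∈ halfBall Y r ∧ z.1 • L.sl z.2 = x :=
    fun x => by
      by_cases hx : x ∈ W
      · obtain ⟨z, hz⟩ := hx
        exact ⟨z, fun _ => hz⟩
      · exact ⟨(1, 0), fun h => (hx h).elim⟩
  choose co hco using hex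
  have hmk : ∀ a : Circle, ∀ q ∈ halfBall Y r, a • L.sl q ∈ W := fun a q hq => ⟨(a, q), hq, rfl⟩
  have hcomk : ∀ a : Circle, ∀ q ∈ halfBall Y r, co (a • L.sl q) = (a, q) := by
    intro a q hq
    obtain ⟨h1, h2⟩ := hco _ (hmk a q hq)
    obtain ⟨h3, h4⟩ := hinj (a⁻¹ * (co (a • L.sl q)).1) _ h1 q hq (by
      rw [mul_smul, h2, inv_smul_smul])
    exact Prod.ext (inv_mul_eq_one.1 h3).symm h4
  -- the local description of the coordinates
  set D₁ := L.D ∩ L.π ⁻¹' Metric.ball 0 r with hD₁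
  have hD₁o : IsOpen D₁ := L.contMDiffOn_π.continuousOn.isOpen_inter_preimage L.isOpen_D
    Metric.isOpen_ball
  -- After rotation by `a⁻¹` the global coordinates are given by the local slice data. This yields
  -- openness of W and smoothness of the coordinates along entire orbits.
  have hloc : ∀ a : Circle, ∀ x : U, a⁻¹ • x ∈ D₁ → x ∈ W ∧
      co x = (a * Circle.exp (L.τ (a⁻¹ • x)), L.π (a⁻¹ • x)) := by
    intro a x hx
    have h1 : L.π (a⁻¹ • x) ∈ halfBall Y r := ⟨hx.2, L.π_nonneg _ hx.1⟩
    have h2 : (a * Circle.exp (L.τ (a⁻¹ • x))) • L.sl (L.π (a⁻¹ • x)) = x := by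
      rw [L.sl_π _ hx.1, mul_smul, smul_inv_smul, smul_inv_smul]
    have h3 := hcomk (a * Circle.exp (L.τ (a⁻¹ • x))) _ h1
    have h4 := hmk (a * Circle.exp (L.τ (a⁻¹ • x))) _ h1
    rw [h2] at h3 h4
    exact ⟨h4, h3⟩
  have hπsl : ∀ q ∈ halfBall Y r, L.π (L.sl q) = q := by
    intro q hq
    exact L.π_sl q (hbO q hq) (hbD q hq)
  have hmem : ∀ x ∈ W, (co x).1⁻¹ • x ∈ D₁ := by
    intro x hx
    obtain ⟨h1, h2⟩ := hco x hx
    have h3 : (co x).1⁻¹ • x = L.sl (co x).2 := by rw [inv_smul_eq_iff, h2]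
    rw [h3]
    refine ⟨hbD _ h1, ?_⟩
    rw [mem_preimage, hπsl _ h1]
    exact h1.1
  have hnear : ∀ x ∈ W, {z : U | (co x).1⁻¹ • z ∈ D₁} ∈ 𝓝 x := fun x hx =>
    (hD₁o.preimage (continuous_const_smul _)).mem_nhds (hmem x hx)
  have hsm : ContMDiff ((𝓡 1).prod (𝓡∂ (d + 1))) (𝓡∂ (d + 1)) ∞
    (fun z : Circle × U => z.1 • z.2) := ContMDiffSMul.contMDiff_smul
  refine ⟨⟨r, hr, W, fun x => (co x).1, fun x => (co x).2, L.sl, ?_, ?_, ?_, L.sl_zero, ?_,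
    fun x hx => (hco x hx).1, ?_, ?_, ?_, ?_, fun x hx => (hco x hx).2, ?_,
    L.contMDiffOn_sl.mono hbO, ?_, ?_, fun q hq => L.sl_mem_source q (hbO q hq),
    ContinuousLinearEquiv.ofFinrankEq ?_, ContinuousLinearEquiv.ofFinrankEq ?_⟩⟩
  · rintro x ⟨z, hz, rfl⟩
    exact hVi _ _ (hball _ hz.1).2.2
  · exact isOpen_iff_mem_nhds.2 fun x hx =>
      Filter.mem_of_superset (hnear x hx) fun z hz => (hloc _ z hz).1
  · rintro a x ⟨z, hz, rfl⟩
    exact ⟨(a * z.1, z.2), hz, mul_smul _ _ _⟩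
  · intro q hq
    simpa using hmk 1 q hq
  · rintro a x ⟨z, hz, rfl⟩
    simp only [smul_smul, hcomk _ _ hz]
  · rintro a x ⟨z, hz, rfl⟩
    simp only [smul_smul, hcomk _ _ hz]
  · intro q hq
    simpa using congrArg Prod.fst (hcomk 1 q hq)
  · intro q hq
    simpa using congrArg Prod.snd (hcomk 1 q hq)
  · rintro x ⟨z, hz, rfl⟩
    simp only [hcomk _ _ hz]
    rw [smul_mem_boundary_iff]
    exact L.mem_boundary_iff _ (hbO _ hz)
  · intro x hx
    have h1 : ContMDiffAt (𝓡∂ (d + 1)) (𝓡 1) ∞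
        (fun z => (co x).1 * Circle.exp (L.τ ((co x).1⁻¹ • z))) x := by
      refine contMDiffAt_const.mul (contMDiff_circleExp.contMDiffAt.comp x ?_)
      exact (L.contMDiffOn_τ.contMDiffAt (L.isOpen_D.mem_nhds (hmem x hx).1)).comp x
        (contMDiff_smul_left _).contMDiffAt
    refine (h1.congr_of_eventuallyEq ?_).contMDiffWithinAt
    filter_upwards [hnear x hx] with z hz
    rw [(hloc _ z hz).2]
  · intro x hx
    have h1 : ContMDiffAt (𝓡∂ (d + 1)) 𝓘(ℝ, Y × ℝ) ∞
        (fun z => L.π ((co x).1⁻¹ • z)) x :=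
      (L.contMDiffOn_π.contMDiffAt (L.isOpen_D.mem_nhds (hmem x hx).1)).comp x
        (contMDiff_smul_left _).contMDiffAt
    refine (h1.congr_of_eventuallyEq ?_).contMDiffWithinAt
    filter_upwards [hnear x hx] with z hz
    rw [(hloc _ z hz).2]
  · simp only [finrank_euclideanSpace, Fintype.card_fin, Module.finrank_prod,
      Complex.finrank_real_complex]
    omega
  · simp only [finrank_euclideanSpace, Fintype.card_fin, Module.finrank_prod,
      Module.finrank_self]
    omega

end AdaptedExistence


/-! ### Charts on quotient spaces. -/

section ChartConstruction

/-- The chart of a quotient space induced by a function `κ` on a saturated open subset `W` of the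
total space. -/
def quotChart {M X E : Type*} [TopologicalSpace M] [TopologicalSpace X] [TopologicalSpace E]
    {c : M → X} (hc : IsQuotientMap c) {W : Set M} (hW : IsOpen W)
    (hWs : ∀ x ∈ W, ∀ x', c x = c x' → x' ∈ W) {κ : M → E} (hκ : ContinuousOn κ W)
    (hκc : ∀ x ∈ W, ∀ x', c x = c x' → κ x = κ x') {T : Set E} (hT : IsOpen T) {σ : E → X}
    (hσ : ContinuousOn σ T) (hκT : ∀ x ∈ W, κ x ∈ T) (hσκ : ∀ x ∈ W, σ (κ x) = c x)
    (hκσ : ∀ v ∈ T, ∃ x ∈ W, c x = σ v ∧ κ x = v) : OpenPartialHomeomorph X E where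
  -- Any preimage would do, since κ is constant on the fibres that meet W.
  toFun z := κ (surjInv hc.surjective z)
  invFun := σ
  source := c '' W
  target := T
  map_source' := by
    rintro _ ⟨x, hx, rfl⟩
    exact hκT _ (hWs x hx _ (surjInv_eq hc.surjective _).symm)
  map_target' v hv := by
    obtain ⟨x, hx, h, -⟩ := hκσ v hv
    exact ⟨x, hx, h⟩
  left_inv' := by
    rintro _ ⟨x, hx, rfl⟩
    rw [hσκ _ (hWs x hx _ (surjInv_eq hc.surjective _).symm)]
    exact surjInv_eq hc.surjective _
  right_inv' v hv := by
    obtain ⟨x, hx, h, h'⟩ := hκσ v hv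
    rw [← hκc x hx _ (h.trans (surjInv_eq hc.surjective _).symm), h']
  open_source := by
    rw [← hc.isOpen_preimage]
    convert hW
    exact Subset.antisymm (fun x ⟨y, hy, h⟩ => hWs y hy x h) (subset_preimage_image c W)
  open_target := hT
  continuousOn_toFun := by
    have hpre : c ⁻¹' (c '' W) = W :=
      Subset.antisymm (fun x ⟨y, hy, h⟩ => hWs y hy x h) (subset_preimage_image c W)
    rw [hc.continuousOn_isOpen_iff (by rw [← hc.isOpen_preimage, hpre]; exact hW), hpre]
    exact hκ.congr fun x hx => (hκc x hx _ (surjInv_eq hc.surjective _).symm).symm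
  continuousOn_invFun := hσ

lemma quotChart_apply {M X E : Type*} [TopologicalSpace M] [TopologicalSpace X]
    [TopologicalSpace E]
    {c : M → X} (hc : IsQuotientMap c) {W : Set M} (hW : IsOpen W)
    (hWs : ∀ x ∈ W, ∀ x', c x = c x' → x' ∈ W) {κ : M → E} (hκ : ContinuousOn κ W)
    (hκc : ∀ x ∈ W, ∀ x', c x = c x' → κ x = κ x') {T : Set E} (hT : IsOpen T) {σ : E → X}
    (hσ : ContinuousOn σ T) (hκT : ∀ x ∈ W, κ x ∈ T) (hσκ : ∀ x ∈ W, σ (κ x) = c x)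
    (hκσ : ∀ v ∈ T, ∃ x ∈ W, c x = σ v ∧ κ x = v) {x : M} (hx : x ∈ W) :
    quotChart hc hW hWs hκ hκc hT hσ hκT hσκ hκσ (c x) = κ x :=
  (hκc x hx _ (surjInv_eq hc.surjective _).symm).symm

/-- The charted space structure given by a chart around each point. -/
abbrev chartedSpaceOfFamily {X E : Type*} [TopologicalSpace X] [TopologicalSpace E]
    (φ : X → OpenPartialHomeomorph X E) (hφ : ∀ x, x ∈ (φ x).source) : ChartedSpace E X where
  atlas := range φ
  chartAt := φ
  mem_chart_source := hφ
  chart_mem_atlas x := ⟨x, rfl⟩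

lemma isManifold_chartedSpaceOfFamily {X E : Type*} [TopologicalSpace X] [NormedAddCommGroup E]
    [NormedSpace ℝ E] (φ : X → OpenPartialHomeomorph X E) (hφ : ∀ x, x ∈ (φ x).source)
    (h : ∀ x y, ∀ v ∈ (φ x).target, (φ x).symm v ∈ (φ y).source →
      ContDiffAt ℝ ∞ (fun v => φ y ((φ x).symm v)) v) :
    @IsManifold ℝ _ E _ _ E _ 𝓘(ℝ, E) ∞ X _ (chartedSpaceOfFamily φ hφ) := by
  let _ := chartedSpaceOfFamily φ hφ
  refine isManifold_of_contDiffOn _ _ _ ?_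
  rintro _ _ ⟨x, rfl⟩ ⟨y, rfl⟩
  simp only [modelWithCornersSelf_coe, modelWithCornersSelf_coe_symm, range_id, inter_univ,
    preimage_id_eq, id_eq, Function.comp_id, Function.id_comp]
  intro v hv
  rw [OpenPartialHomeomorph.trans_source, OpenPartialHomeomorph.symm_source] at hv
  exact (h x y v hv.1 hv.2).contDiffWithinAt

end ChartConstruction

/-! ### The direction of a complex number. -/

section CircleUnit

/-- The point of the unit circle in the direction of a complex number. -/
def circleUnit (w : ℂ) : Circle := Circle.exp (Complex.arg w)

lemma norm_mul_circleUnit (w : ℂ) : (‖w‖ : ℂ) * circleUnit w = w := by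
  rw [circleUnit, Circle.coe_exp]
  exact Complex.norm_mul_exp_arg_mul_I w

@[simp] lemma circleUnit_zero : circleUnit 0 = 1 := by simp [circleUnit]

lemma circleUnit_ofReal_mul {t : ℝ} (ht : 0 < t) (a : Circle) : circleUnit (t * a) = a := by
  rw [circleUnit, Complex.arg_real_mul _ ht, circle_exp_arg]

lemma circleUnit_mul (a : Circle) {w : ℂ} (hw : w ≠ 0) : circleUnit (a * w) = a * circleUnit w := by
  conv_lhs => rw [← norm_mul_circleUnit w]
  rw [mul_left_comm, ← Circle.coe_mul, circleUnit_ofReal_mul (norm_pos_iff.2 hw)]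

lemma contDiffAt_arg {w : ℂ} (hw : w ∈ Complex.slitPlane) : ContDiffAt ℝ ∞ Complex.arg w := by
  have h1 : ContDiffAt ℝ ∞ Complex.log w := (Complex.contDiffAt_log hw).restrict_scalars ℝ
  have h2 := Complex.imCLM.contDiff.contDiffAt.comp w h1
  exact h2.congr_of_eventuallyEq (Filter.Eventually.of_forall fun z => (Complex.log_im z).symm)

/-- The argument is smooth only off the negative real axis, so it is taken of `w⁻¹ * z`, which is
near 1, and the rotation is undone by multiplication in the circle. -/
lemma contMDiffAt_circleUnit {w : ℂ} (hw : w ≠ 0) :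
    ContMDiffAt 𝓘(ℝ, ℂ) (𝓡 1) ∞ circleUnit w := by
  have h1 : ContDiffAt ℝ ∞ (fun z : ℂ => Complex.arg (w⁻¹ * z)) w := by
    refine (contDiffAt_arg ?_).comp w (contDiffAt_const.mul contDiffAt_id)
    simp [hw]
  have h2 : ContMDiffAt 𝓘(ℝ, ℂ) (𝓡 1) ∞
      (fun z : ℂ => circleUnit w * Circle.exp (Complex.arg (w⁻¹ * z))) w :=
    contMDiffAt_const.mul (contMDiff_circleExp.contMDiffAt.comp w h1.contMDiffAt)
  refine h2.congr_of_eventuallyEq ?_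
  filter_upwards [isOpen_ne.mem_nhds hw] with z hz
  have h3 : z = ‖w‖ * (circleUnit w * (w⁻¹ * z)) := by
    rw [← mul_assoc, norm_mul_circleUnit, mul_inv_cancel_left₀ hw]
  conv_lhs => rw [h3]
  rw [circleUnit, Complex.arg_real_mul _ (norm_pos_iff.2 hw)]
  exact circleUnit_mul _ (mul_ne_zero (inv_ne_zero hw) hz)

lemma contMDiff_circle_coe : ContMDiff (𝓡 1) 𝓘(ℝ, ℂ) ∞ (fun a : Circle => (a : ℂ)) :=
  have : Fact (Module.finrank ℝ ℂ = 1 + 1) := finrank_real_complex_fact'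
  contMDiff_coe_sphere

end CircleUnit


/-! ### Polar coordinates: charts of the cut space near the reduced space. -/

section AdaptedCharts

variable {d : ℕ} {M : Type*} [TopologicalSpace M] [ChartedSpace (EuclideanHalfSpace (d + 1)) M]
  [IsManifold (𝓡∂ (d + 1)) ∞ M]
  {U : TopologicalSpace.Opens M} [MulAction Circle U]
  [ContMDiffSMul (𝓡 1) (𝓡∂ (d + 1)) ∞ Circle U]
  {Y : Type} [NormedAddCommGroup Y] [NormedSpace ℝ Y]

lemma cutMap_coe_eq_iff {x : U} {x' : M} : cutMap d U x = cutMap d U x' ↔ (x : M) = x' ∨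
    ((x : M) ∈ (𝓡∂ (d + 1)).boundary M ∧ ∃ a : Circle, ((a • x : U) : M) = x') := by
  constructor
  · intro h
    rcases cutMap_eq_iff.1 h with h | ⟨hx, -, x₁, x₂, h1, h2, a, h3⟩
    · exact Or.inl h
    · obtain rfl : x₁ = x := Subtype.ext h1
      exact Or.inr ⟨hx, a, by rw [h3, h2]⟩
  · rintro (h | ⟨hx, a, h⟩)
    · rw [h]
    · rw [← h, cutMap_smul_of_mem hx]

lemma mem_halfBall_zero_iff {r : ℝ} {y : Y} : (y, (0 : ℝ)) ∈ halfBall Y r ↔ ‖y‖ < r := by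
  simp [halfBall, upperHalf, Prod.norm_def]

lemma contMDiffAt_extend {F : Type*} [NormedAddCommGroup F] [NormedSpace ℝ F] {g : U → F} {x : U}
    (h : ContMDiffAt (𝓡∂ (d + 1)) 𝓘(ℝ, F) ∞ g x) :
    ContMDiffAt (𝓡∂ (d + 1)) 𝓘(ℝ, F) ∞ (extend Subtype.val g 0 : M → F) (x : M) := by
  rw [← contMDiffAt_subtype_iff (U := U)]
  have : (fun x : U => extend Subtype.val g (0 : M → F) (x : M)) = g :=
    funext fun x => Subtype.val_injective.extend_apply g 0 x
  rwa [this]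

namespace AdaptedChart

variable {V : Set U} {p : U} (A : AdaptedChart d U Y V p)

/-- The polar coordinate map of an adapted chart. -/
def polar (v : Y × ℂ) : U := circleUnit v.2 • A.slice (v.1, ‖v.2‖ ^ 2)

/-- The domain of the polar coordinate map. -/
def polarDom : Set (Y × ℂ) := {v | (v.1, ‖v.2‖ ^ 2) ∈ Metric.ball (0 : Y × ℝ) A.r}

/-- The inverse of the polar coordinate map. -/
def cutCoord (x : U) : Y × ℂ := ((A.pr x).1, (√(A.pr x).2 : ℝ) * A.ang x)

lemma isOpen_polarDom : IsOpen A.polarDom :=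
  Metric.isOpen_ball.preimage (f := fun v : Y × ℂ => (v.1, ‖v.2‖ ^ 2)) (by fun_prop)

lemma sq_mem_halfBall {v : Y × ℂ} (hv : v ∈ A.polarDom) : (v.1, ‖v.2‖ ^ 2) ∈ halfBall Y A.r :=
  ⟨hv, show 0 ≤ ‖v.2‖ ^ 2 from sq_nonneg _⟩

lemma polar_mem {v : Y × ℂ} (hv : v ∈ A.polarDom) : A.polar v ∈ A.dom :=
  A.smul_mem _ _ (A.slice_mem _ (A.sq_mem_halfBall hv))

lemma pr_polar {v : Y × ℂ} (hv : v ∈ A.polarDom) : A.pr (A.polar v) = (v.1, ‖v.2‖ ^ 2) := by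
  have h := A.sq_mem_halfBall hv
  rw [polar, A.pr_smul _ _ (A.slice_mem _ h), A.pr_slice _ h]

lemma ang_polar {v : Y × ℂ} (hv : v ∈ A.polarDom) : A.ang (A.polar v) = circleUnit v.2 := by
  have h := A.sq_mem_halfBall hv
  rw [polar, A.ang_smul _ _ (A.slice_mem _ h), A.ang_slice _ h, mul_one]

lemma cutCoord_polar {v : Y × ℂ} (hv : v ∈ A.polarDom) : A.cutCoord (A.polar v) = v := by
  rw [cutCoord, A.pr_polar hv, A.ang_polar hv, Real.sqrt_sq (norm_nonneg _), norm_mul_circleUnit]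

lemma pr_snd_nonneg {x : U} (hx : x ∈ A.dom) : 0 ≤ (A.pr x).2 := (A.pr_mem x hx).2

lemma norm_cutCoord_sq {x : U} (hx : x ∈ A.dom) : ‖(A.cutCoord x).2‖ ^ 2 = (A.pr x).2 := by
  rw [cutCoord, norm_mul, Circle.norm_coe, mul_one, Complex.norm_real,
    Real.norm_of_nonneg (Real.sqrt_nonneg _), Real.sq_sqrt (A.pr_snd_nonneg hx)]

lemma cutCoord_mem {x : U} (hx : x ∈ A.dom) : A.cutCoord x ∈ A.polarDom := by
  rw [polarDom, mem_ofPred_eq, A.norm_cutCoord_sq hx]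
  exact (A.pr_mem x hx).1

lemma polar_cutCoord_of_pos {x : U} (hx : x ∈ A.dom) (h : 0 < (A.pr x).2) :
    A.polar (A.cutCoord x) = x := by
  rw [polar, A.norm_cutCoord_sq hx, cutCoord]
  rw [circleUnit_ofReal_mul (Real.sqrt_pos.2 h)]
  exact A.ang_smul_slice x hx

lemma pr_pos_iff {x : U} (hx : x ∈ A.dom) :
    0 < (A.pr x).2 ↔ (x : M) ∉ (𝓡∂ (d + 1)).boundary M := by
  rw [A.mem_boundary_iff x hx, (A.pr_snd_nonneg hx).lt_iff_ne, ne_comm]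

/-- On the boundary the coordinate w = 0 forgets the angle. Then `polar` returns the slice point of
the same orbit, which the cut map does not distinguish from x. -/
lemma cutMap_polar_cutCoord {x : U} (hx : x ∈ A.dom) :
    cutMap d U (A.polar (A.cutCoord x)) = cutMap d U x := by
  by_cases hb : (x : M) ∈ (𝓡∂ (d + 1)).boundary M
  · have h0 := (A.mem_boundary_iff x hx).1 hb
    have h1 : A.polar (A.cutCoord x) = (A.ang x)⁻¹ • x := by
      rw [polar, A.norm_cutCoord_sq hx, cutCoord, h0]
      simp only [Real.sqrt_zero, Complex.ofReal_zero, zero_mul, circleUnit_zero, one_smul]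
      rw [eq_inv_smul_iff, ← h0]
      exact A.ang_smul_slice x hx
    rw [h1, cutMap_smul_of_mem hb]
  · rw [A.polar_cutCoord_of_pos hx ((A.pr_pos_iff hx).2 hb)]

lemma polar_mem_boundary_iff {v : Y × ℂ} (hv : v ∈ A.polarDom) :
    (A.polar v : M) ∈ (𝓡∂ (d + 1)).boundary M ↔ v.2 = 0 := by
  rw [A.mem_boundary_iff _ (A.polar_mem hv), A.pr_polar hv]
  simp

lemma continuousOn_cutCoord : ContinuousOn A.cutCoord A.dom := by
  have h1 := A.contMDiffOn_pr.continuousOn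
  have h2 := continuous_subtype_val.comp_continuousOn A.contMDiffOn_ang.continuousOn
  refine (continuous_fst.comp_continuousOn h1).prodMk ?_
  exact (Complex.continuous_ofReal.comp_continuousOn
    (Real.continuous_sqrt.comp_continuousOn (continuous_snd.comp_continuousOn h1))).mul h2

lemma contMDiffAt_slice {q : Y × ℝ} (hq : q ∈ halfBall Y A.r) (h0 : 0 < q.2) :
    ContMDiffAt 𝓘(ℝ, Y × ℝ) (𝓡∂ (d + 1)) ∞ A.slice q :=
  A.contMDiffOn_slice.contMDiffAt
    (Filter.inter_mem (Metric.isOpen_ball.mem_nhds hq.1) (upperHalf_mem_nhds h0))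

lemma contMDiffAt_polar {v : Y × ℂ} (hv : v ∈ A.polarDom) (h0 : v.2 ≠ 0) :
    ContMDiffAt 𝓘(ℝ, Y × ℂ) (𝓡∂ (d + 1)) ∞ A.polar v := by
  have h1 : ContMDiffAt 𝓘(ℝ, Y × ℂ) (𝓡∂ (d + 1)) ∞ (fun v => A.slice (v.1, ‖v.2‖ ^ 2)) v := by
    refine ContMDiffAt.comp (g := A.slice) v
      (A.contMDiffAt_slice (A.sq_mem_halfBall hv) (by positivity)) ?_
    exact (contDiff_fst.prodMk (contDiff_snd.norm_sq ℝ)).contMDiff.contMDiffAt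
  have h2 : ContMDiffAt 𝓘(ℝ, Y × ℂ) (𝓡 1) ∞ (fun v : Y × ℂ => circleUnit v.2) v :=
    (contMDiffAt_circleUnit h0).comp v contDiff_snd.contMDiff.contMDiffAt
  have hsm : ContMDiff ((𝓡 1).prod (𝓡∂ (d + 1))) (𝓡∂ (d + 1)) ∞
    (fun z : Circle × U => z.1 • z.2) := ContMDiffSMul.contMDiff_smul
  exact hsm.contMDiffAt.comp v (h2.prodMk h1)

lemma contMDiffAt_cutCoord {x : U} (hx : x ∈ A.dom) (h0 : 0 < (A.pr x).2) :
    ContMDiffAt (𝓡∂ (d + 1)) 𝓘(ℝ, Y × ℂ) ∞ A.cutCoord x := by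
  have h1 := A.contMDiffOn_pr.contMDiffAt (A.isOpen_dom.mem_nhds hx)
  have h2 := contMDiff_circle_coe.contMDiffAt.comp x
    (A.contMDiffOn_ang.contMDiffAt (A.isOpen_dom.mem_nhds hx))
  have h3 : ContMDiffAt (𝓡∂ (d + 1)) 𝓘(ℝ, (Y × ℝ) × ℂ) ∞
      (fun x => (A.pr x, (A.ang x : ℂ))) x := h1.prodMk_space h2
  have h4 : ContDiffAt ℝ ∞ (fun z : (Y × ℝ) × ℂ => (z.1.1, ((√z.1.2 : ℝ) : ℂ) * z.2))
      (A.pr x, (A.ang x : ℂ)) := by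
    have h5 : ContDiffAt ℝ ∞ (fun z : (Y × ℝ) × ℂ => √z.1.2) (A.pr x, (A.ang x : ℂ)) :=
      (contDiff_snd.comp contDiff_fst).contDiffAt.sqrt h0.ne'
    exact (contDiff_fst.comp contDiff_fst).contDiffAt.prodMk
      ((Complex.ofRealCLM.contDiff.contDiffAt.comp _ h5).mul contDiff_snd.contDiffAt)
  exact h4.contMDiffAt.comp x h3

/-- The map `polar` need not be continuous at w = 0, where the direction of w has no limit. But all
rotations of the limiting slice point have the same image in the cut space, and compactness of the
circle gives a neighbourhood that works for all directions at once. -/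
lemma continuousOn_cutMap_polar :
    ContinuousOn (fun v => cutMap d U (A.polar v)) A.polarDom := by
  have hcs := continuousSMul_circle d U
  intro v hv
  refine ContinuousAt.continuousWithinAt ?_
  by_cases h0 : v.2 = 0
  · intro O hO
    set q₀ : halfBall Y A.r := ⟨_, A.sq_mem_halfBall hv⟩ with hq₀
    have hF : Continuous (fun z : halfBall Y A.r × Circle => cutMap d U (z.2 • A.slice z.1 : U)) := by
      have h1 : Continuous (fun q : halfBall Y A.r => A.slice q) :=
        continuousOn_iff_continuous_domRestrict.1 A.contMDiffOn_slice.continuousOn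
      exact continuous_cutMap.comp (continuous_subtype_val.comp
        (continuous_snd.smul (h1.comp continuous_fst)))
    have hb : (A.slice (v.1, ‖v.2‖ ^ 2) : M) ∈ (𝓡∂ (d + 1)).boundary M := by
      rw [A.mem_boundary_iff _ (A.slice_mem _ q₀.2), A.pr_slice _ q₀.2]
      change ‖v.2‖ ^ 2 = 0
      rw [h0]
      simp
    have h2 : ∀ᶠ q : halfBall Y A.r in 𝓝 q₀, ∀ a ∈ (univ : Set Circle), cutMap d U (a • A.slice q : U) ∈ O := by
      refine isCompact_univ.eventually_forall_of_forall_eventually fun a _ => ?_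
      refine hF.continuousAt.eventually (p := fun z => z ∈ O) ?_
      change O ∈ 𝓝 (cutMap d U (a • A.slice (v.1, ‖v.2‖ ^ 2) : U))
      rw [cutMap_smul_of_mem hb, ← cutMap_smul_of_mem (a := circleUnit v.2) hb]
      exact hO
    rw [nhds_subtype_eq_comap, Filter.eventually_comap] at h2
    have h3 : ContinuousAt (fun v : Y × ℂ => (v.1, ‖v.2‖ ^ 2)) v := by fun_prop
    change ∀ᶠ v' in 𝓝 v, cutMap d U (A.polar v') ∈ O
    filter_upwards [h3.eventually h2, A.isOpen_polarDom.mem_nhds hv] with v' h4 h5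
    exact h4 ⟨_, A.sq_mem_halfBall h5⟩ rfl _ (mem_univ _)
  · exact continuous_cutMap.continuousAt.comp (continuous_subtype_val.continuousAt.comp
      (A.contMDiffAt_polar hv h0).continuousAt)

lemma saturated_dom {x : M} (hx : x ∈ Subtype.val '' A.dom) (x' : M)
    (h : cutMap d U x = cutMap d U x') : x' ∈ Subtype.val '' A.dom := by
  obtain ⟨x, hx, rfl⟩ := hx
  rcases cutMap_coe_eq_iff.1 h with rfl | ⟨-, a, rfl⟩
  · exact ⟨x, hx, rfl⟩
  · exact ⟨_, A.smul_mem a x hx, rfl⟩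

lemma extend_cutCoord (x : U) : extend Subtype.val A.cutCoord 0 (x : M) = A.cutCoord x :=
  Subtype.val_injective.extend_apply _ _ _

lemma cutCoord_eq {x x' : U} (hx : x ∈ A.dom) (h : cutMap d U x = cutMap d U x') :
    A.cutCoord x = A.cutCoord x' := by
  rcases cutMap_coe_eq_iff.1 h with h | ⟨hb, a, h⟩
  · rw [Subtype.ext h]
  · rw [← Subtype.ext h, cutCoord, cutCoord, A.pr_smul _ _ hx, (A.mem_boundary_iff x hx).1 hb]
    simp

/-- The chart of the cut space near a point of the reduced space, with values in `Y × ℂ`. -/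
def cutChartAux : OpenPartialHomeomorph (CutSpace d U) (Y × ℂ) :=
  quotChart (W := Subtype.val '' A.dom) (κ := extend Subtype.val A.cutCoord 0) (T := A.polarDom)
    (σ := fun v => cutMap d U (A.polar v))
    isQuotientMap_cutMap (U.isOpenEmbedding'.isOpenMap _ A.isOpen_dom)
    (fun _ hx => A.saturated_dom hx)
    (by
      rintro _ ⟨x, hx, rfl⟩
      refine ContinuousAt.continuousWithinAt ?_
      rw [← U.isOpenEmbedding'.continuousAt_iff]
      exact (A.continuousOn_cutCoord.continuousAt (A.isOpen_dom.mem_nhds hx)).congr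
        (Filter.Eventually.of_forall fun x => (A.extend_cutCoord x).symm))
    (by
      rintro _ ⟨x, hx, rfl⟩ x' h
      obtain ⟨x', hx', rfl⟩ := A.saturated_dom ⟨x, hx, rfl⟩ x' h
      rw [A.extend_cutCoord, A.extend_cutCoord, A.cutCoord_eq hx h])
    A.isOpen_polarDom A.continuousOn_cutMap_polar
    (by
      rintro _ ⟨x, hx, rfl⟩
      rw [A.extend_cutCoord]
      exact A.cutCoord_mem hx)
    (by
      rintro _ ⟨x, hx, rfl⟩
      rw [A.extend_cutCoord, A.cutMap_polar_cutCoord hx])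
    (fun v hv => ⟨A.polar v, ⟨_, A.polar_mem hv, rfl⟩, rfl, by
      rw [A.extend_cutCoord, A.cutCoord_polar hv]⟩)

/-- The chart of the cut space near a point of the reduced space. -/
def cutChart : OpenPartialHomeomorph (CutSpace d U) (EuclideanSpace ℝ (Fin (d + 1))) :=
  A.cutChartAux.transHomeomorph A.cutModel.symm.toHomeomorph

lemma cutChart_apply {x : U} (hx : x ∈ A.dom) :
    A.cutChart (cutMap d U x) = A.cutModel.symm (A.cutCoord x) := by
  change A.cutModel.symm (A.cutChartAux (cutMap d U x)) = _
  have hx' : (x : M) ∈ Subtype.val '' A.dom := ⟨x, hx, rfl⟩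
  rw [← A.extend_cutCoord]
  exact congrArg _ (quotChart_apply _ _ _ _ _ _ _ _ _ _ hx')

lemma cutChart_symm_apply (v : EuclideanSpace ℝ (Fin (d + 1))) :
    A.cutChart.symm v = cutMap d U (A.polar (A.cutModel v)) := rfl

lemma mem_cutChart_target {v : EuclideanSpace ℝ (Fin (d + 1))} :
    v ∈ A.cutChart.target ↔ A.cutModel v ∈ A.polarDom := Iff.rfl

lemma cutMap_mem_cutChart_source {x : M} :
    cutMap d U x ∈ A.cutChart.source ↔ x ∈ Subtype.val '' A.dom :=
  ⟨fun ⟨_, hx', h⟩ => A.saturated_dom hx' x h, fun h => ⟨x, h, rfl⟩⟩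

end AdaptedChart
end AdaptedCharts


/-! ### Smoothness of the transitions between adapted charts. -/

section NormalQuotSign

variable {Y : Type} [NormedAddCommGroup Y] [NormedSpace ℝ Y]

/-- A continuous function on a half space whose values off the boundary hyperplane lie in a closed
set has all its values in that set. -/
lemma mem_of_continuousOn_upperHalf {Z : Type*} [TopologicalSpace Z] {G : Y × ℝ → Z} {S : Set Z}
    (hS : IsClosed S) {O : Set (Y × ℝ)} (hO : IsOpen O) (hG : ContinuousOn G (O ∩ upperHalf Y))
    (h : ∀ q ∈ O, 0 < q.2 → G q ∈ S) {q : Y × ℝ} (hq : q ∈ O ∩ upperHalf Y) : G q ∈ S := by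
  rcases (show (0 : ℝ) ≤ q.2 from hq.2).eq_or_lt with h0 | h0
  · have hc : Continuous (fun t : ℝ => (q.1, t)) := by fun_prop
    have hq0 : (q.1, (0 : ℝ)) = q := Prod.ext rfl h0
    have h1 : ∀ᶠ t in 𝓝[>] (0 : ℝ), (q.1, t) ∈ O :=
      nhdsWithin_le_nhds (hc.continuousAt.eventually (hO.mem_nhds
        (show (q.1, (0 : ℝ)) ∈ O from hq0.symm ▸ hq.1)))
    have h2 : Filter.Tendsto (fun t : ℝ => (q.1, t)) (𝓝[>] 0) (𝓝[O ∩ upperHalf Y] q) := by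
      refine tendsto_nhdsWithin_iff.2 ⟨?_, ?_⟩
      · have := (hc.tendsto 0).mono_left (nhdsWithin_le_nhds (s := Ioi (0 : ℝ)))
        rwa [hq0] at this
      · filter_upwards [h1, self_mem_nhdsWithin] with t ht1 ht2
        exact ⟨ht1, (show (0 : ℝ) < t from ht2).le⟩
    refine hS.mem_of_tendsto ((hG q hq).tendsto.comp h2) ?_
    filter_upwards [h1, self_mem_nhdsWithin] with t ht1 ht2
    exact h _ ht1 ht2
  · exact h q hq.1 h0

end NormalQuotSign

section AdaptedTransitions

variable {d : ℕ} {M : Type*} [TopologicalSpace M] [ChartedSpace (EuclideanHalfSpace (d + 1)) M]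
  [IsManifold (𝓡∂ (d + 1)) ∞ M]
  {U : TopologicalSpace.Opens M} [MulAction Circle U]
  [ContMDiffSMul (𝓡 1) (𝓡∂ (d + 1)) ∞ Circle U]
  {Y : Type} [NormedAddCommGroup Y] [NormedSpace ℝ Y]

namespace AdaptedChart

variable {V : Set U} {p p' : U} (A : AdaptedChart d U Y V p) (A' : AdaptedChart d U Y V p')

/-- The part of the slice that lies in the domain of another adapted chart. -/
def overlap : Set (Y × ℝ) := halfBall Y A.r ∩ A.slice ⁻¹' A'.dom

/-- The transition map between the slices of two adapted charts. -/
def transSlice (q : Y × ℝ) : Y × ℝ := A'.pr (A.slice q)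

lemma exists_isOpen_overlap : ∃ O, IsOpen O ∧ A.overlap A' = O ∩ upperHalf Y := by
  obtain ⟨O, hO, h⟩ := (continuousOn_iff'.1 A.contMDiffOn_slice.continuousOn) A'.dom A'.isOpen_dom
  refine ⟨O ∩ Metric.ball 0 A.r, hO.inter Metric.isOpen_ball, ?_⟩
  rw [overlap, inter_comm, h, halfBall, inter_assoc]

lemma contDiffOn_transSlice : ContDiffOn ℝ ∞ (A.transSlice A') (A.overlap A') :=
  contMDiffOn_iff_contDiffOn.1 (A'.contMDiffOn_pr.comp
    (A.contMDiffOn_slice.mono inter_subset_left) (fun _ hq => hq.2))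

lemma contDiffOn_ang_slice :
    ContDiffOn ℝ ∞ (fun q => (A'.ang (A.slice q) : ℂ)) (A.overlap A') :=
  contMDiffOn_iff_contDiffOn.1 (contMDiff_circle_coe.comp_contMDiffOn (A'.contMDiffOn_ang.comp
    (A.contMDiffOn_slice.mono inter_subset_left) (fun _ hq => hq.2)))

lemma slice_transSlice {q : Y × ℝ} (hq : q ∈ A.overlap A') :
    A'.slice (A.transSlice A' q) = (A'.ang (A.slice q))⁻¹ • A.slice q := by
  rw [eq_inv_smul_iff]
  exact A'.ang_smul_slice _ hq.2

lemma transSlice_mem {q : Y × ℝ} (hq : q ∈ A.overlap A') : A.transSlice A' q ∈ A'.overlap A := by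
  refine ⟨A'.pr_mem _ hq.2, ?_⟩
  rw [mem_preimage, A.slice_transSlice A' hq]
  exact A.smul_mem _ _ (A.slice_mem _ hq.1)

lemma transSlice_transSlice {q : Y × ℝ} (hq : q ∈ A.overlap A') :
    A'.transSlice A (A.transSlice A' q) = q := by
  rw [transSlice, A.slice_transSlice A' hq, A.pr_smul _ _ (A.slice_mem _ hq.1), A.pr_slice _ hq.1]

lemma slice_mem_boundary_iff {q : Y × ℝ} (hq : q ∈ halfBall Y A.r) :
    (A.slice q : M) ∈ (𝓡∂ (d + 1)).boundary M ↔ q.2 = 0 := by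
  rw [A.mem_boundary_iff _ (A.slice_mem _ hq), A.pr_slice _ hq]

lemma transSlice_snd_eq_zero_iff {q : Y × ℝ} (hq : q ∈ A.overlap A') :
    (A.transSlice A' q).2 = 0 ↔ q.2 = 0 := by
  rw [transSlice, ← A'.mem_boundary_iff _ hq.2, A.slice_mem_boundary_iff hq.1]

lemma transSlice_snd_pos {q : Y × ℝ} (hq : q ∈ A.overlap A') (h0 : 0 < q.2) :
    0 < (A.transSlice A' q).2 :=
  lt_of_le_of_ne (A'.pr_snd_nonneg hq.2)
    fun h => h0.ne' ((A.transSlice_snd_eq_zero_iff A' hq).1 h.symm)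

/-- The ratio of the normal coordinates of two adapted charts. -/
def ratio : Y × ℝ → ℝ := normalQuot (fun q => (A.transSlice A' q).2)

/-- The normal coordinate of one chart vanishes with that of the other, so Hadamard's lemma divides
it out. -/
lemma contDiffOn_ratio : ContDiffOn ℝ ∞ (A.ratio A') (A.overlap A') := by
  obtain ⟨O, hO, h⟩ := A.exists_isOpen_overlap A'
  have h1 := contDiff_snd.comp_contDiffOn (A.contDiffOn_transSlice A')
  -- off the overlap the values of the second coordinate are irrelevant
  rw [h] at h1 ⊢
  refine contDiffOn_normalQuot hO h1 fun q hq h0 => ?_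
  exact (A.transSlice_snd_eq_zero_iff A' (h ▸ ⟨hq, h0.ge⟩)).2 h0

lemma snd_mul_ratio {q : Y × ℝ} (hq : q ∈ A.overlap A') :
    q.2 * A.ratio A' q = (A.transSlice A' q).2 :=
  mul_normalQuot fun h0 => (A.transSlice_snd_eq_zero_iff A' hq).2 h0

/-- The ratios of a transition and of its inverse have product 1 for t > 0, hence also at t = 0 by
continuity. Likewise the ratio is nonnegative up to the boundary, and it cannot vanish there. -/
lemma ratio_pos {q : Y × ℝ} (hq : q ∈ A.overlap A') : 0 < A.ratio A' q := by
  obtain ⟨O, hO, h⟩ := A.exists_isOpen_overlap A'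
  have hmul : A.ratio A' q * A'.ratio A (A.transSlice A' q) = 1 := by
    refine mem_of_continuousOn_upperHalf (S := {1})
      (G := fun q => A.ratio A' q * A'.ratio A (A.transSlice A' q)) isClosed_singleton hO ?_ ?_
      (h ▸ hq)
    · rw [← h]
      exact (A.contDiffOn_ratio A').continuousOn.mul ((A'.contDiffOn_ratio A).continuousOn.comp
        (A.contDiffOn_transSlice A').continuousOn fun q hq => A.transSlice_mem A' hq)
    · intro q hq h0
      have hq' : q ∈ A.overlap A' := h ▸ ⟨hq, h0.le⟩
      have h1 := A'.snd_mul_ratio A (A.transSlice_mem A' hq')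
      rw [A.transSlice_transSlice A' hq', ← A.snd_mul_ratio A' hq', mul_assoc] at h1
      exact mul_left_cancel₀ h0.ne' (h1.trans (mul_one _).symm)
  refine lt_of_le_of_ne ?_ fun h0 => ?_
  · refine mem_of_continuousOn_upperHalf (S := Ici 0) isClosed_Ici hO
      (h ▸ (A.contDiffOn_ratio A').continuousOn) ?_ (h ▸ hq)
    intro q hq h0
    have hq' : q ∈ A.overlap A' := h ▸ ⟨hq, h0.le⟩
    have h1 := A.transSlice_snd_pos A' hq' h0
    rw [← A.snd_mul_ratio A' hq'] at h1
    exact (pos_of_mul_pos_right h1 h0.le).le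
  · rw [← h0, zero_mul] at hmul
    exact zero_ne_one hmul

/-- The computation behind the smooth structure. The new radius is |w| √ratio and the new angle is
that of w shifted by the angle of the slice point. So w is multiplied by a factor depending only on
(y, |w|²), and the singular functions |w| and arg w disappear. -/
lemma cutCoord_polar_trans {v : Y × ℂ} (hv : v ∈ A.polarDom) (hv' : A.polar v ∈ A'.dom) :
    (v.1, ‖v.2‖ ^ 2) ∈ A.overlap A' ∧ A'.cutCoord (A.polar v) =
      ((A.transSlice A' (v.1, ‖v.2‖ ^ 2)).1, v.2 * ((√(A.ratio A' (v.1, ‖v.2‖ ^ 2)) : ℝ) *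
        A'.ang (A.slice (v.1, ‖v.2‖ ^ 2)))) := by
  have h1 : A.slice (v.1, ‖v.2‖ ^ 2) ∈ A'.dom := by
    have := A'.smul_mem (circleUnit v.2)⁻¹ _ hv'
    rwa [polar, inv_smul_smul] at this
  have h2 : (v.1, ‖v.2‖ ^ 2) ∈ A.overlap A' := ⟨A.sq_mem_halfBall hv, h1⟩
  refine ⟨h2, ?_⟩
  rw [cutCoord, polar, A'.pr_smul _ _ h1, A'.ang_smul _ _ h1]
  refine Prod.ext rfl ?_
  change ((√(A.transSlice A' _).2 : ℝ) : ℂ) * _ = _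
  rw [← A.snd_mul_ratio A' h2, Real.sqrt_mul (sq_nonneg _), Real.sqrt_sq (norm_nonneg _),
    Circle.coe_mul]
  have hw (z : ℂ) : v.2 * z = ‖v.2‖ * circleUnit v.2 * z := by rw [norm_mul_circleUnit]
  rw [hw]
  push_cast
  ring

lemma contDiffAt_cutCoord_polar {v : Y × ℂ} (hv : v ∈ A.polarDom) (hv' : A.polar v ∈ A'.dom) :
    ContDiffAt ℝ ∞ (fun v => A'.cutCoord (A.polar v)) v := by
  obtain ⟨O, hO, h⟩ := A.exists_isOpen_overlap A'
  set κ : Y × ℂ → Y × ℝ := fun v => (v.1, ‖v.2‖ ^ 2) with hκ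
  have hκd : ContDiff ℝ ∞ κ := contDiff_fst.prodMk (contDiff_snd.norm_sq ℝ)
  have hmaps : MapsTo κ (κ ⁻¹' O) (A.overlap A') := fun v hv =>
    h ▸ ⟨hv, show 0 ≤ ‖v.2‖ ^ 2 from sq_nonneg _⟩
  have hopen : IsOpen (κ ⁻¹' O) := hO.preimage hκd.continuous
  have h1 : ContDiffOn ℝ ∞ (fun v => ((A.transSlice A' (κ v)).1,
      v.2 * ((√(A.ratio A' (κ v)) : ℝ) * (A'.ang (A.slice (κ v)) : ℂ)))) (κ ⁻¹' O) := by
    refine (contDiff_fst.comp_contDiffOn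
      ((A.contDiffOn_transSlice A').comp hκd.contDiffOn hmaps)).prodMk
      (contDiff_snd.contDiffOn.mul ((Complex.ofRealCLM.contDiff.comp_contDiffOn
        (((A.contDiffOn_ratio A').comp hκd.contDiffOn hmaps).sqrt fun v hv =>
          (A.ratio_pos A' (hmaps hv)).ne')).mul
        ((A.contDiffOn_ang_slice A').comp hκd.contDiffOn hmaps)))
  have hvO : v ∈ κ ⁻¹' O := by
    have := (A.cutCoord_polar_trans A' hv hv').1
    rw [h] at this
    exact this.1
  refine (h1.contDiffAt (hopen.mem_nhds hvO)).congr_of_eventuallyEq ?_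
  filter_upwards [hopen.mem_nhds hvO, A.isOpen_polarDom.mem_nhds hv] with v' h2 h3
  exact (A.cutCoord_polar_trans A' h3 (A'.smul_mem _ _ (hmaps h2).2)).2

lemma contDiffAt_cutChart_symm {v : EuclideanSpace ℝ (Fin (d + 1))} (hv : v ∈ A.cutChart.target)
    (hv' : A.cutChart.symm v ∈ A'.cutChart.source) :
    ContDiffAt ℝ ∞ (fun v => A'.cutChart (A.cutChart.symm v)) v := by
  have hdom : ∀ v, A.cutChart.symm v ∈ A'.cutChart.source → A.polar (A.cutModel v) ∈ A'.dom := by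
    intro v hv
    rw [cutChart_symm_apply, cutMap_mem_cutChart_source] at hv
    obtain ⟨x, hx, h⟩ := hv
    rwa [← Subtype.ext h]
  have h1 : ContDiffAt ℝ ∞ (fun v => A'.cutModel.symm
      (A'.cutCoord (A.polar (A.cutModel v)))) v :=
    A'.cutModel.symm.contDiff.contDiffAt.comp v
      ((A.contDiffAt_cutCoord_polar A' (A.mem_cutChart_target.1 hv) (hdom v hv')).comp v
        A.cutModel.contDiff.contDiffAt)
  refine h1.congr_of_eventuallyEq ?_
  filter_upwards [(A.cutChart.isOpen_inter_preimage_symm A'.cutChart.open_source).mem_nhds ⟨hv, hv'⟩]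
    with v' h2
  rw [cutChart_symm_apply, A'.cutChart_apply (hdom v' h2.2)]

end AdaptedChart
end AdaptedTransitions

/-! ### Charts of the cut space over the interior. -/

section CutCharts

variable {d : ℕ} {M : Type*} [TopologicalSpace M] [ChartedSpace (EuclideanHalfSpace (d + 1)) M]
  [IsManifold (𝓡∂ (d + 1)) ∞ M]
  {U : TopologicalSpace.Opens M} [MulAction Circle U]
  [ContMDiffSMul (𝓡 1) (𝓡∂ (d + 1)) ∞ Circle U]

/-- A chart of the cut space that is compatible with the smooth structure of the interior. -/
structure IsCutChart (φ : OpenPartialHomeomorph (CutSpace d U) (EuclideanSpace ℝ (Fin (d + 1)))) :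
    Prop where
  contMDiffAt_comp : ∀ x ∈ (𝓡∂ (d + 1)).interior M, cutMap d U x ∈ φ.source →
    ContMDiffAt (𝓡∂ (d + 1)) 𝓘(ℝ, EuclideanSpace ℝ (Fin (d + 1))) ∞ (fun x => φ (cutMap d U x)) x
  exists_lift : ∃ s : EuclideanSpace ℝ (Fin (d + 1)) → M, ∀ v ∈ φ.target,
    cutMap d U (s v) = φ.symm v ∧ (φ.symm v ∉ redSet d U →
      ContMDiffAt 𝓘(ℝ, EuclideanSpace ℝ (Fin (d + 1))) (𝓡∂ (d + 1)) ∞ s v)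

lemma cutMap_not_mem_redSet_iff {x : M} :
    cutMap d U x ∉ redSet d U ↔ x ∈ (𝓡∂ (d + 1)).interior M := by
  rw [cutMap_mem_redSet_iff, mem_interior_iff_not_mem_boundary]

/-- Off the reduced space a transition factors through M: lift by the smooth section of one chart,
then apply the other chart after the cut map. -/
lemma IsCutChart.contDiffAt_trans
    {φ ψ : OpenPartialHomeomorph (CutSpace d U) (EuclideanSpace ℝ (Fin (d + 1)))}
    (hφ : IsCutChart φ) (hψ : IsCutChart ψ) {v : EuclideanSpace ℝ (Fin (d + 1))}
    (hv : v ∈ φ.target) (hv' : φ.symm v ∈ ψ.source) (hr : φ.symm v ∉ redSet d U) :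
    ContDiffAt ℝ ∞ (fun v => ψ (φ.symm v)) v := by
  obtain ⟨s, hs⟩ := hφ.exists_lift
  have h1 := (hs v hv).1
  have h2 : ContMDiffAt 𝓘(ℝ, EuclideanSpace ℝ (Fin (d + 1)))
      𝓘(ℝ, EuclideanSpace ℝ (Fin (d + 1))) ∞ (fun v => ψ (cutMap d U (s v))) v :=
    ContMDiffAt.comp (g := fun x => ψ (cutMap d U x)) v
      (hψ.contMDiffAt_comp (s v) (cutMap_not_mem_redSet_iff.1 (h1 ▸ hr)) (h1 ▸ hv'))
      ((hs v hv).2 hr)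
  refine (contMDiffAt_iff_contDiffAt.1 h2).congr_of_eventuallyEq ?_
  filter_upwards [φ.open_target.mem_nhds hv] with v' h3
  rw [(hs v' h3).1]

lemma AdaptedChart.isCutChart {Y : Type} [NormedAddCommGroup Y] [NormedSpace ℝ Y] {V : Set U}
    {p : U} (A : AdaptedChart d U Y V p) : IsCutChart A.cutChart where
  contMDiffAt_comp := by
    intro x hx hs
    obtain ⟨x, hxd, rfl⟩ := A.cutMap_mem_cutChart_source.1 hs
    have h0 := (A.pr_pos_iff hxd).2 (mem_interior_iff_not_mem_boundary.1 hx)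
    rw [← contMDiffAt_subtype_iff (U := U)]
    have h1 : ContMDiffAt (𝓡∂ (d + 1)) 𝓘(ℝ, EuclideanSpace ℝ (Fin (d + 1))) ∞
        (fun x => A.cutModel.symm (A.cutCoord x)) x :=
      A.cutModel.symm.contDiff.contMDiff.contMDiffAt.comp x (A.contMDiffAt_cutCoord hxd h0)
    refine h1.congr_of_eventuallyEq ?_
    filter_upwards [A.isOpen_dom.mem_nhds hxd] with x' hx'
    exact A.cutChart_apply hx'
  exists_lift := by
    refine ⟨fun v => A.polar (A.cutModel v), fun v hv => ⟨rfl, fun hr => ?_⟩⟩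
    have hv' := A.mem_cutChart_target.1 hv
    have h0 : (A.cutModel v).2 ≠ 0 := by
      intro h0
      rw [A.cutChart_symm_apply, cutMap_mem_redSet_iff, A.polar_mem_boundary_iff hv'] at hr
      exact hr h0
    exact contMDiff_subtype_val.contMDiffAt.comp v
      ((A.contMDiffAt_polar hv' h0).comp v A.cutModel.contDiff.contMDiff.contMDiffAt)

lemma mem_interior_iff_extChartAt_pos {x₀ x : M}
    (hx : x ∈ (extChartAt (𝓡∂ (d + 1)) x₀).source) :
    x ∈ (𝓡∂ (d + 1)).interior M ↔ 0 < (extChartAt (𝓡∂ (d + 1)) x₀ x) 0 := by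
  rw [extChartAt_source] at hx
  rw [mem_interior_iff_not_mem_boundary, mem_boundary_iff_of_mem_atlas (chart_mem_atlas _ x₀) hx]
  have h0 : (0 : ℝ) ≤ (chartAt (EuclideanHalfSpace (d + 1)) x₀ x).1 0 :=
    (chartAt (EuclideanHalfSpace (d + 1)) x₀ x).2
  exact ⟨fun h => lt_of_le_of_ne h0 (Ne.symm h), fun h => h.ne'⟩

variable (U) in
/-- The chart of the cut space near the image of an interior point. -/
def interiorChart (x₀ : M) :
    OpenPartialHomeomorph (CutSpace d U) (EuclideanSpace ℝ (Fin (d + 1))) :=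
  quotChart (W := (extChartAt (𝓡∂ (d + 1)) x₀).source ∩ (𝓡∂ (d + 1)).interior M)
    (κ := extChartAt (𝓡∂ (d + 1)) x₀)
    (T := (𝓡∂ (d + 1)).symm ⁻¹' (chartAt (EuclideanHalfSpace (d + 1)) x₀).target ∩ {v | 0 < v 0})
    (σ := fun v => cutMap d U ((extChartAt (𝓡∂ (d + 1)) x₀).symm v))
    isQuotientMap_cutMap ((isOpen_extChartAt_source x₀).inter isOpen_interior')
    (fun x hx x' h => by
      rwa [← cutMap_injective_of_not_mem (mem_interior_iff_not_mem_boundary.1 hx.2) h])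
    ((continuousOn_extChartAt x₀).mono inter_subset_left)
    (fun x hx x' h => by
      rw [← cutMap_injective_of_not_mem (mem_interior_iff_not_mem_boundary.1 hx.2) h])
    (((chartAt _ x₀).open_target.preimage (𝓡∂ (d + 1)).continuous_symm).inter
      (isOpen_lt continuous_const (by fun_prop)))
    (continuous_cutMap.comp_continuousOn (((chartAt _ x₀).continuousOn_symm.comp
      (𝓡∂ (d + 1)).continuous_symm.continuousOn (fun v hv => hv)).mono inter_subset_left))
    (fun x hx => by
      have h1 := (extChartAt (𝓡∂ (d + 1)) x₀).map_source hx.1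
      rw [extChartAt_target] at h1
      exact ⟨h1.1, (mem_interior_iff_extChartAt_pos hx.1).1 hx.2⟩)
    (fun x hx => by rw [(extChartAt (𝓡∂ (d + 1)) x₀).left_inv hx.1])
    (fun v hv => by
      have h1 : v ∈ (extChartAt (𝓡∂ (d + 1)) x₀).target := by
        rw [extChartAt_target]
        exact ⟨hv.1, mem_range_halfSpace_iff.2 hv.2.le⟩
      have h2 := (extChartAt (𝓡∂ (d + 1)) x₀).map_target h1
      have h3 := (extChartAt (𝓡∂ (d + 1)) x₀).right_inv h1
      refine ⟨_, ⟨h2, (mem_interior_iff_extChartAt_pos h2).2 ?_⟩, rfl, h3⟩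
      rw [h3]
      exact hv.2)

lemma interiorChart_apply {x₀ x : M} (hx : x ∈ (extChartAt (𝓡∂ (d + 1)) x₀).source)
    (hxi : x ∈ (𝓡∂ (d + 1)).interior M) :
    interiorChart U x₀ (cutMap d U x) = extChartAt (𝓡∂ (d + 1)) x₀ x :=
  quotChart_apply _ _ _ _ _ _ _ _ _ _ ⟨hx, hxi⟩

lemma cutMap_mem_interiorChart_source {x₀ x : M} :
    cutMap d U x ∈ (interiorChart U x₀).source ↔
      x ∈ (extChartAt (𝓡∂ (d + 1)) x₀).source ∧ x ∈ (𝓡∂ (d + 1)).interior M := by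
  refine ⟨?_, fun h => ⟨x, h, rfl⟩⟩
  rintro ⟨x', hx', h⟩
  rwa [← cutMap_injective_of_not_mem (mem_interior_iff_not_mem_boundary.1 hx'.2) h]

lemma interiorChart_source_disjoint {x₀ : M} {z : CutSpace d U}
    (hz : z ∈ (interiorChart U x₀).source) : z ∉ redSet d U := by
  obtain ⟨x, rfl⟩ := surjective_cutMap z
  exact cutMap_not_mem_redSet_iff.2 (cutMap_mem_interiorChart_source.1 hz).2

lemma isCutChart_interiorChart (x₀ : M) : IsCutChart (interiorChart (d := d) U x₀) where
  contMDiffAt_comp := by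
    intro x hx hs
    have h1 := (cutMap_mem_interiorChart_source.1 hs).1
    have h2 : ContMDiffAt (𝓡∂ (d + 1)) 𝓘(ℝ, EuclideanSpace ℝ (Fin (d + 1))) ∞
        (extChartAt (𝓡∂ (d + 1)) x₀) x := by
      rw [extChartAt_source] at h1
      exact contMDiffAt_extChartAt' h1
    refine h2.congr_of_eventuallyEq ?_
    filter_upwards [((isOpen_extChartAt_source (I := 𝓡∂ (d + 1)) x₀)).mem_nhds h1,
      (isOpen_interior' (d := d) (M := M)).mem_nhds hx] with x' h3 h4
    exact interiorChart_apply h3 h4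
  exists_lift := by
    refine ⟨(extChartAt (𝓡∂ (d + 1)) x₀).symm, fun v hv => ⟨rfl, fun _ => ?_⟩⟩
    have h1 : v ∈ (extChartAt (𝓡∂ (d + 1)) x₀).target := by
      rw [extChartAt_target]
      exact ⟨hv.1, mem_range_halfSpace_iff.2 hv.2.le⟩
    refine (contMDiffOn_extChartAt_symm (I := 𝓡∂ (d + 1)) x₀).contMDiffAt ?_
    rw [extChartAt_target]
    refine Filter.inter_mem (((chartAt _ x₀).open_target.preimage
      (𝓡∂ (d + 1)).continuous_symm).mem_nhds hv.1) ?_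
    have : {v : EuclideanSpace ℝ (Fin (d + 1)) | 0 < v 0} ∈ 𝓝 v :=
      (isOpen_lt continuous_const (by fun_prop)).mem_nhds hv.2
    filter_upwards [this] with v' h2
    exact mem_range_halfSpace_iff.2 (le_of_lt h2)

end CutCharts


/-! ### Charts of the reduced space and the choice of atlases. -/

section RedCharts

variable {d : ℕ} {M : Type*} [TopologicalSpace M] [ChartedSpace (EuclideanHalfSpace (d + 1)) M]
  [IsManifold (𝓡∂ (d + 1)) ∞ M]
  {U : TopologicalSpace.Opens M} [MulAction Circle U]
  [ContMDiffSMul (𝓡 1) (𝓡∂ (d + 1)) ∞ Circle U]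
  {Y : Type} [NormedAddCommGroup Y] [NormedSpace ℝ Y]

/-- The cut map is closed and ∂M is a closed subset, so the restriction to it is a closed continuous
surjection. -/
lemma isQuotientMap_redMap (hU : (𝓡∂ (d + 1)).boundary M ⊆ U) : IsQuotientMap (redMap d U) := by
  have hcl : IsClosedMap (redMap d U) := by
    intro C hC
    have h1 := isClosedMap_cutMap hU _ (isClosed_boundary'.isClosedEmbedding_subtypeVal.isClosedMap
      C hC)
    have h2 : redMap d U '' C = Subtype.val ⁻¹' (cutMap d U '' (Subtype.val '' C)) := by
      ext z
      constructor
      · rintro ⟨x, hx, rfl⟩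
        exact ⟨x, ⟨x, hx, rfl⟩, rfl⟩
      · rintro ⟨_, ⟨x, hx, rfl⟩, h⟩
        exact ⟨x, hx, Subtype.ext h⟩
    rw [h2]
    exact h1.preimage continuous_subtype_val
  refine hcl.isQuotientMap ?_ ?_
  · exact (continuous_cutMap.comp continuous_subtype_val).subtype_mk _
  · rintro ⟨_, x, hx, rfl⟩
    exact ⟨⟨x, hx⟩, rfl⟩

/-- A boundary point as a point of `U`. -/
def bdryPt (hU : (𝓡∂ (d + 1)).boundary M ⊆ U) (x : (𝓡∂ (d + 1)).boundary M) : U := ⟨x, hU x.2⟩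

namespace AdaptedChart

variable {V : Set U} {p p' : U} (A : AdaptedChart d U Y V p) (A' : AdaptedChart d U Y V p')

open Classical in
/-- The point of the reduced space on the slice with coordinate `y`. -/
def redPoint (z₀ : redSet d U) (y : Y) : redSet d U :=
  if h : (A.slice (y, 0) : M) ∈ (𝓡∂ (d + 1)).boundary M then redMap d U ⟨_, h⟩ else z₀

lemma slice_zero_mem_boundary {y : Y} (hy : ‖y‖ < A.r) :
    (A.slice (y, 0) : M) ∈ (𝓡∂ (d + 1)).boundary M :=
  (A.slice_mem_boundary_iff (mem_halfBall_zero_iff.2 hy)).2 rfl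

lemma coe_redPoint (z₀ : redSet d U) {y : Y} (hy : ‖y‖ < A.r) :
    (A.redPoint z₀ y : CutSpace d U) = cutMap d U (A.slice (y, 0)) := by
  rw [redPoint, dif_pos (A.slice_zero_mem_boundary hy)]
  rfl

lemma pr_eq_of_mem_boundary {x : U} (hx : x ∈ A.dom) (hb : (x : M) ∈ (𝓡∂ (d + 1)).boundary M) :
    A.pr x = ((A.pr x).1, 0) := Prod.ext rfl ((A.mem_boundary_iff x hx).1 hb)

lemma norm_pr_fst_lt {x : U} (hx : x ∈ A.dom) : ‖(A.pr x).1‖ < A.r := by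
  have h := (A.pr_mem x hx).1
  rw [mem_ball_zero_iff] at h
  exact (norm_fst_le _).trans_lt h

lemma continuous_bdryPt (hU : (𝓡∂ (d + 1)).boundary M ⊆ U) : Continuous (bdryPt hU) :=
  continuous_subtype_val.subtype_mk _

lemma redMap_eq_iff (hU : (𝓡∂ (d + 1)).boundary M ⊆ U) {x x' : (𝓡∂ (d + 1)).boundary M} :
    redMap d U x = redMap d U x' ↔ ∃ a : Circle, a • bdryPt hU x = bdryPt hU x' := by
  rw [Subtype.ext_iff]
  refine (cutMap_coe_eq_iff (x := bdryPt hU x)).trans ⟨?_, ?_⟩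
  · rintro (h | ⟨-, a, h⟩)
    · exact ⟨1, by rw [one_smul]; exact Subtype.ext h⟩
    · exact ⟨a, Subtype.ext h⟩
  · rintro ⟨a, h⟩
    exact Or.inr ⟨x.2, a, congrArg _ h⟩

/-- The chart of the reduced space induced by an adapted chart. -/
def redChart (hU : (𝓡∂ (d + 1)).boundary M ⊆ U) (z₀ : redSet d U) :
    OpenPartialHomeomorph (redSet d U) Y :=
  quotChart (W := bdryPt hU ⁻¹' A.dom) (κ := fun x => (A.pr (bdryPt hU x)).1)
    (T := Metric.ball 0 A.r) (σ := A.redPoint z₀) (isQuotientMap_redMap hU)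
    (A.isOpen_dom.preimage (continuous_bdryPt hU))
    (fun x hx x' h => by
      obtain ⟨a, h⟩ := (redMap_eq_iff hU).1 h
      rw [mem_preimage, ← h]
      exact A.smul_mem a _ hx)
    (continuous_fst.comp_continuousOn (A.contMDiffOn_pr.continuousOn.comp
      (continuous_bdryPt hU).continuousOn fun _ hx => hx))
    (fun x hx x' h => by
      obtain ⟨a, h⟩ := (redMap_eq_iff hU).1 h
      rw [← h, A.pr_smul a _ hx])
    Metric.isOpen_ball
    (by
      rw [IsInducing.subtypeVal.continuousOn_iff]
      have h1 : ContinuousOn (fun y => A.slice (y, 0)) (Metric.ball 0 A.r) :=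
        A.contMDiffOn_slice.continuousOn.comp (by fun_prop) fun y hy =>
          mem_halfBall_zero_iff.2 (mem_ball_zero_iff.1 hy)
      refine (continuous_cutMap.comp_continuousOn
        (continuous_subtype_val.comp_continuousOn h1)).congr fun y hy => ?_
      exact A.coe_redPoint z₀ (mem_ball_zero_iff.1 hy))
    (fun x hx => mem_ball_zero_iff.2 (A.norm_pr_fst_lt hx))
    (fun x hx => by
      apply Subtype.ext
      rw [A.coe_redPoint z₀ (A.norm_pr_fst_lt hx), ← A.pr_eq_of_mem_boundary hx x.2]
      conv_rhs => rw [redMap]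
      change _ = cutMap d U (bdryPt hU x)
      conv_rhs => rw [← A.ang_smul_slice _ hx]
      refine (cutMap_smul_of_mem ?_).symm
      rw [A.pr_eq_of_mem_boundary hx x.2]
      exact A.slice_zero_mem_boundary (A.norm_pr_fst_lt hx))
    (fun y hy => by
      have hy' := mem_ball_zero_iff.1 hy
      have hyh := mem_halfBall_zero_iff.2 hy'
      refine ⟨⟨_, A.slice_zero_mem_boundary hy'⟩, A.slice_mem _ hyh,
        Subtype.ext (A.coe_redPoint z₀ hy').symm, ?_⟩
      exact congrArg Prod.fst (A.pr_slice _ hyh))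

lemma redChart_apply (hU : (𝓡∂ (d + 1)).boundary M ⊆ U) (z₀ : redSet d U)
    {x : (𝓡∂ (d + 1)).boundary M} (hx : bdryPt hU x ∈ A.dom) :
    A.redChart hU z₀ (redMap d U x) = (A.pr (bdryPt hU x)).1 :=
  quotChart_apply _ _ _ _ _ _ _ _ _ _ hx

lemma redMap_mem_redChart_source (hU : (𝓡∂ (d + 1)).boundary M ⊆ U) {z₀ : redSet d U}
    {x : (𝓡∂ (d + 1)).boundary M} :
    redMap d U x ∈ (A.redChart hU z₀).source ↔ bdryPt hU x ∈ A.dom := by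
  refine ⟨?_, fun h => ⟨x, h, rfl⟩⟩
  rintro ⟨x', hx', h⟩
  obtain ⟨a, h⟩ := (redMap_eq_iff hU).1 h
  rw [← h]
  exact A.smul_mem a _ hx'

lemma mem_redChart_target (hU : (𝓡∂ (d + 1)).boundary M ⊆ U) {z₀ : redSet d U} {y : Y} :
    y ∈ (A.redChart hU z₀).target ↔ ‖y‖ < A.r := mem_ball_zero_iff

lemma redChart_symm_apply (hU : (𝓡∂ (d + 1)).boundary M ⊆ U) {z₀ : redSet d U} {y : Y}
    (hy : ‖y‖ < A.r) : (A.redChart hU z₀).symm y =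
      redMap d U ⟨A.slice (y, 0), A.slice_zero_mem_boundary hy⟩ :=
  dif_pos (A.slice_zero_mem_boundary hy)

lemma redChart_redChart_symm (hU : (𝓡∂ (d + 1)).boundary M ⊆ U) {z₀ z₁ : redSet d U} {y : Y}
    (hy : y ∈ (A.redChart hU z₀).target)
    (hy' : (A.redChart hU z₀).symm y ∈ (A'.redChart hU z₁).source) :
    (y, (0 : ℝ)) ∈ A.overlap A' ∧
      A'.redChart hU z₁ ((A.redChart hU z₀).symm y) = (A.transSlice A' (y, 0)).1 := by
  rw [mem_redChart_target] at hy
  rw [A.redChart_symm_apply hU hy, redMap_mem_redChart_source] at hy'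
  refine ⟨⟨mem_halfBall_zero_iff.2 hy, hy'⟩, ?_⟩
  rw [A.redChart_symm_apply hU hy, A'.redChart_apply hU z₁ hy']
  rfl

lemma contDiffAt_redChart_symm (hU : (𝓡∂ (d + 1)).boundary M ⊆ U) {z₀ z₁ : redSet d U} {y : Y}
    (hy : y ∈ (A.redChart hU z₀).target)
    (hy' : (A.redChart hU z₀).symm y ∈ (A'.redChart hU z₁).source) :
    ContDiffAt ℝ ∞ (fun y => A'.redChart hU z₁ ((A.redChart hU z₀).symm y)) y := by
  have h1 := ((A.redChart hU z₀).isOpen_inter_preimage_symm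
    (A'.redChart hU z₁).open_source).mem_nhds ⟨hy, hy'⟩
  refine ContDiffOn.contDiffAt (s := (A.redChart hU z₀).target ∩
    (A.redChart hU z₀).symm ⁻¹' (A'.redChart hU z₁).source) ?_ h1
  have h2 : ContDiffOn ℝ ∞ (fun y : Y => (A.transSlice A' (y, 0)).1)
      ((A.redChart hU z₀).target ∩ (A.redChart hU z₀).symm ⁻¹' (A'.redChart hU z₁).source) :=
    contDiff_fst.comp_contDiffOn ((A.contDiffOn_transSlice A').comp
      (contDiff_id.prodMk contDiff_const).contDiffOn fun y hy =>
        (A.redChart_redChart_symm A' hU (z₁ := z₁) hy.1 hy.2).1)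
  exact h2.congr fun y hy => (A.redChart_redChart_symm A' hU hy.1 hy.2).2

end AdaptedChart

variable (d U Y) in
/-- A choice of an adapted chart near each orbit in the boundary. -/
structure CutAtlas (V : Set U) where
  pt : redSet d U → U
  cutMap_pt : ∀ z, cutMap d U (pt z) = z
  chart : ∀ z, AdaptedChart d U Y V (pt z)

lemma exists_cutAtlas [T2Space M] (hfree : ∀ (a : Circle) (x : U), a • x = x → a = 1)
    [FiniteDimensional ℝ Y] (hY : Module.finrank ℝ Y + 1 = d)
    (hU : (𝓡∂ (d + 1)).boundary M ⊆ U) {V : Set U} (hV : IsInvariantNhd d U V) :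
    Nonempty (CutAtlas d U Y V) := by
  have h : ∀ z : redSet d U, ∃ p : U, (p : M) ∈ (𝓡∂ (d + 1)).boundary M ∧ cutMap d U p = z := by
    rintro ⟨_, x, hx, rfl⟩
    exact ⟨⟨x, hU hx⟩, hx, rfl⟩
  choose p hpb hp using h
  exact ⟨⟨p, hp, fun z => (nonempty_adaptedChart hfree hY (hpb z) hV.isOpen hV.smul_mem
    (hV.boundary_subset _ (hpb z))).some⟩⟩

namespace CutAtlas

variable {V : Set U} (𝒜 : CutAtlas d U Y V)

lemma pt_mem_boundary (z : redSet d U) : (𝒜.pt z : M) ∈ (𝓡∂ (d + 1)).boundary M := by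
  rw [← cutMap_mem_redSet_iff (U := U), 𝒜.cutMap_pt]
  exact z.2

lemma pt_mem_dom (z : redSet d U) : 𝒜.pt z ∈ (𝒜.chart z).dom := by
  have h := (𝒜.chart z).slice_mem 0 ⟨Metric.mem_ball_self (𝒜.chart z).r_pos, le_refl (0 : ℝ)⟩
  rwa [(𝒜.chart z).slice_zero] at h

/-- The charts of the reduced space. -/
def redFamily (hU : (𝓡∂ (d + 1)).boundary M ⊆ U) (z : redSet d U) :
    OpenPartialHomeomorph (redSet d U) Y := (𝒜.chart z).redChart hU z

lemma mem_redFamily_source (hU : (𝓡∂ (d + 1)).boundary M ⊆ U) (z : redSet d U) :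
    z ∈ (𝒜.redFamily hU z).source :=
  ⟨⟨𝒜.pt z, 𝒜.pt_mem_boundary z⟩, 𝒜.pt_mem_dom z, Subtype.ext (𝒜.cutMap_pt z)⟩

/-- The smooth structure of the reduced space. -/
abbrev redChartedSpace (hU : (𝓡∂ (d + 1)).boundary M ⊆ U) : ChartedSpace Y (redSet d U) :=
  chartedSpaceOfFamily (𝒜.redFamily hU) (𝒜.mem_redFamily_source hU)

lemma isManifold_redSet (hU : (𝓡∂ (d + 1)).boundary M ⊆ U) :
    @IsManifold ℝ _ Y _ _ Y _ 𝓘(ℝ, Y) ∞ (redSet d U) _ (𝒜.redChartedSpace hU) :=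
  isManifold_chartedSpaceOfFamily _ _ fun z z' _ hv hv' =>
    (𝒜.chart z).contDiffAt_redChart_symm (𝒜.chart z') hU hv hv'

open Classical in
/-- The charts of the cut space. -/
def cutFamily (z : CutSpace d U) :
    OpenPartialHomeomorph (CutSpace d U) (EuclideanSpace ℝ (Fin (d + 1))) :=
  if h : z ∈ redSet d U then (𝒜.chart ⟨z, h⟩).cutChart
  else interiorChart U (surjInv surjective_cutMap z)

lemma cutFamily_of_mem {z : CutSpace d U} (h : z ∈ redSet d U) :
    𝒜.cutFamily z = (𝒜.chart ⟨z, h⟩).cutChart := dif_pos h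

lemma cutFamily_of_not_mem {z : CutSpace d U} (h : z ∉ redSet d U) :
    𝒜.cutFamily z = interiorChart U (surjInv surjective_cutMap z) := dif_neg h

lemma mem_cutFamily_source (z : CutSpace d U) : z ∈ (𝒜.cutFamily z).source := by
  by_cases h : z ∈ redSet d U
  · rw [𝒜.cutFamily_of_mem h]
    exact ⟨𝒜.pt ⟨z, h⟩, ⟨_, 𝒜.pt_mem_dom _, rfl⟩, 𝒜.cutMap_pt _⟩
  · rw [𝒜.cutFamily_of_not_mem h]
    have h1 := surjInv_eq (surjective_cutMap (d := d) (U := U)) z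
    have h2 : cutMap d U (surjInv surjective_cutMap z) ∈
        (interiorChart U (surjInv (surjective_cutMap (d := d) (U := U)) z)).source := by
      refine cutMap_mem_interiorChart_source.2
        ⟨mem_extChartAt_source (I := 𝓡∂ (d + 1)) (surjInv surjective_cutMap z), ?_⟩
      rw [← cutMap_not_mem_redSet_iff (U := U), h1]
      exact h
    rwa [h1] at h2

lemma isCutChart_cutFamily (z : CutSpace d U) : IsCutChart (𝒜.cutFamily z) := by
  by_cases h : z ∈ redSet d U
  · rw [𝒜.cutFamily_of_mem h]
    exact (𝒜.chart _).isCutChart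
  · rw [𝒜.cutFamily_of_not_mem h]
    exact isCutChart_interiorChart _

lemma mem_redSet_of_mem_cutFamily_source {z z' : CutSpace d U} (h : z' ∈ (𝒜.cutFamily z).source)
    (hz' : z' ∈ redSet d U) : z ∈ redSet d U := by
  by_contra hz
  rw [𝒜.cutFamily_of_not_mem hz] at h
  exact interiorChart_source_disjoint h hz'

/-- The smooth structure of the cut space. -/
abbrev cutChartedSpace : ChartedSpace (EuclideanSpace ℝ (Fin (d + 1))) (CutSpace d U) :=
  chartedSpaceOfFamily 𝒜.cutFamily 𝒜.mem_cutFamily_source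

/-- Interior charts miss the reduced space. At its points both charts are therefore adapted, and at
all other points the transition factors through the interior of M. -/
lemma contDiffAt_cutFamily_trans {z z' : CutSpace d U} {v : EuclideanSpace ℝ (Fin (d + 1))}
    (hv : v ∈ (𝒜.cutFamily z).target) (hv' : (𝒜.cutFamily z).symm v ∈ (𝒜.cutFamily z').source) :
    ContDiffAt ℝ ∞ (fun v => 𝒜.cutFamily z' ((𝒜.cutFamily z).symm v)) v := by
  by_cases hr : (𝒜.cutFamily z).symm v ∈ redSet d U
  · have h1 := 𝒜.mem_redSet_of_mem_cutFamily_source ((𝒜.cutFamily z).map_target hv) hr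
    have h2 := 𝒜.mem_redSet_of_mem_cutFamily_source hv' hr
    rw [𝒜.cutFamily_of_mem h1] at hv hv' ⊢
    rw [𝒜.cutFamily_of_mem h2] at hv' ⊢
    exact (𝒜.chart _).contDiffAt_cutChart_symm (𝒜.chart _) hv hv'
  · exact (𝒜.isCutChart_cutFamily z).contDiffAt_trans (𝒜.isCutChart_cutFamily z') hv hv' hr

lemma isManifold_cutSpace :
    @IsManifold ℝ _ (EuclideanSpace ℝ (Fin (d + 1))) _ _ (EuclideanSpace ℝ (Fin (d + 1))) _
      𝓘(ℝ, EuclideanSpace ℝ (Fin (d + 1))) ∞ (CutSpace d U) _ 𝒜.cutChartedSpace :=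
  isManifold_chartedSpaceOfFamily _ _ fun _ _ _ hv hv' => 𝒜.contDiffAt_cutFamily_trans hv hv'

end CutAtlas
end RedCharts


/-! ### One-forms given by local expressions. -/

section OneForms

variable {E F : Type*} [NormedAddCommGroup E] [NormedSpace ℝ E] [NormedAddCommGroup F]
  [NormedSpace ℝ F]

/-- Continuous linear functionals as alternating one-forms. -/
abbrev formOne (E : Type*) [NormedAddCommGroup E] [NormedSpace ℝ E] :
    (E →L[ℝ] ℝ) ≃ₗᵢ[ℝ] (E [⋀^Fin 1]→L[ℝ] ℝ) :=
  ContinuousAlternatingMap.ofSubsingletonLIE (0 : Fin 1)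

lemma formOne_comp (l : F →L[ℝ] ℝ) (L : E →L[ℝ] F) :
    (formOne F l).compContinuousLinearMap L = formOne E (l.comp L) := rfl

lemma extDerivWithin_formOne {b : E → E →L[ℝ] ℝ} {s : Set E} {x : E}
    (hs : UniqueDiffWithinAt ℝ s x) (v w : E) :
    extDerivWithin (fun x => formOne E (b x)) s x ![v, w] =
      fderivWithin ℝ b s x v w - fderivWithin ℝ b s x w v := by
  have h1 : fderivWithin ℝ (fun x => formOne E (b x)) s x =
      ((formOne E).toContinuousLinearEquiv : (E →L[ℝ] ℝ) →L[ℝ] _).comp (fderivWithin ℝ b s x) :=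
    (formOne E).toContinuousLinearEquiv.comp_fderivWithin hs
  rw [extDerivWithin, ContinuousAlternatingMap.alternatizeUncurryFin_apply, h1]
  simp [Fin.sum_univ_two, Fin.removeNth, sub_eq_add_neg]

lemma extDeriv_formOne {b : E → E →L[ℝ] ℝ} {x : E} (v w : E) :
    extDeriv (fun x => formOne E (b x)) x ![v, w] = fderiv ℝ b x v w - fderiv ℝ b x w v := by
  rw [← extDerivWithin_univ, extDerivWithin_formOne uniqueDiffWithinAt_univ, fderivWithin_univ]

end OneForms

section GluedForms

variable {E : Type*} [NormedAddCommGroup E] [NormedSpace ℝ E] {X : Type*} [TopologicalSpace X]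
  [ChartedSpace E X]
  {F : Type*} [NormedAddCommGroup F] [NormedSpace ℝ F] {H : Type*} [TopologicalSpace H]
  {J : ModelWithCorners ℝ F H} {N : Type*} [TopologicalSpace N] [ChartedSpace H N]

/-- The derivative of a map to a manifold is computed in the preferred chart. -/
lemma hasMFDerivAt_of_chart {f : N → X} {n : N} (hf : ContinuousAt f n)
    {L : TangentSpace J n →L[ℝ] E}
    (h : HasMFDerivAt J 𝓘(ℝ, E) (fun n' => chartAt E (f n) (f n')) n L) :
    HasMFDerivAt J 𝓘(ℝ, E) f n L := ⟨hf, h.2⟩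

/-- The one-form that is given in the preferred charts by the functionals `ζ x`. -/
def gluedForm (ζ : X → E → E →L[ℝ] ℝ) : DiffForm 𝓘(ℝ, E) X 1 :=
  fun x => formOne E (ζ x (chartAt E x x))

/-- Compatibility of local one-forms with the transitions to the preferred charts. -/
def IsCompatible (ζ : X → E → E →L[ℝ] ℝ) : Prop :=
  ∀ x₀ : X, ∀ v ∈ (chartAt E x₀).target,
    ζ x₀ v = (ζ ((chartAt E x₀).symm v) (chartAt E ((chartAt E x₀).symm v)
      ((chartAt E x₀).symm v))).comp
      (fderiv ℝ (fun v' => chartAt E ((chartAt E x₀).symm v) ((chartAt E x₀).symm v')) v)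

variable [IsManifold 𝓘(ℝ, E) ∞ X]

lemma differentiableAt_chart_symm (x₀ : X) {v : E} (hv : v ∈ (chartAt E x₀).target) :
    DifferentiableAt ℝ
      (fun v' => chartAt E ((chartAt E x₀).symm v) ((chartAt E x₀).symm v')) v := by
  have h1 : ContMDiffAt 𝓘(ℝ, E) 𝓘(ℝ, E) ∞ (chartAt E x₀).symm v :=
    contMDiffOn_chart_symm.contMDiffAt ((chartAt E x₀).open_target.mem_nhds hv)
  have h2 : ContMDiffAt 𝓘(ℝ, E) 𝓘(ℝ, E) ∞ (chartAt E ((chartAt E x₀).symm v))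
      ((chartAt E x₀).symm v) :=
    contMDiffOn_chart.contMDiffAt ((chartAt E _).open_source.mem_nhds (mem_chart_source E _))
  exact (contMDiffAt_iff_contDiffAt.1 (h2.comp v h1)).differentiableAt (by simp)

/-- The tangent space at a point is identified with E by the preferred chart there. Thus the
derivative of an inverse chart is that of the transition to the preferred chart at the image point,
which is why `IsCompatible` is phrased with this transition. -/
lemma mfderivWithin_extChartAt_symm_self (x₀ : X) {v : E} (hv : v ∈ (chartAt E x₀).target) :
    mfderivWithin 𝓘(ℝ, E) 𝓘(ℝ, E) (extChartAt 𝓘(ℝ, E) x₀).symm (range 𝓘(ℝ, E)) v =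
      fderiv ℝ (fun v' => chartAt E ((chartAt E x₀).symm v) ((chartAt E x₀).symm v')) v := by
  rw [modelWithCornersSelf_coe, range_id, mfderivWithin_univ]
  refine HasMFDerivAt.mfderiv (hasMFDerivAt_of_chart
    ((chartAt E x₀).continuousAt_symm hv) ?_)
  exact (differentiableAt_chart_symm x₀ hv).hasFDerivAt.hasMFDerivAt

lemma gluedForm_inChart {ζ : X → E → E →L[ℝ] ℝ} (hζ : IsCompatible ζ) (x₀ : X) {v : E}
    (hv : v ∈ (chartAt E x₀).target) : (gluedForm ζ).inChart x₀ v = formOne E (ζ x₀ v) := by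
  rw [DiffForm.inChart, mfderivWithin_extChartAt_symm_self x₀ hv, hζ x₀ v hv]
  rfl

lemma isSmooth_gluedForm {ζ : X → E → E →L[ℝ] ℝ} (hζ : IsCompatible ζ)
    (hs : ∀ x, ContDiffOn ℝ ∞ (ζ x) (chartAt E x).target) : (gluedForm ζ).IsSmooth := by
  intro x₀
  rw [show (extChartAt 𝓘(ℝ, E) x₀).target = (chartAt E x₀).target by simp [mfld_simps]]
  exact ((formOne E).toContinuousLinearEquiv.contDiff.comp_contDiffOn (hs x₀)).congr
    fun v hv => gluedForm_inChart hζ x₀ hv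

lemma gluedForm_d {ζ : X → E → E →L[ℝ] ℝ} (hζ : IsCompatible ζ) (x : X) :
    (gluedForm ζ).d x = extDeriv (fun v => formOne E (ζ x v)) (chartAt E x x) := by
  rw [DiffForm.d, modelWithCornersSelf_coe, range_id, extDerivWithin_univ]
  refine Filter.EventuallyEq.extDeriv_eq ?_
  filter_upwards [(chartAt E x).open_target.mem_nhds (mem_chart_target E x)] with v hv
  exact gluedForm_inChart hζ x hv

/-- The exterior derivative at x is computed in the preferred chart at x, so contactness has to be
tested only at the image of x in that chart. -/
lemma isContactForm_gluedForm {m : ℕ} (hdim : Module.finrank ℝ E = 2 * m + 1)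
    {ζ : X → E → E →L[ℝ] ℝ} (hζ : IsCompatible ζ)
    (hs : ∀ x, ContDiffOn ℝ ∞ (ζ x) (chartAt E x).target)
    (hc : ∀ x, ∀ v, ζ x (chartAt E x x) v = 0 → (∀ w, ζ x (chartAt E x x) w = 0 →
      fderiv ℝ (ζ x) (chartAt E x x) v w - fderiv ℝ (ζ x) (chartAt E x x) w v = 0) → v = 0) :
    IsContactForm m (gluedForm ζ) where
  finrank_eq := hdim
  isSmooth := isSmooth_gluedForm hζ hs
  wedge_ne_zero x := by
    have : FiniteDimensional ℝ E := Module.finite_of_finrank_pos (by omega)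
    refine wedge_ne_zero_of_isContactPair (V := E) hdim ?_
    intro v hv hvw
    refine hc x v hv fun w hw => ?_
    have h1 := hvw w hw
    rw [gluedForm_d hζ] at h1
    have h2 : toBilin (V := E) (extDeriv (fun v => formOne E (ζ x v))
      (chartAt E x x)).toAlternatingMap v w = 0 := h1
    rw [toBilin_apply] at h2
    exact (extDeriv_formOne v w).symm.trans h2

/-- The value of a form at a point is its expression in the preferred chart. -/
lemma inChart_self (β : DiffForm 𝓘(ℝ, E) X 1) (x : X) : β.inChart x (chartAt E x x) = β x := by
  have h1 := mfderivWithin_extChartAt_symm_self x (mem_chart_target E x)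
  have h3 : (extChartAt 𝓘(ℝ, E) x).symm (chartAt E x x) = x :=
    (chartAt E x).left_inv (mem_chart_source E x)
  have h2 : fderiv ℝ (fun v' => chartAt E ((chartAt E x).symm (chartAt E x x))
      ((chartAt E x).symm v')) (chartAt E x x) = ContinuousLinearMap.id ℝ E := by
    refine HasFDerivAt.fderiv ((hasFDerivAt_id _).congr_of_eventuallyEq ?_)
    filter_upwards [(chartAt E x).open_target.mem_nhds (mem_chart_target E x)] with v hv
    rw [(chartAt E x).left_inv (mem_chart_source E x)]
    exact (chartAt E x).right_inv hv
  ext w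
  rw [DiffForm.inChart, h1, h2]
  change (β ((extChartAt 𝓘(ℝ, E) x).symm (chartAt E x x)) : E [⋀^Fin 1]→L[ℝ] ℝ) w =
    (β x : E [⋀^Fin 1]→L[ℝ] ℝ) w
  rw [h3]

/-- Forms are determined by their expressions in charts on dense subsets. -/
lemma diffForm_ext_of_dense {β β' : DiffForm 𝓘(ℝ, E) X 1} (hβ : β.IsSmooth) (hβ' : β'.IsSmooth)
    {S : X → Set E} (hS : ∀ x, (chartAt E x).target ⊆ closure ((chartAt E x).target ∩ S x))
    (h : ∀ x, ∀ v ∈ (chartAt E x).target ∩ S x, β.inChart x v = β'.inChart x v) : β = β' := by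
  funext x
  rw [← inChart_self β x, ← inChart_self β' x]
  have htgt : (extChartAt 𝓘(ℝ, E) x).target = (chartAt E x).target := by simp [mfld_simps]
  have h1 := (hβ x).continuousOn
  have h2 := (hβ' x).continuousOn
  rw [htgt] at h1 h2
  exact EqOn.of_subset_closure (h x) h1 h2 inter_subset_left (hS x) (mem_chart_target E x)

end GluedForms


section Covectors

variable {E : Type*} [NormedAddCommGroup E] [NormedSpace ℝ E] {H : Type*} [TopologicalSpace H]
  {I : ModelWithCorners ℝ E H} {M : Type*} [TopologicalSpace M] [ChartedSpace H M]

/-- The value of a one-form at a point, as a functional on the model space. -/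
def covec (β : DiffForm I M 1) (x : M) : E →L[ℝ] ℝ := (formOne E).symm (β x)

/-- The expression of a one-form in a chart, as a functional on the model space. -/
def chartCovec (β : DiffForm I M 1) (x₀ : M) (y : E) : E →L[ℝ] ℝ := (formOne E).symm (β.inChart x₀ y)

lemma contDiffOn_chartCovec {β : DiffForm I M 1} (hβ : β.IsSmooth) (x₀ : M) :
    ContDiffOn ℝ ∞ (chartCovec β x₀) (extChartAt I x₀).target :=
  (formOne E).symm.toContinuousLinearEquiv.contDiff.comp_contDiffOn (hβ x₀)

lemma chartCovec_eq (β : DiffForm I M 1) (x₀ : M) (y : E) :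
    chartCovec β x₀ y = (covec β ((extChartAt I x₀).symm y)).comp
      (mfderivWithin 𝓘(ℝ, E) I (extChartAt I x₀).symm (range I) y : E →L[ℝ] E) := rfl

variable [IsManifold I ∞ M]

lemma covec_eq_chartCovec (β : DiffForm I M 1) {x₀ x : M} (hx : x ∈ (extChartAt I x₀).source) :
    covec β x = (chartCovec β x₀ (extChartAt I x₀ x)).comp
      (mfderiv I 𝓘(ℝ, E) (extChartAt I x₀) x : E →L[ℝ] E) := by
  have : IsManifold I 1 M := IsManifold.of_le (n := ∞) (by simp)
  have h1 : (mfderivWithin 𝓘(ℝ, E) I (extChartAt I x₀).symm (range I) (extChartAt I x₀ x) :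
      E →L[ℝ] E).comp (mfderiv I 𝓘(ℝ, E) (extChartAt I x₀) x : E →L[ℝ] E) =
      ContinuousLinearMap.id ℝ E :=
    mfderivWithin_extChartAt_symm_comp_mfderiv_extChartAt' hx
  ext v
  refine Eq.trans ?_ (congrArg (fun L : E →L[ℝ] E => covec β ((extChartAt I x₀).symm
    (extChartAt I x₀ x)) (L v)) h1).symm
  rw [(extChartAt I x₀).left_inv hx]
  rfl

lemma chartCovec_self (β : DiffForm I M 1) (x : M) :
    chartCovec β x (extChartAt I x x) = covec β x := by
  have : IsManifold I 1 M := IsManifold.of_le (n := ∞) (by simp)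
  have h1 : (mfderiv I 𝓘(ℝ, E) (extChartAt I x) x : E →L[ℝ] E) = ContinuousLinearMap.id ℝ E :=
    mfderiv_extChartAt_self
  rw [covec_eq_chartCovec β (mem_extChartAt_source x)]
  exact (congrArg (fun L : E →L[ℝ] E => (chartCovec β x (extChartAt I x x)).comp L) h1).symm

end Covectors

/-! ### Pullback of invariant forms along the orbits of a slice. -/

section SlicePullback

variable {d : ℕ} {M : Type*} [TopologicalSpace M] [ChartedSpace (EuclideanHalfSpace (d + 1)) M]
  [IsManifold (𝓡∂ (d + 1)) ∞ M]
  {U : TopologicalSpace.Opens M} [MulAction Circle U]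
  [ContMDiffSMul (𝓡 1) (𝓡∂ (d + 1)) ∞ Circle U]
  {Y : Type} [NormedAddCommGroup Y] [NormedSpace ℝ Y]

/-- Invariance of a one-form on a subset of `U`. -/
def InvariantOn (β : DiffForm (𝓡∂ (d + 1)) M 1) (V : Set U) : Prop :=
  ∀ a : Circle, ∀ x ∈ V,
    DiffForm.pullback (𝓡∂ (d + 1)) (𝓡∂ (d + 1)) (fun y : U => ((a • y : U) : M)) β x =
      DiffForm.pullback (𝓡∂ (d + 1)) (𝓡∂ (d + 1)) (fun y : U => (y : M)) β x

variable (Y) in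
/-- The closed half space of `ℝ × (Y × ℝ)`. -/
def flowCone : Set (ℝ × (Y × ℝ)) := univ ×ˢ upperHalf Y

lemma uniqueDiffOn_flowCone : UniqueDiffOn ℝ (flowCone Y) :=
  uniqueDiffOn_univ.prod uniqueDiffOn_upperHalf

namespace AdaptedChart

variable {V : Set U} {p p' : U} (A : AdaptedChart d U Y V p)

/-- The map `(τ, q) ↦ exp (iτ) • slice q`. -/
def flow (z : ℝ × (Y × ℝ)) : U := Circle.exp z.1 • A.slice z.2

lemma flow_mem {z : ℝ × (Y × ℝ)} (hz : z.2 ∈ halfBall Y A.r) : A.flow z ∈ A.dom :=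
  A.smul_mem _ _ (A.slice_mem _ hz)

lemma contMDiffOn_flow : ContMDiffOn 𝓘(ℝ, ℝ × (Y × ℝ)) (𝓡∂ (d + 1)) ∞ A.flow
    (univ ×ˢ halfBall Y A.r) := by
  have hsm : ContMDiff ((𝓡 1).prod (𝓡∂ (d + 1))) (𝓡∂ (d + 1)) ∞
    (fun z : Circle × U => z.1 • z.2) := ContMDiffSMul.contMDiff_smul
  exact hsm.comp_contMDiffOn ((contMDiff_circleExp.comp contDiff_fst.contMDiff).contMDiffOn.prodMk
    (A.contMDiffOn_slice.comp contDiff_snd.contMDiff.contMDiffOn fun z hz => hz.2))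

lemma halfBall_mem_nhdsWithin {z : ℝ × (Y × ℝ)} (hz : z.2 ∈ halfBall Y A.r) :
    univ ×ˢ halfBall Y A.r ∈ 𝓝[flowCone Y] z := by
  have h1 : Prod.snd ⁻¹' Metric.ball 0 A.r ∈ 𝓝 z :=
    (Metric.isOpen_ball.preimage continuous_snd).mem_nhds hz.1
  filter_upwards [mem_nhdsWithin_of_mem_nhds h1, self_mem_nhdsWithin] with z' h2 h3
  exact ⟨mem_univ _, h2, h3.2⟩

lemma contMDiffWithinAt_flow {z : ℝ × (Y × ℝ)} (hz : z.2 ∈ halfBall Y A.r) :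
    ContMDiffWithinAt 𝓘(ℝ, ℝ × (Y × ℝ)) (𝓡∂ (d + 1)) ∞ A.flow (flowCone Y) z :=
  (A.contMDiffOn_flow z ⟨mem_univ _, hz⟩).mono_of_mem_nhdsWithin (A.halfBall_mem_nhdsWithin hz)

lemma contMDiffWithinAt_coe_flow {z : ℝ × (Y × ℝ)} (hz : z.2 ∈ halfBall Y A.r) :
    ContMDiffWithinAt 𝓘(ℝ, ℝ × (Y × ℝ)) (𝓡∂ (d + 1)) ∞ (fun z => (A.flow z : M)) (flowCone Y) z :=
  contMDiff_subtype_val.contMDiffAt.comp_contMDiffWithinAt z (A.contMDiffWithinAt_flow hz)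

/-- The pullback of a one-form under `(τ, q) ↦ exp (iτ) • slice q`. -/
def slicePull (β : DiffForm (𝓡∂ (d + 1)) M 1) (z : ℝ × (Y × ℝ)) : ℝ × (Y × ℝ) →L[ℝ] ℝ :=
  (covec β (A.flow z : M)).comp (mfderivWithin 𝓘(ℝ, ℝ × (Y × ℝ)) (𝓡∂ (d + 1))
    (fun z => (A.flow z : M)) (flowCone Y) z :
      ℝ × (Y × ℝ) →L[ℝ] EuclideanSpace ℝ (Fin (d + 1)))

variable {β : DiffForm (𝓡∂ (d + 1)) M 1}
  {F : Type*} [NormedAddCommGroup F] [NormedSpace ℝ F] {H : Type*} [TopologicalSpace H]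
  {J : ModelWithCorners ℝ F H} {N : Type*} [TopologicalSpace N] [ChartedSpace H N]

/-- The pullback of an invariant one-form under a map of the form
`n ↦ a • exp (iτ(n)) • slice (q(n))`. -/
lemma exists_hasMFDerivWithinAt_flow
    (hβ : InvariantOn β V)
    {κ : N → ℝ × (Y × ℝ)} {S : Set N} {n : N} {K : F →L[ℝ] ℝ × (Y × ℝ)}
    (hκ : HasMFDerivWithinAt J 𝓘(ℝ, ℝ × (Y × ℝ)) κ S n K) (hS : MapsTo κ S (flowCone Y))
    (hn : (κ n).2 ∈ halfBall Y A.r) (a : Circle) {h : N → M}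
    (hh : h =ᶠ[𝓝[S] n] fun n => ((a • A.flow (κ n) : U) : M))
    (hhn : h n = ((a • A.flow (κ n) : U) : M)) :
    ∃ L : F →L[ℝ] EuclideanSpace ℝ (Fin (d + 1)), HasMFDerivWithinAt J (𝓡∂ (d + 1)) h S n L ∧
      (covec β (h n)).comp L = (A.slicePull β (κ n)).comp K := by
  have h1 := ((A.contMDiffWithinAt_flow hn).mdifferentiableWithinAt
    (by simp)).hasMFDerivWithinAt
  have h2 : MDifferentiableAt (𝓡∂ (d + 1)) (𝓡∂ (d + 1)) (fun y : U => ((a • y : U) : M))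
      (A.flow (κ n)) :=
    ((contMDiff_subtype_val.comp (contMDiff_smul_left (d := d) a)).mdifferentiable (by simp)) _
  have h3 : MDifferentiableAt (𝓡∂ (d + 1)) (𝓡∂ (d + 1)) (fun y : U => (y : M))
      (A.flow (κ n)) :=
    (contMDiff_subtype_val.mdifferentiable (n := ∞) (by simp)) _
  have h4 := h1.comp n hκ hS
  have h5 := HasMFDerivAt.comp_hasMFDerivWithinAt (f := A.flow ∘ κ) n h2.hasMFDerivAt h4
  refine ⟨_, h5.congr_of_eventuallyEq hh hhn, ?_⟩
  have hun : UniqueMDiffWithinAt 𝓘(ℝ, ℝ × (Y × ℝ)) (flowCone Y) (κ n) :=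
    (uniqueDiffOn_flowCone _ ⟨mem_univ _, hn.2⟩).uniqueMDiffWithinAt
  have h6 := (HasMFDerivAt.comp_hasMFDerivWithinAt (κ n) h3.hasMFDerivAt h1).mfderivWithin hun
  -- Invariance of β at the point `A.flow (κ n)`, which lies in V because the domain of the adapted
  -- chart does; it removes the rotation by a.
  have h7 : (covec β ((a • A.flow (κ n) : U) : M)).comp
      (mfderiv (𝓡∂ (d + 1)) (𝓡∂ (d + 1)) (fun y : U => ((a • y : U) : M)) (A.flow (κ n)) :
        EuclideanSpace ℝ (Fin (d + 1)) →L[ℝ] EuclideanSpace ℝ (Fin (d + 1))) =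
      (covec β (A.flow (κ n) : M)).comp
      (mfderiv (𝓡∂ (d + 1)) (𝓡∂ (d + 1)) (fun y : U => (y : M)) (A.flow (κ n)) :
        EuclideanSpace ℝ (Fin (d + 1)) →L[ℝ] EuclideanSpace ℝ (Fin (d + 1))) :=
    congrArg (formOne (EuclideanSpace ℝ (Fin (d + 1)))).symm
      (hβ a _ (A.dom_subset (A.flow_mem hn)))
  rw [slicePull, hhn]
  ext v
  have h8 := congrArg (fun l => l ((mfderivWithin 𝓘(ℝ, ℝ × (Y × ℝ)) (𝓡∂ (d + 1)) A.flow
    (flowCone Y) (κ n) : ℝ × (Y × ℝ) →L[ℝ] EuclideanSpace ℝ (Fin (d + 1))) (K v))) h7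
  refine Eq.trans h8 ?_
  refine Eq.symm ?_
  exact congrArg (fun L : ℝ × (Y × ℝ) →L[ℝ] EuclideanSpace ℝ (Fin (d + 1)) =>
    covec β (A.flow (κ n) : M) (L (K v))) h6

lemma flow_zero_left (q : Y × ℝ) : A.flow (0, q) = A.slice q := by simp [flow]

/-- A shift of τ is a rotation, and rotations preserve β. Hence the coefficients of the pulled back
form depend on the slice coordinate only. -/
lemma slicePull_eq_zero
    (hβ : InvariantOn β V)
    (τ : ℝ) {q : Y × ℝ} (hq : q ∈ halfBall Y A.r) :
    A.slicePull β (τ, q) = A.slicePull β (0, q) := by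
  set κ : ℝ × (Y × ℝ) → ℝ × (Y × ℝ) := fun z => (z.1 - τ, z.2) with hκ
  have hκd : HasMFDerivWithinAt 𝓘(ℝ, ℝ × (Y × ℝ)) 𝓘(ℝ, ℝ × (Y × ℝ)) κ (flowCone Y) (τ, q)
      (ContinuousLinearMap.id ℝ (ℝ × (Y × ℝ))) := by
    have h1 : HasFDerivAt κ (ContinuousLinearMap.id ℝ (ℝ × (Y × ℝ))) (τ, q) :=
      ((hasFDerivAt_id (τ, q)).sub_const (τ, (0 : Y × ℝ))).congr_of_eventuallyEq
        (Filter.Eventually.of_forall fun z => by simp [hκ, Prod.ext_iff])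
    exact h1.hasFDerivWithinAt.hasMFDerivWithinAt
  have hκq : κ (τ, q) = (0, q) := by simp [hκ]
  have hfl : ∀ z, (A.flow z : M) = ((Circle.exp τ • A.flow (κ z) : U) : M) := by
    intro z
    rw [flow, flow, smul_smul, ← Circle.exp_add, hκ, add_sub_cancel]
  obtain ⟨L, hL, h⟩ := A.exists_hasMFDerivWithinAt_flow hβ hκd (fun z hz => ⟨mem_univ _, hz.2⟩)
    hq (Circle.exp τ) (h := fun z => (A.flow z : M)) (Filter.Eventually.of_forall hfl) (hfl _)
  have hun : UniqueMDiffWithinAt 𝓘(ℝ, ℝ × (Y × ℝ)) (flowCone Y) (τ, q) :=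
    (uniqueDiffOn_flowCone (τ, q) ⟨mem_univ _, hq.2⟩).uniqueMDiffWithinAt
  rw [ContinuousLinearMap.comp_id, hκq] at h
  rw [← h]
  have h1 : (mfderivWithin 𝓘(ℝ, ℝ × (Y × ℝ)) (𝓡∂ (d + 1)) (fun z => (A.flow z : M)) (flowCone Y)
    (τ, q) : ℝ × (Y × ℝ) →L[ℝ] EuclideanSpace ℝ (Fin (d + 1))) = L := hL.mfderivWithin hun
  rw [← h1]
  rfl

/-- The angular component of the pullback vanishes along the boundary. -/
lemma slicePull_angular_eq_zero
    (hβ : InvariantOn β V)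
    {hU : (𝓡∂ (d + 1)).boundary M ⊆ U} (hb : IsBasicOnBoundary U hU β)
    {q : Y × ℝ} (hq : q ∈ halfBall Y A.r) (h0 : q.2 = 0) :
    A.slicePull β (0, q) (1, 0) = 0 := by
  set κ : ℝ → ℝ × (Y × ℝ) := fun t => (t, q) with hκ
  have hκd : HasMFDerivWithinAt 𝓘(ℝ, ℝ) 𝓘(ℝ, ℝ × (Y × ℝ)) κ univ 0
      (ContinuousLinearMap.inl ℝ ℝ (Y × ℝ)) :=
    (hasFDerivAt_prodMk_left (𝕜 := ℝ) (0 : ℝ) q).hasMFDerivAt.hasMFDerivWithinAt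
  have hqb := (A.slice_mem_boundary_iff hq).2 h0
  obtain ⟨L, hL, h⟩ := A.exists_hasMFDerivWithinAt_flow hβ hκd (fun z hz => ⟨mem_univ _, hq.2⟩)
    hq 1 (h := fun t : ℝ => ((Circle.exp t • (⟨A.slice q, hU hqb⟩ : U) : U) : M))
    (Filter.Eventually.of_forall fun t =>
      congrArg Subtype.val (one_smul Circle (A.flow (κ t))).symm)
    (congrArg Subtype.val (one_smul Circle (A.flow (κ 0))).symm)
  have hL := hasMFDerivWithinAt_univ.1 hL
  have h1 := hb.horizontal ⟨A.slice q, hqb⟩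
  have h2 := congrArg (fun l => l (1 : ℝ)) h
  have h3 : (mfderiv 𝓘(ℝ, ℝ) (𝓡∂ (d + 1))
    (fun t : ℝ => ((Circle.exp t • (⟨A.slice q, hU hqb⟩ : U) : U) : M)) 0 :
      ℝ →L[ℝ] EuclideanSpace ℝ (Fin (d + 1))) = L := hL.mfderiv
  rw [← h3] at h2
  exact h2.symm.trans h1

section ChartExpression

/-- The expression of `flow` in the chart at the centre of an adapted chart. -/
def chartFlow (z : ℝ × (Y × ℝ)) : EuclideanSpace ℝ (Fin (d + 1)) :=
  extChartAt (𝓡∂ (d + 1)) (p : M) (A.flow z : M)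

/-- The parameters that `flow` maps into the chart at the centre. -/
def flowDom : Set (ℝ × (Y × ℝ)) :=
  {z | z.2 ∈ halfBall Y A.r ∧ (A.flow z : M) ∈ (extChartAt (𝓡∂ (d + 1)) (p : M)).source}

lemma exists_isOpen_flowDom : ∃ O, IsOpen O ∧ A.flowDom = O ∩ flowCone Y := by
  obtain ⟨O, hO, h⟩ := (continuousOn_iff'.1
    (continuous_subtype_val.comp_continuousOn A.contMDiffOn_flow.continuousOn)) _
    (isOpen_extChartAt_source (I := 𝓡∂ (d + 1)) (p : M))
  refine ⟨O ∩ Prod.snd ⁻¹' Metric.ball 0 A.r,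
    hO.inter (Metric.isOpen_ball.preimage continuous_snd), ?_⟩
  ext z
  have h1 : _ ↔ _ := Set.ext_iff.1 h z
  constructor
  · rintro ⟨hz, hz'⟩
    exact ⟨⟨(h1.1 ⟨hz', mem_univ _, hz⟩).1, hz.1⟩, mem_univ _, hz.2⟩
  · rintro ⟨⟨hz, hz'⟩, -, hz''⟩
    exact ⟨⟨hz', hz''⟩, (h1.2 ⟨hz, mem_univ _, hz', hz''⟩).1⟩

lemma zero_mem_flowDom {q : Y × ℝ} (hq : q ∈ halfBall Y A.r) : (0, q) ∈ A.flowDom := by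
  refine ⟨hq, ?_⟩
  rw [flow_zero_left, extChartAt_source]
  exact A.slice_mem_source q hq

lemma flowDom_mem_nhdsWithin {z : ℝ × (Y × ℝ)} (hz : z ∈ A.flowDom) :
    A.flowDom ∈ 𝓝[flowCone Y] z := by
  obtain ⟨O, hO, h⟩ := A.exists_isOpen_flowDom
  rw [h] at hz ⊢
  rw [inter_comm]
  exact inter_mem_nhdsWithin _ (hO.mem_nhds hz.1)

lemma contDiffOn_chartFlow : ContDiffOn ℝ ∞ A.chartFlow A.flowDom := by
  have h1 : ContMDiffOn (𝓡∂ (d + 1)) 𝓘(ℝ, EuclideanSpace ℝ (Fin (d + 1))) ∞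
      (extChartAt (𝓡∂ (d + 1)) (p : M)) (extChartAt (𝓡∂ (d + 1)) (p : M)).source := by
    rw [extChartAt_source]
    exact contMDiffOn_extChartAt
  exact contMDiffOn_iff_contDiffOn.1 (h1.comp (contMDiff_subtype_val.comp_contMDiffOn
    (A.contMDiffOn_flow.mono fun z hz => ⟨mem_univ _, hz.1⟩)) fun z hz => hz.2)

lemma fderivWithin_chartFlow {z : ℝ × (Y × ℝ)} (hz : z ∈ A.flowDom) :
    fderivWithin ℝ A.chartFlow (flowCone Y) z =
      (mfderiv (𝓡∂ (d + 1)) 𝓘(ℝ, EuclideanSpace ℝ (Fin (d + 1)))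
        (extChartAt (𝓡∂ (d + 1)) (p : M)) (A.flow z : M) :
        EuclideanSpace ℝ (Fin (d + 1)) →L[ℝ] EuclideanSpace ℝ (Fin (d + 1))).comp
      (mfderivWithin 𝓘(ℝ, ℝ × (Y × ℝ)) (𝓡∂ (d + 1)) (fun z => (A.flow z : M)) (flowCone Y) z :
        ℝ × (Y × ℝ) →L[ℝ] EuclideanSpace ℝ (Fin (d + 1))) := by
  have : IsManifold (𝓡∂ (d + 1)) 1 M := IsManifold.of_le (n := ∞) (by simp)
  have h1 := ((A.contMDiffWithinAt_coe_flow hz.1).mdifferentiableWithinAt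
    (by simp)).hasMFDerivWithinAt
  have hz' := hz.2
  rw [extChartAt_source] at hz'
  have h2 := (mdifferentiableAt_extChartAt (I := 𝓡∂ (d + 1)) hz').hasMFDerivAt
  have h3 := (HasMFDerivAt.comp_hasMFDerivWithinAt (f := fun z => (A.flow z : M)) z h2
    h1).hasFDerivWithinAt
  obtain ⟨L, hL, hL'⟩ : ∃ L : ℝ × (Y × ℝ) →L[ℝ] EuclideanSpace ℝ (Fin (d + 1)),
      HasFDerivWithinAt A.chartFlow L (flowCone Y) z ∧ L =
      (mfderiv (𝓡∂ (d + 1)) 𝓘(ℝ, EuclideanSpace ℝ (Fin (d + 1)))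
        (extChartAt (𝓡∂ (d + 1)) (p : M)) (A.flow z : M) :
        EuclideanSpace ℝ (Fin (d + 1)) →L[ℝ] EuclideanSpace ℝ (Fin (d + 1))).comp
      (mfderivWithin 𝓘(ℝ, ℝ × (Y × ℝ)) (𝓡∂ (d + 1)) (fun z => (A.flow z : M)) (flowCone Y) z :
        ℝ × (Y × ℝ) →L[ℝ] EuclideanSpace ℝ (Fin (d + 1))) := ⟨_, h3, rfl⟩
  rw [← hL']
  exact hL.fderivWithin (uniqueDiffOn_flowCone z ⟨mem_univ _, hz.1.2⟩)

lemma slicePull_eq_chartCovec {z : ℝ × (Y × ℝ)} (hz : z ∈ A.flowDom) :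
    A.slicePull β z = (chartCovec β (p : M) (A.chartFlow z)).comp
      (fderivWithin ℝ A.chartFlow (flowCone Y) z) := by
  rw [A.fderivWithin_chartFlow hz, slicePull, covec_eq_chartCovec β hz.2]
  rfl

/-- In the chart at the centre the pullback is the smooth chart expression of β composed with the
derivative of a smooth map on part of a half space. -/
lemma contDiffOn_slicePull (hβs : β.IsSmooth) :
    ContDiffOn ℝ ∞ (A.slicePull β) A.flowDom := by
  obtain ⟨O, hO, h⟩ := A.exists_isOpen_flowDom
  have hf := A.contDiffOn_chartFlow
  have h1 : ContDiffOn ℝ ∞ (fun z => chartCovec β (p : M) (A.chartFlow z)) A.flowDom :=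
    (contDiffOn_chartCovec hβs (p : M)).comp hf fun z hz =>
      (extChartAt (𝓡∂ (d + 1)) (p : M)).map_source hz.2
  have hun : UniqueDiffOn ℝ A.flowDom := by
    rw [h, inter_comm]
    exact uniqueDiffOn_flowCone.inter hO
  have h2 : ContDiffOn ℝ ∞ (fderivWithin ℝ A.chartFlow (flowCone Y)) A.flowDom := by
    refine (hf.fderivWithin hun (m := ∞) (by simp)).congr fun z hz => ?_
    -- `flowDom` is relatively open in the half space, so derivatives within either set agree.
    have h3 : A.flowDom =ᶠ[𝓝 z] flowCone Y := by
      rw [h]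
      exact (Filter.eventuallyEq_of_mem (hO.mem_nhds (h ▸ hz).1) fun z' hz' =>
        propext ⟨fun h => h.2, fun h => ⟨hz', h⟩⟩)
    exact (fderivWithin_congr_set h3).symm
  exact (h1.clm_comp h2).congr fun z hz => A.slicePull_eq_chartCovec hz

end ChartExpression

end AdaptedChart
end SlicePullback


/-! ### Local formulas for the cut form and the reduced form. -/

section LocalForms

/-- The functional `ζ ↦ Im (w̄ ζ)`. -/
def crossForm (w : ℂ) : ℂ →L[ℝ] ℝ := innerSL ℝ (Complex.I * w)

lemma crossForm_apply (w z : ℂ) : crossForm w z = (starRingEnd ℂ w * z).im := by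
  change inner ℝ (Complex.I * w) z = _
  rw [Complex.inner]
  simp
  ring

lemma contDiff_crossForm : ContDiff ℝ ∞ crossForm :=
  (innerSL ℝ).contDiff.comp (contDiff_const.mul contDiff_id)

/-- This is dθ = Im(w̄ dw) / |w|², with the argument measured from w so that the branch cut is
avoided. -/
lemma hasFDerivAt_arg_inv_mul {w : ℂ} (hw : w ≠ 0) :
    HasFDerivAt (fun z : ℂ => Complex.arg (w⁻¹ * z)) ((‖w‖ ^ 2)⁻¹ • crossForm w) w := by
  have h1 : HasDerivAt (fun z : ℂ => Complex.log (w⁻¹ * z)) w⁻¹ w := by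
    have h2 : HasDerivAt (fun z : ℂ => w⁻¹ * z) w⁻¹ w := by
      simpa using (hasDerivAt_id w).const_mul w⁻¹
    have h3 := (Complex.hasDerivAt_log (z := w⁻¹ * w) (by simp [hw])).comp w h2
    rw [inv_mul_cancel₀ hw, inv_one, one_mul] at h3
    exact h3
  have h4 := Complex.imCLM.hasFDerivAt.comp w (h1.hasFDerivAt.restrictScalars ℝ)
  have h5 : (Complex.imCLM : ℂ → ℝ) ∘ (fun z : ℂ => Complex.log (w⁻¹ * z)) =
      fun z => Complex.arg (w⁻¹ * z) := funext fun z => Complex.log_im _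
  rw [h5] at h4
  refine h4.congr_fderiv ?_
  refine ContinuousLinearMap.ext fun z => ?_
  rw [smul_apply, crossForm_apply, ← Complex.normSq_eq_norm_sq]
  change (z * w⁻¹).im = _
  rw [Complex.inv_def, smul_eq_mul]
  simp
  ring

variable {d : ℕ} {M : Type*} [TopologicalSpace M] [ChartedSpace (EuclideanHalfSpace (d + 1)) M]
  [IsManifold (𝓡∂ (d + 1)) ∞ M]
  {U : TopologicalSpace.Opens M} [MulAction Circle U]
  [ContMDiffSMul (𝓡 1) (𝓡∂ (d + 1)) ∞ Circle U]
  {Y : Type} [NormedAddCommGroup Y] [NormedSpace ℝ Y]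

/-- In the chart of the boundary induced by a chart of M, the inclusion is the inclusion of the
boundary hyperplane. -/
lemma contMDiff_boundary_val :
    ContMDiff (𝓡 d) (𝓡∂ (d + 1)) ∞ (Subtype.val : (𝓡∂ (d + 1)).boundary M → M) := by
  intro x
  rw [contMDiffAt_iff]
  refine ⟨continuous_subtype_val.continuousAt, ?_⟩
  refine ContDiffAt.contDiffWithinAt ?_
  refine (contDiff_euclCons d).contDiffAt.congr_of_eventuallyEq ?_
  filter_upwards [(chartAt (EuclideanSpace ℝ (Fin d)) x).open_target.mem_nhds
    (mem_chart_target _ x)] with y hy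
  have hy' : halfCons d y ∈ (chartAt (EuclideanHalfSpace (d + 1)) (x : M)).target := hy
  have h1 : (((chartAt (EuclideanSpace ℝ (Fin d)) x).symm y : (𝓡∂ (d + 1)).boundary M) : M) =
      (chartAt (EuclideanHalfSpace (d + 1)) (x : M)).symm (halfCons d y) :=
    congrArg Subtype.val (dif_pos hy')
  change (chartAt (EuclideanHalfSpace (d + 1)) (x : M)
    ((chartAt (EuclideanSpace ℝ (Fin d)) x).symm y : (𝓡∂ (d + 1)).boundary M)).1 = euclCons d y
  rw [h1, (chartAt (EuclideanHalfSpace (d + 1)) (x : M)).right_inv hy']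
  rfl

lemma contMDiff_bdryPt (hU : (𝓡∂ (d + 1)).boundary M ⊆ U) :
    ContMDiff (𝓡 d) (𝓡∂ (d + 1)) ∞ (bdryPt hU) := fun x =>
  contMDiffAt_iff.2 ⟨(AdaptedChart.continuous_bdryPt hU).continuousAt,
    (contMDiffAt_iff.1 (contMDiff_boundary_val x)).2⟩

variable (Y) in
/-- The derivative of `(y, w) ↦ (y, ‖w‖ ^ 2)`. -/
def sqDeriv (w : ℂ) : Y × ℂ →L[ℝ] Y × ℝ :=
  (ContinuousLinearMap.fst ℝ Y ℂ).prod
    (((2 : ℝ) • innerSL ℝ w).comp (ContinuousLinearMap.snd ℝ Y ℂ))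

lemma hasFDerivAt_sq (v : Y × ℂ) :
    HasFDerivAt (fun v : Y × ℂ => (v.1, ‖v.2‖ ^ 2)) (sqDeriv Y v.2) v := by
  have h1 : HasFDerivAt (fun v : Y × ℂ => ‖v.2‖ ^ 2)
      (((2 : ℝ) • innerSL ℝ v.2).comp (ContinuousLinearMap.snd ℝ Y ℂ)) v :=
    ((hasStrictFDerivAt_norm_sq v.2).hasFDerivAt.comp v hasFDerivAt_snd).congr_fderiv (by
      ext <;> simp
      ring)
  exact hasFDerivAt_fst.prodMk h1

lemma contDiff_sqDeriv : ContDiff ℝ ∞ (sqDeriv Y) := by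
  have h1 : ContDiff ℝ ∞ (fun w : ℂ => ((2 : ℝ) • innerSL ℝ w).comp
      (ContinuousLinearMap.snd ℝ Y ℂ)) :=
    ((innerSL ℝ).contDiff.const_smul (2 : ℝ)).clm_comp contDiff_const
  have h2 : sqDeriv Y = fun w => (ContinuousLinearMap.inl ℝ Y ℝ).comp
      (ContinuousLinearMap.fst ℝ Y ℂ) + (ContinuousLinearMap.inr ℝ Y ℝ).comp
        (((2 : ℝ) • innerSL ℝ w).comp (ContinuousLinearMap.snd ℝ Y ℂ)) := by
    ext w v <;> simp [sqDeriv]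
  rw [h2]
  exact contDiff_const.add (contDiff_const.clm_comp h1)

namespace AdaptedChart

variable {V : Set U} {p p' : U} (A : AdaptedChart d U Y V p)

lemma contMDiffAt_pr_bdryPt {hU : (𝓡∂ (d + 1)).boundary M ⊆ U}
    {x : (𝓡∂ (d + 1)).boundary M} (hx : bdryPt hU x ∈ A.dom) :
    ContMDiffAt (𝓡 d) 𝓘(ℝ, Y × ℝ) ∞ (fun x => A.pr (bdryPt hU x)) x :=
  (A.contMDiffOn_pr.contMDiffAt (A.isOpen_dom.mem_nhds hx)).comp x
    (contMDiff_bdryPt hU).contMDiffAt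

lemma contMDiffAt_ang_bdryPt {hU : (𝓡∂ (d + 1)).boundary M ⊆ U}
    {x : (𝓡∂ (d + 1)).boundary M} (hx : bdryPt hU x ∈ A.dom) :
    ContMDiffAt (𝓡 d) (𝓡 1) ∞ (fun x => A.ang (bdryPt hU x)) x :=
  (A.contMDiffOn_ang.contMDiffAt (A.isOpen_dom.mem_nhds hx)).comp x
    (contMDiff_bdryPt hU).contMDiffAt

/-- The angular component of the pullback of a one-form to the slice. -/
def angular (β : DiffForm (𝓡∂ (d + 1)) M 1) (q : Y × ℝ) : ℝ := A.slicePull β (0, q) (1, 0)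

/-- The angular component divided by the normal coordinate. -/
def angularQuot (β : DiffForm (𝓡∂ (d + 1)) M 1) : Y × ℝ → ℝ := normalQuot (A.angular β)

/-- The expression of the cut form in the coordinates of `Y × ℂ`. -/
def cutForm (β : DiffForm (𝓡∂ (d + 1)) M 1) (v : Y × ℂ) : Y × ℂ →L[ℝ] ℝ :=
  (A.slicePull β (0, (v.1, ‖v.2‖ ^ 2))).comp
    ((ContinuousLinearMap.inr ℝ ℝ (Y × ℝ)).comp (sqDeriv Y v.2)) +
  A.angularQuot β (v.1, ‖v.2‖ ^ 2) • (crossForm v.2).comp (ContinuousLinearMap.snd ℝ Y ℂ)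

/-- The expression of the reduced form in the coordinates of `Y`. -/
def redForm (β : DiffForm (𝓡∂ (d + 1)) M 1) (y : Y) : Y →L[ℝ] ℝ :=
  (A.slicePull β (0, (y, 0))).comp
    ((ContinuousLinearMap.inr ℝ ℝ (Y × ℝ)).comp (ContinuousLinearMap.inl ℝ Y ℝ))

variable {β : DiffForm (𝓡∂ (d + 1)) M 1}

lemma contDiffOn_slicePull_zero (hβs : β.IsSmooth) :
    ContDiffOn ℝ ∞ (fun q => A.slicePull β (0, q)) (halfBall Y A.r) :=
  (A.contDiffOn_slicePull hβs).comp (contDiff_const.prodMk contDiff_id).contDiffOn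
    fun _ hq => A.zero_mem_flowDom hq

lemma contDiffOn_angular (hβs : β.IsSmooth) :
    ContDiffOn ℝ ∞ (A.angular β) (halfBall Y A.r) :=
  (A.contDiffOn_slicePull_zero hβs).clm_apply contDiffOn_const

lemma contDiffOn_redForm (hβs : β.IsSmooth) :
    ContDiffOn ℝ ∞ (A.redForm β) (Metric.ball 0 A.r) :=
  ((A.contDiffOn_slicePull_zero hβs).comp (contDiff_id.prodMk contDiff_const).contDiffOn
    fun _ hy => mem_halfBall_zero_iff.2 (mem_ball_zero_iff.1 hy)).clm_comp contDiffOn_const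

variable (hβ : InvariantOn β V) {hU : (𝓡∂ (d + 1)).boundary M ⊆ U}
  (hb : IsBasicOnBoundary U hU β)
include hβ hb

lemma snd_mul_angularQuot {q : Y × ℝ} (hq : q ∈ halfBall Y A.r) :
    q.2 * A.angularQuot β q = A.angular β q :=
  mul_normalQuot fun h0 => A.slicePull_angular_eq_zero hβ hb hq h0

lemma contDiffOn_angularQuot (hβs : β.IsSmooth) :
    ContDiffOn ℝ ∞ (A.angularQuot β) (halfBall Y A.r) :=
  contDiffOn_normalQuot Metric.isOpen_ball (A.contDiffOn_angular hβs) fun _ hq h0 =>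
    A.slicePull_angular_eq_zero hβ hb ⟨hq, h0.ge⟩ h0

/-- Every coefficient is a smooth function of (y, |w|²) up to the boundary value |w|² = 0. The
division of the angular component by t has already been carried out in `angularQuot`. -/
lemma contDiffOn_cutForm (hβs : β.IsSmooth) : ContDiffOn ℝ ∞ (A.cutForm β) A.polarDom := by
  have hκ : ContDiff ℝ ∞ (fun v : Y × ℂ => (v.1, ‖v.2‖ ^ 2)) :=
    contDiff_fst.prodMk (contDiff_snd.norm_sq ℝ)
  have hm : MapsTo (fun v : Y × ℂ => (v.1, ‖v.2‖ ^ 2)) A.polarDom (halfBall Y A.r) :=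
    fun v hv => A.sq_mem_halfBall hv
  refine (((A.contDiffOn_slicePull_zero hβs).comp hκ.contDiffOn hm).clm_comp ?_).add
    (((A.contDiffOn_angularQuot hβ hb hβs).comp hκ.contDiffOn hm).smul ?_)
  · exact contDiffOn_const.clm_comp ((contDiff_sqDeriv (Y := Y)).comp contDiff_snd).contDiffOn
  · exact (contDiff_crossForm.comp contDiff_snd).contDiffOn.clm_comp contDiffOn_const

/-- The cut form pulls back to the given form under polar coordinates. -/
lemma exists_hasMFDerivAt_polar {v : Y × ℂ} (hv : v ∈ A.polarDom) (h0 : v.2 ≠ 0) :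
    ∃ L : Y × ℂ →L[ℝ] EuclideanSpace ℝ (Fin (d + 1)),
      HasMFDerivAt 𝓘(ℝ, Y × ℂ) (𝓡∂ (d + 1)) (fun v => (A.polar v : M)) v L ∧
      (covec β (A.polar v : M)).comp L = A.cutForm β v := by
  -- The angle is measured from the direction of `v.2`, so `polar` near v is the rotation by that
  -- direction of the flow at (relative angle, y, |w|²).
  set κ : Y × ℂ → ℝ × (Y × ℝ) := fun v' => (Complex.arg (v.2⁻¹ * v'.2), (v'.1, ‖v'.2‖ ^ 2))
    with hκ
  have hκd : HasFDerivAt κ ((((‖v.2‖ ^ 2)⁻¹ • crossForm v.2).comp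
      (ContinuousLinearMap.snd ℝ Y ℂ)).prod (sqDeriv Y v.2)) v :=
    ((hasFDerivAt_arg_inv_mul h0).comp v hasFDerivAt_snd).prodMk (hasFDerivAt_sq v)
  have hκv : κ v = (0, (v.1, ‖v.2‖ ^ 2)) := by simp [hκ, h0]
  have hpol : ∀ v' : Y × ℂ, v'.2 ≠ 0 → (A.polar v' : M) =
      ((circleUnit v.2 • A.flow (κ v') : U) : M) := by
    intro v' h'
    rw [flow, smul_smul, polar]
    congr 3
    have h1 : v.2⁻¹ * v'.2 ≠ 0 := mul_ne_zero (inv_ne_zero h0) h'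
    have h2 : v'.2 = ((‖v.2‖ * ‖v.2⁻¹ * v'.2‖ : ℝ) : ℂ) *
        ((circleUnit v.2 * circleUnit (v.2⁻¹ * v'.2) : Circle) : ℂ) := by
      rw [Circle.coe_mul, Complex.ofReal_mul, mul_mul_mul_comm, norm_mul_circleUnit,
        norm_mul_circleUnit, mul_inv_cancel_left₀ h0]
    conv_lhs => rw [h2]
    exact circleUnit_ofReal_mul (mul_pos (norm_pos_iff.2 h0) (norm_pos_iff.2 h1)) _
  obtain ⟨L, hL, h⟩ := A.exists_hasMFDerivWithinAt_flow hβ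
    (S := univ) (h := fun v => (A.polar v : M)) hκd.hasMFDerivAt.hasMFDerivWithinAt
    (fun v' _ => ⟨mem_univ _, show 0 ≤ ‖v'.2‖ ^ 2 from sq_nonneg _⟩)
    (hκv ▸ A.sq_mem_halfBall hv) (circleUnit v.2)
    (by
      rw [nhdsWithin_univ]
      filter_upwards [continuous_snd.continuousAt.eventually (isOpen_ne.mem_nhds h0)] with v' h'
      exact hpol v' h')
    (hpol v h0)
  refine ⟨L, hasMFDerivWithinAt_univ.1 hL, h.trans ?_⟩
  rw [hκv]
  have h1 := A.snd_mul_angularQuot hβ hb (A.sq_mem_halfBall hv)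
  have h2 : ‖v.2‖ ^ 2 ≠ 0 := by positivity
  refine ContinuousLinearMap.ext fun u => ?_
  set c : ℝ := (‖v.2‖ ^ 2)⁻¹ * crossForm v.2 u.2 with hc
  have h3 : ((((‖v.2‖ ^ 2)⁻¹ • crossForm v.2).comp
      (ContinuousLinearMap.snd ℝ Y ℂ)).prod (sqDeriv Y v.2)) u =
      (0, sqDeriv Y v.2 u) + c • ((1, 0) : ℝ × (Y × ℝ)) := by
    refine Prod.ext ?_ ?_
    · simp [hc]
    · simp
  rw [ContinuousLinearMap.comp_apply, h3, map_add, map_smul]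
  -- The angular component is |w|² times `angularQuot`, and the factor |w|² cancels the denominator
  -- of dθ.
  change _ + c * A.angular β _ = _ + A.angularQuot β _ * crossForm v.2 u.2
  rw [← h1, hc]
  have : (‖v.2‖ ^ 2)⁻¹ * ‖v.2‖ ^ 2 = 1 := inv_mul_cancel₀ h2
  congr 1
  linear_combination (crossForm v.2 u.2 * A.angularQuot β (v.1, ‖v.2‖ ^ 2)) * this

omit hb

/-- The pullback of an invariant form to the boundary in terms of the reduced form. -/
lemma exists_hasMFDerivAt_boundary (hb : IsBasicOnBoundary U hU β)
    {x : (𝓡∂ (d + 1)).boundary M} (hx : bdryPt hU x ∈ A.dom) :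
    ∃ (L : EuclideanSpace ℝ (Fin d) →L[ℝ] EuclideanSpace ℝ (Fin (d + 1)))
      (K : EuclideanSpace ℝ (Fin d) →L[ℝ] Y),
      HasMFDerivAt (𝓡 d) (𝓡∂ (d + 1)) (Subtype.val : (𝓡∂ (d + 1)).boundary M → M) x L ∧
      HasMFDerivAt (𝓡 d) 𝓘(ℝ, Y) (fun x => (A.pr (bdryPt hU x)).1) x K ∧
      (covec β (x : M)).comp L = (A.redForm β (A.pr (bdryPt hU x)).1).comp K := by
  -- The angle is taken relative to x, so its value at x is 0 and the argument is smooth there.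
  have hang := (contDiffAt_arg (w := ((A.ang (bdryPt hU x))⁻¹ * A.ang (bdryPt hU x) : Circle))
    (by simp)).contMDiffAt.comp x ((contMDiff_circle_coe.contMDiffAt.comp x
      (contMDiffAt_const.mul (A.contMDiffAt_ang_bdryPt hx))) :
      ContMDiffAt (𝓡 d) 𝓘(ℝ, ℂ) ∞ (fun x' => (((A.ang (bdryPt hU x))⁻¹ * A.ang (bdryPt hU x') :
        Circle) : ℂ)) x)
  have hpr : ContMDiffAt (𝓡 d) 𝓘(ℝ, Y) ∞ (fun x => (A.pr (bdryPt hU x)).1) x :=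
    contDiff_fst.contMDiff.contMDiffAt.comp x (A.contMDiffAt_pr_bdryPt hx)
  have h1 := (hang.mdifferentiableAt (by simp)).hasMFDerivAt
  have h2 := (hpr.mdifferentiableAt (by simp)).hasMFDerivAt
  have hcl : HasFDerivAt (fun y : Y => (y, (0 : ℝ))) (ContinuousLinearMap.inl ℝ Y ℝ)
      (A.pr (bdryPt hU x)).1 := hasFDerivAt_prodMk_left _ _
  obtain ⟨K₁, hK₁⟩ : ∃ K₁ : EuclideanSpace ℝ (Fin d) →L[ℝ] ℝ, HasMFDerivAt (𝓡 d) 𝓘(ℝ, ℝ)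
    (fun x' => Complex.arg (((A.ang (bdryPt hU x))⁻¹ * A.ang (bdryPt hU x') : Circle) : ℂ)) x K₁ :=
    ⟨_, h1⟩
  obtain ⟨K, hK⟩ : ∃ K : EuclideanSpace ℝ (Fin d) →L[ℝ] Y, HasMFDerivAt (𝓡 d) 𝓘(ℝ, Y)
    (fun x => (A.pr (bdryPt hU x)).1) x K := ⟨_, h2⟩
  set κ : (𝓡∂ (d + 1)).boundary M → ℝ × (Y × ℝ) := fun x' =>
    (Complex.arg (((A.ang (bdryPt hU x))⁻¹ * A.ang (bdryPt hU x') : Circle) : ℂ),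
      ((A.pr (bdryPt hU x')).1, 0)) with hκ
  have hκd : HasMFDerivAt (𝓡 d) 𝓘(ℝ, ℝ × (Y × ℝ)) κ x
      (K₁.prod ((ContinuousLinearMap.inl ℝ Y ℝ).comp K)) := by
    have h3 := hcl.hasMFDerivAt.comp x hK
    exact ⟨hK₁.1.prodMk h3.1, HasFDerivWithinAt.prodMk hK₁.2 h3.2⟩
  have hκx : κ x = (0, ((A.pr (bdryPt hU x)).1, 0)) := by simp [hκ]
  have hflow : ∀ x', bdryPt hU x' ∈ A.dom →
      (x' : M) = ((A.ang (bdryPt hU x) • A.flow (κ x') : U) : M) := by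
    intro x' hx'
    have h3 : A.flow (κ x') = ((A.ang (bdryPt hU x))⁻¹ * A.ang (bdryPt hU x')) •
        A.slice (A.pr (bdryPt hU x')) := by
      rw [A.pr_eq_of_mem_boundary hx' x'.2, ← circle_exp_arg (_ * _)]
      rfl
    rw [h3, smul_smul, mul_inv_cancel_left, A.ang_smul_slice _ hx']
    rfl
  have hq : ((A.pr (bdryPt hU x)).1, (0 : ℝ)) ∈ halfBall Y A.r :=
    mem_halfBall_zero_iff.2 (A.norm_pr_fst_lt hx)
  obtain ⟨L, hL, h⟩ := A.exists_hasMFDerivWithinAt_flow hβ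
    (S := univ) (h := (Subtype.val : (𝓡∂ (d + 1)).boundary M → M)) hκd.hasMFDerivWithinAt
    (fun x' _ => ⟨mem_univ _, le_refl (0 : ℝ)⟩) (hκx ▸ hq) (A.ang (bdryPt hU x))
    (by
      rw [nhdsWithin_univ]
      filter_upwards [(A.isOpen_dom.preimage (continuous_bdryPt hU)).mem_nhds hx] with x' h'
      exact hflow x' h')
    (hflow x hx)
  refine ⟨L, K, hasMFDerivWithinAt_univ.1 hL, hK, h.trans ?_⟩
  rw [hκx]
  refine ContinuousLinearMap.ext fun u => ?_
  have h3 : (K₁.prod ((ContinuousLinearMap.inl ℝ Y ℝ).comp K)) u =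
      (0, (K u, 0)) + K₁ u • ((1, 0) : ℝ × (Y × ℝ)) := by
    refine Prod.ext ?_ ?_ <;> simp
  -- On the boundary the angular component vanishes by horizontality, so only the Y-component of the
  -- derivative contributes.
  rw [ContinuousLinearMap.comp_apply, h3, map_add, map_smul,
    A.slicePull_angular_eq_zero hβ hb hq rfl, smul_zero, add_zero]
  rfl

end AdaptedChart
end LocalForms


/-! ### The contact condition at a point and its linear algebra. -/

section ContactAt

variable {E F : Type*} [NormedAddCommGroup E] [NormedSpace ℝ E] [NormedAddCommGroup F]
  [NormedSpace ℝ F]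

/-- The contact condition at a point for a one-form with value `b` and derivative `D`. -/
def ContactAt (b : E →L[ℝ] ℝ) (D : E →L[ℝ] E →L[ℝ] ℝ) : Prop :=
  ∀ v, b v = 0 → (∀ w, b w = 0 → D v w - D w v = 0) → v = 0

lemma ContactAt.comp {b : F →L[ℝ] ℝ} {D : F →L[ℝ] F →L[ℝ] ℝ} (h : ContactAt b D)
    {L : E →L[ℝ] F} (hL : Bijective L) {D' : E →L[ℝ] E →L[ℝ] ℝ}
    (hD : ∀ v w, D' v w - D' w v = D (L v) (L w) - D (L w) (L v)) :
    ContactAt (b.comp L) D' := by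
  intro v hv hw
  refine hL.1 ((h (L v) hv fun w hbw => ?_).trans L.map_zero.symm)
  obtain ⟨w, rfl⟩ := hL.2 w
  rw [← hD]
  exact hw w hbw

variable {H : Type*} [TopologicalSpace H] {I : ModelWithCorners ℝ E H} {M : Type*}
  [TopologicalSpace M] [ChartedSpace H M] [IsManifold I ∞ M]

lemma differentiableWithinAt_chartCovec {β : DiffForm I M 1} (hβ : β.IsSmooth) (x : M) :
    DifferentiableWithinAt ℝ (chartCovec β x) (range I) (extChartAt I x x) :=
  ((contDiffOn_chartCovec hβ x _ (mem_extChartAt_target x)).mono_of_mem_nhdsWithin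
    (extChartAt_target_mem_nhdsWithin x)).differentiableWithinAt (by simp)

/-- The wedge condition is translated to nondegeneracy, with dβ written as the antisymmetrised
derivative of the chart expression. -/
lemma IsContactForm.contactAt {m : ℕ} {β : DiffForm I M 1} (hβ : IsContactForm m β) (x : M) :
    ContactAt (covec β x)
      (fderivWithin ℝ (chartCovec β x) (range I) (extChartAt I x x)) := by
  have : FiniteDimensional ℝ E := Module.finite_of_finrank_pos (by have := hβ.finrank_eq; omega)
  have h := isContactPair_of_wedge_ne_zero (V := E) hβ.finrank_eq (hβ.wedge_ne_zero x)
  refine fun v hv hw => h v hv fun w hbw => ?_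
  refine (toBilin_apply (V := E) _ v w).trans ?_
  have h1 : β.inChart x = fun y => formOne E (chartCovec β x y) :=
    funext fun y => ((formOne E).apply_symm_apply _).symm
  have h2 := extDerivWithin_formOne (b := chartCovec β x) (s := range I) (x := extChartAt I x x)
    (I.uniqueDiffOn _ (mem_range_self _)) v w
  rw [← h1] at h2
  exact h2.trans (hw w hbw)

end ContactAt

section LinearAlgebra

variable {Y : Type} [NormedAddCommGroup Y] [NormedSpace ℝ Y]
  {a : ℝ × (Y × ℝ) →L[ℝ] ℝ} {D : ℝ × (Y × ℝ) →L[ℝ] ℝ × (Y × ℝ) →L[ℝ] ℝ} {G : ℝ}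

/-- The contact condition for an invariant form whose angular component vanishes along the
boundary. -/
lemma ContactAt.ne_zero (h : ContactAt a D) (h0 : a (1, 0) = 0) (hD : D (1, 0) = 0)
    (hG : ∀ y t, D (0, (y, t)) (1, 0) = t * G) : G ≠ 0 := by
  intro h1
  -- If G were 0, the orbit direction would lie in ker a and pair to zero with every vector,
  -- contradicting the contact condition.
  have h2 := h (1, 0) h0 fun w _ => ?_
  · simpa using congrArg Prod.fst h2
  · have h3 : w = w.1 • ((1, 0) : ℝ × (Y × ℝ)) + (0, (w.2.1, w.2.2)) := by
      refine Prod.ext ?_ ?_ <;> simp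
    rw [h3, map_add D, map_smul D, hD]
    simp [hG, h1]

/-- A vector η degenerate for the form induced on Y is completed to a vector (s, (η, 0)) degenerate
for the whole form. Vectors of ker a decompose into orbit directions, horizontal vectors and
multiples of one vector `w₀` with normal component 1. Only the pairing with `w₀` can fail to vanish,
and since G ≠ 0 it is cancelled by s = c / G. If there is no such `w₀`, then ker a has no normal
component and s = 0 works. -/
lemma ContactAt.horizontal (h : ContactAt a D) (h0 : a (1, 0) = 0) (hD : D (1, 0) = 0)
    (hG : ∀ y t, D (0, (y, t)) (1, 0) = t * G) {η : Y} (hη : a (0, (η, 0)) = 0)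
    (hR : ∀ η', a (0, (η', 0)) = 0 →
      D (0, (η, 0)) (0, (η', 0)) - D (0, (η', 0)) (0, (η, 0)) = 0) : η = 0 := by
  have hG0 := h.ne_zero h0 hD hG
  have hdec (w : ℝ × (Y × ℝ)) : w = w.1 • ((1, 0) : ℝ × (Y × ℝ)) + (0, (w.2.1, w.2.2)) := by
    refine Prod.ext ?_ ?_ <;> simp
  have ha (w : ℝ × (Y × ℝ)) : a w = a (0, (w.2.1, w.2.2)) := by
    conv_lhs => rw [hdec w, map_add, map_smul, h0, smul_zero, zero_add]
  -- the antisymmetrisation in terms of the components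
  have hA (s : ℝ) (w : ℝ × (Y × ℝ)) : D (s, (η, 0)) w - D w (s, (η, 0)) =
      D (0, (η, 0)) (0, (w.2.1, w.2.2)) - D (0, (w.2.1, w.2.2)) (0, (η, 0)) - s * (w.2.2 * G) := by
    have h1 : ((s, (η, 0)) : ℝ × (Y × ℝ)) = s • ((1, 0) : ℝ × (Y × ℝ)) + (0, (η, 0)) := by
      refine Prod.ext ?_ ?_ <;> simp
    rw [h1]
    conv_lhs => rw [hdec w]
    simp only [map_add, map_smul, hD, add_apply, smul_apply, zero_apply, hG, smul_eq_mul]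
    ring
  by_cases hw : ∃ w₀ : Y × ℝ, a (0, w₀) = 0 ∧ w₀.2 = 1
  · obtain ⟨w₀, hw₀, hw₁⟩ := hw
    set c := D (0, (η, 0)) (0, w₀) - D (0, w₀) (0, (η, 0)) with hc
    have hv := h (c / G, (η, 0)) (by rw [ha]; exact hη) fun w hbw => ?_
    · exact congrArg (fun v => v.2.1) hv
    · rw [hA]
      rw [ha] at hbw
      set η' := w.2.1 - w.2.2 • w₀.1 with hη'
      have h2 : ((0, (w.2.1, w.2.2)) : ℝ × (Y × ℝ)) = (0, (η', 0)) + w.2.2 • (0, w₀) := by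
        refine Prod.ext ?_ (Prod.ext ?_ ?_) <;> simp [hη', hw₁]
      have h3 : a (0, (η', 0)) = 0 := by
        rw [h2, map_add, map_smul, hw₀, smul_zero, add_zero] at hbw
        exact hbw
      have h4 := hR η' h3
      rw [h2]
      simp only [map_add, map_smul, add_apply, smul_apply, smul_eq_mul]
      have h5 : c / G * (w.2.2 * G) = w.2.2 * c := by field_simp
      rw [h5, hc]
      linear_combination h4
  · have hv := h (0, (η, 0)) hη fun w hbw => ?_
    · exact congrArg (fun v => v.2.1) hv
    · rw [hA]
      rw [ha] at hbw
      have h1 : w.2.2 = 0 := by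
        by_contra h1
        refine hw ⟨(w.2.2)⁻¹ • (w.2.1, w.2.2), ?_, by simp [h1]⟩
        have h2 : ((0, (w.2.2)⁻¹ • (w.2.1, w.2.2)) : ℝ × (Y × ℝ)) =
            (w.2.2)⁻¹ • (0, (w.2.1, w.2.2)) := by
          refine Prod.ext ?_ rfl
          simp
        rw [h2, map_smul, hbw, smul_zero]
      rw [h1] at hbw ⊢
      rw [hR _ hbw]
      ring

end LinearAlgebra

/-! ### Contactness of the local forms. -/

section LocalContact

variable {d : ℕ} {M : Type*} [TopologicalSpace M] [ChartedSpace (EuclideanHalfSpace (d + 1)) M]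
  [IsManifold (𝓡∂ (d + 1)) ∞ M]
  {U : TopologicalSpace.Opens M} [MulAction Circle U]
  [ContMDiffSMul (𝓡 1) (𝓡∂ (d + 1)) ∞ Circle U]
  {Y : Type} [NormedAddCommGroup Y] [NormedSpace ℝ Y]

namespace AdaptedChart

variable {V : Set U} {p : U} (A : AdaptedChart d U Y V p)

lemma zero_mem_halfBall : (0 : Y × ℝ) ∈ halfBall Y A.r :=
  ⟨Metric.mem_ball_self A.r_pos, le_refl (0 : ℝ)⟩

lemma flow_zero : A.flow 0 = p := (A.flow_zero_left 0).trans A.slice_zero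

lemma chartFlow_zero : A.chartFlow 0 = extChartAt (𝓡∂ (d + 1)) (p : M) p := by
  rw [chartFlow, A.flow_zero]

lemma zero_mem_flowDom' : (0 : ℝ × (Y × ℝ)) ∈ A.flowDom := A.zero_mem_flowDom A.zero_mem_halfBall

lemma zero_mem_flowCone : (0 : ℝ × (Y × ℝ)) ∈ flowCone Y := ⟨mem_univ _, le_refl (0 : ℝ)⟩

lemma zero_mem_closure_interior_flowCone :
    (0 : ℝ × (Y × ℝ)) ∈ closure (interior (flowCone Y)) := by
  have h : flowCone Y = univ ×ˢ (univ ×ˢ Ici (0 : ℝ)) := by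
    ext; simp [flowCone, upperHalf]
  rw [h, interior_prod_eq, interior_prod_eq, interior_univ, interior_univ, interior_Ici,
    closure_prod_eq, closure_prod_eq, closure_univ, closure_univ, closure_Ioi]
  simp

/-- Near the centre the coordinates (argument of `ang`, `pr`) give a smooth left inverse of the
flow, so the derivative has a left inverse too. -/
lemma injective_fderivWithin_chartFlow :
    Injective (fderivWithin ℝ A.chartFlow (flowCone Y) 0) := by
  have hM1 : IsManifold (𝓡∂ (d + 1)) 1 M := IsManifold.of_le (n := ∞) (by simp)
  have hp : p ∈ A.dom := by
    have := A.slice_mem 0 A.zero_mem_halfBall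
    rwa [A.slice_zero] at this
  have hang1 : A.ang p = 1 := by
    have := A.ang_slice 0 A.zero_mem_halfBall
    rwa [A.slice_zero] at this
  have hJ : ContMDiffAt (𝓡∂ (d + 1)) 𝓘(ℝ, ℝ × (Y × ℝ)) ∞
      (fun x : U => (Complex.arg (A.ang x), A.pr x)) p := by
    have h1 := A.contMDiffOn_pr.contMDiffAt (A.isOpen_dom.mem_nhds hp)
    have h2 := contMDiff_circle_coe.contMDiffAt.comp p
      (A.contMDiffOn_ang.contMDiffAt (A.isOpen_dom.mem_nhds hp))
    exact ((contDiffAt_arg (w := (A.ang p : ℂ)) (by simp [hang1])).contMDiffAt.comp p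
      h2).prodMk_space h1
  have hJ' := ((contMDiffAt_extend hJ).mdifferentiableAt (by simp)).hasMFDerivAt
  obtain ⟨K, hK⟩ : ∃ K : EuclideanSpace ℝ (Fin (d + 1)) →L[ℝ] ℝ × (Y × ℝ),
    HasMFDerivAt (𝓡∂ (d + 1)) 𝓘(ℝ, ℝ × (Y × ℝ))
      (extend Subtype.val (fun x : U => (Complex.arg (A.ang x), A.pr x)) 0) (p : M) K := ⟨_, hJ'⟩
  have hfl := ((A.contMDiffWithinAt_coe_flow (z := 0) A.zero_mem_halfBall).mdifferentiableWithinAt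
    (by simp)).hasMFDerivWithinAt
  obtain ⟨L, hL, hLeq⟩ : ∃ L : ℝ × (Y × ℝ) →L[ℝ] EuclideanSpace ℝ (Fin (d + 1)),
    HasMFDerivWithinAt 𝓘(ℝ, ℝ × (Y × ℝ)) (𝓡∂ (d + 1)) (fun z => (A.flow z : M)) (flowCone Y) 0 L ∧
    mfderivWithin 𝓘(ℝ, ℝ × (Y × ℝ)) (𝓡∂ (d + 1)) (fun z => (A.flow z : M)) (flowCone Y) 0 = L :=
    ⟨_, hfl, rfl⟩
  have hfp : (A.flow 0 : M) = p := congrArg _ A.flow_zero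
  have hcomp := (HasMFDerivAt.comp_hasMFDerivWithinAt (f := fun z => (A.flow z : M)) 0
    (hfp.symm ▸ hK) hL).hasFDerivWithinAt
  have hid : HasFDerivWithinAt (fun z : ℝ × (Y × ℝ) => z) (K.comp L) (flowCone Y) 0 := by
    refine HasFDerivWithinAt.congr_of_eventuallyEq hcomp ?_ ?_
    · have h1 : ∀ᶠ z : ℝ × (Y × ℝ) in 𝓝[flowCone Y] 0, z.1 ∈ Ioo (-Real.pi) Real.pi :=
        nhdsWithin_le_nhds (continuous_fst.continuousAt.eventually
          (Ioo_mem_nhds (neg_lt_zero.2 Real.pi_pos) Real.pi_pos))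
      filter_upwards [A.halfBall_mem_nhdsWithin (z := 0) A.zero_mem_halfBall, h1] with z h2 h3
      have h4 := A.slice_mem _ h2.2
      change z = extend Subtype.val (fun x : U => (Complex.arg (A.ang x), A.pr x)) 0 (A.flow z : M)
      rw [Subtype.val_injective.extend_apply, flow, A.ang_smul _ _ h4, A.pr_smul _ _ h4,
        A.ang_slice _ h2.2, A.pr_slice _ h2.2, mul_one, Circle.arg_exp h3.1 h3.2.le]
    · change (0 : ℝ × (Y × ℝ)) = extend Subtype.val
        (fun x : U => (Complex.arg (A.ang x), A.pr x)) 0 (A.flow 0 : M)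
      rw [Subtype.val_injective.extend_apply, A.flow_zero, hang1]
      have h5 := A.pr_slice 0 A.zero_mem_halfBall
      rw [A.slice_zero] at h5
      rw [h5]
      simp
      rfl
  have h6 : K.comp L = ContinuousLinearMap.id ℝ (ℝ × (Y × ℝ)) :=
    (uniqueDiffOn_flowCone 0 zero_mem_flowCone).eq hid (hasFDerivWithinAt_id 0 _)
  have h7 : fderivWithin ℝ A.chartFlow (flowCone Y) 0 = L := by
    rw [A.fderivWithin_chartFlow A.zero_mem_flowDom', ← hLeq]
    have h8 : (mfderiv (𝓡∂ (d + 1)) 𝓘(ℝ, EuclideanSpace ℝ (Fin (d + 1)))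
        (extChartAt (𝓡∂ (d + 1)) (p : M)) (A.flow 0 : M) :
        EuclideanSpace ℝ (Fin (d + 1)) →L[ℝ] EuclideanSpace ℝ (Fin (d + 1))) =
        ContinuousLinearMap.id ℝ _ := by
      rw [hfp]
      exact mfderiv_extChartAt_self
    rw [h8]
    rfl
  rw [h7]
  exact LeftInverse.injective (g := K) fun v => congrArg (fun l => l v) h6

include A in
lemma finiteDimensional : FiniteDimensional ℝ Y := by
  have : FiniteDimensional ℝ (Y × ℂ) := A.cutModel.toLinearEquiv.finiteDimensional
  exact FiniteDimensional.of_surjective (LinearMap.fst ℝ Y ℂ) LinearMap.fst_surjective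

include A in
lemma finrank_add_two : Module.finrank ℝ Y + 2 = d + 1 := by
  have h := A.cutModel.toLinearEquiv.finrank_eq
  have := A.finiteDimensional
  rw [Module.finrank_prod, finrank_euclideanSpace, Fintype.card_fin, Complex.finrank_real_complex]
    at h
  exact h.symm

lemma bijective_fderivWithin_chartFlow :
    Bijective (fderivWithin ℝ A.chartFlow (flowCone Y) 0) := by
  have h1 := A.injective_fderivWithin_chartFlow
  have := A.finiteDimensional
  have h2 : Module.finrank ℝ (ℝ × (Y × ℝ)) = Module.finrank ℝ (EuclideanSpace ℝ (Fin (d + 1))) := by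
    have := A.finrank_add_two
    rw [Module.finrank_prod, Module.finrank_prod, Module.finrank_self, finrank_euclideanSpace,
      Fintype.card_fin]
    omega
  exact ⟨h1, (LinearMap.injective_iff_surjective_of_finrank_eq_finrank h2
    (f := (fderivWithin ℝ A.chartFlow (flowCone Y) 0 :
      ℝ × (Y × ℝ) →ₗ[ℝ] EuclideanSpace ℝ (Fin (d + 1))))).1 h1⟩

variable {β : DiffForm (𝓡∂ (d + 1)) M 1} {m : ℕ}

/-- The exterior derivative commutes with pullback, also within a half space, and the flow has
bijective derivative at 0; so the contact condition at p is carried to the coordinates (τ, q). -/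
lemma contactAt_slicePull (hβ : IsContactForm m β) :
    ContactAt (A.slicePull β 0) (fderivWithin ℝ (A.slicePull β) (flowCone Y) 0) := by
  have h0 : A.slicePull β 0 = (covec β (p : M)).comp
      (fderivWithin ℝ A.chartFlow (flowCone Y) 0) := by
    rw [A.slicePull_eq_chartCovec A.zero_mem_flowDom', A.chartFlow_zero, chartCovec_self]
  rw [h0]
  refine (hβ.contactAt (p : M)).comp A.bijective_fderivWithin_chartFlow fun v w => ?_
  have hun : UniqueDiffWithinAt ℝ (flowCone Y) 0 := uniqueDiffOn_flowCone 0 zero_mem_flowCone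
  have h1 := extDerivWithin_formOne (b := A.slicePull β) hun v w
  have h2 : extDerivWithin (fun z => formOne (ℝ × (Y × ℝ)) (A.slicePull β z)) (flowCone Y) 0 =
      extDerivWithin (fun z => (formOne _ (chartCovec β (p : M)
        (A.chartFlow z))).compContinuousLinearMap (fderivWithin ℝ A.chartFlow (flowCone Y) z))
        (flowCone Y) 0 := by
    refine Filter.EventuallyEq.extDerivWithin_eq ?_ ?_
    · filter_upwards [A.flowDom_mem_nhdsWithin A.zero_mem_flowDom'] with z hz
      rw [formOne_comp, A.slicePull_eq_chartCovec hz]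
    · rw [formOne_comp, A.slicePull_eq_chartCovec A.zero_mem_flowDom']
  have h3 : extDerivWithin (fun z => (formOne _ (chartCovec β (p : M)
      (A.chartFlow z))).compContinuousLinearMap (fderivWithin ℝ A.chartFlow (flowCone Y) z))
      (flowCone Y) 0 =
      (extDerivWithin (fun u => formOne (EuclideanSpace ℝ (Fin (d + 1)))
        (chartCovec β (p : M) u)) (range (𝓡∂ (d + 1))) (A.chartFlow 0)).compContinuousLinearMap
        (fderivWithin ℝ A.chartFlow (flowCone Y) 0) := extDerivWithin_pullback (r := (2 : ℕ))
    (t := range (𝓡∂ (d + 1)))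
    (by
      rw [A.chartFlow_zero]
      exact (formOne _).toContinuousLinearEquiv.differentiableAt.comp_differentiableWithinAt _
        (differentiableWithinAt_chartCovec hβ.isSmooth (p : M)))
    (contDiffWithinAt_infty.1 ((A.contDiffOn_chartFlow 0
      A.zero_mem_flowDom').mono_of_mem_nhdsWithin
        (A.flowDom_mem_nhdsWithin A.zero_mem_flowDom')) 2)
    (by rw [minSmoothness_of_isRCLikeNormedField]; rfl) uniqueDiffOn_flowCone
    zero_mem_closure_interior_flowCone zero_mem_flowCone (fun z _ => mem_range_self _)
  rw [← h1, h2, h3, A.chartFlow_zero]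
  have h4 := extDerivWithin_formOne (b := chartCovec β (p : M)) (s := range (𝓡∂ (d + 1)))
    (x := extChartAt (𝓡∂ (d + 1)) (p : M) p) ((𝓡∂ (d + 1)).uniqueDiffOn _ (mem_range_self _))
    (fderivWithin ℝ A.chartFlow (flowCone Y) 0 v) (fderivWithin ℝ A.chartFlow (flowCone Y) 0 w)
  rw [← h4, ContinuousAlternatingMap.compContinuousLinearMap_apply]
  congr 1
  ext i
  fin_cases i <;> rfl

lemma hasFDerivWithinAt_slicePull (hβs : β.IsSmooth) :
    HasFDerivWithinAt (A.slicePull β) (fderivWithin ℝ (A.slicePull β) (flowCone Y) 0)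
      (flowCone Y) 0 :=
  (((A.contDiffOn_slicePull hβs 0 A.zero_mem_flowDom').mono_of_mem_nhdsWithin
    (A.flowDom_mem_nhdsWithin A.zero_mem_flowDom')).differentiableWithinAt
      (by simp)).hasFDerivWithinAt

/-- The pulled back form does not depend on τ. -/
lemma fderivWithin_slicePull_angular (hβ : InvariantOn β V) (hβs : β.IsSmooth) :
    fderivWithin ℝ (A.slicePull β) (flowCone Y) 0 (1, 0) = 0 := by
  have h1 : HasDerivWithinAt (fun s : ℝ => ((s, 0) : ℝ × (Y × ℝ))) (1, 0) univ 0 :=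
    ((hasDerivAt_id (0 : ℝ)).prodMk (hasDerivAt_const (0 : ℝ) (0 : Y × ℝ))).hasDerivWithinAt
  have h2 := HasFDerivWithinAt.comp_hasDerivWithinAt (t := flowCone Y) 0
    (A.hasFDerivWithinAt_slicePull hβs) h1 (fun s _ => ⟨mem_univ _, le_refl (0 : ℝ)⟩)
  rw [hasDerivWithinAt_univ] at h2
  have h3 : (A.slicePull β ∘ fun s : ℝ => ((s, 0) : ℝ × (Y × ℝ))) = fun _ => A.slicePull β 0 :=
    funext fun s => A.slicePull_eq_zero hβ s A.zero_mem_halfBall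
  rw [h3] at h2
  exact h2.unique (hasDerivAt_const _ _)

lemma hasFDerivWithinAt_slicePull_zero (hβs : β.IsSmooth) :
    HasFDerivWithinAt (fun q => A.slicePull β (0, q))
      ((fderivWithin ℝ (A.slicePull β) (flowCone Y) 0).comp
        (ContinuousLinearMap.inr ℝ ℝ (Y × ℝ))) (upperHalf Y) 0 := by
  have h1 : HasFDerivWithinAt (fun q : Y × ℝ => ((0, q) : ℝ × (Y × ℝ)))
      (ContinuousLinearMap.inr ℝ ℝ (Y × ℝ)) (upperHalf Y) 0 :=
    (hasFDerivAt_prodMk_right _ _).hasFDerivWithinAt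
  exact HasFDerivWithinAt.comp (t := flowCone Y) 0 (A.hasFDerivWithinAt_slicePull hβs) h1
    fun q hq => ⟨mem_univ _, hq⟩

lemma halfBall_mem_nhdsWithin_zero : halfBall Y A.r ∈ 𝓝[upperHalf Y] 0 := by
  rw [halfBall, inter_comm]
  exact inter_mem_nhdsWithin _ (Metric.ball_mem_nhds _ A.r_pos)

section Basic

variable (hβ : InvariantOn β V) (hβs : β.IsSmooth) {hU : (𝓡∂ (d + 1)).boundary M ⊆ U}
  (hb : IsBasicOnBoundary U hU β)
include hβ hβs hb

lemma hasFDerivWithinAt_angularQuot : ∃ K : Y × ℝ →L[ℝ] ℝ,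
    HasFDerivWithinAt (A.angularQuot β) K (upperHalf Y) 0 :=
  ⟨_, (((A.contDiffOn_angularQuot hβ hb hβs 0 A.zero_mem_halfBall).mono_of_mem_nhdsWithin
    A.halfBall_mem_nhdsWithin_zero).differentiableWithinAt (by simp)).hasFDerivWithinAt⟩

/-- The angular component is t · `angularQuot`, and at t = 0 the product rule leaves only the
derivative of t. This identifies the constant G of the linear algebra with `angularQuot` at 0. -/
lemma fderivWithin_slicePull_apply_angular (y : Y) (t : ℝ) :
    fderivWithin ℝ (A.slicePull β) (flowCone Y) 0 (0, (y, t)) (1, 0) =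
      t * A.angularQuot β 0 := by
  have h1 := (A.hasFDerivWithinAt_slicePull_zero hβs).clm_apply
    (hasFDerivWithinAt_const ((1, 0) : ℝ × (Y × ℝ)) _ _)
  obtain ⟨K, hK⟩ := A.hasFDerivWithinAt_angularQuot hβ hβs hb
  have h2 := (hasFDerivWithinAt_snd (𝕜 := ℝ) (p := (0 : Y × ℝ)) (s := upperHalf Y)).mul hK
  have h3 : (fun q => A.slicePull β (0, q) (1, 0)) =ᶠ[𝓝[upperHalf Y] 0]
      fun q => q.2 * A.angularQuot β q := by
    filter_upwards [A.halfBall_mem_nhdsWithin_zero] with q hq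
    exact (A.snd_mul_angularQuot hβ hb hq).symm
  have h4 := h2.congr_of_eventuallyEq h3 (A.snd_mul_angularQuot hβ hb A.zero_mem_halfBall).symm
  have h5 := (uniqueDiffOn_upperHalf (0 : Y × ℝ) (le_refl (0 : ℝ))).eq h1 h4
  have h6 := congrArg (fun l => l (y, t)) h5
  simpa [mul_comm] using h6

lemma contactAt_redForm {m : ℕ} (hβc : IsContactForm m β) :
    ContactAt (A.redForm β 0) (fderiv ℝ (A.redForm β) 0) := by
  set D := fderivWithin ℝ (A.slicePull β) (flowCone Y) 0 with hD
  have h1 : HasFDerivAt (fun y : Y => (y, (0 : ℝ))) (ContinuousLinearMap.inl ℝ Y ℝ) 0 :=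
    hasFDerivAt_prodMk_left _ _
  have h2 := HasFDerivWithinAt.comp (g := fun q => A.slicePull β (0, q)) (f := fun y : Y => (y, (0 : ℝ)))
    (t := upperHalf Y) 0 (A.hasFDerivWithinAt_slicePull_zero hβs)
    (h1.hasFDerivWithinAt (s := univ)) fun y _ => le_refl (0 : ℝ)
  rw [hasFDerivWithinAt_univ] at h2
  have h3 := h2.clm_comp (hasFDerivAt_const
    ((ContinuousLinearMap.inr ℝ ℝ (Y × ℝ)).comp (ContinuousLinearMap.inl ℝ Y ℝ)) 0)
  have h4 : ∀ η η', fderiv ℝ (A.redForm β) 0 η η' = D (0, (η, 0)) (0, (η', 0)) := by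
    intro η η'
    have h5 : fderiv ℝ (A.redForm β) 0 = _ := h3.fderiv
    rw [h5]
    simp [hD]
  intro η hη hR
  refine (A.contactAt_slicePull hβc).horizontal (A.slicePull_angular_eq_zero hβ hb
    A.zero_mem_halfBall rfl) (A.fderivWithin_slicePull_angular hβ hβs)
    (A.fderivWithin_slicePull_apply_angular hβ hβs hb) hη fun η' hη' => ?_
  rw [← hD, ← h4, ← h4]
  exact hR η' hη'

/-- Computed along the ray s ↦ s v. There |w|² is of second order, so the coefficients vary only in
the direction of Y, while `sqDeriv` and `crossForm` contribute terms linear in s. The middle summand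
is symmetric and drops out of the exterior derivative. -/
lemma fderiv_cutForm (v u : Y × ℂ) :
    fderiv ℝ (A.cutForm β) 0 v u =
      fderivWithin ℝ (A.slicePull β) (flowCone Y) 0 (0, (v.1, 0)) (0, (u.1, 0)) +
      2 * inner ℝ v.2 u.2 * A.slicePull β 0 (0, (0, 1)) +
      A.angularQuot β 0 * crossForm v.2 u.2 := by
  set D := fderivWithin ℝ (A.slicePull β) (flowCone Y) 0 with hD
  have h0 : (0 : Y × ℂ) ∈ A.polarDom := by
    change ((0 : Y), ‖(0 : ℂ)‖ ^ 2) ∈ Metric.ball (0 : Y × ℝ) A.r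
    simpa using A.r_pos
  have hc : HasFDerivAt (A.cutForm β) (fderiv ℝ (A.cutForm β) 0) 0 :=
    (((A.contDiffOn_cutForm hβ hb hβs).contDiffAt
      (A.isOpen_polarDom.mem_nhds h0)).differentiableAt (by simp)).hasFDerivAt
  have hl : HasDerivAt (fun t : ℝ => t • v) v 0 := by
    simpa using (hasDerivAt_id (0 : ℝ)).smul_const v
  have h1 : HasDerivAt (fun t : ℝ => A.cutForm β (t • v) u) (fderiv ℝ (A.cutForm β) 0 v u) 0 := by
    have h2 := HasFDerivAt.comp_hasDerivAt (0 : ℝ) (by rw [zero_smul]; exact hc) hl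
    simpa using h2.clm_apply (hasDerivAt_const (0 : ℝ) u)
  set γ : ℝ → Y × ℝ := fun t => (t • v.1, t ^ 2 * ‖v.2‖ ^ 2) with hγ
  have hγ0 : γ 0 = 0 := by simp [hγ]
  have hγd : HasDerivWithinAt γ (v.1, 0) univ 0 := by
    have h2 : HasDerivAt (fun t : ℝ => t • v.1) v.1 0 := by
      simpa using (hasDerivAt_id (0 : ℝ)).smul_const v.1
    have h3 : HasDerivAt (fun t : ℝ => t ^ 2 * ‖v.2‖ ^ 2) 0 0 := by
      simpa using (hasDerivAt_pow 2 (0 : ℝ)).mul_const (‖v.2‖ ^ 2)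
    exact (h2.prodMk h3).hasDerivWithinAt
  have hγm : MapsTo γ univ (upperHalf Y) := fun t _ => by
    change 0 ≤ t ^ 2 * ‖v.2‖ ^ 2
    positivity
  have h2 := HasFDerivWithinAt.comp_hasDerivWithinAt (t := upperHalf Y) (0 : ℝ)
    (by rw [hγ0]; exact A.hasFDerivWithinAt_slicePull_zero hβs) hγd hγm
  obtain ⟨K, hK⟩ := A.hasFDerivWithinAt_angularQuot hβ hβs hb
  have h3 := HasFDerivWithinAt.comp_hasDerivWithinAt (t := upperHalf Y) (0 : ℝ)
    (by rw [hγ0]; exact hK) hγd hγm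
  rw [hasDerivWithinAt_univ] at h2 h3
  have h4 : HasDerivAt (fun t : ℝ => ((0, (u.1, t * (2 * inner ℝ v.2 u.2))) : ℝ × (Y × ℝ)))
      (0, (0, 2 * inner ℝ v.2 u.2)) 0 :=
    (hasDerivAt_const _ _).prodMk ((hasDerivAt_const _ _).prodMk
      (by simpa using (hasDerivAt_id (0 : ℝ)).mul_const (2 * inner ℝ v.2 u.2)))
  have h5 : HasDerivAt (fun t : ℝ => t * crossForm v.2 u.2) (crossForm v.2 u.2) 0 := by
    simpa using (hasDerivAt_id (0 : ℝ)).mul_const (crossForm v.2 u.2)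
  have h6 := (h2.clm_apply h4).add (h3.mul h5)
  have h7 : (fun t : ℝ => A.cutForm β (t • v) u) = fun t : ℝ =>
      ((fun q => A.slicePull β (0, q)) ∘ γ) t (0, (u.1, t * (2 * inner ℝ v.2 u.2))) +
        (A.angularQuot β ∘ γ) t * (t * crossForm v.2 u.2) := by
    funext t
    have h8 : ((t • v).1, ‖(t • v).2‖ ^ 2) = γ t := by
      simp [hγ, mul_pow]
    rw [cutForm, h8]
    have h9 : crossForm (t • v).2 u.2 = t * crossForm v.2 u.2 := by
      simp [crossForm_apply, mul_assoc, mul_add]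
    have h10 : sqDeriv Y (t • v).2 u = (u.1, t * (2 * inner ℝ v.2 u.2)) := by
      simp [sqDeriv]
      ring
    change A.slicePull β (0, γ t) (0, sqDeriv Y (t • v).2 u) +
      A.angularQuot β (γ t) * crossForm (t • v).2 u.2 = _
    rw [h9, h10]
    rfl
  rw [h7] at h1
  rw [h1.unique h6]
  have h11 : ((0, (0, 2 * inner ℝ v.2 u.2)) : ℝ × (Y × ℝ)) =
      (2 * inner ℝ v.2 u.2 : ℝ) • (0, (0, 1)) := by
    refine Prod.ext ?_ (Prod.ext ?_ ?_) <;> simp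
  rw [h11]
  simp only [Function.comp_apply, hγ0, map_smul, smul_eq_mul, zero_mul, mul_zero, zero_add]
  rfl

/-- At 0 the exterior derivative is that of the reduced form plus twice G times the area form of ℂ.
Pairing with (0, i w) gives 2 G |w|² = 0, hence w = 0 as G ≠ 0. The Y-component then vanishes by
`ContactAt.horizontal`. -/
lemma contactAt_cutForm {m : ℕ} (hβc : IsContactForm m β) :
    ContactAt (A.cutForm β 0) (fderiv ℝ (A.cutForm β) 0) := by
  set D := fderivWithin ℝ (A.slicePull β) (flowCone Y) 0 with hD
  have hc := A.contactAt_slicePull hβc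
  have ha0 := A.slicePull_angular_eq_zero hβ hb A.zero_mem_halfBall rfl
  have hD0 := A.fderivWithin_slicePull_angular hβ hβs
  have hG := A.fderivWithin_slicePull_apply_angular hβ hβs hb
  have hG0 := hc.ne_zero ha0 hD0 hG
  have hval : ∀ u : Y × ℂ, A.cutForm β 0 u = A.slicePull β 0 (0, (u.1, 0)) := by
    intro u
    simp [cutForm, sqDeriv, crossForm]
    rfl
  have hanti : ∀ v u, fderiv ℝ (A.cutForm β) 0 v u - fderiv ℝ (A.cutForm β) 0 u v =
      D (0, (v.1, 0)) (0, (u.1, 0)) - D (0, (u.1, 0)) (0, (v.1, 0)) +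
        2 * A.angularQuot β 0 * crossForm v.2 u.2 := by
    intro v u
    have h1 : crossForm u.2 v.2 = - crossForm v.2 u.2 := by
      simp only [crossForm_apply, Complex.mul_im, Complex.conj_re, Complex.conj_im]
      ring
    rw [A.fderiv_cutForm hβ hβs hb, A.fderiv_cutForm hβ hβs hb, h1, real_inner_comm]
    ring
  rintro ⟨η, w⟩ hv hR
  rw [hval] at hv
  have hw : w = 0 := by
    have h1 := hR (0, Complex.I * w) (by rw [hval]; exact (A.slicePull β 0).map_zero)
    rw [hanti] at h1
    have h2 : crossForm w (Complex.I * w) = ‖w‖ ^ 2 := by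
      rw [crossForm_apply, ← Complex.normSq_eq_norm_sq, Complex.normSq_apply]
      simp
    have h3 : D (0, (0, 0)) = 0 := D.map_zero
    have h4 : D (0, (η, 0)) (0, (0, 0)) = 0 := (D (0, (η, 0))).map_zero
    simp only [h3, h4, h2, zero_apply, sub_zero, zero_add] at h1
    have h5 : ‖w‖ ^ 2 = 0 := (mul_eq_zero.1 h1).resolve_left (mul_ne_zero two_ne_zero hG0)
    simpa using h5
  subst hw
  have hη := hc.horizontal ha0 hD0 hG hv fun η' hη' => by
    have h1 := hR (η', 0) (by rw [hval]; exact hη')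
    rw [hanti] at h1
    simpa [crossForm] using h1
  exact Prod.ext hη rfl

end Basic

end AdaptedChart
end LocalContact


/-! ### The contact form on the cut space. -/

section CutForms

variable {d : ℕ} {M : Type*} [TopologicalSpace M] [ChartedSpace (EuclideanHalfSpace (d + 1)) M]
  [IsManifold (𝓡∂ (d + 1)) ∞ M]
  {U : TopologicalSpace.Opens M} [MulAction Circle U]
  [ContMDiffSMul (𝓡 1) (𝓡∂ (d + 1)) ∞ Circle U]
  {Y : Type} [NormedAddCommGroup Y] [NormedSpace ℝ Y]

/-- The local one-form `ζ` in the chart `φ` of the cut space is induced by `β`. -/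
def IsInducedForm (β : DiffForm (𝓡∂ (d + 1)) M 1)
    (φ : OpenPartialHomeomorph (CutSpace d U) (EuclideanSpace ℝ (Fin (d + 1))))
    (ζ : EuclideanSpace ℝ (Fin (d + 1)) → EuclideanSpace ℝ (Fin (d + 1)) →L[ℝ] ℝ) : Prop :=
  ∃ s : EuclideanSpace ℝ (Fin (d + 1)) → M, ∀ v ∈ φ.target,
    cutMap d U (s v) = φ.symm v ∧ (φ.symm v ∉ redSet d U →
      ∃ L : EuclideanSpace ℝ (Fin (d + 1)) →L[ℝ] EuclideanSpace ℝ (Fin (d + 1)),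
        HasMFDerivAt 𝓘(ℝ, EuclideanSpace ℝ (Fin (d + 1))) (𝓡∂ (d + 1)) s v L ∧
        (covec β (s v)).comp L = ζ v)

variable {β : DiffForm (𝓡∂ (d + 1)) M 1}
  {φ φ' : OpenPartialHomeomorph (CutSpace d U) (EuclideanSpace ℝ (Fin (d + 1)))}
  {ζ ζ' : EuclideanSpace ℝ (Fin (d + 1)) → EuclideanSpace ℝ (Fin (d + 1)) →L[ℝ] ℝ}

lemma eventually_mem_interior {N : Type*} [TopologicalSpace N] {s : N → M} {n : N}
    (hs : ContinuousAt s n) (h : cutMap d U (s n) ∉ redSet d U) :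
    ∀ᶠ n' in 𝓝 n, s n' ∉ (𝓡∂ (d + 1)).boundary M := by
  filter_upwards [hs.eventually (isOpen_interior'.mem_nhds (cutMap_not_mem_redSet_iff.1 h))]
    with n' hn'
  exact mem_interior_iff_not_mem_boundary.1 hn'

/-- Off the reduced space the cut map is injective, so the lifts attached to the two charts agree up
to the transition, and so do their derivatives. -/
lemma IsInducedForm.eq_comp (h : IsInducedForm β φ ζ) (h' : IsInducedForm β φ' ζ')
    {v : EuclideanSpace ℝ (Fin (d + 1))} (hv : v ∈ φ.target) (hv' : φ.symm v ∈ φ'.source)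
    (hr : φ.symm v ∉ redSet d U) (hτ : DifferentiableAt ℝ (fun v => φ' (φ.symm v)) v) :
    ζ v = (ζ' (φ' (φ.symm v))).comp (fderiv ℝ (fun v => φ' (φ.symm v)) v) := by
  obtain ⟨s, hs⟩ := h
  obtain ⟨s', hs'⟩ := h'
  obtain ⟨h1, h2⟩ := hs v hv
  obtain ⟨L, hL, hLζ⟩ := h2 hr
  obtain ⟨h3, h4⟩ := hs' _ (φ'.map_source hv')
  rw [φ'.left_inv hv'] at h3 h4
  obtain ⟨L', hL', hLζ'⟩ := h4 hr
  have h5 : s =ᶠ[𝓝 v] fun v => s' (φ' (φ.symm v)) := by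
    filter_upwards [eventually_mem_interior hL.continuousAt (h1.symm ▸ hr),
      (φ.isOpen_inter_preimage_symm φ'.open_source).mem_nhds ⟨hv, hv'⟩] with v' h6 h7
    refine cutMap_injective_of_not_mem (U := U) h6 ?_
    rw [(hs v' h7.1).1, (hs' _ (φ'.map_source h7.2)).1, φ'.left_inv h7.2]
  have h6 := (HasMFDerivAt.comp (f := fun v => φ' (φ.symm v)) v hL'
    hτ.hasFDerivAt.hasMFDerivAt).congr_of_eventuallyEq h5
  have h7 : L = L'.comp (fderiv ℝ (fun v => φ' (φ.symm v)) v) := hasMFDerivAt_unique hL h6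
  rw [← hLζ, ← hLζ', h7, h5.eq_of_nhds]
  rfl

lemma isInducedForm_interiorChart (x₀ : M) :
    IsInducedForm (U := U) β (interiorChart U x₀) (chartCovec β x₀) := by
  refine ⟨(extChartAt (𝓡∂ (d + 1)) x₀).symm, fun v hv => ⟨rfl, fun _ => ?_⟩⟩
  have h2 : range (𝓡∂ (d + 1)) ∈ 𝓝 v := by
    have : {v : EuclideanSpace ℝ (Fin (d + 1)) | 0 < v 0} ∈ 𝓝 v :=
      (isOpen_lt continuous_const (by fun_prop)).mem_nhds hv.2
    filter_upwards [this] with v' h2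
    exact mem_range_halfSpace_iff.2 (le_of_lt h2)
  have h1 : v ∈ (extChartAt (𝓡∂ (d + 1)) x₀).target := by
    rw [extChartAt_target]
    exact ⟨hv.1, mem_range_halfSpace_iff.2 hv.2.le⟩
  have : IsManifold (𝓡∂ (d + 1)) 1 M := IsManifold.of_le (n := ∞) (by simp)
  have h3 := (mdifferentiableWithinAt_extChartAt_symm (I := 𝓡∂ (d + 1)) h1).hasMFDerivWithinAt
  exact ⟨_, h3.hasMFDerivAt h2, (chartCovec_eq β x₀ v).symm⟩

lemma AdaptedChart.isInducedForm {V : Set U} {p : U} (A : AdaptedChart d U Y V p)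
    (hβ : InvariantOn β V) {hU : (𝓡∂ (d + 1)).boundary M ⊆ U} (hb : IsBasicOnBoundary U hU β) :
    IsInducedForm β A.cutChart fun v => (A.cutForm β (A.cutModel v)).comp
      (A.cutModel : EuclideanSpace ℝ (Fin (d + 1)) →L[ℝ] Y × ℂ) := by
  refine ⟨fun v => A.polar (A.cutModel v), fun v hv => ⟨rfl, fun hr => ?_⟩⟩
  have hv' := A.mem_cutChart_target.1 hv
  have h0 : (A.cutModel v).2 ≠ 0 := by
    intro h0
    rw [A.cutChart_symm_apply, cutMap_mem_redSet_iff, A.polar_mem_boundary_iff hv'] at hr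
    exact hr h0
  obtain ⟨L, hL, hLζ⟩ := A.exists_hasMFDerivAt_polar hβ hb hv' h0
  refine ⟨L.comp (A.cutModel : EuclideanSpace ℝ (Fin (d + 1)) →L[ℝ] Y × ℂ),
    hL.comp v A.cutModel.hasFDerivAt.hasMFDerivAt, ?_⟩
  exact congrArg (fun l => l.comp
    (A.cutModel : EuclideanSpace ℝ (Fin (d + 1)) →L[ℝ] Y × ℂ)) hLζ

namespace CutAtlas

variable {V : Set U} (𝒜 : CutAtlas d U Y V)

open Classical in
/-- The expressions of the cut form in the charts of the cut space. -/
def cutLocal (β : DiffForm (𝓡∂ (d + 1)) M 1) (z : CutSpace d U)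
    (v : EuclideanSpace ℝ (Fin (d + 1))) : EuclideanSpace ℝ (Fin (d + 1)) →L[ℝ] ℝ :=
  if h : z ∈ redSet d U then ((𝒜.chart ⟨z, h⟩).cutForm β ((𝒜.chart ⟨z, h⟩).cutModel v)).comp
    ((𝒜.chart ⟨z, h⟩).cutModel : EuclideanSpace ℝ (Fin (d + 1)) →L[ℝ] Y × ℂ)
  else chartCovec β (surjInv (surjective_cutMap (d := d) (U := U)) z) v

lemma cutLocal_of_mem {z : CutSpace d U} (h : z ∈ redSet d U) :
    𝒜.cutLocal β z = fun v => ((𝒜.chart ⟨z, h⟩).cutForm β ((𝒜.chart ⟨z, h⟩).cutModel v)).comp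
      ((𝒜.chart ⟨z, h⟩).cutModel : EuclideanSpace ℝ (Fin (d + 1)) →L[ℝ] Y × ℂ) :=
  funext fun _ => dif_pos h

lemma cutLocal_of_not_mem {z : CutSpace d U} (h : z ∉ redSet d U) :
    𝒜.cutLocal β z = chartCovec β (surjInv (surjective_cutMap (d := d) (U := U)) z) :=
  funext fun _ => dif_neg h

lemma pr_pt (z : redSet d U) : (𝒜.chart z).pr (𝒜.pt z) = 0 := by
  have h := (𝒜.chart z).pr_slice 0 (𝒜.chart z).zero_mem_halfBall
  rwa [(𝒜.chart z).slice_zero] at h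

lemma cutFamily_self {z : CutSpace d U} (h : z ∈ redSet d U) : 𝒜.cutFamily z z = 0 := by
  rw [𝒜.cutFamily_of_mem h]
  refine (congrArg (𝒜.chart ⟨z, h⟩).cutChart (𝒜.cutMap_pt ⟨z, h⟩).symm).trans ?_
  rw [AdaptedChart.cutChart_apply _ (𝒜.pt_mem_dom _), AdaptedChart.cutCoord, 𝒜.pr_pt]
  simp

/-- In an adapted chart the reduced space is w = 0, with dense complement; interior charts do not
meet it. Identities of continuous forms may therefore be checked off the reduced space. -/
lemma target_subset_closure (z : CutSpace d U) :
    ∀ O ⊆ (𝒜.cutFamily z).target, IsOpen O →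
      O ⊆ closure (O ∩ {v | (𝒜.cutFamily z).symm v ∉ redSet d U}) := by
  intro O hOt hO
  by_cases h : z ∈ redSet d U
  · have h1 : Dense {v : EuclideanSpace ℝ (Fin (d + 1)) |
        ((𝒜.chart ⟨z, h⟩).cutModel v).2 ≠ 0} := by
      have h2 : Dense {u : Y × ℂ | u.2 ≠ 0} :=
        (dense_compl_singleton (0 : ℂ)).preimage isOpenMap_snd
      exact h2.preimage (𝒜.chart ⟨z, h⟩).cutModel.toHomeomorph.isOpenMap
    refine (h1.open_subset_closure_inter hO).trans (closure_mono fun v hv => ⟨hv.1, ?_⟩)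
    have hv' := hOt hv.1
    change (𝒜.cutFamily z).symm v ∉ redSet d U
    rw [𝒜.cutFamily_of_mem h] at hv' ⊢
    rw [AdaptedChart.cutChart_symm_apply, cutMap_mem_redSet_iff, AdaptedChart.polar_mem_boundary_iff
      _ ((𝒜.chart ⟨z, h⟩).mem_cutChart_target.1 hv')]
    exact hv.2
  · refine subset_closure.trans (closure_mono fun v hv => ⟨hv, fun hr => h ?_⟩)
    exact 𝒜.mem_redSet_of_mem_cutFamily_source ((𝒜.cutFamily z).map_target (hOt hv)) hr

variable (hβ : InvariantOn β V) {hU : (𝓡∂ (d + 1)).boundary M ⊆ U}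
  (hb : IsBasicOnBoundary U hU β)
include hβ hb

lemma isInducedForm_cutLocal (z : CutSpace d U) :
    IsInducedForm β (𝒜.cutFamily z) (𝒜.cutLocal β z) := by
  by_cases h : z ∈ redSet d U
  · rw [𝒜.cutFamily_of_mem h, 𝒜.cutLocal_of_mem h]
    exact (𝒜.chart ⟨z, h⟩).isInducedForm hβ hb
  · rw [𝒜.cutFamily_of_not_mem h, 𝒜.cutLocal_of_not_mem h]
    exact isInducedForm_interiorChart _

lemma contDiffOn_cutLocal (hβs : β.IsSmooth) (z : CutSpace d U) :
    ContDiffOn ℝ ∞ (𝒜.cutLocal β z) (𝒜.cutFamily z).target := by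
  by_cases h : z ∈ redSet d U
  · rw [𝒜.cutFamily_of_mem h, 𝒜.cutLocal_of_mem h]
    exact (((𝒜.chart ⟨z, h⟩).contDiffOn_cutForm hβ hb hβs).comp
      (𝒜.chart ⟨z, h⟩).cutModel.contDiff.contDiffOn fun v hv => hv).clm_comp contDiffOn_const
  · rw [𝒜.cutFamily_of_not_mem h, 𝒜.cutLocal_of_not_mem h]
    refine (contDiffOn_chartCovec hβs _).mono fun v hv => ?_
    rw [extChartAt_target]
    exact ⟨hv.1, mem_range_halfSpace_iff.2 hv.2.le⟩

/-- Off the reduced space both expressions are induced by β and hence agree; at the remaining points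
they agree by continuity. -/
lemma isCompatible_cutLocal (hβs : β.IsSmooth) :
    @IsCompatible (EuclideanSpace ℝ (Fin (d + 1))) _ _ (CutSpace d U) _ 𝒜.cutChartedSpace
      (𝒜.cutLocal β) := by
  intro z₀ v hv
  change v ∈ (𝒜.cutFamily z₀).target at hv
  change 𝒜.cutLocal β z₀ v = (𝒜.cutLocal β ((𝒜.cutFamily z₀).symm v)
    (𝒜.cutFamily ((𝒜.cutFamily z₀).symm v) ((𝒜.cutFamily z₀).symm v))).comp
      (fderiv ℝ (fun v' => 𝒜.cutFamily ((𝒜.cutFamily z₀).symm v) ((𝒜.cutFamily z₀).symm v')) v)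
  set z := (𝒜.cutFamily z₀).symm v with hz
  set O := (𝒜.cutFamily z₀).target ∩ (𝒜.cutFamily z₀).symm ⁻¹' (𝒜.cutFamily z).source with hO
  have hOo : IsOpen O := (𝒜.cutFamily z₀).isOpen_inter_preimage_symm (𝒜.cutFamily z).open_source
  have hτ : ContDiffOn ℝ ∞ (fun v' => 𝒜.cutFamily z ((𝒜.cutFamily z₀).symm v')) O :=
    fun v' hv' => (𝒜.contDiffAt_cutFamily_trans hv'.1 hv'.2).contDiffWithinAt
  have h1 : ContinuousOn (fun v' => (𝒜.cutLocal β z (𝒜.cutFamily z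
      ((𝒜.cutFamily z₀).symm v'))).comp
      (fderiv ℝ (fun v' => 𝒜.cutFamily z ((𝒜.cutFamily z₀).symm v')) v')) O :=
    ((𝒜.contDiffOn_cutLocal hβ hb hβs z).continuousOn.comp hτ.continuousOn
      fun v' hv' => (𝒜.cutFamily z).map_source hv'.2).clm_comp
        (hτ.continuousOn_fderiv_of_isOpen hOo (by simp))
  have h2 : EqOn (𝒜.cutLocal β z₀) (fun v' => (𝒜.cutLocal β z (𝒜.cutFamily z
      ((𝒜.cutFamily z₀).symm v'))).comp
      (fderiv ℝ (fun v' => 𝒜.cutFamily z ((𝒜.cutFamily z₀).symm v')) v'))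
      (O ∩ {v | (𝒜.cutFamily z₀).symm v ∉ redSet d U}) := fun v' hv' =>
    (𝒜.isInducedForm_cutLocal hβ hb z₀).eq_comp (𝒜.isInducedForm_cutLocal hβ hb z) hv'.1.1
      hv'.1.2 hv'.2 ((𝒜.contDiffAt_cutFamily_trans hv'.1.1 hv'.1.2).differentiableAt (by simp))
  exact EqOn.of_subset_closure h2
    ((𝒜.contDiffOn_cutLocal hβ hb hβs z₀).continuousOn.mono inter_subset_left) h1
    inter_subset_left (𝒜.target_subset_closure z₀ O inter_subset_left hOo)
    ⟨hv, 𝒜.mem_cutFamily_source z⟩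

-- For uniqueness: a form that pulls back to β on the interior has its chart expression off the
-- reduced space forced by the lift.
omit hβ hb in
lemma inChart_of_isCutForm (β' : letI := 𝒜.cutChartedSpace; DiffForm (𝓡 (d + 1)) (CutSpace d U) 1)
    (hβ' : letI := 𝒜.cutChartedSpace; ∀ x ∈ (𝓡∂ (d + 1)).interior M,
      DiffForm.pullback (𝓡∂ (d + 1)) (𝓡 (d + 1)) (cutMap d U) β' x = β x)
    (z : CutSpace d U) {ζ : EuclideanSpace ℝ (Fin (d + 1)) → EuclideanSpace ℝ (Fin (d + 1)) →L[ℝ] ℝ}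
    (hζ : IsInducedForm β (𝒜.cutFamily z) ζ) {v : EuclideanSpace ℝ (Fin (d + 1))}
    (hv : v ∈ (𝒜.cutFamily z).target) (hr : (𝒜.cutFamily z).symm v ∉ redSet d U) :
    letI := 𝒜.cutChartedSpace; β'.inChart z v = formOne _ (ζ v) := by
  let _ := 𝒜.cutChartedSpace
  have := 𝒜.isManifold_cutSpace
  have : IsManifold (𝓡 (d + 1)) 1 (CutSpace d U) := IsManifold.of_le (n := ∞) (by simp)
  obtain ⟨s, hs⟩ := hζ
  obtain ⟨h1, h2⟩ := hs v hv
  obtain ⟨L, hL, hLζ⟩ := h2 hr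
  have hint : s v ∈ (𝓡∂ (d + 1)).interior M := cutMap_not_mem_redSet_iff.1 (h1.symm ▸ hr)
  have hc : MDifferentiableAt (𝓡∂ (d + 1)) (𝓡 (d + 1)) (cutMap d U) (s v) := by
    have h3 := (𝒜.isCutChart_cutFamily (cutMap d U (s v))).contMDiffAt_comp (s v) hint
      (𝒜.mem_cutFamily_source _)
    exact (hasMFDerivAt_of_chart continuous_cutMap.continuousAt
      (h3.mdifferentiableAt (by simp)).hasMFDerivAt).mdifferentiableAt
  have h3 : HasMFDerivAt 𝓘(ℝ, EuclideanSpace ℝ (Fin (d + 1))) (𝓡 (d + 1))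
      (extChartAt (𝓡 (d + 1)) z).symm v
      ((mfderiv (𝓡∂ (d + 1)) (𝓡 (d + 1)) (cutMap d U) (s v) : EuclideanSpace ℝ (Fin (d + 1)) →L[ℝ]
        EuclideanSpace ℝ (Fin (d + 1))).comp L) := by
    refine (hc.hasMFDerivAt.comp v hL).congr_of_eventuallyEq ?_
    filter_upwards [(𝒜.cutFamily z).open_target.mem_nhds hv] with v' hv'
    exact (hs v' hv').1.symm
  have h4 : (mfderivWithin 𝓘(ℝ, EuclideanSpace ℝ (Fin (d + 1))) (𝓡 (d + 1))
      (extChartAt (𝓡 (d + 1)) z).symm (range (𝓡 (d + 1))) v : EuclideanSpace ℝ (Fin (d + 1)) →L[ℝ]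
        EuclideanSpace ℝ (Fin (d + 1))) =
      (mfderiv (𝓡∂ (d + 1)) (𝓡 (d + 1)) (cutMap d U) (s v) : EuclideanSpace ℝ (Fin (d + 1)) →L[ℝ]
        EuclideanSpace ℝ (Fin (d + 1))).comp L := by
    rw [modelWithCornersSelf_coe, range_id, mfderivWithin_univ]
    exact h3.mfderiv
  have h5 := hβ' (s v) hint
  rw [← hLζ, ← formOne_comp]
  have h6 : formOne (EuclideanSpace ℝ (Fin (d + 1))) (covec β (s v)) = β (s v) :=
    (formOne _).apply_symm_apply _
  rw [h6, ← h5]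
  have h7 : (extChartAt (𝓡 (d + 1)) z).symm v = cutMap d U (s v) := h1.symm
  refine (congrArg (fun l => ContinuousAlternatingMap.compContinuousLinearMap
    (M := EuclideanSpace ℝ (Fin (d + 1))) (β' ((extChartAt (𝓡 (d + 1)) z).symm v)) l) h4).trans ?_
  rw [h7]
  rfl

/-- Existence and uniqueness of the contact form on the cut space. -/
theorem exists_isCutForm {m : ℕ} (hβc : IsContactForm m β) :
    letI := 𝒜.cutChartedSpace
    IsCutForm β (gluedForm (𝒜.cutLocal β) : DiffForm (𝓡 (d + 1)) (CutSpace d U) 1) ∧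
      (∀ β' : DiffForm (𝓡 (d + 1)) (CutSpace d U) 1, IsCutForm β β' →
        β' = gluedForm (𝒜.cutLocal β)) ∧
      IsContactForm m (gluedForm (𝒜.cutLocal β) : DiffForm (𝓡 (d + 1)) (CutSpace d U) 1) := by
  let _ := 𝒜.cutChartedSpace
  have := 𝒜.isManifold_cutSpace
  have hβs := hβc.isSmooth
  have hcomp := 𝒜.isCompatible_cutLocal hβ hb hβs
  have hsm : (gluedForm (𝒜.cutLocal β) : DiffForm (𝓡 (d + 1)) (CutSpace d U) 1).IsSmooth :=
    isSmooth_gluedForm hcomp (𝒜.contDiffOn_cutLocal hβ hb hβs)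
  have hpull : ∀ x ∈ (𝓡∂ (d + 1)).interior M, DiffForm.pullback (𝓡∂ (d + 1)) (𝓡 (d + 1))
      (cutMap d U) (gluedForm (𝒜.cutLocal β)) x = β x := by
    intro x hx
    set z := cutMap d U x with hz
    obtain ⟨s, hs⟩ := 𝒜.isInducedForm_cutLocal hβ hb z
    have hzs := 𝒜.mem_cutFamily_source z
    obtain ⟨h1, h2⟩ := hs _ ((𝒜.cutFamily z).map_source hzs)
    rw [(𝒜.cutFamily z).left_inv hzs] at h1 h2
    have hzr : z ∉ redSet d U := cutMap_not_mem_redSet_iff.2 hx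
    obtain ⟨L, hL, hLζ⟩ := h2 hzr
    have h3 := (((𝒜.isCutChart_cutFamily z).contMDiffAt_comp x hx hzs).mdifferentiableAt
      (by simp)).hasMFDerivAt
    obtain ⟨K, hK⟩ : ∃ K : EuclideanSpace ℝ (Fin (d + 1)) →L[ℝ] EuclideanSpace ℝ (Fin (d + 1)),
      HasMFDerivAt (𝓡∂ (d + 1)) 𝓘(ℝ, EuclideanSpace ℝ (Fin (d + 1)))
        (fun x => 𝒜.cutFamily z (cutMap d U x)) x K := ⟨_, h3⟩
    have h4 : (mfderiv (𝓡∂ (d + 1)) (𝓡 (d + 1)) (cutMap d U) x :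
        EuclideanSpace ℝ (Fin (d + 1)) →L[ℝ] EuclideanSpace ℝ (Fin (d + 1))) = K :=
      (hasMFDerivAt_of_chart continuous_cutMap.continuousAt hK).mfderiv
    have h5 : (fun x => s (𝒜.cutFamily z (cutMap d U x))) =ᶠ[𝓝 x] id := by
      filter_upwards [(isOpen_interior' (d := d) (M := M)).mem_nhds hx,
        continuous_cutMap.continuousAt.eventually ((𝒜.cutFamily z).open_source.mem_nhds hzs)]
        with x' h6 h7
      refine (cutMap_injective_of_not_mem (U := U) (mem_interior_iff_not_mem_boundary.1 h6) ?_).symm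
      change cutMap d U x' ∈ (𝒜.cutFamily z).source at h7
      rw [(hs _ ((𝒜.cutFamily z).map_source h7)).1, (𝒜.cutFamily z).left_inv h7]
    have h6 : L.comp K = ContinuousLinearMap.id ℝ (EuclideanSpace ℝ (Fin (d + 1))) :=
      hasMFDerivAt_unique ((HasMFDerivAt.comp (f := fun x => 𝒜.cutFamily z (cutMap d U x)) x hL
        hK).congr_of_eventuallyEq h5.symm) (hasMFDerivAt_id x)
    have h7 : s (𝒜.cutFamily z z) = x := h5.eq_of_nhds
    have h8 : (formOne _ (𝒜.cutLocal β z (𝒜.cutFamily z z))).compContinuousLinearMap K =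
        formOne _ (covec β x) := by
      rw [formOne_comp, ← hLζ, h7, ContinuousLinearMap.comp_assoc, h6,
        ContinuousLinearMap.comp_id]
    rw [← h4] at h8
    exact h8.trans ((formOne _).apply_symm_apply _)
  refine ⟨⟨hsm, hpull⟩, fun β' hβ' => ?_, ?_⟩
  · refine diffForm_ext_of_dense hβ'.isSmooth hsm
      (S := fun z => {v | (𝒜.cutFamily z).symm v ∉ redSet d U})
      (fun z => 𝒜.target_subset_closure z _ subset_rfl (𝒜.cutFamily z).open_target) ?_
    rintro z v ⟨hv, hr⟩
    exact (𝒜.inChart_of_isCutForm β' hβ'.pullback_eq z (𝒜.isInducedForm_cutLocal hβ hb z) hv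
      hr).trans (gluedForm_inChart hcomp z hv).symm
  · refine isContactForm_gluedForm hβc.finrank_eq hcomp (𝒜.contDiffOn_cutLocal hβ hb hβs)
      fun z => ?_
    change ContactAt (𝒜.cutLocal β z (𝒜.cutFamily z z))
      (fderiv ℝ (𝒜.cutLocal β z) (𝒜.cutFamily z z))
    -- On the reduced space the preferred chart is centred at 0, where `contactAt_cutForm` applies;
    -- elsewhere the expression is that of β in a chart of M at an interior point.
    by_cases h : z ∈ redSet d U
    · have h1 : 𝒜.cutFamily z z = 0 := 𝒜.cutFamily_self h
      set A := 𝒜.chart ⟨z, h⟩ with hA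
      rw [h1, 𝒜.cutLocal_of_mem h, ← hA]
      change ContactAt ((A.cutForm β (A.cutModel 0)).comp _) _
      rw [map_zero]
      refine (A.contactAt_cutForm hβ hβs hb hβc).comp A.cutModel.bijective fun v w => ?_
      have h0 : A.cutModel 0 ∈ A.polarDom := by
        have h3 := (𝒜.cutFamily z).map_source (𝒜.mem_cutFamily_source z)
        rw [h1, 𝒜.cutFamily_of_mem h] at h3
        exact h3
      have h4 := ((A.contDiffOn_cutForm hβ hb hβs).contDiffAt
        (A.isOpen_polarDom.mem_nhds h0)).differentiableAt (by simp)
      have h5 := (HasFDerivAt.comp (g := A.cutForm β) 0 h4.hasFDerivAt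
        A.cutModel.hasFDerivAt).clm_comp (hasFDerivAt_const
          (A.cutModel : EuclideanSpace ℝ (Fin (d + 1)) →L[ℝ] Y × ℂ) 0)
      rw [map_zero] at h5
      have h6 : fderiv ℝ (fun v => (A.cutForm β (A.cutModel v)).comp
        (A.cutModel : EuclideanSpace ℝ (Fin (d + 1)) →L[ℝ] Y × ℂ)) 0 = _ := h5.fderiv
      rw [h6]
      simp
    · set x := surjInv (surjective_cutMap (d := d) (U := U)) z with hx
      have hxz : cutMap d U x = z := surjInv_eq _ z
      have hxi : x ∈ (𝓡∂ (d + 1)).interior M := cutMap_not_mem_redSet_iff.1 (hxz.symm ▸ h)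
      have h1 : 𝒜.cutFamily z z = extChartAt (𝓡∂ (d + 1)) x x := by
        rw [𝒜.cutFamily_of_not_mem h, ← hx]
        conv_lhs => rw [← hxz]
        exact interiorChart_apply (mem_extChartAt_source x) hxi
      rw [h1, 𝒜.cutLocal_of_not_mem h, ← hx, chartCovec_self]
      have h2 : range (𝓡∂ (d + 1)) ∈ 𝓝 (extChartAt (𝓡∂ (d + 1)) x x) := by
        have h3 := (mem_interior_iff_extChartAt_pos (mem_extChartAt_source x)).1 hxi
        have : {v : EuclideanSpace ℝ (Fin (d + 1)) | 0 < v 0} ∈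
            𝓝 (extChartAt (𝓡∂ (d + 1)) x x) :=
          (isOpen_lt continuous_const (by fun_prop)).mem_nhds h3
        filter_upwards [this] with v' h2
        exact mem_range_halfSpace_iff.2 (le_of_lt h2)
      rw [← fderivWithin_of_mem_nhds h2]
      exact hβc.contactAt x

end CutAtlas
end CutForms


/-! ### Product charts of the boundary. -/

section MaximalAtlas

variable {E : Type*} [NormedAddCommGroup E] [NormedSpace ℝ E] {X : Type*} [TopologicalSpace X]
  [ChartedSpace E X] [IsManifold 𝓘(ℝ, E) ∞ X]

lemma mem_maximalAtlas_of_contMDiffOn {e : OpenPartialHomeomorph X E}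
    (he : ContMDiffOn 𝓘(ℝ, E) 𝓘(ℝ, E) ∞ e e.source)
    (he' : ContMDiffOn 𝓘(ℝ, E) 𝓘(ℝ, E) ∞ e.symm e.target) :
    e ∈ IsManifold.maximalAtlas 𝓘(ℝ, E) ∞ X := by
  refine mem_maximalAtlas_iff.2 fun e₁ he₁ => ?_
  have h1 := contMDiffOn_of_mem_maximalAtlas (IsManifold.subset_maximalAtlas
    (I := 𝓘(ℝ, E)) (n := ∞) he₁)
  have h2 := contMDiffOn_symm_of_mem_maximalAtlas (IsManifold.subset_maximalAtlas
    (I := 𝓘(ℝ, E)) (n := ∞) he₁)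
  have h3 : ContDiffOn ℝ ∞ (e.symm ≫ₕ e₁) (e.symm ≫ₕ e₁).source :=
    contMDiffOn_iff_contDiffOn.1 (h1.comp (he'.mono fun v hv => (e.symm.trans_source e₁ ▸ hv).1)
      fun v hv => (e.symm.trans_source e₁ ▸ hv).2)
  have h4 : ContDiffOn ℝ ∞ (e₁.symm ≫ₕ e) (e₁.symm ≫ₕ e).source :=
    contMDiffOn_iff_contDiffOn.1 (he.comp (h2.mono fun v hv => (e₁.symm.trans_source e ▸ hv).1)
      fun v hv => (e₁.symm.trans_source e ▸ hv).2)
  have key : ∀ f : OpenPartialHomeomorph E E, ContDiffOn ℝ ∞ f f.source →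
      ContDiffOn ℝ ∞ f.symm f.target → f ∈ contDiffGroupoid ∞ 𝓘(ℝ, E) := by
    intro f hf hf'
    refine mem_groupoid_of_pregroupoid.2 ⟨?_, ?_⟩
    · change ContDiffOn ℝ ∞ (𝓘(ℝ, E) ∘ f ∘ 𝓘(ℝ, E).symm)
        (𝓘(ℝ, E).symm ⁻¹' f.source ∩ range 𝓘(ℝ, E))
      simpa using hf
    · change ContDiffOn ℝ ∞ (𝓘(ℝ, E) ∘ f.symm ∘ 𝓘(ℝ, E).symm)
        (𝓘(ℝ, E).symm ⁻¹' f.target ∩ range 𝓘(ℝ, E))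
      simpa using hf'
  refine ⟨key _ h3 ?_, key _ h4 ?_⟩
  · have : (e.symm ≫ₕ e₁).symm = e₁.symm ≫ₕ e := by
      rw [OpenPartialHomeomorph.trans_symm_eq_symm_trans_symm, OpenPartialHomeomorph.symm_symm]
    rw [← OpenPartialHomeomorph.symm_source, this]
    exact h4
  · have : (e₁.symm ≫ₕ e).symm = e.symm ≫ₕ e₁ := by
      rw [OpenPartialHomeomorph.trans_symm_eq_symm_trans_symm, OpenPartialHomeomorph.symm_symm]
    rw [← OpenPartialHomeomorph.symm_source, this]
    exact h3

end MaximalAtlas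

section RedForms

variable {d : ℕ} {M : Type*} [TopologicalSpace M] [ChartedSpace (EuclideanHalfSpace (d + 1)) M]
  [IsManifold (𝓡∂ (d + 1)) ∞ M]
  {U : TopologicalSpace.Opens M} [MulAction Circle U]
  [ContMDiffSMul (𝓡 1) (𝓡∂ (d + 1)) ∞ Circle U]
  {Y : Type} [NormedAddCommGroup Y] [NormedSpace ℝ Y]

/-- A map to the boundary is smooth if it is smooth as a map to the manifold. -/
lemma contMDiffAt_boundary_of_val {F : Type*} [NormedAddCommGroup F] [NormedSpace ℝ F]
    {H : Type*} [TopologicalSpace H] {J : ModelWithCorners ℝ F H} {N : Type*} [TopologicalSpace N]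
    [ChartedSpace H N] {f : N → (𝓡∂ (d + 1)).boundary M} {n : N}
    (hf : ContMDiffAt J (𝓡∂ (d + 1)) ∞ (fun n => (f n : M)) n) : ContMDiffAt J (𝓡 d) ∞ f n := by
  rw [contMDiffAt_iff] at hf ⊢
  exact ⟨Topology.IsInducing.subtypeVal.continuousAt_iff.2 hf.1,
    (contDiff_euclTail d).comp_contDiffWithinAt hf.2⟩

namespace AdaptedChart

variable {V : Set U} {p p' : U} (A : AdaptedChart d U Y V p)

lemma flow_mem_boundary (a : Circle) (z : ℝ × Y) (hz : ‖z.2‖ < A.r) :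
    ((a • A.flow (z.1, (z.2, 0)) : U) : M) ∈ (𝓡∂ (d + 1)).boundary M := by
  rw [flow, smul_mem_boundary_iff, smul_mem_boundary_iff]
  exact A.slice_zero_mem_boundary hz

open Classical in
/-- The parametrisation `(τ, y) ↦ a • exp (iτ) • slice (y, 0)` of the boundary. -/
def bdryFlow (a : Circle) (x₀ : (𝓡∂ (d + 1)).boundary M) (z : ℝ × Y) :
    (𝓡∂ (d + 1)).boundary M :=
  if h : ‖z.2‖ < A.r then ⟨_, A.flow_mem_boundary a z h⟩ else x₀

lemma bdryPt_bdryFlow (hU : (𝓡∂ (d + 1)).boundary M ⊆ U) (a : Circle)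
    (x₀ : (𝓡∂ (d + 1)).boundary M) {z : ℝ × Y} (hz : ‖z.2‖ < A.r) :
    bdryPt hU (A.bdryFlow a x₀ z) = a • A.flow (z.1, (z.2, 0)) := by
  rw [bdryFlow, dif_pos hz]
  rfl

lemma contMDiffOn_bdryFlow (a : Circle) (x₀ : (𝓡∂ (d + 1)).boundary M) :
    ContMDiffOn 𝓘(ℝ, ℝ × Y) (𝓡 d) ∞ (A.bdryFlow a x₀) {z | ‖z.2‖ < A.r} := by
  have ho : IsOpen {z : ℝ × Y | ‖z.2‖ < A.r} := isOpen_lt (by fun_prop) continuous_const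
  intro z hz
  refine (contMDiffAt_boundary_of_val ?_).contMDiffWithinAt
  have h1 : ContMDiffOn 𝓘(ℝ, ℝ × Y) (𝓡∂ (d + 1)) ∞
      (fun z : ℝ × Y => ((a • A.flow (z.1, (z.2, 0)) : U) : M)) {z | ‖z.2‖ < A.r} := by
    refine contMDiff_subtype_val.comp_contMDiffOn ((contMDiff_smul_left (d := d) a).comp_contMDiffOn
      (A.contMDiffOn_flow.comp ?_ fun z hz => ⟨mem_univ _, mem_halfBall_zero_iff.2 hz⟩))
    exact (contDiff_fst.prodMk (contDiff_snd.prodMk contDiff_const)).contMDiff.contMDiffOn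
  refine (h1.contMDiffAt (ho.mem_nhds hz)).congr_of_eventuallyEq ?_
  filter_upwards [ho.mem_nhds hz] with z' hz'
  change ‖z'.2‖ < A.r at hz'
  rw [bdryFlow, dif_pos hz']

variable {hU : (𝓡∂ (d + 1)).boundary M ⊆ U}

lemma bdryFlow_mem {a : Circle} {x₀ : (𝓡∂ (d + 1)).boundary M} {z : ℝ × Y} (hz : ‖z.2‖ < A.r) :
    bdryPt hU (A.bdryFlow a x₀ z) ∈ A.dom := by
  rw [A.bdryPt_bdryFlow hU a x₀ hz]
  exact A.smul_mem _ _ (A.flow_mem (mem_halfBall_zero_iff.2 hz))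

lemma pr_bdryFlow {a : Circle} {x₀ : (𝓡∂ (d + 1)).boundary M} {z : ℝ × Y} (hz : ‖z.2‖ < A.r) :
    A.pr (bdryPt hU (A.bdryFlow a x₀ z)) = (z.2, 0) := by
  have h := mem_halfBall_zero_iff.2 hz
  rw [A.bdryPt_bdryFlow hU a x₀ hz, A.pr_smul _ _ (A.flow_mem h), flow,
    A.pr_smul _ _ (A.slice_mem _ h), A.pr_slice _ h]

lemma ang_bdryFlow {a : Circle} {x₀ : (𝓡∂ (d + 1)).boundary M} {z : ℝ × Y} (hz : ‖z.2‖ < A.r) :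
    A.ang (bdryPt hU (A.bdryFlow a x₀ z)) = a * Circle.exp z.1 := by
  have h := mem_halfBall_zero_iff.2 hz
  rw [A.bdryPt_bdryFlow hU a x₀ hz, A.ang_smul _ _ (A.flow_mem h), flow,
    A.ang_smul _ _ (A.slice_mem _ h), A.ang_slice _ h, mul_one]

lemma bdryFlow_eq {a : Circle} {x₀ x : (𝓡∂ (d + 1)).boundary M} (hx : bdryPt hU x ∈ A.dom)
    {τ : ℝ} (hτ : a * Circle.exp τ = A.ang (bdryPt hU x)) :
    A.bdryFlow a x₀ (τ, (A.pr (bdryPt hU x)).1) = x := by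
  have h1 : bdryPt hU (A.bdryFlow a x₀ (τ, (A.pr (bdryPt hU x)).1)) = bdryPt hU x := by
    rw [A.bdryPt_bdryFlow hU a x₀ (A.norm_pr_fst_lt hx), flow, smul_smul, hτ,
      ← A.pr_eq_of_mem_boundary hx x.2, A.ang_smul_slice _ hx]
  exact Subtype.ext (congrArg (fun x : U => (x : M)) h1)

/-- The derivative of the projection of the boundary to `Y` is surjective. -/
lemma surjective_of_hasMFDerivAt_pr {x : (𝓡∂ (d + 1)).boundary M} (hx : bdryPt hU x ∈ A.dom)
    {K : EuclideanSpace ℝ (Fin d) →L[ℝ] Y}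
    (hK : HasMFDerivAt (𝓡 d) 𝓘(ℝ, Y) (fun x => (A.pr (bdryPt hU x)).1) x K) : Surjective K := by
  have ho : IsOpen {z : ℝ × Y | ‖z.2‖ < A.r} := isOpen_lt (by fun_prop) continuous_const
  set z₀ : ℝ × Y := (0, (A.pr (bdryPt hU x)).1) with hz₀
  have hz : z₀ ∈ {z : ℝ × Y | ‖z.2‖ < A.r} := A.norm_pr_fst_lt hx
  have h1 : A.bdryFlow (A.ang (bdryPt hU x)) x z₀ = x := A.bdryFlow_eq hx (by simp)
  have h2 := (((A.contMDiffOn_bdryFlow (A.ang (bdryPt hU x)) x).contMDiffAt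
    (ho.mem_nhds hz)).mdifferentiableAt (by simp)).hasMFDerivAt
  obtain ⟨S, hS⟩ : ∃ S : ℝ × Y →L[ℝ] EuclideanSpace ℝ (Fin d), HasMFDerivAt 𝓘(ℝ, ℝ × Y) (𝓡 d)
    (A.bdryFlow (A.ang (bdryPt hU x)) x) z₀ S := ⟨_, h2⟩
  -- Composed with the parametrisation by (τ, y) the projection becomes (τ, y) ↦ y, whose derivative
  -- is onto.
  have h3 := HasMFDerivAt.comp z₀ (h1.symm ▸ hK) hS
  have h4 : HasFDerivAt (fun z : ℝ × Y => z.2) (K.comp S) z₀ := by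
    refine HasFDerivAt.congr_of_eventuallyEq h3.hasFDerivAt ?_
    filter_upwards [ho.mem_nhds hz] with z hz'
    exact (congrArg Prod.fst (A.pr_bdryFlow hz')).symm
  have h5 : K.comp S = ContinuousLinearMap.snd ℝ ℝ Y := h4.unique hasFDerivAt_snd
  intro y
  exact ⟨S (0, y), congrArg (fun l => l (0, y)) h5⟩

variable (hU) in
/-- The chart of the boundary given by the angle and the coordinate in `Y`. -/
def bdryChart (x₀ : (𝓡∂ (d + 1)).boundary M) :
    OpenPartialHomeomorph ((𝓡∂ (d + 1)).boundary M) (ℝ × Y) where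
  -- The angle relative to `x₀` takes values in (−π, π) once the opposite point of each circle is
  -- removed.
  toFun x := (Complex.arg (((A.ang (bdryPt hU x₀))⁻¹ * A.ang (bdryPt hU x) : Circle) : ℂ),
    (A.pr (bdryPt hU x)).1)
  invFun := A.bdryFlow (A.ang (bdryPt hU x₀)) x₀
  source := bdryPt hU ⁻¹' A.dom ∩ (fun x =>
    (((A.ang (bdryPt hU x₀))⁻¹ * A.ang (bdryPt hU x) : Circle) : ℂ)) ⁻¹' Complex.slitPlane
  target := Ioo (-Real.pi) Real.pi ×ˢ Metric.ball 0 A.r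
  map_source' x hx := by
    have h1 := Complex.mem_slitPlane_iff_arg.1 hx.2
    exact ⟨⟨Complex.neg_pi_lt_arg _, lt_of_le_of_ne (Complex.arg_le_pi _) h1.1⟩,
      mem_ball_zero_iff.2 (A.norm_pr_fst_lt hx.1)⟩
  map_target' z hz := by
    have hz' := mem_ball_zero_iff.1 hz.2
    refine ⟨A.bdryFlow_mem hz', ?_⟩
    rw [mem_preimage, A.ang_bdryFlow hz', inv_mul_cancel_left, Complex.mem_slitPlane_iff_arg,
      Circle.arg_exp hz.1.1 hz.1.2.le]
    exact ⟨hz.1.2.ne, Circle.coe_ne_zero _⟩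
  left_inv' x hx := by
    refine A.bdryFlow_eq hx.1 ?_
    rw [circle_exp_arg, mul_inv_cancel_left]
  right_inv' z hz := by
    have hz' := mem_ball_zero_iff.1 hz.2
    refine Prod.ext ?_ (congrArg Prod.fst (A.pr_bdryFlow hz'))
    change Complex.arg _ = z.1
    rw [A.ang_bdryFlow hz', inv_mul_cancel_left, Circle.arg_exp hz.1.1 hz.1.2.le]
  open_source := by
    refine ContinuousOn.isOpen_inter_preimage ?_
      (A.isOpen_dom.preimage (continuous_bdryPt hU)) Complex.isOpen_slitPlane
    exact fun x hx => ((contMDiff_circle_coe.continuous.continuousAt.comp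
      (continuousAt_const.mul (A.contMDiffAt_ang_bdryPt hx).continuousAt))).continuousWithinAt
  open_target := isOpen_Ioo.prod Metric.isOpen_ball
  continuousOn_toFun := fun x hx => by
    refine ContinuousAt.continuousWithinAt (ContinuousAt.prodMk ?_ ?_)
    · exact ContinuousAt.comp (g := Complex.arg) (Complex.continuousAt_arg hx.2)
        (contMDiff_circle_coe.continuous.continuousAt.comp
        (continuousAt_const.mul (A.contMDiffAt_ang_bdryPt hx.1).continuousAt))
    · exact continuous_fst.continuousAt.comp (A.contMDiffAt_pr_bdryPt hx.1).continuousAt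
  continuousOn_invFun := (A.contMDiffOn_bdryFlow _ x₀).continuousOn.mono
    fun z hz => mem_ball_zero_iff.1 hz.2

lemma contMDiffOn_bdryChart (x₀ : (𝓡∂ (d + 1)).boundary M) :
    ContMDiffOn (𝓡 d) 𝓘(ℝ, ℝ × Y) ∞ (A.bdryChart hU x₀) (A.bdryChart hU x₀).source := by
  intro x hx
  have h1 : ContMDiffAt (𝓡 d) 𝓘(ℝ, ℂ) ∞ (fun x => (((A.ang (bdryPt hU x₀))⁻¹ *
      A.ang (bdryPt hU x) : Circle) : ℂ)) x := contMDiff_circle_coe.contMDiffAt.comp x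
    (contMDiffAt_const.mul (A.contMDiffAt_ang_bdryPt hx.1))
  exact (((contDiffAt_arg hx.2).contMDiffAt.comp x h1).prodMk_space
    (contDiff_fst.contMDiff.contMDiffAt.comp x (A.contMDiffAt_pr_bdryPt hx.1))).contMDiffWithinAt

/-- The chart of the boundary with values in Euclidean space. -/
lemma bdryChart_mem_maximalAtlas (x₀ : (𝓡∂ (d + 1)).boundary M) :
    (A.bdryChart hU x₀).transHomeomorph A.bdryModel.symm.toHomeomorph ∈
      IsManifold.maximalAtlas (𝓡 d) ∞ ((𝓡∂ (d + 1)).boundary M) := by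
  refine mem_maximalAtlas_of_contMDiffOn ?_ ?_
  · exact A.bdryModel.symm.contDiff.contMDiff.comp_contMDiffOn (A.contMDiffOn_bdryChart x₀)
  · exact (A.contMDiffOn_bdryFlow _ x₀).comp A.bdryModel.contDiff.contMDiff.contMDiffOn
      fun v hv => mem_ball_zero_iff.1 (show A.bdryModel v ∈ Ioo (-Real.pi) Real.pi ×ˢ
        Metric.ball (0 : Y) A.r from hv).2

end AdaptedChart
end RedForms


/-! ### The contact form on the reduced space. -/

section RedForm

variable {d : ℕ} {M : Type*} [TopologicalSpace M] [ChartedSpace (EuclideanHalfSpace (d + 1)) M]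
  [IsManifold (𝓡∂ (d + 1)) ∞ M]
  {U : TopologicalSpace.Opens M} [MulAction Circle U]
  [ContMDiffSMul (𝓡 1) (𝓡∂ (d + 1)) ∞ Circle U]
  {Y : Type} [NormedAddCommGroup Y] [NormedSpace ℝ Y]

namespace CutAtlas

variable {V : Set U} (𝒜 : CutAtlas d U Y V) {β : DiffForm (𝓡∂ (d + 1)) M 1}
  (hU : (𝓡∂ (d + 1)).boundary M ⊆ U)

/-- The expressions of the reduced form in the charts of the reduced space. -/
def redLocal (β : DiffForm (𝓡∂ (d + 1)) M 1) (z : redSet d U) : Y → Y →L[ℝ] ℝ :=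
  (𝒜.chart z).redForm β

lemma redFamily_self (z : redSet d U) : 𝒜.redFamily hU z z = 0 := by
  have h : redMap d U ⟨𝒜.pt z, 𝒜.pt_mem_boundary z⟩ = z := Subtype.ext (𝒜.cutMap_pt z)
  have h1 := (𝒜.chart z).redChart_apply hU z (x := ⟨𝒜.pt z, 𝒜.pt_mem_boundary z⟩) (𝒜.pt_mem_dom z)
  rw [h] at h1
  exact h1.trans (congrArg Prod.fst (𝒜.pr_pt z))

lemma bdryPt_mem_dom (x : (𝓡∂ (d + 1)).boundary M) :
    bdryPt hU x ∈ (𝒜.chart (redMap d U x)).dom :=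
  ((𝒜.chart (redMap d U x)).redMap_mem_redChart_source hU).1 (𝒜.mem_redFamily_source hU _)

lemma contDiffOn_redLocal (hβs : β.IsSmooth) (z : redSet d U) :
    ContDiffOn ℝ ∞ (𝒜.redLocal β z) (𝒜.redFamily hU z).target :=
  (𝒜.chart z).contDiffOn_redForm hβs

variable {hU}

lemma hasMFDerivAt_redMap {x : (𝓡∂ (d + 1)).boundary M} {K : EuclideanSpace ℝ (Fin d) →L[ℝ] Y}
    (hK : HasMFDerivAt (𝓡 d) 𝓘(ℝ, Y)
      (fun x' => ((𝒜.chart (redMap d U x)).pr (bdryPt hU x')).1) x K) :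
    letI := 𝒜.redChartedSpace hU; HasMFDerivAt (𝓡 d) 𝓘(ℝ, Y) (redMap d U) x K := by
  let _ := 𝒜.redChartedSpace hU
  refine hasMFDerivAt_of_chart (isQuotientMap_redMap hU).continuous.continuousAt ?_
  refine hK.congr_of_eventuallyEq ?_
  filter_upwards [((𝒜.chart (redMap d U x)).isOpen_dom.preimage
    (AdaptedChart.continuous_bdryPt hU)).mem_nhds (𝒜.bdryPt_mem_dom hU x)] with x' hx'
  exact (𝒜.chart (redMap d U x)).redChart_apply hU _ hx'

variable (hβ : InvariantOn β V) (hb : IsBasicOnBoundary U hU β)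
include hβ hb

/-- Both local expressions pull back to the same form on the boundary, and the projection to Y has
surjective derivative, which can be cancelled. -/
lemma isCompatible_redLocal :
    @IsCompatible Y _ _ (redSet d U) _ (𝒜.redChartedSpace hU) (𝒜.redLocal β) := by
  intro z₀ y hy
  change y ∈ (𝒜.redFamily hU z₀).target at hy
  change 𝒜.redLocal β z₀ y = (𝒜.redLocal β ((𝒜.redFamily hU z₀).symm y)
    (𝒜.redFamily hU ((𝒜.redFamily hU z₀).symm y) ((𝒜.redFamily hU z₀).symm y))).comp
      (fderiv ℝ (fun y' => 𝒜.redFamily hU ((𝒜.redFamily hU z₀).symm y)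
        ((𝒜.redFamily hU z₀).symm y')) y)
  have hy' : ‖y‖ < (𝒜.chart z₀).r := ((𝒜.chart z₀).mem_redChart_target hU).1 hy
  obtain ⟨x, hxz, hx0, hxy⟩ : ∃ x, (𝒜.redFamily hU z₀).symm y = redMap d U x ∧
      bdryPt hU x ∈ (𝒜.chart z₀).dom ∧ ((𝒜.chart z₀).pr (bdryPt hU x)).1 = y :=
    ⟨_, (𝒜.chart z₀).redChart_symm_apply hU hy',
      (𝒜.chart z₀).slice_mem _ (mem_halfBall_zero_iff.2 hy'),
      congrArg Prod.fst ((𝒜.chart z₀).pr_slice _ (mem_halfBall_zero_iff.2 hy'))⟩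
  have hx1 := 𝒜.bdryPt_mem_dom hU x
  have hτ := ((𝒜.chart z₀).contDiffAt_redChart_symm (𝒜.chart (redMap d U x)) hU hy
    (z₁ := redMap d U x) (by
      change (𝒜.redFamily hU z₀).symm y ∈ _
      rw [hxz]
      exact 𝒜.mem_redFamily_source hU _)).differentiableAt (by simp)
  rw [hxz]
  have h1 : 𝒜.redFamily hU (redMap d U x) (redMap d U x) =
      ((𝒜.chart (redMap d U x)).pr (bdryPt hU x)).1 := AdaptedChart.redChart_apply _ hU _ hx1
  rw [h1]
  obtain ⟨L, K, hL, hK, h⟩ := (𝒜.chart z₀).exists_hasMFDerivAt_boundary hβ hb hx0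
  obtain ⟨L', K', hL', hK', h'⟩ :=
    (𝒜.chart (redMap d U x)).exists_hasMFDerivAt_boundary hβ hb hx1
  obtain rfl : L = L' := hasMFDerivAt_unique hL hL'
  obtain ⟨T, hT, hTe⟩ : ∃ T : Y →L[ℝ] Y, HasFDerivAt (fun y' => 𝒜.redFamily hU (redMap d U x)
    ((𝒜.redFamily hU z₀).symm y')) T y ∧ T = fderiv ℝ (fun y' => 𝒜.redFamily hU (redMap d U x)
    ((𝒜.redFamily hU z₀).symm y')) y := ⟨_, hτ.hasFDerivAt, rfl⟩
  rw [← hTe]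
  -- The two projections of the boundary to Y differ by the transition map of the reduced space.
  have hK'T : K' = T.comp K := by
    refine hasMFDerivAt_unique hK' ((HasMFDerivAt.comp x (hxy.symm ▸ hT.hasMFDerivAt)
      hK).congr_of_eventuallyEq ?_)
    filter_upwards [((𝒜.chart z₀).isOpen_dom.preimage
      (AdaptedChart.continuous_bdryPt hU)).mem_nhds hx0,
      ((𝒜.chart (redMap d U x)).isOpen_dom.preimage
      (AdaptedChart.continuous_bdryPt hU)).mem_nhds hx1] with x' h0 h1
    have h2 := (𝒜.redFamily hU z₀).left_inv
      (((𝒜.chart z₀).redMap_mem_redChart_source hU (z₀ := z₀)).2 h0)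
    have h3 : 𝒜.redFamily hU z₀ (redMap d U x') = _ := (𝒜.chart z₀).redChart_apply hU z₀ h0
    rw [h3] at h2
    change _ = 𝒜.redFamily hU (redMap d U x) ((𝒜.redFamily hU z₀).symm _)
    rw [h2]
    exact ((𝒜.chart (redMap d U x)).redChart_apply hU _ h1).symm
  have hKs := (𝒜.chart z₀).surjective_of_hasMFDerivAt_pr hx0 hK
  refine ContinuousLinearMap.ext fun u => ?_
  obtain ⟨w, rfl⟩ := hKs u
  have h2 := congrArg (fun l => l w) (h.symm.trans h')
  rw [hK'T, hxy] at h2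
  exact h2

end CutAtlas

namespace CutAtlas

variable {n : ℕ} {V : Set U} (𝒜 : CutAtlas d U (EuclideanSpace ℝ (Fin n)) V)
  {β : DiffForm (𝓡∂ (d + 1)) M 1} {hU : (𝓡∂ (d + 1)).boundary M ⊆ U}

lemma pullback_redMap (hβ : InvariantOn β V) (hb : IsBasicOnBoundary U hU β)
    (x : (𝓡∂ (d + 1)).boundary M) :
    letI := 𝒜.redChartedSpace hU
    ∃ K : EuclideanSpace ℝ (Fin d) →L[ℝ] EuclideanSpace ℝ (Fin n), Surjective K ∧
      (mfderiv (𝓡 d) (𝓡 n) (redMap d U) x :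
        EuclideanSpace ℝ (Fin d) →L[ℝ] EuclideanSpace ℝ (Fin n)) = K ∧
      (formOne (EuclideanSpace ℝ (Fin n)) (𝒜.redLocal β (redMap d U x)
        (𝒜.redFamily hU (redMap d U x) (redMap d U x)))).compContinuousLinearMap K =
        boundaryPullback β x := by
  let _ := 𝒜.redChartedSpace hU
  have hx := 𝒜.bdryPt_mem_dom hU x
  obtain ⟨L, K, hL, hK, h⟩ :=
    (𝒜.chart (redMap d U x)).exists_hasMFDerivAt_boundary hβ hb hx
  refine ⟨K, AdaptedChart.surjective_of_hasMFDerivAt_pr _ hx hK,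
    (𝒜.hasMFDerivAt_redMap hK).mfderiv, ?_⟩
  have h1 : 𝒜.redFamily hU (redMap d U x) (redMap d U x) =
      ((𝒜.chart (redMap d U x)).pr (bdryPt hU x)).1 := AdaptedChart.redChart_apply _ hU _ hx
  rw [h1, formOne_comp]
  refine (congrArg (formOne (EuclideanSpace ℝ (Fin d))) h.symm).trans ?_
  rw [← formOne_comp]
  have h6 : formOne (EuclideanSpace ℝ (Fin (d + 1))) (covec β x) = β x :=
    (formOne _).apply_symm_apply _
  rw [h6]
  exact (congrArg (fun l : EuclideanSpace ℝ (Fin d) →L[ℝ] EuclideanSpace ℝ (Fin (d + 1)) =>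
    ContinuousAlternatingMap.compContinuousLinearMap (β (x : M)) l) hL.mfderiv).symm

/-- Existence and uniqueness of the contact form on the reduced space. -/
theorem exists_isReducedForm (hβ : InvariantOn β V) (hb : IsBasicOnBoundary U hU β)
    {m m' : ℕ} (hβc : IsContactForm m β) (hn : n = 2 * m' + 1) :
    letI := 𝒜.redChartedSpace hU
    IsReducedForm β (gluedForm (𝒜.redLocal β) : DiffForm (𝓡 n) (redSet d U) 1) ∧
      (∀ β' : DiffForm (𝓡 n) (redSet d U) 1, IsReducedForm β β' → β' = gluedForm (𝒜.redLocal β)) ∧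
      IsContactForm m' (gluedForm (𝒜.redLocal β) : DiffForm (𝓡 n) (redSet d U) 1) := by
  let _ := 𝒜.redChartedSpace hU
  have := 𝒜.isManifold_redSet hU
  have hcomp := 𝒜.isCompatible_redLocal hβ hb
  have hs := 𝒜.contDiffOn_redLocal hU hβc.isSmooth
  refine ⟨⟨isSmooth_gluedForm hcomp hs, ?_⟩, fun β' hβ' => ?_, ?_⟩
  · funext x
    obtain ⟨K, -, hK, h⟩ := 𝒜.pullback_redMap hβ hb x
    refine Eq.trans ?_ h
    exact congrArg (fun l : EuclideanSpace ℝ (Fin d) →L[ℝ] EuclideanSpace ℝ (Fin n) =>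
      ContinuousAlternatingMap.compContinuousLinearMap
        (gluedForm (𝒜.redLocal β) (redMap d U x)) l) hK
  · funext z
    obtain ⟨x, rfl⟩ := (isQuotientMap_redMap hU).surjective z
    obtain ⟨K, hKs, hK, h⟩ := 𝒜.pullback_redMap hβ hb x
    have h1 := (congrFun hβ'.pullback_eq x).trans h.symm
    have h2 := (congrArg (fun l : EuclideanSpace ℝ (Fin d) →L[ℝ] EuclideanSpace ℝ (Fin n) =>
      ContinuousAlternatingMap.compContinuousLinearMap (β' (redMap d U x)) l) hK).symm.trans h1
    refine ContinuousAlternatingMap.ext fun v => ?_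
    -- Tangent vectors of the reduced space lift to the boundary, where the values of the form are
    -- prescribed.
    choose u hu using fun i => hKs (v i)
    obtain rfl : K ∘ u = v := funext hu
    exact congrArg (fun l => l u) h2
  · refine isContactForm_gluedForm (by simp [hn]) hcomp hs fun z => ?_
    have h1 : chartAt (EuclideanSpace ℝ (Fin n)) z z = 0 := 𝒜.redFamily_self hU z
    rw [h1]
    exact (𝒜.chart z).contactAt_redForm hβ hβc.isSmooth hb hβc

end CutAtlas
end RedForm


/-! ### The reduced space as a contact submanifold. -/

section RedSubmanifold

variable {d n : ℕ} {M : Type*} [TopologicalSpace M] [ChartedSpace (EuclideanHalfSpace (d + 1)) M]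
  [IsManifold (𝓡∂ (d + 1)) ∞ M]
  {U : TopologicalSpace.Opens M} [MulAction Circle U]
  [ContMDiffSMul (𝓡 1) (𝓡∂ (d + 1)) ∞ Circle U]

namespace CutAtlas

variable {V : Set U} (𝒜 : CutAtlas d U (EuclideanSpace ℝ (Fin n)) V)
  {β : DiffForm (𝓡∂ (d + 1)) M 1} {hU : (𝓡∂ (d + 1)).boundary M ⊆ U}

/-- In the product chart (angle, y) of the boundary the quotient map is the projection to y; the
complement ℝ is the angle. -/
theorem isSubmersion_redMap :
    letI := 𝒜.redChartedSpace hU; IsSubmersion (𝓡 d) (𝓡 n) ∞ (redMap d U) := by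
  let _ := 𝒜.redChartedSpace hU
  have := 𝒜.isManifold_redSet hU
  refine IsSubmersionOfComplement.isSubmersion (F := ℝ) fun x => ?_
  have hx := 𝒜.bdryPt_mem_dom hU x
  set A := 𝒜.chart (redMap d U x) with hA
  refine IsSubmersionAtOfComplement.mk_of_continuousAt
    (isQuotientMap_redMap hU).continuous.continuousAt
    (A.bdryModel.trans (ContinuousLinearEquiv.prodComm ℝ ℝ (EuclideanSpace ℝ (Fin n))))
    ((A.bdryChart hU x).transHomeomorph A.bdryModel.symm.toHomeomorph)
    (𝒜.redFamily hU (redMap d U x)) ⟨hx, ?_⟩ (𝒜.mem_redFamily_source hU _)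
    (A.bdryChart_mem_maximalAtlas x) (IsManifold.chart_mem_maximalAtlas (redMap d U x)) ?_
  · rw [mem_preimage, inv_mul_cancel]
    exact Complex.one_mem_slitPlane
  · intro v hv
    have hv' : A.bdryModel v ∈ (A.bdryChart hU x).target := by
      simpa [mfld_simps] using hv
    have h1 := mem_ball_zero_iff.1 hv'.2
    change 𝒜.redFamily hU (redMap d U x) (redMap d U (A.bdryFlow _ x (A.bdryModel v))) =
      (A.bdryModel v).2
    exact (A.redChart_apply hU _ (A.bdryFlow_mem h1)).trans (congrArg Prod.fst (A.pr_bdryFlow h1))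

/-- The charts of both spaces at z come from the same adapted chart, so the inclusion reads y ↦ (y,
0). This is at once the normal form of an immersion and the formula for its derivative. -/
lemma cutFamily_redFamily_symm (z : redSet d U) {y : EuclideanSpace ℝ (Fin n)}
    (hy : y ∈ (𝒜.redFamily hU z).target) :
    𝒜.cutFamily z ((𝒜.redFamily hU z).symm y : redSet d U) =
      (𝒜.chart z).cutModel.symm (y, 0) := by
  have hy' := ((𝒜.chart z).mem_redChart_target hU).1 hy
  have h1 := mem_halfBall_zero_iff.2 hy'
  rw [𝒜.cutFamily_of_mem z.2]
  refine (congrArg (fun x : redSet d U => (𝒜.chart z).cutChart x)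
    ((𝒜.chart z).redChart_symm_apply hU hy')).trans ?_
  refine ((𝒜.chart z).cutChart_apply ((𝒜.chart z).slice_mem _ h1)).trans ?_
  rw [AdaptedChart.cutCoord, (𝒜.chart z).pr_slice _ h1]
  simp

theorem isSmoothEmbedding_val :
    letI := 𝒜.redChartedSpace hU
    letI := 𝒜.cutChartedSpace
    IsSmoothEmbedding (𝓡 n) (𝓡 (d + 1)) ∞ (Subtype.val : redSet d U → CutSpace d U) := by
  let _ := 𝒜.redChartedSpace hU
  let _ := 𝒜.cutChartedSpace
  have := 𝒜.isManifold_redSet hU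
  have := 𝒜.isManifold_cutSpace
  refine ⟨IsImmersionOfComplement.isImmersion (F := ℂ) fun z => ?_, IsEmbedding.subtypeVal⟩
  refine IsImmersionAtOfComplement.mk_of_continuousAt continuous_subtype_val.continuousAt
    (𝒜.chart z).cutModel.symm (𝒜.redFamily hU z) (𝒜.cutFamily z) (𝒜.mem_redFamily_source hU z)
    (𝒜.mem_cutFamily_source z) (IsManifold.chart_mem_maximalAtlas z)
    (IsManifold.chart_mem_maximalAtlas (z : CutSpace d U)) fun y hy => ?_
  refine 𝒜.cutFamily_redFamily_symm (hU := hU) z ?_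
  simpa [mfld_simps] using hy

/-- At w = 0 the term with `crossForm` vanishes and |w|² has zero derivative. -/
lemma cutForm_zero_comp_inl {p : U} (A : AdaptedChart d U (EuclideanSpace ℝ (Fin n)) V p) :
    (A.cutForm β 0).comp (ContinuousLinearMap.inl ℝ (EuclideanSpace ℝ (Fin n)) ℂ) =
      A.redForm β 0 := by
  ext u
  simp [AdaptedChart.cutForm, AdaptedChart.redForm, sqDeriv, crossForm]

theorem pullback_val_cutForm :
    letI := 𝒜.redChartedSpace hU
    letI := 𝒜.cutChartedSpace
    DiffForm.pullback (𝓡 n) (𝓡 (d + 1)) (Subtype.val : redSet d U → CutSpace d U)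
      (gluedForm (𝒜.cutLocal β)) = gluedForm (𝒜.redLocal β) := by
  let _ := 𝒜.redChartedSpace hU
  let _ := 𝒜.cutChartedSpace
  funext z
  have h1 : HasMFDerivAt (𝓡 n) (𝓡 (d + 1)) (Subtype.val : redSet d U → CutSpace d U) z
      (((𝒜.chart z).cutModel.symm : EuclideanSpace ℝ (Fin n) × ℂ →L[ℝ]
        EuclideanSpace ℝ (Fin (d + 1))).comp
        (ContinuousLinearMap.inl ℝ (EuclideanSpace ℝ (Fin n)) ℂ)) := by
    refine ⟨continuous_subtype_val.continuousAt, HasFDerivAt.hasFDerivWithinAt ?_⟩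
    refine HasFDerivAt.congr_of_eventuallyEq
      (f := fun y : EuclideanSpace ℝ (Fin n) => (𝒜.chart z).cutModel.symm (y, 0)) ?_ ?_
    · exact (𝒜.chart z).cutModel.symm.hasFDerivAt.comp _ (hasFDerivAt_prodMk_left _ _)
    · filter_upwards [(𝒜.redFamily hU z).open_target.mem_nhds
        ((𝒜.redFamily hU z).map_source (𝒜.mem_redFamily_source hU z))] with y hy
      exact 𝒜.cutFamily_redFamily_symm z hy
  have h2 : 𝒜.cutLocal β z (𝒜.cutFamily z z) = ((𝒜.chart z).cutForm β 0).comp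
      ((𝒜.chart z).cutModel : EuclideanSpace ℝ (Fin (d + 1)) →L[ℝ]
        EuclideanSpace ℝ (Fin n) × ℂ) := by
    rw [𝒜.cutFamily_self z.2, 𝒜.cutLocal_of_mem z.2]
    exact congrArg (fun w => ((𝒜.chart z).cutForm β w).comp ((𝒜.chart z).cutModel :
      EuclideanSpace ℝ (Fin (d + 1)) →L[ℝ] EuclideanSpace ℝ (Fin n) × ℂ)) (map_zero _)
  have h3 : (𝒜.cutLocal β z (𝒜.cutFamily z z)).comp
      (((𝒜.chart z).cutModel.symm : EuclideanSpace ℝ (Fin n) × ℂ →L[ℝ]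
        EuclideanSpace ℝ (Fin (d + 1))).comp
        (ContinuousLinearMap.inl ℝ (EuclideanSpace ℝ (Fin n)) ℂ)) =
      𝒜.redLocal β z (𝒜.redFamily hU z z) := by
    rw [h2, 𝒜.redFamily_self hU z, redLocal, ← cutForm_zero_comp_inl]
    ext u
    simp
  refine Eq.trans ?_ (congrArg (formOne (EuclideanSpace ℝ (Fin n))) h3)
  exact congrArg (fun l : EuclideanSpace ℝ (Fin n) →L[ℝ] EuclideanSpace ℝ (Fin (d + 1)) =>
    ContinuousAlternatingMap.compContinuousLinearMap
      (gluedForm (𝒜.cutLocal β) (z : CutSpace d U)) l) h1.mfderiv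

end CutAtlas
end RedSubmanifold


/-! ### Elements of `cutSmoothFunctions` are smooth. -/

section CutFunctions

variable {d : ℕ} {M : Type*} [TopologicalSpace M] [ChartedSpace (EuclideanHalfSpace (d + 1)) M]
  [IsManifold (𝓡∂ (d + 1)) ∞ M]
  {U : TopologicalSpace.Opens M} [MulAction Circle U]
  [ContMDiffSMul (𝓡 1) (𝓡∂ (d + 1)) ∞ Circle U]
  {Y : Type} [NormedAddCommGroup Y] [NormedSpace ℝ Y]

namespace AdaptedChart

variable {V : Set U} {p : U} (A : AdaptedChart d U Y V p)

/-- The quotient of a boundary defining function by the normal coordinate. -/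
def slope (f : M → ℝ) : Y × ℝ → ℝ := normalQuot fun q => f (A.slice q)

variable {f : M → ℝ} (hf : IsInvariantBoundaryDefining d U f)
include hf

lemma contDiffOn_comp_slice : ContDiffOn ℝ ∞ (fun q => f (A.slice q)) (halfBall Y A.r) :=
  contMDiffOn_iff_contDiffOn.1
    (hf.contMDiff.comp_contMDiffOn (contMDiff_subtype_val.comp_contMDiffOn A.contMDiffOn_slice))

lemma comp_slice_eq_zero {q : Y × ℝ} (hq : q ∈ halfBall Y A.r) (h0 : q.2 = 0) :
    f (A.slice q) = 0 :=
  (hf.eq_zero_iff _).2 ((A.slice_mem_boundary_iff hq).2 h0)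

lemma snd_mul_slope {q : Y × ℝ} (hq : q ∈ halfBall Y A.r) :
    q.2 * A.slope f q = f (A.slice q) :=
  mul_normalQuot fun h0 => A.comp_slice_eq_zero hf hq h0

lemma contDiffOn_slope : ContDiffOn ℝ ∞ (A.slope f) (halfBall Y A.r) :=
  contDiffOn_normalQuot Metric.isOpen_ball (A.contDiffOn_comp_slice hf) fun _ hq h0 =>
    A.comp_slice_eq_zero hf ⟨hq, h0.ge⟩ h0

/-- The value at 0 is the limit of f / t as t decreases to 0. -/
lemma slope_zero_nonneg : 0 ≤ A.slope f 0 := by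
  have h1 : ContinuousWithinAt (A.slope f) (halfBall Y A.r) 0 :=
    (A.contDiffOn_slope hf).continuousOn 0 A.zero_mem_halfBall
  have h2 : Filter.Tendsto (fun t : ℝ => ((0 : Y), t)) (𝓝[>] 0) (𝓝[halfBall Y A.r] 0) := by
    refine tendsto_nhdsWithin_iff.2 ⟨?_, ?_⟩
    · exact ((by fun_prop : Continuous (fun t : ℝ => ((0 : Y), t))).tendsto' 0 0 rfl).mono_left
        nhdsWithin_le_nhds
    · filter_upwards [Ioo_mem_nhdsGT A.r_pos] with t ht
      refine ⟨?_, show (0 : ℝ) ≤ t from ht.1.le⟩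
      rw [mem_ball_zero_iff, Prod.norm_mk, norm_zero, Real.norm_eq_abs, abs_of_pos ht.1,
        max_eq_right ht.1.le]
      exact ht.2
  refine ge_of_tendsto (h1.tendsto.comp h2) ?_
  filter_upwards [h2.eventually self_mem_nhdsWithin, self_mem_nhdsWithin] with t ht ht0
  have h3 := A.snd_mul_slope hf ht
  have h4 := hf.nonneg (A.slice (0, t))
  rw [← h3] at h4
  exact nonneg_of_mul_nonneg_right h4 ht0

/-- If the slope vanished, f would have zero derivative along the slice, and by invariance also
along the flow. As the flow has surjective derivative at 0, this would force df = 0 at p. -/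
lemma slope_zero_pos (hp : (p : M) ∈ (𝓡∂ (d + 1)).boundary M) : 0 < A.slope f 0 := by
  refine lt_of_le_of_ne (A.slope_zero_nonneg hf) fun h0 => hf.mfderiv_ne_zero p hp ?_
  obtain ⟨W, hW, hfW⟩ := hf.invariant
  have h1 : HasFDerivWithinAt (fun q => f (A.slice q)) (0 : Y × ℝ →L[ℝ] ℝ) (upperHalf Y) 0 := by
    have h2 : HasFDerivWithinAt (A.slope f) (fderivWithin ℝ (A.slope f) (halfBall Y A.r) 0)
        (halfBall Y A.r) 0 :=
      ((A.contDiffOn_slope hf).differentiableOn (by simp) 0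
        A.zero_mem_halfBall).hasFDerivWithinAt
    have h3 := (hasFDerivWithinAt_snd (𝕜 := ℝ) (p := (0 : Y × ℝ)) (s := halfBall Y A.r)).mul h2
    have h4 : (0 : Y × ℝ).2 • fderivWithin ℝ (A.slope f) (halfBall Y A.r) 0 +
        A.slope f 0 • ContinuousLinearMap.snd ℝ Y ℝ = 0 := by
      rw [← h0]
      simp
    rw [h4] at h3
    exact (h3.congr (fun q hq => (A.snd_mul_slope hf hq).symm)
      (A.snd_mul_slope hf A.zero_mem_halfBall).symm).mono_of_mem_nhdsWithin
      A.halfBall_mem_nhdsWithin_zero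
  have hfd : HasMFDerivAt (𝓡∂ (d + 1)) 𝓘(ℝ, ℝ) f (p : M) (mfderiv (𝓡∂ (d + 1)) 𝓘(ℝ, ℝ) f p) :=
    (hf.contMDiff.mdifferentiableAt (by simp)).hasMFDerivAt
  obtain ⟨K, hK, hKeq⟩ : ∃ K : EuclideanSpace ℝ (Fin (d + 1)) →L[ℝ] ℝ,
    HasMFDerivAt (𝓡∂ (d + 1)) 𝓘(ℝ, ℝ) f (p : M) K ∧ mfderiv (𝓡∂ (d + 1)) 𝓘(ℝ, ℝ) f p = K :=
    ⟨_, hfd, rfl⟩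
  rw [hKeq]
  have hD : HasFDerivWithinAt A.chartFlow (fderivWithin ℝ A.chartFlow (flowCone Y) 0)
      (flowCone Y) 0 :=
    ((A.contDiffOn_chartFlow.differentiableOn (by simp) 0 A.zero_mem_flowDom').mono_of_mem_nhdsWithin
      (A.flowDom_mem_nhdsWithin A.zero_mem_flowDom')).hasFDerivWithinAt
  have hg : HasFDerivWithinAt (fun v => f ((extChartAt (𝓡∂ (d + 1)) (p : M)).symm v)) K
      (range (𝓡∂ (d + 1))) (A.chartFlow 0) := by
    rw [A.chartFlow_zero]
    exact hK.2
  have h2 := hg.comp 0 hD fun z _ => mem_range_self _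
  have h3 := h1.comp (0 : ℝ × (Y × ℝ)) hasFDerivWithinAt_snd fun z hz => (hz : z ∈ flowCone Y).2
  have hslice : ContinuousWithinAt (fun z : ℝ × (Y × ℝ) => A.slice z.2) (flowCone Y) 0 := by
    have h4 := (A.contMDiffOn_slice.continuousOn 0 A.zero_mem_halfBall).mono_of_mem_nhdsWithin
      A.halfBall_mem_nhdsWithin_zero
    exact ContinuousWithinAt.comp (g := A.slice) h4 continuous_snd.continuousWithinAt
      fun z hz => (hz : z ∈ flowCone Y).2
  have hpW : A.slice (0 : ℝ × (Y × ℝ)).2 ∈ W := by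
    change A.slice 0 ∈ W
    rw [A.slice_zero]
    exact hW.boundary_subset _ hp
  have h4 : ∀ z ∈ A.flowDom, A.slice z.2 ∈ W →
      f ((extChartAt (𝓡∂ (d + 1)) (p : M)).symm (A.chartFlow z)) = f (A.slice z.2) := by
    intro z hz hzW
    rw [chartFlow, (extChartAt (𝓡∂ (d + 1)) (p : M)).left_inv hz.2, flow, hfW _ _ hzW]
  have h5 := h3.congr_of_eventuallyEq (f₁ := fun z => f ((extChartAt (𝓡∂ (d + 1)) (p : M)).symm
      (A.chartFlow z))) (by
    filter_upwards [A.flowDom_mem_nhdsWithin A.zero_mem_flowDom',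
      hslice.eventually (hW.isOpen.mem_nhds hpW)] with z hz hzW
    exact h4 z hz hzW) (h4 0 A.zero_mem_flowDom' hpW)
  have h6 := (uniqueDiffOn_flowCone (0 : ℝ × (Y × ℝ)) zero_mem_flowCone).eq h2 h5
  refine ContinuousLinearMap.ext fun v => ?_
  obtain ⟨u, rfl⟩ := A.bijective_fderivWithin_chartFlow.2 v
  exact congrArg (fun l => l u) h6

lemma eq_snd_mul_slope {W : Set U}
    (hfW : ∀ (a : Circle), ∀ x ∈ W, f (a • x : U) = f x) {x : U} (hx : x ∈ A.dom) (hxW : x ∈ W) :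
    f x = (A.pr x).2 * A.slope f (A.pr x) := by
  rw [A.snd_mul_slope hf (A.pr_mem x hx), ← hfW (A.ang x)⁻¹ x hxW]
  conv_lhs => rw [← A.ang_smul_slice x hx]
  rw [A.ang_smul _ _ (A.slice_mem _ (A.pr_mem x hx)), A.ang_slice _ (A.pr_mem x hx), mul_one,
    inv_smul_smul]

end AdaptedChart

lemma contMDiffAt_of_contDiffAt_symm {E X F : Type*} [NormedAddCommGroup E] [NormedSpace ℝ E]
    [NormedAddCommGroup F] [NormedSpace ℝ F]
    [TopologicalSpace X] [ChartedSpace E X] [IsManifold 𝓘(ℝ, E) ∞ X] {g : X → F} {x : X}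
    (h : ContDiffAt ℝ ∞ (fun v => g ((chartAt E x).symm v)) (chartAt E x x)) :
    ContMDiffAt 𝓘(ℝ, E) 𝓘(ℝ, F) ∞ g x := by
  have h1 : ContMDiffAt 𝓘(ℝ, E) 𝓘(ℝ, E) ∞ (chartAt E x) x :=
    contMDiffOn_chart.contMDiffAt ((chartAt E x).open_source.mem_nhds (mem_chart_source E x))
  refine (h.contMDiffAt.comp x h1).congr_of_eventuallyEq ?_
  filter_upwards [(chartAt E x).open_source.mem_nhds (mem_chart_source E x)] with x' hx'
  rw [Function.comp_apply, (chartAt E x).left_inv hx']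

namespace CutAtlas

variable {V : Set U} (𝒜 : CutAtlas d U Y V) {f : M → ℝ} (hf : IsInvariantBoundaryDefining d U f)
include hf

/-- Near the reduced space √f = |w| √slope. Equivariance moves the direction of w from the first
argument of H to the second and leaves H at (slice (y, |w|²), √slope · w), which is smooth because
slope is positive. Over the interior the smooth lifts suffice. -/
lemma contMDiff_of_mem_cutSmoothFunctions {h : CutSpace d U → ℝ}
    (hh : h ∈ cutSmoothFunctions d U f) :
    letI := 𝒜.cutChartedSpace; ContMDiff (𝓡 (d + 1)) 𝓘(ℝ, ℝ) ∞ h := by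
  let _ := 𝒜.cutChartedSpace
  have := 𝒜.isManifold_cutSpace
  obtain ⟨hint, V', H, hV', hH, hHe, hHf⟩ := hh
  obtain ⟨W, hW, hfW⟩ := hf.invariant
  intro z
  refine contMDiffAt_of_contDiffAt_symm ?_
  change ContDiffAt ℝ ∞ (fun v => h ((𝒜.cutFamily z).symm v)) (𝒜.cutFamily z z)
  by_cases hz : z ∈ redSet d U
  · rw [𝒜.cutFamily_self hz, 𝒜.cutFamily_of_mem hz]
    set A := 𝒜.chart ⟨z, hz⟩ with hA
    have hpt := 𝒜.pt_mem_boundary ⟨z, hz⟩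
    have h0 : (0 : Y × ℂ) ∈ A.polarDom := by
      change ((0 : Y), ‖(0 : ℂ)‖ ^ 2) ∈ Metric.ball (0 : Y × ℝ) A.r
      simpa using A.r_pos
    set q : Y × ℂ → Y × ℝ := fun v => (v.1, ‖v.2‖ ^ 2) with hq
    have hq0 : q 0 = 0 := by simp [hq]
    have hqs : ContDiff ℝ ∞ q := contDiff_fst.prodMk (contDiff_snd.norm_sq ℝ)
    have hsl : ContMDiffAt 𝓘(ℝ, Y × ℂ) (𝓡∂ (d + 1)) ∞ (fun v => A.slice (q v)) 0 :=
      (A.contMDiffOn_slice.comp hqs.contMDiff.contMDiffOn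
        fun v hv => A.sq_mem_halfBall hv).contMDiffAt (A.isOpen_polarDom.mem_nhds h0)
    have hsp : ContDiffAt ℝ ∞ (fun v => A.slope f (q v)) 0 :=
      ((A.contDiffOn_slope hf).comp hqs.contDiffOn
        fun v hv => A.sq_mem_halfBall hv).contDiffAt (A.isOpen_polarDom.mem_nhds h0)
    have hsl0 : A.slice (q 0) = 𝒜.pt ⟨z, hz⟩ := by rw [hq0, A.slice_zero]
    have hptV : A.slice (q 0) ∈ V' := hsl0.symm ▸ hV'.boundary_subset _ hpt
    have hptW : A.slice (q 0) ∈ W := hsl0.symm ▸ hW.boundary_subset _ hpt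
    have hF : ContDiffAt ℝ ∞ (fun v => H (A.slice (q v), ((√(A.slope f (q v)) : ℝ) : ℂ) * v.2))
        0 := by
      have h1 : ContDiffAt ℝ ∞ (fun v : Y × ℂ => ((√(A.slope f (q v)) : ℝ) : ℂ) * v.2) 0 :=
        (Complex.ofRealCLM.contDiff.contDiffAt.comp _ (hsp.sqrt
          (by rw [hq0]; exact (A.slope_zero_pos hf hpt).ne'))).mul contDiff_snd.contDiffAt
      have h2 : ContMDiffAt ((𝓡∂ (d + 1)).prod 𝓘(ℝ, ℂ)) 𝓘(ℝ, ℝ) ∞ H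
          (A.slice (q 0), ((√(A.slope f (q 0)) : ℝ) : ℂ) * (0 : Y × ℂ).2) :=
        hH.contMDiffAt ((hV'.isOpen.prod isOpen_univ).mem_nhds
          ⟨hptV, mem_univ _⟩)
      exact contMDiffAt_iff_contDiffAt.1 (h2.comp 0 (hsl.prodMk h1.contMDiffAt))
    have key : ∀ᶠ v in 𝓝 (0 : Y × ℂ), h (cutMap d U (A.polar v)) =
        H (A.slice (q v), ((√(A.slope f (q v)) : ℝ) : ℂ) * v.2) := by
      filter_upwards [A.isOpen_polarDom.mem_nhds h0,
        hsl.continuousAt.eventually ((hV'.isOpen.inter hW.isOpen).mem_nhds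
          (show A.slice (q 0) ∈ V' ∩ W from ⟨hptV, hptW⟩))] with v hv hvV
      have h1 : A.polar v = circleUnit v.2 • A.slice (q v) := rfl
      have h2 := A.snd_mul_slope hf (A.sq_mem_halfBall hv)
      rw [hHf _ (h1 ▸ hV'.smul_mem _ _ hvV.1), h1, hHe _ _ hvV.1, hfW _ _ hvV.2]
      change _ = f (A.slice (q v)) at h2
      rw [← h2, Real.sqrt_mul (sq_nonneg _), Real.sqrt_sq (norm_nonneg _), Complex.ofReal_mul]
      congr 2
      conv_rhs => rw [← norm_mul_circleUnit v.2]
      ring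
    have h3 : ContDiffAt ℝ ∞ (fun v => h (cutMap d U (A.polar v))) (A.cutModel 0) := by
      rw [map_zero]
      exact hF.congr_of_eventuallyEq key
    exact h3.comp 0 A.cutModel.contDiff.contDiffAt
  · obtain ⟨s, hs⟩ := (𝒜.isCutChart_cutFamily z).exists_lift
    have hv := (𝒜.cutFamily z).map_source (𝒜.mem_cutFamily_source z)
    obtain ⟨h1, h2⟩ := hs _ hv
    rw [(𝒜.cutFamily z).left_inv (𝒜.mem_cutFamily_source z)] at h1 h2
    have h3 : s (𝒜.cutFamily z z) ∈ (𝓡∂ (d + 1)).interior M :=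
      cutMap_not_mem_redSet_iff.1 (h1.symm ▸ hz)
    have h4 := (hint.contMDiffAt (isOpen_interior'.mem_nhds h3)).comp _ (h2 hz)
    refine (contMDiffAt_iff_contDiffAt.1 h4).congr_of_eventuallyEq ?_
    filter_upwards [(𝒜.cutFamily z).open_target.mem_nhds hv] with v hv'
    exact congrArg h (hs v hv').1.symm

end CutAtlas
end CutFunctions


/-! ### Averaging over the circle. -/

section Averaging

variable {d : ℕ} {M : Type*} [TopologicalSpace M] [ChartedSpace (EuclideanHalfSpace (d + 1)) M]
  [IsManifold (𝓡∂ (d + 1)) ∞ M]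
  {U : TopologicalSpace.Opens M} [MulAction Circle U]

/-- The average of a function on `U × ℂ` over the circle. -/
def circleAverage (G : U × ℂ → ℝ) (y : U × ℂ) : ℝ :=
  (2 * Real.pi)⁻¹ * ∫ θ in (0 : ℝ)..2 * Real.pi,
    G (Circle.exp θ • y.1, (Circle.exp (-θ) : ℂ) * y.2)

/-- Rotating x by a amounts to shifting the integration variable by arg a, provided z is rotated
too; periodicity absorbs the shift. -/
lemma circleAverage_smul (G : U × ℂ → ℝ) (a : Circle) (x : U) (z : ℂ) :
    circleAverage G (a • x, z) = circleAverage G (x, a * z) := by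
  set K : ℝ → ℝ := fun θ => G (Circle.exp θ • x, (Circle.exp (-θ) : ℂ) * (a * z)) with hK
  have hper : Function.Periodic K (2 * Real.pi) := by
    intro θ
    have h1 : Circle.exp (θ + 2 * Real.pi) = Circle.exp θ := Circle.periodic_exp θ
    have h2 : Circle.exp (-(θ + 2 * Real.pi)) = Circle.exp (-θ) := by
      rw [Circle.exp_neg, h1, Circle.exp_neg]
    simp only [hK, h1, h2]
  set s := Complex.arg a with hs
  have h1 : ∀ θ : ℝ, G (Circle.exp θ • a • x, (Circle.exp (-θ) : ℂ) * z) = K (θ + s) := by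
    intro θ
    have h2 : Circle.exp s = a := circle_exp_arg a
    have h3 : ((Circle.exp (-(θ + s)) : Circle) : ℂ) * (a * z) = (Circle.exp (-θ) : ℂ) * z := by
      rw [← mul_assoc, ← Circle.coe_mul, neg_add, Circle.exp_add, Circle.exp_neg s, h2,
        inv_mul_cancel_right]
    simp only [hK]
    rw [Circle.exp_add, h2, mul_smul, h3]
  rw [circleAverage, circleAverage]
  congr 1
  simp only [h1]
  rw [intervalIntegral.integral_comp_add_right, zero_add, add_comm (2 * Real.pi) s]
  exact (hper.intervalIntegral_add_eq s 0).trans (by rw [zero_add])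

lemma circleAverage_eq {G : U × ℂ → ℝ} {y : U × ℂ} {r : ℝ}
    (h : ∀ θ : ℝ, G (Circle.exp θ • y.1, (Circle.exp (-θ) : ℂ) * y.2) = r) :
    circleAverage G y = r := by
  have : 2 * Real.pi ≠ 0 := Real.two_pi_pos.ne'
  simp only [circleAverage, h, intervalIntegral.integral_const, sub_zero, smul_eq_mul]
  field_simp

variable [ContMDiffSMul (𝓡 1) (𝓡∂ (d + 1)) ∞ Circle U]

/-- In a chart of U the average is a parameter integral over a convex piece of the half space times
ℂ, so one may differentiate under the integral. -/
lemma contMDiff_circleAverage {G : U × ℂ → ℝ}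
    (hG : ContMDiff ((𝓡∂ (d + 1)).prod 𝓘(ℝ, ℂ)) 𝓘(ℝ, ℝ) ∞ G) :
    ContMDiff ((𝓡∂ (d + 1)).prod 𝓘(ℝ, ℂ)) 𝓘(ℝ, ℝ) ∞ (circleAverage G) := by
  rintro ⟨x₀, z₀⟩
  set e := extChartAt (𝓡∂ (d + 1)) x₀ with he
  set F : (EuclideanSpace ℝ (Fin (d + 1)) × ℂ) × ℝ → ℝ := fun w =>
    G (Circle.exp w.2 • e.symm w.1.1, (Circle.exp (-w.2) : ℂ) * w.1.2) with hF
  have hFs : ContDiffOn ℝ ∞ F ((e.target ×ˢ univ) ×ˢ univ) := by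
    have hsm : ContMDiff ((𝓡 1).prod (𝓡∂ (d + 1))) (𝓡∂ (d + 1)) ∞
      (fun z : Circle × U => z.1 • z.2) := ContMDiffSMul.contMDiff_smul
    have h1 : ContMDiffOn 𝓘(ℝ, (EuclideanSpace ℝ (Fin (d + 1)) × ℂ) × ℝ) (𝓡∂ (d + 1)) ∞
        (fun w : (EuclideanSpace ℝ (Fin (d + 1)) × ℂ) × ℝ => Circle.exp w.2 • e.symm w.1.1)
        ((e.target ×ˢ univ) ×ˢ univ) :=
      hsm.comp_contMDiffOn ((contMDiff_circleExp.comp contDiff_snd.contMDiff).contMDiffOn.prodMk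
        ((contMDiffOn_extChartAt_symm x₀).comp
          (contDiff_fst.comp contDiff_fst).contMDiff.contMDiffOn fun w hw => hw.1.1))
    have h2 : ContDiff ℝ ∞ (fun w : (EuclideanSpace ℝ (Fin (d + 1)) × ℂ) × ℝ =>
        (Circle.exp (-w.2) : ℂ) * w.1.2) := by
      simp only [Circle.coe_exp]
      have : ContDiff ℝ ∞ (fun w : (EuclideanSpace ℝ (Fin (d + 1)) × ℂ) × ℝ =>
          ((-w.2 : ℝ) : ℂ)) := Complex.ofRealCLM.contDiff.comp contDiff_snd.neg
      exact (this.mul contDiff_const).cexp.mul (contDiff_snd.comp contDiff_fst)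
    exact contMDiffOn_iff_contDiffOn.1 (hG.comp_contMDiffOn (h1.prodMk h2.contMDiff.contMDiffOn))
  obtain ⟨ρ, hρ, hball⟩ : ∃ ρ > 0, Metric.ball (e x₀) ρ ∩ range (𝓡∂ (d + 1)) ⊆ e.target := by
    have h1 : e.target ∈ 𝓝[range (𝓡∂ (d + 1))] (e x₀) := extChartAt_target_mem_nhdsWithin x₀
    exact Metric.mem_nhdsWithin_iff.1 h1
  set A : Set (EuclideanSpace ℝ (Fin (d + 1)) × ℂ) :=
    (Metric.ball (e x₀) ρ ∩ range (𝓡∂ (d + 1))) ×ˢ univ with hA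
  have hAc : Convex ℝ A := ((convex_ball _ _).inter (𝓡∂ (d + 1)).convex_range).prod convex_univ
  have hAu : UniqueDiffOn ℝ A := by
    refine UniqueDiffOn.prod ?_ uniqueDiffOn_univ
    rw [inter_comm]
    exact (𝓡∂ (d + 1)).uniqueDiffOn.inter Metric.isOpen_ball
  have hI := contDiffOn_intervalIntegral hAc hAu Real.two_pi_pos
    (hFs.mono (prod_mono (prod_mono hball subset_rfl) (subset_univ (Icc 0 (2 * Real.pi)))))
  have hex : ContMDiffAt ((𝓡∂ (d + 1)).prod 𝓘(ℝ, ℂ))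
      𝓘(ℝ, EuclideanSpace ℝ (Fin (d + 1)) × ℂ) ∞ (fun y : U × ℂ => (e y.1, y.2)) (x₀, z₀) :=
    (contMDiffAt_extChartAt.comp (x₀, z₀) contMDiffAt_fst).prodMk_space contMDiffAt_snd
  have hN : ∀ᶠ y : U × ℂ in 𝓝 (x₀, z₀), (e y.1, y.2) ∈ A ∧ e.symm (e y.1) = y.1 := by
    have h1 : ∀ᶠ y : U × ℂ in 𝓝 (x₀, z₀), y.1 ∈ e.source :=
      continuous_fst.continuousAt.eventually
        ((isOpen_extChartAt_source x₀).mem_nhds (mem_extChartAt_source x₀))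
    have h2 : ∀ᶠ y : U × ℂ in 𝓝 (x₀, z₀), (e y.1, y.2) ∈ Metric.ball (e x₀) ρ ×ˢ univ :=
      hex.continuousAt.eventually ((Metric.isOpen_ball.prod isOpen_univ).mem_nhds
        ⟨Metric.mem_ball_self hρ, mem_univ _⟩)
    filter_upwards [h1, h2] with y hy1 hy2
    exact ⟨⟨⟨hy2.1, extChartAt_target_subset_range x₀ (e.map_source hy1)⟩, mem_univ _⟩,
      e.left_inv hy1⟩
  have h3 : ContMDiffAt ((𝓡∂ (d + 1)).prod 𝓘(ℝ, ℂ)) 𝓘(ℝ, ℝ) ∞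
      (fun y : U × ℂ => ∫ θ in (0 : ℝ)..2 * Real.pi, F ((e y.1, y.2), θ)) (x₀, z₀) := by
    exact (ContMDiffWithinAt.comp (x₀, z₀)
      (g := fun v => ∫ θ in (0 : ℝ)..2 * Real.pi, F (v, θ))
      (hI.contMDiffOn (e x₀, z₀) hN.self_of_nhds.1)
      (hex.contMDiffWithinAt (s := (fun y : U × ℂ => (e y.1, y.2)) ⁻¹' A)) fun _ hy => hy).contMDiffAt
      (hN.mono fun y hy => hy.1)
  have h5 : ContMDiffAt ((𝓡∂ (d + 1)).prod 𝓘(ℝ, ℂ)) 𝓘(ℝ, ℝ) ∞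
      (fun y : U × ℂ => (2 * Real.pi)⁻¹ *
        ∫ θ in (0 : ℝ)..2 * Real.pi, F ((e y.1, y.2), θ)) (x₀, z₀) :=
    (contDiff_const.mul contDiff_id : ContDiff ℝ ∞ fun r : ℝ =>
      (2 * Real.pi)⁻¹ * r).contMDiff.contMDiffAt.comp _ h3
  refine h5.congr_of_eventuallyEq ?_
  filter_upwards [hN] with y hy
  rw [circleAverage]
  simp only [hF, hy.2]

end Averaging


/-! ### Smooth functions on the cut space belong to `cutSmoothFunctions`. -/

section LocalExtension

variable {d : ℕ} {M : Type*} [TopologicalSpace M] [ChartedSpace (EuclideanHalfSpace (d + 1)) M]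
  [IsManifold (𝓡∂ (d + 1)) ∞ M]
  {U : TopologicalSpace.Opens M} [MulAction Circle U]
  [ContMDiffSMul (𝓡 1) (𝓡∂ (d + 1)) ∞ Circle U]
  {Y : Type} [NormedAddCommGroup Y] [NormedSpace ℝ Y]

/-- The values at `(x, z)` that are admissible for an extension of `h`: there is a condition only
if `‖z‖ ^ 2 = f x`. -/
def extensionSet (h : CutSpace d U → ℝ) (f : M → ℝ) (y : U × ℂ) : Set ℝ :=
  {r | ‖y.2‖ ^ 2 = f y.1 → r = h (cutMap d U (circleUnit y.2 • y.1 : U))}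

/-- Either one value is prescribed or all are allowed. Convexity permits gluing by a partition of
unity. -/
lemma convex_extensionSet (h : CutSpace d U → ℝ) (f : M → ℝ) (y : U × ℂ) :
    Convex ℝ (extensionSet h f y) := by
  intro r hr s hs a b _ _ hab hy
  rw [hr hy, hs hy, ← add_smul, hab, one_smul]

namespace AdaptedChart

variable {V : Set U} {p : U} (A : AdaptedChart d U Y V p)
  {f : M → ℝ} (hf : IsInvariantBoundaryDefining d U f)
include hf

/-- The extension is h in the cut chart, evaluated at w = z · ang x / √slope. Where |z|² = f(x) = t
· slope, this w together with y gives the cut coordinates of x rotated by the direction of z, as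
required. -/
lemma exists_local_extension (hp : (p : M) ∈ (𝓡∂ (d + 1)).boundary M) {x₀ : U} (hx₀ : x₀ ∈ A.dom)
    (hb : (x₀ : M) ∈ (𝓡∂ (d + 1)).boundary M)
    (hpr : A.pr x₀ = 0) {h : CutSpace d U → ℝ}
    (hh : ContDiffOn ℝ ∞ (fun v => h (A.cutChart.symm v)) A.cutChart.target) :
    ∃ N ∈ 𝓝 (x₀, (0 : ℂ)), ∃ g : U × ℂ → ℝ,
      ContMDiffOn ((𝓡∂ (d + 1)).prod 𝓘(ℝ, ℂ)) 𝓘(ℝ, ℝ) ∞ g N ∧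
      ∀ y ∈ N, g y ∈ extensionSet h f y := by
  obtain ⟨W, hW, hfW⟩ := hf.invariant
  have hO : IsOpen {y : U × ℂ | y.1 ∈ A.dom ∩ W} :=
    (A.isOpen_dom.inter hW.isOpen).preimage continuous_fst
  have hpr' : ContMDiffOn ((𝓡∂ (d + 1)).prod 𝓘(ℝ, ℂ)) 𝓘(ℝ, Y × ℝ) ∞ (fun y : U × ℂ => A.pr y.1)
      {y | y.1 ∈ A.dom ∩ W} :=
    A.contMDiffOn_pr.comp contMDiff_fst.contMDiffOn fun y hy => hy.1
  have hsl : ContMDiffOn ((𝓡∂ (d + 1)).prod 𝓘(ℝ, ℂ)) 𝓘(ℝ, ℝ) ∞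
      (fun y : U × ℂ => A.slope f (A.pr y.1)) {y | y.1 ∈ A.dom ∩ W} :=
    (A.contDiffOn_slope hf).contMDiffOn.comp hpr' fun y hy => A.pr_mem _ hy.1
  set N₁ : Set (U × ℂ) := {y | y.1 ∈ A.dom ∩ W} ∩ (fun y => A.slope f (A.pr y.1)) ⁻¹' Ioi 0 with hN₁
  have hN₁o : IsOpen N₁ := hsl.continuousOn.isOpen_inter_preimage hO isOpen_Ioi
  set B : U × ℂ → Y × ℂ := fun y =>
    ((A.pr y.1).1, (((√(A.slope f (A.pr y.1)))⁻¹ : ℝ) : ℂ) * (y.2 * A.ang y.1)) with hB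
  have hBs : ContMDiffOn ((𝓡∂ (d + 1)).prod 𝓘(ℝ, ℂ)) 𝓘(ℝ, Y × ℂ) ∞ B N₁ := by
    intro y hy
    have h1 : ContMDiffAt ((𝓡∂ (d + 1)).prod 𝓘(ℝ, ℂ)) 𝓘(ℝ, ℂ) ∞ (fun y : U × ℂ =>
        ((A.ang y.1 : Circle) : ℂ)) y := contMDiff_circle_coe.contMDiffAt.comp y
      ((A.contMDiffOn_ang.contMDiffAt (A.isOpen_dom.mem_nhds hy.1.1)).comp y contMDiffAt_fst)
    have h2 : ContMDiffAt ((𝓡∂ (d + 1)).prod 𝓘(ℝ, ℂ)) 𝓘(ℝ, ((Y × ℝ) × ℝ) × (ℂ × ℂ)) ∞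
        (fun y : U × ℂ => ((A.pr y.1, A.slope f (A.pr y.1)), (y.2, ((A.ang y.1 : Circle) : ℂ)))) y :=
      ((hpr'.contMDiffAt (hO.mem_nhds hy.1)).prodMk_space
        (hsl.contMDiffAt (hO.mem_nhds hy.1))).prodMk_space (contMDiffAt_snd.prodMk_space h1)
    have h3 : ContDiffAt ℝ ∞ (fun w : ((Y × ℝ) × ℝ) × (ℂ × ℂ) =>
        (w.1.1.1, (((√w.1.2)⁻¹ : ℝ) : ℂ) * (w.2.1 * w.2.2)))
        ((A.pr y.1, A.slope f (A.pr y.1)), (y.2, ((A.ang y.1 : Circle) : ℂ))) := by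
      have hpos : 0 < A.slope f (A.pr y.1) := hy.2
      have h4 : ContDiff ℝ ∞ (fun w : ((Y × ℝ) × ℝ) × (ℂ × ℂ) => w.1.2) :=
        contDiff_snd.comp contDiff_fst
      have h5 : ContDiffAt ℝ ∞ (fun w : ((Y × ℝ) × ℝ) × (ℂ × ℂ) => (√w.1.2)⁻¹)
          ((A.pr y.1, A.slope f (A.pr y.1)), (y.2, ((A.ang y.1 : Circle) : ℂ))) :=
        (h4.contDiffAt.sqrt hpos.ne').inv (Real.sqrt_pos.2 hpos).ne'
      exact (contDiff_fst.comp (contDiff_fst.comp contDiff_fst)).contDiffAt.prodMk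
        ((Complex.ofRealCLM.contDiff.contDiffAt.comp _ h5).mul
          ((contDiff_fst.comp contDiff_snd).mul (contDiff_snd.comp contDiff_snd)).contDiffAt)
    exact (h3.contMDiffAt.comp y h2).contMDiffWithinAt
  have h0 : (x₀, (0 : ℂ)) ∈ N₁ := by
    refine ⟨⟨hx₀, hW.boundary_subset _ hb⟩, ?_⟩
    change 0 < A.slope f (A.pr x₀)
    rw [hpr]
    exact A.slope_zero_pos hf hp
  have hB0 : B (x₀, (0 : ℂ)) ∈ A.polarDom := by
    simp only [hB, hpr]
    simpa [polarDom] using A.r_pos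
  refine ⟨N₁ ∩ B ⁻¹' A.polarDom,
    (hBs.continuousOn.isOpen_inter_preimage hN₁o A.isOpen_polarDom).mem_nhds ⟨h0, hB0⟩,
    fun y => h (A.cutChart.symm (A.cutModel.symm (B y))), ?_, ?_⟩
  · refine hh.contMDiffOn.comp (A.cutModel.symm.contDiff.contMDiff.comp_contMDiffOn
      (hBs.mono inter_subset_left)) fun y hy => ?_
    change A.cutModel.symm (B y) ∈ A.cutChart.target
    rw [A.mem_cutChart_target, ContinuousLinearEquiv.apply_symm_apply]
    exact hy.2
  · rintro y ⟨⟨⟨hyd, hyW⟩, hys⟩, -⟩ hy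
    have hys' : 0 < A.slope f (A.pr y.1) := hys
    have hd := A.smul_mem (circleUnit y.2) _ hyd
    have h1 : A.cutCoord (circleUnit y.2 • y.1) = B y := by
      rw [A.eq_snd_mul_slope hf hfW hyd hyW] at hy
      have h2 : (A.pr y.1).2 = (‖y.2‖ * (√(A.slope f (A.pr y.1)))⁻¹) ^ 2 := by
        rw [mul_pow, hy, inv_pow, Real.sq_sqrt hys'.le]
        field_simp
      rw [cutCoord, A.pr_smul _ _ hyd, A.ang_smul _ _ hyd, h2,
        Real.sqrt_sq (by positivity), Circle.coe_mul, Complex.ofReal_mul]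
      refine Prod.ext rfl ?_
      simp only [hB]
      conv_rhs => rw [← norm_mul_circleUnit y.2]
      ring
    change h (A.cutChart.symm (A.cutModel.symm (B y))) = _
    rw [← h1, ← A.cutChart_apply hd, A.cutChart.left_inv]
    exact A.cutMap_mem_cutChart_source.2 ⟨_, hd, rfl⟩

end AdaptedChart

namespace CutAtlas

variable {V : Set U} (𝒜 : CutAtlas d U Y V)

lemma contMDiffOn_comp_cutMap {h : CutSpace d U → ℝ}
    (hh : letI := 𝒜.cutChartedSpace; ContMDiff (𝓡 (d + 1)) 𝓘(ℝ, ℝ) ∞ h) :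
    ContMDiffOn (𝓡∂ (d + 1)) 𝓘(ℝ, ℝ) ∞ (h ∘ cutMap d U) ((𝓡∂ (d + 1)).interior M) := by
  let _ := 𝒜.cutChartedSpace
  have := 𝒜.isManifold_cutSpace
  intro x hx
  set z := cutMap d U x with hz
  have hzs := 𝒜.mem_cutFamily_source z
  have h1 := (𝒜.isCutChart_cutFamily z).contMDiffAt_comp x hx hzs
  have h2 : ContMDiffAt 𝓘(ℝ, EuclideanSpace ℝ (Fin (d + 1))) (𝓡 (d + 1)) ∞ (𝒜.cutFamily z).symm
      (𝒜.cutFamily z z) :=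
    (contMDiffOn_chart_symm (x := z)).contMDiffAt
      ((𝒜.cutFamily z).open_target.mem_nhds ((𝒜.cutFamily z).map_source hzs))
  have h3 : ContMDiffAt (𝓡∂ (d + 1)) 𝓘(ℝ, ℝ) ∞
      (fun x => h ((𝒜.cutFamily z).symm (𝒜.cutFamily z (cutMap d U x)))) x :=
    hh.contMDiffAt.comp x (h2.comp x h1)
  refine (h3.congr_of_eventuallyEq ?_).contMDiffWithinAt
  filter_upwards [continuous_cutMap.continuousAt.eventually
    ((𝒜.cutFamily z).open_source.mem_nhds hzs)] with x' hx'
  rw [(𝒜.cutFamily z).left_inv hx', comp_apply]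

variable {f : M → ℝ} (hf : IsInvariantBoundaryDefining d U f)
include hf

/-- Where |z|² ≠ f(x) nothing is prescribed nearby. Where equality holds with z ≠ 0, the point x is
interior and the prescribed expression is itself smooth. Only z = 0, at a boundary point, needs the
adapted chart. -/
lemma exists_local_extension {h : CutSpace d U → ℝ}
    (hh : letI := 𝒜.cutChartedSpace; ContMDiff (𝓡 (d + 1)) 𝓘(ℝ, ℝ) ∞ h) (y₀ : U × ℂ) :
    ∃ N ∈ 𝓝 y₀, ∃ g : U × ℂ → ℝ,
      ContMDiffOn ((𝓡∂ (d + 1)).prod 𝓘(ℝ, ℂ)) 𝓘(ℝ, ℝ) ∞ g N ∧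
      ∀ y ∈ N, g y ∈ extensionSet h f y := by
  have hint := 𝒜.contMDiffOn_comp_cutMap hh
  have hsm : ContMDiff ((𝓡 1).prod (𝓡∂ (d + 1))) (𝓡∂ (d + 1)) ∞
    (fun z : Circle × U => z.1 • z.2) := ContMDiffSMul.contMDiff_smul
  have hfU : Continuous fun y : U × ℂ => f y.1 :=
    hf.contMDiff.continuous.comp (continuous_subtype_val.comp continuous_fst)
  by_cases hy₀ : ‖y₀.2‖ ^ 2 = f y₀.1
  swap
  · refine ⟨{y | ‖y.2‖ ^ 2 ≠ f y.1}, (isOpen_ne_fun (by fun_prop) hfU).mem_nhds hy₀, fun _ => 0,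
      contMDiffOn_const, fun y hy h => absurd h hy⟩
  by_cases hz₀ : y₀.2 = 0
  · have hb : (y₀.1 : M) ∈ (𝓡∂ (d + 1)).boundary M := by
      rw [← hf.eq_zero_iff, ← hy₀, hz₀]
      simp
    set z : redSet d U := ⟨cutMap d U y₀.1, y₀.1, hb, rfl⟩ with hz
    have hd : (y₀.1 : U) ∈ (𝒜.chart z).dom ∧ (𝒜.chart z).pr y₀.1 = 0 := by
      rcases cutMap_coe_eq_iff.1 (𝒜.cutMap_pt z) with h1 | ⟨-, a, h1⟩
      · rw [← Subtype.ext h1]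
        exact ⟨𝒜.pt_mem_dom z, 𝒜.pr_pt z⟩
      · rw [← Subtype.ext h1, (𝒜.chart z).pr_smul _ _ (𝒜.pt_mem_dom z)]
        exact ⟨(𝒜.chart z).smul_mem _ _ (𝒜.pt_mem_dom z), 𝒜.pr_pt z⟩
    have h2 : ContDiffOn ℝ ∞ (fun v => h ((𝒜.chart z).cutChart.symm v))
        (𝒜.chart z).cutChart.target := by
      let _ := 𝒜.cutChartedSpace
      have := 𝒜.isManifold_cutSpace
      rw [← 𝒜.cutFamily_of_mem z.2]
      exact contMDiffOn_iff_contDiffOn.1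
        (hh.comp_contMDiffOn (contMDiffOn_chart_symm (x := (z : CutSpace d U))))
    have h3 := (𝒜.chart z).exists_local_extension hf (𝒜.pt_mem_boundary z) hd.1 hb hd.2 h2
    rwa [← hz₀] at h3
  · refine ⟨{y | y.2 ≠ 0} ∩ {y | (y.1 : M) ∈ (𝓡∂ (d + 1)).interior M}, ?_,
      fun y => h (cutMap d U (circleUnit y.2 • y.1 : U)), ?_, fun y _ _ => rfl⟩
    · refine Filter.inter_mem ((isOpen_ne.preimage continuous_snd).mem_nhds hz₀)
        ((isOpen_interior'.preimage (continuous_subtype_val.comp continuous_fst)).mem_nhds ?_)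
      rw [mem_preimage, mem_interior_iff_not_mem_boundary, ← hf.eq_zero_iff]
      change f y₀.1 ≠ 0
      rw [← hy₀]
      positivity
    · rintro y ⟨hy, hyi⟩
      have h1 : ((circleUnit y.2 • y.1 : U) : M) ∈ (𝓡∂ (d + 1)).interior M := by
        rw [mem_interior_iff_not_mem_boundary, smul_mem_boundary_iff,
          ← mem_interior_iff_not_mem_boundary]
        exact hyi
      have h2 : ContMDiffAt ((𝓡∂ (d + 1)).prod 𝓘(ℝ, ℂ)) (𝓡∂ (d + 1)) ∞
          (fun y : U × ℂ => ((circleUnit y.2 • y.1 : U) : M)) y :=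
        contMDiff_subtype_val.contMDiffAt.comp y (hsm.contMDiffAt.comp y
          (((contMDiffAt_circleUnit hy).comp y contMDiffAt_snd).prodMk contMDiffAt_fst))
      exact ((hint.contMDiffAt (isOpen_interior'.mem_nhds h1)).comp y h2).contMDiffWithinAt

variable [T2Space M] [SecondCountableTopology M]

/-- A global G with the prescribed values comes from a partition of unity; averaging makes it
equivariant. The points (a x, a⁻¹ √f(x)) all carry the same prescribed value h(c(x)), so the average
keeps it. -/
lemma mem_cutSmoothFunctions_of_contMDiff {h : CutSpace d U → ℝ}
    (hh : letI := 𝒜.cutChartedSpace; ContMDiff (𝓡 (d + 1)) 𝓘(ℝ, ℝ) ∞ h) :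
    h ∈ cutSmoothFunctions d U f := by
  refine ⟨𝒜.contMDiffOn_comp_cutMap hh, ?_⟩
  obtain ⟨W, hW, hfW⟩ := hf.invariant
  have : LocallyCompactSpace U := Manifold.locallyCompact_of_finiteDimensional (𝓡∂ (d + 1))
  have : SecondCountableTopology U := inferInstance
  have : SigmaCompactSpace (U × ℂ) := inferInstance
  obtain ⟨G, hG⟩ := exists_contMDiffMap_forall_mem_convex_of_local
    ((𝓡∂ (d + 1)).prod 𝓘(ℝ, ℂ)) (n := ⊤) (convex_extensionSet h f)
    (𝒜.exists_local_extension hf hh)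
  refine ⟨W, circleAverage G, hW, (contMDiff_circleAverage G.contMDiff).contMDiffOn,
    fun a x _ z => circleAverage_smul G a x z, fun x hx => (circleAverage_eq fun θ => ?_).symm⟩
  have h1 := hG (Circle.exp θ • x, (Circle.exp (-θ) : ℂ) * ((√(f x) : ℝ) : ℂ)) (by
    simp only [norm_mul, Circle.norm_coe, one_mul, Complex.norm_real, Real.norm_eq_abs, sq_abs]
    rw [hfW _ _ hx, Real.sq_sqrt (hf.nonneg x)])
  rw [h1]
  simp only
  by_cases h0 : f x = 0
  · rw [h0, Real.sqrt_zero, Complex.ofReal_zero, mul_zero, circleUnit_zero, one_smul,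
      cutMap_smul_of_mem ((hf.eq_zero_iff x).1 h0)]
  · have h2 : 0 < √(f x) := Real.sqrt_pos.2 (lt_of_le_of_ne (hf.nonneg x) (Ne.symm h0))
    rw [mul_comm, circleUnit_ofReal_mul h2, smul_smul, ← Circle.exp_add, neg_add_cancel,
      Circle.exp_zero, one_smul]

theorem contMDiff_iff_mem_cutSmoothFunctions {h : CutSpace d U → ℝ} :
    (letI := 𝒜.cutChartedSpace; ContMDiff (𝓡 (d + 1)) 𝓘(ℝ, ℝ) ∞ h) ↔
      h ∈ cutSmoothFunctions d U f :=
  ⟨𝒜.mem_cutSmoothFunctions_of_contMDiff hf, 𝒜.contMDiff_of_mem_cutSmoothFunctions hf⟩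

end CutAtlas
end LocalExtension


/-! ### The one-dimensional case and the conclusion. -/

section LowDimension

variable {M : Type*} [TopologicalSpace M] [ChartedSpace (EuclideanHalfSpace (0 + 1)) M]
  [IsManifold (𝓡∂ (0 + 1)) ∞ M] {U : TopologicalSpace.Opens M} [MulAction Circle U]
  [ContMDiffSMul (𝓡 1) (𝓡∂ (0 + 1)) ∞ Circle U]

/-- The circle cannot act freely near the zero-dimensional boundary of a curve. -/
lemma boundary_eq_empty_of_free (hfree : ∀ (a : Circle) (x : U), a • x = x → a = 1)
    (hU : (𝓡∂ (0 + 1)).boundary M ⊆ U) : (𝓡∂ (0 + 1)).boundary M = ∅ := by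
  refine eq_empty_iff_forall_notMem.2 fun x hx => ?_
  have := continuousSMul_circle 0 U
  have : DiscreteTopology ((𝓡∂ (0 + 1)).boundary M) :=
    ChartedSpace.discreteTopology (EuclideanSpace ℝ (Fin 0)) _
  set o : ℝ → (𝓡∂ (0 + 1)).boundary M := fun t =>
    ⟨(Circle.exp t • (⟨x, hU hx⟩ : U) : U), (smul_mem_boundary_iff _ _).2 hx⟩ with ho
  have hoc : Continuous o := (continuous_subtype_val.comp
    ((Circle.exp.continuous).smul continuous_const)).subtype_mk _
  -- A continuous curve in a discrete space is constant, so exp(iπ) = −1 would fix the boundary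
  -- point.
  have h1 : o Real.pi = o 0 := PreconnectedSpace.constant inferInstance hoc
  have h2 : Circle.exp Real.pi • (⟨x, hU hx⟩ : U) = Circle.exp 0 • (⟨x, hU hx⟩ : U) :=
    Subtype.ext (congrArg (fun y : (𝓡∂ (0 + 1)).boundary M => (y : M)) h1)
  rw [Circle.exp_zero, one_smul] at h2
  have h3 := congrArg (fun a : Circle => (a : ℂ)) (hfree _ _ h2)
  simp only [Circle.coe_exp, Complex.exp_pi_mul_I, Circle.coe_one] at h3
  norm_num at h3

end LowDimension

/-- For k ≥ 1 the model dimension `2 * (k - 1) + 1` is 2k − 1. For k = 0 truncated subtraction gives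
1, which is harmless because the reduced space is empty and the atlas vacuous. -/
lemma exists_cutAtlas_of_free {k : ℕ} {M : Type*} [TopologicalSpace M] [T2Space M]
    [ChartedSpace (EuclideanHalfSpace (2 * k + 1)) M] [IsManifold (𝓡∂ (2 * k + 1)) ∞ M]
    {U : TopologicalSpace.Opens M} [MulAction Circle U]
    [ContMDiffSMul (𝓡 1) (𝓡∂ (2 * k + 1)) ∞ Circle U]
    (hfree : ∀ (a : Circle) (x : U), a • x = x → a = 1)
    (hU : (𝓡∂ (2 * k + 1)).boundary M ⊆ U) {V : Set U} (hV : IsInvariantNhd (2 * k) U V) :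
    Nonempty (CutAtlas (2 * k) U (EuclideanSpace ℝ (Fin (2 * (k - 1) + 1))) V) := by
  cases k with
  | zero =>
    have : IsEmpty (redSet (2 * 0) U) := by
      refine isEmpty_coe_sort.2 ?_
      change redSet 0 U = ∅
      rw [redSet, boundary_eq_empty_of_free hfree hU, image_empty]
    exact ⟨⟨fun z => isEmptyElim z, fun z => isEmptyElim z, fun z => isEmptyElim z⟩⟩
  | succ m =>
    refine exists_cutAtlas hfree ?_ hU hV
    rw [finrank_euclideanSpace, Fintype.card_fin]
    omega

end CircleCut
end

open CircleCut in
theorem mainTheorem8 (k : ℕ) (M : Type*) [TopologicalSpace M] [T2Space M]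
    [SecondCountableTopology M] [ChartedSpace (EuclideanHalfSpace (2 * k + 1)) M]
    [IsManifold (𝓡∂ (2 * k + 1)) ∞ M]
    (U : TopologicalSpace.Opens M) (hU : (𝓡∂ (2 * k + 1)).boundary M ⊆ U)
    [MulAction Circle U] [ContMDiffSMul (𝓡 1) (𝓡∂ (2 * k + 1)) ∞ Circle U]
    (hfree : ∀ (a : Circle) (x : U), a • x = x → a = 1)
    (β : DiffForm (𝓡∂ (2 * k + 1)) M 1) (hβ : IsContactForm k β)
    (hbasic : IsBasicOnBoundary U hU β) (hinv : IsInvariantNearBoundary (2 * k) U β) :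
    T2Space (CutSpace (2 * k) U) ∧ SecondCountableTopology (CutSpace (2 * k) U) ∧
    ∃ (_ : ChartedSpace (EuclideanSpace ℝ (Fin (2 * (k - 1) + 1))) (redSet (2 * k) U))
      (_ : IsManifold (𝓡 (2 * (k - 1) + 1)) ∞ (redSet (2 * k) U)),
      IsSubmersion (𝓡 (2 * k)) (𝓡 (2 * (k - 1) + 1)) ∞ (redMap (2 * k) U) ∧
      ∃ βred : DiffForm (𝓡 (2 * (k - 1) + 1)) (redSet (2 * k) U) 1,
        IsReducedForm β βred ∧ (∀ β', IsReducedForm β β' → β' = βred) ∧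
        IsContactForm (k - 1) βred ∧
        ∀ f : M → ℝ, IsInvariantBoundaryDefining (2 * k) U f →
          ∃ (_ : ChartedSpace (EuclideanSpace ℝ (Fin (2 * k + 1))) (CutSpace (2 * k) U))
            (_ : IsManifold (𝓡 (2 * k + 1)) ∞ (CutSpace (2 * k) U)),
            (∀ h : CutSpace (2 * k) U → ℝ, ContMDiff (𝓡 (2 * k + 1)) 𝓘(ℝ, ℝ) ∞ h ↔
              h ∈ cutSmoothFunctions (2 * k) U f) ∧
            ∃ βcut : DiffForm (𝓡 (2 * k + 1)) (CutSpace (2 * k) U) 1,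
              IsCutForm β βcut ∧ (∀ β', IsCutForm β β' → β' = βcut) ∧
              IsContactForm k βcut ∧
              IsSmoothEmbedding (𝓡 (2 * (k - 1) + 1)) (𝓡 (2 * k + 1)) ∞
                (Subtype.val : redSet (2 * k) U → CutSpace (2 * k) U) ∧
              DiffForm.pullback (𝓡 (2 * (k - 1) + 1)) (𝓡 (2 * k + 1))
                (Subtype.val : redSet (2 * k) U → CutSpace (2 * k) U) βcut = βred := by
  -- All adapted charts are chosen inside the neighbourhood where β is invariant. They are fixed
  -- before f is given.
  obtain ⟨V, hV, hβV⟩ := hinv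
  obtain ⟨𝒜⟩ := exists_cutAtlas_of_free hfree hU hV
  obtain ⟨h1, h2, h3⟩ := 𝒜.exists_isReducedForm hβV hbasic hβ (m' := k - 1) rfl
  obtain ⟨h4, h5, h6⟩ := 𝒜.exists_isCutForm hβV hbasic hβ
  exact ⟨t2Space_cutSpace hU, secondCountableTopology_cutSpace hU, 𝒜.redChartedSpace hU,
    𝒜.isManifold_redSet hU, 𝒜.isSubmersion_redMap, _, h1, h2, h3, fun f hf =>
      ⟨𝒜.cutChartedSpace, 𝒜.isManifold_cutSpace,
        fun h => 𝒜.contMDiff_iff_mem_cutSmoothFunctions hf, _, h4, h5, h6,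
        𝒜.isSmoothEmbedding_val, 𝒜.pullback_val_cutForm⟩⟩
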